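/- Let $\lambda>0$ and let $\Lambda^2_-S^4$ be the total space of the bundle of anti-self-dual 2-forms over the round unit sphere $S^4\subset\mathbb R^5$, with the Bryant–Salamon $G_2$-structure $$\varphi_\lambda = 2s_\lambda\,d\tau + s_\lambda^{-3}\,\mathrm{vol}_{\mathcal V},\qquad g_\lambda = 2s_\lambda^2\,g_{\mathcal H}+s_\lambda^{-2}\,g_{\mathcal V},\qquad s_\lambda=(\lambda+r^2)^{1/4},$$ where $\tau$ is the tautological 2-form, $\mathcal H\oplus\mathcal V$ is the splitting into horizontal and vertical subspaces given by the Levi-Civita connection, $r$ is the fibre radius, and the fibre metric and orientation are such that, for every oriented orthonormal coframe $e^1,\dots,e^4$ of $S^4$, the forms $\omega_1=e^{12}-e^{34}$, $\omega_2=e^{13}-e^{42}$, $\omega_3=e^{14}-e^{23}$ are an oriented orthonormal basis. A 4-dimensional submanifold is coassociative if it is calibrated by $*\varphi_\lambda$. Write $(x,(a_1,a_2,a_3))$ for the point $\sum_i a_i\omega_i$ over $x\in S^4$, where for $x_5\ne\pm1$ the $\omega_i$ are formed with the orthonormal frame $$\tfrac1{\sqrt{1-x_5^2}}\bigl\{(-x_2,x_1,-x_4,x_3,0),\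 (-x_3,x_4,x_1,-x_2,0),\ (-x_4,-x_3,x_2,x_1,0),\ (-x_1x_5,-x_2x_5,-x_3x_5,-x_4x_5,1-x_5^2)\bigr\},$$ and over $(0,0,0,0,\pm1)$ with the frame $(1,0,0,0,0),(0,1,0,0,0),(0,0,1,0,0),(0,0,0,\pm1,0)$. Let $SO(3)=SO(3)\times\{I_2\}\subset SO(5)$ act on $\Lambda^2_-S^4$ by the lift of its standard action on $S^4$. For $C,D\ge0$ and $E\in\mathbb R$ set $$M_{C,D,E}=SO(3)\cdot\Bigl\{\bigl((x_1,0,0,x_4,x_5),(a_1,a_2,0)\bigr)\in\Lambda^2_-S^4:\ x_4^4(\lambda+r^2)=C,\ x_5^4(\lambda+r^2)=D,\ a_1x_1=E\Bigr\}.$$ **(Coassociativity.)** If $E\neq0$ or $\sqrt C+\sqrt D\ne\sqrt\lambda$, then $M_{C,D,E}$ is a smooth embedded coassociative submanifold. If $E=0$ and $\sqrt C+\sqrt D=\sqrt\lambda$, let $S$ be the set of points of $M_{C,D,0}$ in the zero section with $x_1=x_2=x_3=0$. Then $S$ is finite and non-empty, $M_{C,D,0}\setminus S$ is a smooth embedded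 coassociative submanifold, and each point $z$ of $S$ is a conical singularity, near which $M_{C,D,0}$ is not a smooth submanifold. Here conical singularity means: there are coordinates $\chi$ on $\Lambda^2_-S^4$ centred at $z$ such that $(d\chi)_0$ identifies $\varphi_\lambda$ at $z$ with the standard $G_2$-form on $\mathbb R^7$, a compact 3-dimensional submanifold $L\subset S^6$, a rate $\mu\in(1,2)$ and a smooth map $\Psi$, defined on a punctured ball around $0$ in $\mathbb R^7$, such that $\chi\circ\Psi$ maps the cone over $L$ near its apex bijectively onto $M_{C,D,0}\setminus\{z\}$ near $z$, and $|\nabla^j(\Psi-\mathrm{id})(y)|=O(|y|^{\mu-j})$ as $y\to0$ for all $j\ge0$. **(Topology.)** Let $TS^2=\{(v,w)\in S^2\times\mathbb R^3:\langle v,w\rangle=0\}$ and let $N=(\mathbb R_{\ge0}\times SO(3))/(\{0\}\times SO(3))$ be the cone over $SO(3)$ with its apex. Every $M_{C,D,E}$ is non-compact, and it is homeomorphic to - $C>0$, $D>0$, $E=0$, $\sqrt C+\sqrt D\ne\sqrt\lambda$: $TS^2\sqcup TS^2\sqcup TS^2\sqcup TS^2$; - $C>0$, $D>0$, $E=0$,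 $\sqrt C+\sqrt D=\sqrt\lambda$: $N\sqcup N\sqcup N\sqcup N$; - $C>0$, $D>0$, $E\neq0$: $TS^2\sqcup TS^2\sqcup TS^2\sqcup TS^2$; - $C=0$, $D=0$: $TS^2$; - $C>0$, $D=0$, $E=0$, $\sqrt C\neq\sqrt\lambda$: $TS^2\sqcup TS^2$; - $C>0$, $D=0$, $E=0$, $\sqrt C=\sqrt\lambda$: $N\sqcup N$; - $C>0$, $D=0$, $E\ne0$: $TS^2\sqcup TS^2$; - $C=0$, $D>0$, $E=0$, $\sqrt D\neq\sqrt\lambda$: $TS^2\sqcup TS^2$; - $C=0$, $D>0$, $E=0$, $\sqrt D=\sqrt\lambda$: $N\sqcup N$; - $C=0$, $D>0$, $E\ne0$: $TS^2\sqcup TS^2$. **(Desingularizations.)** Orient coassociatives by $*\varphi_\lambda$. Let $C_j,D_j>0$ converge to $C_\infty,D_\infty>0$ with $\sqrt{C_\infty}+\sqrt{D_\infty}=\sqrt\lambda$, and suppose that $\sqrt{C_j}+\sqrt{D_j}<\sqrt\lambda$ for all $j$, or that $\sqrt{C_j}+\sqrt{D_j}>\sqrt\lambda$ for all $j$. Then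 the smooth coassociatives $M_{C_j,D_j,0}$ converge to the conically singular $M_{C_\infty,D_\infty,0}$ in the sense of currents, that is, $\int_{M_{C_j,D_j,0}}\alpha\to\int_{M_{C_\infty,D_\infty,0}}\alpha$ for every smooth compactly supported 4-form $\alpha$. Similarly, if $C_j>0$ converges to $C_\infty=\lambda$ and $C_j<\lambda$ for all $j$, or $C_j>\lambda$ for all $j$, then $M_{C_j,0,0}\to M_{C_\infty,0,0}$ and $M_{0,C_j,0}\to M_{0,C_\infty,0}$ in the sense of currents. -/

import Mathlib

open Set Filter Topology MeasureTheory
open scoped ContDiff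

noncomputable section

namespace BryantSalamon

/-! ### Submanifolds of a normed space -/

section Submanifolds

variable {E : Type*} [NormedAddCommGroup E] [NormedSpace ℝ E]

/-- `ψ : V → S` is a smooth local parametrization of `S` around `p = ψ 0` by an open set `V` of
`ℝⁿ`: it is smooth, its image is a relatively open subset of `S`, and it has a smooth left inverse
defined on an open subset of the ambient space. -/
def IsParamAt (n : ℕ) (S : Set E) (p : E) (ψ : EuclideanSpace ℝ (Fin n) → E)
    (V : Set (EuclideanSpace ℝ (Fin n))) : Prop :=
  IsOpen V ∧ 0 ∈ V ∧ ψ 0 = p ∧ ContDiffOn ℝ ∞ ψ V ∧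
    ∃ (U : Set E) (ρ : E → EuclideanSpace ℝ (Fin n)),
      IsOpen U ∧ ψ '' V = S ∩ U ∧ ContDiffOn ℝ ∞ ρ U ∧ ∀ u ∈ V, ρ (ψ u) = u

/-- Near `p`, the set `S` is a smooth embedded `n`-dimensional submanifold. -/
def IsSubmanifoldAt (n : ℕ) (S : Set E) (p : E) : Prop :=
  ∃ ψ V, IsParamAt n S p ψ V

/-- The velocities at `p` of smooth curves in `S`; the tangent space if `S` is a submanifold. -/
def tangentVecs (S : Set E) (p : E) : Set E :=
  {v | ∃ γ : ℝ → E, ContDiffAt ℝ ∞ γ 0 ∧ γ 0 = p ∧ (∀ᶠ t in 𝓝 0, γ t ∈ S) ∧ HasDerivAt γ v 0}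

end Submanifolds

/-! ### The standard `G₂`-structure on `ℝ⁷` -/

/-- `ℝ⁷`. -/
abbrev R7 : Type := EuclideanSpace ℝ (Fin 7)

/-- The constant form `e^{I 0} ∧ ⋯ ∧ e^{I (k-1)}` on `ℝ⁷`, evaluated on `k` vectors
(indices run from `0` to `6`). -/
def covec {k : ℕ} (I : Fin k → Fin 7) (c : Fin k → R7) : ℝ :=
  Matrix.det (Matrix.of fun a b => c a (I b))

/-- `φ₀ = e¹²³ + e¹⁴⁵ - e¹⁶⁷ + e²⁴⁶ + e²⁵⁷ + e³⁴⁷ - e³⁵⁶`. -/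
def phi0 (c : Fin 3 → R7) : ℝ :=
  covec ![0, 1, 2] c + covec ![0, 3, 4] c - covec ![0, 5, 6] c + covec ![1, 3, 5] c
    + covec ![1, 4, 6] c + covec ![2, 3, 6] c - covec ![2, 4, 5] c

/-- `*φ₀ = e⁴⁵⁶⁷ + e²³⁶⁷ - e²³⁴⁵ + e¹³⁵⁷ + e¹³⁴⁶ + e¹²⁵⁶ - e¹²⁴⁷`. -/
def starPhi0 (c : Fin 4 → R7) : ℝ :=
  covec ![3, 4, 5, 6] c + covec ![1, 2, 5, 6] c - covec ![1, 2, 3, 4] c + covec ![0, 2, 4, 6] c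
    + covec ![0, 2, 3, 5] c + covec ![0, 1, 4, 5] c - covec ![0, 1, 3, 6] c

/-! ### The space `Λ²₋S⁴` -/

/-- `ℝ⁵`, containing the unit sphere `S⁴`. -/
abbrev R5 : Type := EuclideanSpace ℝ (Fin 5)

/-- Alternating 2-forms on `ℝ⁵`. -/
abbrev Form2 : Type := R5 [⋀^Fin 2]→L[ℝ] ℝ

/-- The ambient space of `Λ²₋S⁴`: pairs of a point and a 2-form. -/
abbrev Amb : Type := R5 × Form2

/-- `e` is an oriented orthonormal basis of `T_x S⁴` (outward normal first). -/
def IsOrientedFrame (x : R5) (e : Fin 4 → R5) : Prop :=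
  Orthonormal ℝ e ∧ (∀ i, inner ℝ x (e i) = 0) ∧
    Matrix.det (Matrix.of fun i j => (Matrix.vecCons x e : Fin 5 → R5) i j) = 1

/-- The total space of the bundle of anti-self-dual 2-forms over `S⁴`. A 2-form on `T_x S⁴` is
identified with the 2-form on `ℝ⁵` which restricts to it and is annihilated by the normal `x`. -/
def asd : Set Amb :=
  {p | ‖p.1‖ = 1 ∧ (∀ v, p.2 ![p.1, v] = 0) ∧
    ∀ e : Fin 4 → R5, IsOrientedFrame p.1 e → p.2 ![e 0, e 1] = -p.2 ![e 2, e 3]}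

/-- The standard basis vectors of `ℝ⁵`. -/
def stdE (i : Fin 5) : R5 := EuclideanSpace.single i 1

/-- The fibre metric, normalized so that `e¹² - e³⁴`, `e¹³ - e⁴²`, `e¹⁴ - e²³` are orthonormal
for an oriented orthonormal coframe `e` (see `fibreInner_eq`). -/
def fibreInner (α β : Form2) : ℝ :=
  (1 / 4) * ∑ i, ∑ j, α ![stdE i, stdE j] * β ![stdE i, stdE j]

/-- The volume form of the fibres, for which `e¹² - e³⁴`, `e¹³ - e⁴²`, `e¹⁴ - e²³` is an oriented
orthonormal basis (see `fibreVol_eq`). -/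
def fibreVol (α β γ : Form2) : ℝ :=
  -(1 / 4) * ∑ i, ∑ j, ∑ k, α ![stdE i, stdE j] * β ![stdE j, stdE k] * γ ![stdE k, stdE i]

/-- The coordinates of `α` with respect to `e¹² - e³⁴`, `e¹³ - e⁴²`, `e¹⁴ - e²³`, where
`α` is anti-self-dual and `e` is an oriented orthonormal frame. -/
def asdCoord (e : Fin 4 → R5) (α : Form2) : Fin 3 → ℝ :=
  ![α ![e 0, e 1], α ![e 0, e 2], α ![e 0, e 3]]

/-- The square of the radius function. -/
def rSq (p : Amb) : ℝ := fibreInner p.2 p.2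

/-- The vertical part of a tangent vector `X = (ξ, η)` with respect to the Levi-Civita connection:
the covariant derivative is the tangential part of the derivative in `ℝ⁵`. The horizontal
part is identified with `ξ ∈ T_x S⁴`. -/
def vert (p X : Amb) : Form2 :=
  X.2.compContinuousLinearMap (Submodule.span ℝ {p.1})ᗮ.starProjection

/-- The tautological 2-form `τ_{(x, ω)} = π^* ω`. -/
def taut (p : Amb) : Amb [⋀^Fin 2]→L[ℝ] ℝ :=
  p.2.compContinuousLinearMap (ContinuousLinearMap.fst ℝ R5 Form2)

/-- `s_λ = (λ + r²)^{1/4}`. -/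
def sFun (lam : ℝ) (p : Amb) : ℝ := (lam + rSq p) ^ (1 / 4 : ℝ)

/-- The Bryant–Salamon 3-form `φ_λ = 2 s_λ dτ + s_λ⁻³ vol_𝓥` on tangent vectors of `Λ²₋S⁴`. -/
def phi (lam : ℝ) (p : Amb) (X : Fin 3 → Amb) : ℝ :=
  2 * sFun lam p * extDeriv taut p X
    + 1 / sFun lam p ^ 3 * fibreVol (vert p (X 0)) (vert p (X 1)) (vert p (X 2))

/-- The Bryant–Salamon metric `g_λ = 2 s_λ² g_𝓗 + s_λ⁻² g_𝓥` on tangent vectors of `Λ²₋S⁴`. -/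
def metric (lam : ℝ) (p X Y : Amb) : ℝ :=
  2 * sFun lam p ^ 2 * inner ℝ X.1 Y.1
    + 1 / sFun lam p ^ 2 * fibreInner (vert p X) (vert p Y)

/-- `f` is a `g_λ`-orthonormal basis of `T_p(Λ²₋S⁴)` which identifies `φ_λ` with `φ₀`. -/
def IsG2Frame (lam : ℝ) (p : Amb) (f : Fin 7 → Amb) : Prop :=
  (∀ a, f a ∈ tangentVecs asd p) ∧
    (∀ a b, metric lam p (f a) (f b) = if a = b then 1 else 0) ∧
    ∀ I : Fin 3 → Fin 7, phi lam p (fun i => f (I i)) = phi0 fun i => EuclideanSpace.single (I i) 1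

/-- The value of `*φ_λ` on four tangent vectors `v` of `Λ²₋S⁴` at `p` is `c`. It is computed in
a basis of `T_p(Λ²₋S⁴)` identifying `φ_λ` with `φ₀`, where it is given by `*φ₀`. -/
def StarPhiEq (lam : ℝ) (p : Amb) (v : Fin 4 → Amb) (c : ℝ) : Prop :=
  ∃ f, IsG2Frame lam p f ∧
    ∃ w : Fin 4 → R7, (∀ i, v i = ∑ a, w i a • f a) ∧ starPhi0 w = c

/-- `L` is a coassociative submanifold of `(Λ²₋S⁴, φ_λ, g_λ)`: a smooth 4-dimensional submanifold
such that at each of its points there is an orthonormal basis `v` of its tangent space with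
`*φ_λ(v₁, …, v₄) = 1`. Thus `*φ_λ` restricts to the volume form of `L`, for the orientation of `L`
which it determines. -/
def IsCoassociative (lam : ℝ) (L : Set Amb) : Prop :=
  L ⊆ asd ∧ ∀ p ∈ L, IsSubmanifoldAt 4 L p ∧
    ∃ v : Fin 4 → Amb, (∀ i, v i ∈ tangentVecs L p) ∧
      (∀ i j, metric lam p (v i) (v j) = if i = j then 1 else 0) ∧ StarPhiEq lam p v 1

/-! ### Conical singularities -/

/-- `z` is a conical singularity of `M`. There is a `G₂` coordinate system `χ` centred at `z`
(`χ 0 = z`, and `(dχ)_0` identifies `φ_λ` with `φ₀`), a cone `{r σ : r > 0, σ ∈ L}` on a compact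
3-dimensional submanifold `L` of the unit sphere `S⁶`, and a smooth map `Ψ` which is asymptotic to
the identity at `0` with a rate `μ ∈ (1, 2)`, with all derivatives, such that `χ ∘ Ψ` maps the cone
near its apex bijectively onto `M \ {z}` near `z`. -/
def IsConicalSingularity (lam : ℝ) (M : Set Amb) (z : Amb) : Prop :=
  ∃ (χ : R7 → Amb) (V : Set R7), IsParamAt 7 asd z χ V ∧
    IsG2Frame lam z (fun a => fderiv ℝ χ 0 (EuclideanSpace.single a 1)) ∧
  ∃ L : Set R7, L ⊆ Metric.sphere 0 1 ∧ IsCompact L ∧ L.Nonempty ∧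
    (∀ σ ∈ L, IsSubmanifoldAt 3 L σ) ∧
  ∃ (ε μ : ℝ) (Ψ : R7 → R7), 0 < ε ∧ 1 < μ ∧ μ < 2 ∧
    ContDiffOn ℝ ∞ Ψ (Metric.ball 0 ε \ {0}) ∧
    (∀ j : ℕ, ∃ K : ℝ, ∀ y : R7, 0 < ‖y‖ → ‖y‖ < ε →
      ‖iteratedFDeriv ℝ j (fun y => Ψ y - y) y‖ ≤ K * ‖y‖ ^ (μ - j)) ∧
  ∃ U : Set Amb, IsOpen U ∧ z ∈ U ∧
    BijOn (χ ∘ Ψ) {y | ∃ r ∈ Ioo 0 ε, ∃ σ ∈ L, y = r • σ} ((M \ {z}) ∩ U) ∧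
    MapsTo Ψ {y | ∃ r ∈ Ioo 0 ε, ∃ σ ∈ L, y = r • σ} V

/-- `M` is a coassociative submanifold whose singularities are exactly the points of the nonempty
finite set `S`; they are conical, and `M` is not a smooth submanifold near any of them. -/
def IsConicallySingularCoassociative (lam : ℝ) (M S : Set Amb) : Prop :=
  S ⊆ M ∧ S.Finite ∧ S.Nonempty ∧ IsCoassociative lam (M \ S) ∧
    ∀ z ∈ S, IsConicalSingularity lam M z ∧ ¬ IsSubmanifoldAt 4 M z

/-! ### Currents -/

/-- The integral of the 4-form `α` over `L`, oriented by `*φ_λ`, converges absolutely and equals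
`I`. It is computed with finitely many disjoint positively oriented parametrized pieces of `L` whose
complement in `L` has dimension less than 4. -/
def IntegralEq (lam : ℝ) (L : Set Amb) (α : Amb → Amb [⋀^Fin 4]→L[ℝ] ℝ) (I : ℝ) : Prop :=
  ∃ (k : ℕ) (V : Fin k → Set (EuclideanSpace ℝ (Fin 4)))
    (ψ : Fin k → EuclideanSpace ℝ (Fin 4) → Amb),
    (∀ i, IsOpen (V i) ∧ ContDiffOn ℝ ∞ (ψ i) (V i) ∧ InjOn (ψ i) (V i) ∧ MapsTo (ψ i) (V i) L ∧
      (∀ u ∈ V i, ∃ c > 0,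
        StarPhiEq lam (ψ i u) (fun a => fderiv ℝ (ψ i) u (EuclideanSpace.single a 1)) c) ∧
      IntegrableOn
        (fun u => α (ψ i u) fun a => fderiv ℝ (ψ i) u (EuclideanSpace.single a 1)) (V i)) ∧
    (∀ i j, i ≠ j → Disjoint (ψ i '' V i) (ψ j '' V j)) ∧
    dimH (L \ ⋃ i, ψ i '' V i) < 4 ∧
    I = ∑ i, ∫ u in V i, α (ψ i u) fun a => fderiv ℝ (ψ i) u (EuclideanSpace.single a 1)

/-- The coassociatives `L j`, oriented by `*φ_λ`, converge to `L'` in the sense of currents: the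
integrals of each smooth compactly supported 4-form converge. -/
def TendstoCurrents (lam : ℝ) (L : ℕ → Set Amb) (L' : Set Amb) : Prop :=
  ∀ α : Amb → Amb [⋀^Fin 4]→L[ℝ] ℝ, ContDiff ℝ ∞ α → HasCompactSupport α →
    ∃ (I : ℕ → ℝ) (I' : ℝ), (∀ j, IntegralEq lam (L j) α (I j)) ∧ IntegralEq lam L' α I' ∧
      Tendsto I atTop (𝓝 I')

/-! ### The sets `M_{C,D,E}` -/

/-- The lift of `A ∈ SO(5)` to `Λ²₋S⁴`: `(x, ω) ↦ (A x, (A⁻¹)^* ω)`. -/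
def lift (A : Matrix (Fin 5) (Fin 5) ℝ) (p : Amb) : Amb :=
  (Matrix.toEuclideanCLM (𝕜 := ℝ) A p.1,
    p.2.compContinuousLinearMap (Matrix.toEuclideanCLM (n := Fin 5) (𝕜 := ℝ) A.transpose))

/-- `SO(3)`. -/
abbrev SO3 : Type := Matrix.specialOrthogonalGroup (Fin 3) ℝ

/-- The inclusion `SO(3) × {I₂} ⊂ SO(5)`. -/
def so3Block (g : SO3) : Matrix (Fin 5) (Fin 5) ℝ :=
  Matrix.reindex (finSumFinEquiv (m := 3) (n := 2)) (finSumFinEquiv (m := 3) (n := 2))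
    (Matrix.fromBlocks g.1 0 0 1)

/-- The frame `e₁, …, e₄` of `S⁴ \ {x₅ = ±1}`, together with a frame at the poles
`x₅ = ±1`. Here `x₁, …, x₅` are `x 0, …, x 4`. -/
def frame (x : R5) : Fin 4 → R5 :=
  if x 4 ^ 2 = 1 then
    ![!₂[1, 0, 0, 0, 0], !₂[0, 1, 0, 0, 0], !₂[0, 0, 1, 0, 0], !₂[0, 0, 0, x 4, 0]]
  else fun i => (1 / √(1 - x 4 ^ 2)) •
    (![!₂[-x 1, x 0, -x 3, x 2, 0], !₂[-x 2, x 3, x 0, -x 1, 0], !₂[-x 3, -x 2, x 1, x 0, 0],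
      !₂[-(x 0 * x 4), -(x 1 * x 4), -(x 2 * x 4), -(x 3 * x 4), 1 - x 4 ^ 2]] : Fin 4 → R5) i

/-- The fibre coordinates `(a₁, a₂, a₃)` of a point of `Λ²₋S⁴` with respect to `frame`. -/
def coordA (p : Amb) : Fin 3 → ℝ := asdCoord (frame p.1) p.2

/-- The points `((x₁, 0, 0, x₄, x₅), (a₁, a₂, 0))` with `x₄⁴ (λ + r²) = C`, `x₅⁴ (λ + r²) = D`,
`a₁ x₁ = E`. -/
def slice (lam C D E : ℝ) : Set Amb :=
  {p | p ∈ asd ∧ p.1 1 = 0 ∧ p.1 2 = 0 ∧ coordA p 2 = 0 ∧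
    p.1 3 ^ 4 * (lam + rSq p) = C ∧ p.1 4 ^ 4 * (lam + rSq p) = D ∧ coordA p 0 * p.1 0 = E}

/-- `M_{C,D,E}`. -/
def M (lam C D E : ℝ) : Set Amb :=
  {q | ∃ g : SO3, ∃ p ∈ slice lam C D E, q = lift (so3Block g) p}

/-- The points of `M_{C,D,E}` which are fixed by `SO(3)`: they lie in the zero section, over the
circle `x₁ = x₂ = x₃ = 0`. -/
def apexes (lam C D E : ℝ) : Set Amb :=
  {p | p ∈ M lam C D E ∧ p.1 0 = 0 ∧ p.1 1 = 0 ∧ p.1 2 = 0 ∧ p.2 = 0}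

/-! ### Model spaces -/

/-- `TS² = {(v, w) ∈ S² × ℝ³ : ⟨v, w⟩ = 0}`. -/
abbrev TS2 : Type :=
  {y : EuclideanSpace ℝ (Fin 3) × EuclideanSpace ℝ (Fin 3) // ‖y.1‖ = 1 ∧ inner ℝ y.1 y.2 = 0}

/-- The relation on `ℝ_{≥0} × SO(3)` which collapses `{0} × SO(3)` to a point. -/
def coneSetoid : Setoid (NNReal × SO3) where
  r a b := a = b ∨ (a.1 = 0 ∧ b.1 = 0)
  iseqv :=
    { refl := fun _ => Or.inl rfl
      symm := by
        rintro a b (h | h)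
        · exact Or.inl h.symm
        · exact Or.inr ⟨h.2, h.1⟩
      trans := by
        rintro a b c (rfl | h) (rfl | h')
        · exact Or.inl rfl
        · exact Or.inr h'
        · exact Or.inr h
        · exact Or.inr ⟨h.1, h'.2⟩ }

/-- The cone `N = (ℝ_{≥0} × SO(3)) / ({0} × SO(3))` with its apex, with the quotient topology. -/
abbrev ConeSO3 : Type := Quotient coneSetoid

/-! ### The fibre metric, the fibre volume form and `dτ` in frames -/

theorem form2_add_smul (α : Form2) (u v w : R5) (c : ℝ) :
    α ![u, v] = -α ![v, u] ∧ α ![u + c • w, v] = α ![u, v] + c * α ![w, v] := by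
  constructor
  · have h := α.map_swap ![u, v] (i := 0) (j := 1) (by decide)
    have e : (![u, v] ∘ Equiv.swap (0 : Fin 2) 1) = ![v, u] := by
      ext i; fin_cases i <;> simp
    rw [e] at h
    change α ![v, u] = -α ![u, v] at h
    linarith
  · have h1 := α.map_update_add ![u, v] 0 u (c • w)
    have h2 := α.map_update_smul ![u, v] 0 c w
    have hupd (y : R5) : Function.update ![u, v] 0 y = ![y, v] := by
      ext i; fin_cases i <;> simp
    rw [hupd, hupd, hupd] at h1
    rw [hupd, hupd] at h2
    rw [h1, h2, smul_eq_mul]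

/-- The matrix of a 2-form in a family of vectors. -/
def formMat (b : Fin 5 → R5) (α : Form2) : Matrix (Fin 5) (Fin 5) ℝ :=
  Matrix.of fun i j => α ![b i, b j]

theorem form2_sum_left (α : Form2) (c : Fin 5 → ℝ) (b : Fin 5 → R5) (v : R5) :
    α ![∑ i, c i • b i, v] = ∑ i, c i * α ![b i, v] := by
  have h0 : α ![0, v] = 0 := α.map_coord_zero (m := ![0, v]) 0 rfl
  have add (u w : R5) (t : ℝ) := (form2_add_smul α u v w t).2
  have key : ∀ s : Finset (Fin 5), α ![∑ i ∈ s, c i • b i, v] = ∑ i ∈ s, c i * α ![b i, v] := by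
    intro s
    induction s using Finset.induction_on with
    | empty => simpa using h0
    | insert a s ha ih =>
      rw [Finset.sum_insert ha, Finset.sum_insert ha, add_comm, add, ih, add_comm]
  exact key _

theorem formMat_eq (b : Fin 5 → R5) (α : Form2) :
    formMat b α = Matrix.of (fun i j => b i j) * formMat stdE α *
      (Matrix.of fun i j => b i j).transpose := by
  have hb (i : Fin 5) : b i = ∑ k, b i k • stdE k := by
    ext j; simp [stdE, Finset.sum_apply, Pi.single_apply]
  ext i j
  simp only [formMat, Matrix.of_apply, Matrix.mul_apply, Matrix.transpose_apply]
  calc α ![b i, b j] = ∑ k, b i k * α ![stdE k, b j] := by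
        conv_lhs => rw [hb i]
        exact form2_sum_left α _ _ _
    _ = ∑ k, ∑ l, b i k * (b j l * α ![stdE k, stdE l]) := by
        refine Finset.sum_congr rfl fun k _ => ?_
        rw [(form2_add_smul α (stdE k) (b j) 0 0).1]
        conv_lhs => rw [hb j]
        rw [form2_sum_left, ← Finset.sum_neg_distrib, Finset.mul_sum]
        refine Finset.sum_congr rfl fun l _ => ?_
        rw [(form2_add_smul α (stdE l) (stdE k) 0 0).1]; ring
    _ = _ := by
        rw [Finset.sum_comm]
        refine Finset.sum_congr rfl fun l _ => ?_
        rw [Finset.sum_mul]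
        exact Finset.sum_congr rfl fun k _ => by ring

theorem frame_mul_transpose {x : R5} {e : Fin 4 → R5} (hx : ‖x‖ = 1) (he : IsOrientedFrame x e) :
    (Matrix.of fun i j => (Matrix.vecCons x e : Fin 5 → R5) i j).transpose *
      (Matrix.of fun i j => (Matrix.vecCons x e : Fin 5 → R5) i j) = 1 := by
  refine mul_eq_one_comm.mp ?_
  have hip (u v : R5) : ∑ k, u k * v k = inner ℝ u v := by
    rw [PiLp.inner_apply]; exact Finset.sum_congr rfl fun k _ => by simp [mul_comm]
  ext i j
  simp only [Matrix.mul_apply, Matrix.of_apply, Matrix.transpose_apply, hip]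
  have ho := orthonormal_iff_ite.mp he.1
  refine Fin.cases ?_ (fun i => ?_) i <;> refine Fin.cases ?_ (fun j => ?_) j
  · simp [hx]
  · simpa [Matrix.one_apply, (Fin.succ_ne_zero j).symm] using he.2.1 j
  · simpa [Matrix.one_apply, Fin.succ_ne_zero i, real_inner_comm] using he.2.1 i
  · simpa [Matrix.one_apply] using ho i j

theorem formMat_asd {x : R5} {e : Fin 4 → R5} (he : IsOrientedFrame x e)
    {α : Form2} (hα : (x, α) ∈ asd) (a : Fin 3 → ℝ) (ha : asdCoord e α = a) :
    formMat (Matrix.vecCons x e) α =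
      !![0, 0, 0, 0, 0; 0, 0, a 0, a 1, a 2; 0, -a 0, 0, -a 2, a 1; 0, -a 1, a 2, 0, -a 0;
        0, -a 2, -a 1, a 0, 0] := by
  subst ha
  have anti (u v : R5) := (form2_add_smul α u v 0 0).1
  have diag (u : R5) : α ![u, u] = 0 := by linarith [anti u u]
  have hx0 := hα.2.1
  have hx0' (v : R5) : α ![v, x] = 0 := by rw [anti, hx0 v, neg_zero]
  have h1 := hα.2.2 e he
  have perm (σ : Equiv.Perm (Fin 4)) (hσ : Equiv.Perm.sign σ = 1) :
      IsOrientedFrame x (e ∘ σ) := by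
    refine ⟨he.1.comp _ σ.injective, fun i => he.2.1 _, ?_⟩
    have hd := Matrix.det_permute (Equiv.Perm.decomposeFin.symm (0, σ))
      (Matrix.of fun i j => (Matrix.vecCons x e : Fin 5 → R5) i j)
    rw [he.2.2] at hd
    have hs : Equiv.Perm.sign (Equiv.Perm.decomposeFin.symm ((0 : Fin 5), σ)) = 1 := by
      rw [Equiv.Perm.decomposeFin.symm_sign]; simpa using hσ
    rw [hs] at hd
    simp only [Units.val_one, Int.cast_one, one_mul] at hd
    rw [← hd]
    congr 1
    ext i j
    refine Fin.cases ?_ (fun i => ?_) i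
    · simp
    · simp
  have h2 := hα.2.2 _ (perm (Equiv.swap 1 2 * Equiv.swap 2 3) (by decide))
  have h3 := hα.2.2 _ (perm (Equiv.swap 2 3 * Equiv.swap 1 2) (by decide))
  have e20 : (Equiv.swap 1 2 * Equiv.swap 2 3 : Equiv.Perm (Fin 4)) 0 = 0 := by decide
  have e21 : (Equiv.swap 1 2 * Equiv.swap 2 3 : Equiv.Perm (Fin 4)) 1 = 2 := by decide
  have e22 : (Equiv.swap 1 2 * Equiv.swap 2 3 : Equiv.Perm (Fin 4)) 2 = 3 := by decide
  have e23 : (Equiv.swap 1 2 * Equiv.swap 2 3 : Equiv.Perm (Fin 4)) 3 = 1 := by decide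
  have e30 : (Equiv.swap 2 3 * Equiv.swap 1 2 : Equiv.Perm (Fin 4)) 0 = 0 := by decide
  have e31 : (Equiv.swap 2 3 * Equiv.swap 1 2 : Equiv.Perm (Fin 4)) 1 = 3 := by decide
  have e32 : (Equiv.swap 2 3 * Equiv.swap 1 2 : Equiv.Perm (Fin 4)) 2 = 1 := by decide
  have e33 : (Equiv.swap 2 3 * Equiv.swap 1 2 : Equiv.Perm (Fin 4)) 3 = 2 := by decide
  simp only [Function.comp_apply, e20, e21, e22, e23, e30, e31, e32, e33] at h1 h2 h3
  have q1 := anti (e 1) (e 0)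
  have q2 := anti (e 2) (e 0)
  have q3 := anti (e 3) (e 0)
  have q4 := anti (e 2) (e 1)
  have q5 := anti (e 3) (e 1)
  have q6 := anti (e 3) (e 2)
  have c1 : (Matrix.vecCons x e : Fin 5 → R5) 1 = e 0 := rfl
  have c2 : (Matrix.vecCons x e : Fin 5 → R5) 2 = e 1 := rfl
  have c3 : (Matrix.vecCons x e : Fin 5 → R5) 3 = e 2 := rfl
  have c4 : (Matrix.vecCons x e : Fin 5 → R5) 4 = e 3 := rfl
  have c0 : (Matrix.vecCons x e : Fin 5 → R5) 0 = x := rfl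
  ext i j
  fin_cases i <;> fin_cases j <;>
    simp [formMat, asdCoord, c1, c2, c3, c4, hx0, hx0', diag] <;> linarith

theorem trace_conj_two {U A B : Matrix (Fin 5) (Fin 5) ℝ} (hU : U.transpose * U = 1) :
    (U * A * U.transpose * (U * B * U.transpose).transpose).trace = (A * B.transpose).trace := by
  have h : U * A * U.transpose * (U * B * U.transpose).transpose =
      U * (A * (U.transpose * U) * B.transpose * U.transpose) := by
    simp only [Matrix.transpose_mul, Matrix.transpose_transpose, Matrix.mul_assoc]
  rw [h, hU, Matrix.trace_mul_comm, Matrix.mul_assoc, hU, Matrix.mul_one, Matrix.mul_one]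

theorem trace_conj_three {U A B C : Matrix (Fin 5) (Fin 5) ℝ} (hU : U.transpose * U = 1) :
    (U * A * U.transpose * (U * B * U.transpose * (U * C * U.transpose))).trace =
      (A * (B * C)).trace := by
  have h : U * A * U.transpose * (U * B * U.transpose * (U * C * U.transpose)) =
      U * (A * (U.transpose * U) * (B * (U.transpose * U) * C) * U.transpose) := by
    simp only [Matrix.mul_assoc]
  rw [h, hU, Matrix.trace_mul_comm, Matrix.mul_assoc, hU, Matrix.mul_one, Matrix.mul_one,
    Matrix.mul_one]

theorem fibreInner_eq {x : R5} {e : Fin 4 → R5} (he : IsOrientedFrame x e) {α β : Form2}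
    (hα : (x, α) ∈ asd) (hβ : (x, β) ∈ asd) :
    fibreInner α β = ∑ i, asdCoord e α i * asdCoord e β i := by
  have h1 : fibreInner α β = (1 / 4) * (formMat stdE α * (formMat stdE β).transpose).trace := by
    simp [fibreInner, Matrix.trace, Matrix.mul_apply, formMat]
  rw [h1, ← trace_conj_two (frame_mul_transpose hα.1 he), ← formMat_eq, ← formMat_eq]
  simp only [Matrix.trace, Matrix.diag_apply, Matrix.mul_apply, Matrix.transpose_apply,
    Fin.sum_univ_five, Fin.sum_univ_three]
  rw [formMat_asd he hα _ rfl, formMat_asd he hβ _ rfl]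
  simp
  ring

theorem fibreVol_eq {x : R5} {e : Fin 4 → R5} (he : IsOrientedFrame x e) {α β γ : Form2}
    (hα : (x, α) ∈ asd) (hβ : (x, β) ∈ asd) (hγ : (x, γ) ∈ asd) :
    fibreVol α β γ = Matrix.det (Matrix.of ![asdCoord e α, asdCoord e β, asdCoord e γ]) := by
  have h1 : fibreVol α β γ = -(1 / 4) *
      (formMat stdE α * (formMat stdE β * formMat stdE γ)).trace := by
    simp [fibreVol, Matrix.trace, Matrix.mul_apply, formMat, Finset.mul_sum, mul_assoc]
  rw [h1, ← trace_conj_three (frame_mul_transpose hα.1 he), ← formMat_eq, ← formMat_eq,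
    ← formMat_eq]
  simp only [Matrix.trace, Matrix.diag_apply, Matrix.mul_apply, Fin.sum_univ_five,
    Matrix.det_fin_three, Matrix.of_apply]
  rw [formMat_asd he hα _ rfl, formMat_asd he hβ _ rfl, formMat_asd he hγ _ rfl]
  simp
  ring

theorem extDeriv_taut (p : Amb) (X : Fin 3 → Amb) :
    extDeriv taut p X = (X 0).2 ![(X 1).1, (X 2).1] - (X 1).2 ![(X 0).1, (X 2).1]
      + (X 2).2 ![(X 0).1, (X 1).1] := by
  let T : Amb →L[ℝ] Amb [⋀^Fin 2]→L[ℝ] ℝ :=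
    (ContinuousAlternatingMap.compContinuousLinearMapCLM
      (ContinuousLinearMap.fst ℝ R5 Form2)).comp (ContinuousLinearMap.snd ℝ R5 Form2)
  have hT : taut = T := rfl
  have hval (Y : Amb) (v : Fin 2 → Amb) : T Y v = Y.2 ![(v 0).1, (v 1).1] := by
    change Y.2 (fun i => (v i).1) = _
    congr 1; ext i; fin_cases i <;> rfl
  have hd : fderiv ℝ T p = T :=
    (ContinuousLinearMap.hasFDerivAt (𝕜 := ℝ) (E := Amb) (F := Amb [⋀^Fin 2]→L[ℝ] ℝ) T
      (x := p)).fderiv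
  rw [extDeriv, hT, hd, ContinuousAlternatingMap.alternatizeUncurryFin_apply,
    Fin.sum_univ_three, hval, hval, hval]
  have e0 : Fin.removeNth 0 X 0 = X 1 ∧ Fin.removeNth 0 X 1 = X 2 := ⟨rfl, rfl⟩
  have e1 : Fin.removeNth 1 X 0 = X 0 ∧ Fin.removeNth 1 X 1 = X 2 := ⟨rfl, rfl⟩
  have e2 : Fin.removeNth 2 X 0 = X 0 ∧ Fin.removeNth 2 X 1 = X 1 := ⟨rfl, rfl⟩
  rw [e0.1, e0.2, e1.1, e1.2, e2.1, e2.2]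
  simp
  ring

end BryantSalamon

end

noncomputable section

namespace BryantSalamon

/-! ### Coordinates on the space of 2-forms -/

/-! Write s = (λ + r²)^{1/4}. The functions x₄⁴(λ + r²), x₅⁴(λ + r²) and α(e₄, e₅) are
SO(3)-invariant, and on the slice α(e₄, e₅) = -a₁x₁ (`coordA_zero_mul`, from the pointwise identity
`asd_moment`). Every point of a common level set of the three can be rotated into the slice, so M is
such a level set (`M_eq_levelSet`), and the frame, which is singular at the poles, disappears. On M
the pair (x₄s, x₅s) is continuous with only finitely many possible values (P, Q), the real fourth
roots of (C, D), so M splits into relatively open pieces. Since SO(5) preserves g_λ and φ_λ, the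
piece of (P, Q) can be rotated in the (x₄, x₅)-plane until (P, Q) = (X, 0), with X² = √C + √D. It
then lies over the equator x₅ = 0, and all pieces are copies of one model.

Over the equator, contraction with e₅ identifies an anti-self-dual form with a vector z ⟂ x of ℝ⁴ of
length r (`asd_eq_asdForm`, `rSq_asdForm`). With x = (y, h) and z = (w, -E) in ℝ³ × ℝ, the piece
becomes the set K ⊂ ℝ³ × ℝ³ given by |y|² = 1 - h² and ⟨y, w⟩ = hE, where h = X(λ + E² +
|w|²)^{-1/4}. The origin is the only possible critical point (`levelDeriv_surjective`), and it lies
on K exactly if E = 0 and X² = √λ.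

Coassociativity: in a G₂ frame over the equator, the directions other than e₅ form a ℂ³ on which *φ
is -σ²/2 for the standard symplectic form σ. Constancy of z₄ and of x₄s are the real and imaginary
parts of a single complex linear equation, so tangent spaces of K are complex hyperplanes
(`isCoassociativeAt_theta`, `isCoassociativeAt_of_tangentVecs`).

Topology: where y never vanishes, y/|y| is the base point in S² (`homeomorph_of_lt`,
`homeomorph_of_ne`); where w never vanishes, w/|w| is (`homeomorph_of_gt`). In the singular case y ⟂
w, and |y|, |w| are functions of one radius that vanish together, so K is a cone over the
orthonormal pairs, that is, over SO(3) (`homeomorph_of_eq`).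

Singularities: rescaling the fibre coordinate gives a G₂ chart in which K is exactly the cone |v| =
|h|, ⟨v, h⟩ = 0 (`coneChart_mem_iff`), so that Ψ is the identity. This cone spans six dimensions,
too many for the tangent space of a 4-manifold.

Currents: for E = 0, K is parametrized by Euler angles of an orthonormal pair and by τ, where √(λ +
|w|²) = max(X², √λ) + τ². In this variable the radii have derivatives bounded locally uniformly in
X, across X² = √λ as well, and the omitted set has dimension at most 3. Dominated convergence then
makes the integral continuous in (P, Q) ≠ (0, 0) (`continuousAt_pieceIntegral`). -/

theorem form2_anti (α : Form2) (u v : R5) : α ![u, v] = -α ![v, u] := (form2_add_smul α u v 0 0).1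

theorem form2_self (α : Form2) (u : R5) : α ![u, u] = 0 := by linarith [form2_anti α u u]

theorem form2_add_left (α : Form2) (u v w : R5) : α ![u + v, w] = α ![u, w] + α ![v, w] := by
  simpa using (form2_add_smul α u w v 1).2

theorem form2_smul_left (α : Form2) (c : ℝ) (u w : R5) : α ![c • u, w] = c * α ![u, w] := by
  have h0 : α ![0, w] = 0 := α.map_coord_zero (m := ![0, w]) 0 rfl
  simpa [h0] using (form2_add_smul α 0 w u c).2

theorem form2_add_right (α : Form2) (u v w : R5) : α ![w, u + v] = α ![w, u] + α ![w, v] := by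
  rw [form2_anti, form2_add_left, form2_anti α u, form2_anti α v]; ring

theorem form2_smul_right (α : Form2) (c : ℝ) (u w : R5) : α ![w, c • u] = c * α ![w, u] := by
  rw [form2_anti, form2_smul_left, form2_anti α u]; ring

theorem sum_stdE (u : R5) : u = ∑ k, u k • stdE k := by
  ext j; simp [stdE, Finset.sum_apply, Pi.single_apply]

theorem form2_sum_right (α : Form2) (c : Fin 5 → ℝ) (b : Fin 5 → R5) (v : R5) :
    α ![v, ∑ i, c i • b i] = ∑ i, c i * α ![v, b i] := by
  rw [form2_anti, form2_sum_left, ← Finset.sum_neg_distrib]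
  refine Finset.sum_congr rfl fun i _ => ?_
  rw [form2_anti α (b i)]; ring

theorem form2_expand (α : Form2) (u v : R5) :
    α ![u, v] = ∑ i, ∑ j, u i * v j * α ![stdE i, stdE j] := by
  conv_lhs => rw [sum_stdE u, form2_sum_left]
  refine Finset.sum_congr rfl fun i _ => ?_
  conv_lhs => rw [sum_stdE v, form2_sum_right]
  rw [Finset.mul_sum]
  exact Finset.sum_congr rfl fun j _ => by ring

theorem form2_vec (α : Form2) (v : Fin 2 → R5) : α v = α ![v 0, v 1] := by
  congr 1; ext i; fin_cases i <;> rfl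

theorem form2_ext {α β : Form2} (h : ∀ i j : Fin 5, i < j → α ![stdE i, stdE j] = β ![stdE i, stdE j]) :
    α = β := by
  ext v
  rw [form2_vec α, form2_vec β, form2_expand α, form2_expand β]
  refine Finset.sum_congr rfl fun i _ => Finset.sum_congr rfl fun j _ => ?_
  rcases lt_trichotomy i j with hij | rfl | hij
  · rw [h i j hij]
  · rw [form2_self, form2_self]
  · rw [form2_anti α, form2_anti β, h j i hij]

/-- Evaluation of 2-forms on a pair of vectors. -/
def ev (u v : R5) : Form2 →L[ℝ] ℝ := ContinuousAlternatingMap.apply ℝ R5 ℝ ![u, v]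

@[simp] theorem ev_apply (u v : R5) (α : Form2) : ev u v α = α ![u, v] := rfl

/-- The 2-form whose matrix is the antisymmetrization of `B`. -/
def ofMatForm (B : Fin 5 → Fin 5 → ℝ) : Form2 where
  toFun v := ∑ i, ∑ j, (B i j - B j i) / 2 * (v 0 i * v 1 j)
  map_update_add' := by
    intro inst m i x y
    obtain rfl : inst = instDecidableEqFin 2 := Subsingleton.elim _ _
    fin_cases i <;> simp [← Finset.sum_add_distrib] <;>
      exact Finset.sum_congr rfl fun i _ => Finset.sum_congr rfl fun j _ => by ring
  map_update_smul' := by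
    intro inst m i c x
    obtain rfl : inst = instDecidableEqFin 2 := Subsingleton.elim _ _
    fin_cases i <;> simp [Finset.mul_sum] <;>
      exact Finset.sum_congr rfl fun i _ => Finset.sum_congr rfl fun j _ => by ring
  map_eq_zero_of_eq' := by
    intro v i j hv hij
    have h01 : v 0 = v 1 := by
      fin_cases i <;> fin_cases j <;> simp_all
    simp only [h01, Fin.sum_univ_five]
    ring
  cont := by fun_prop

theorem ofMatForm_apply (B : Fin 5 → Fin 5 → ℝ) (u v : R5) :
    ofMatForm B ![u, v] = ∑ i, ∑ j, (B i j - B j i) / 2 * (u i * v j) := rfl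

/-- `ofMatForm` as a continuous linear map. -/
def ofMat : (Fin 5 → Fin 5 → ℝ) →L[ℝ] Form2 :=
  LinearMap.toContinuousLinearMap
    { toFun := ofMatForm
      map_add' := by
        intro A B
        refine form2_ext fun i j _ => ?_
        change ofMatForm _ _ = ofMatForm A _ + ofMatForm B _
        simp only [ofMatForm_apply, ← Finset.sum_add_distrib, Pi.add_apply]
        exact Finset.sum_congr rfl fun i _ => Finset.sum_congr rfl fun j _ => by ring
      map_smul' := by
        intro c A
        refine form2_ext fun i j _ => ?_
        change ofMatForm _ _ = c * ofMatForm A _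
        simp only [ofMatForm_apply, Finset.mul_sum, Pi.smul_apply, smul_eq_mul]
        exact Finset.sum_congr rfl fun i _ => Finset.sum_congr rfl fun j _ => by ring }

theorem ofMat_apply (B : Fin 5 → Fin 5 → ℝ) (u v : R5) :
    ofMat B ![u, v] = ∑ i, ∑ j, (B i j - B j i) / 2 * (u i * v j) := rfl

theorem ofMat_stdE (B : Fin 5 → Fin 5 → ℝ) (k l : Fin 5) :
    ofMat B ![stdE k, stdE l] = (B k l - B l k) / 2 := by
  rw [ofMat_apply, Finset.sum_eq_single k, Finset.sum_eq_single l]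
  · simp [stdE]
  · intro j _ hj; simp [stdE, hj]
  · simp
  · intro i _ hi; simp [stdE, hi]
  · simp

theorem ofMat_coords (α : Form2) : ofMat (fun i j => α ![stdE i, stdE j]) = α := by
  refine form2_ext fun i j _ => ?_
  rw [ofMat_stdE, form2_anti α (stdE j)]; ring

/-- Makes linear maps out of `Form2`, such as those in `thetaInv`, automatically continuous. -/
instance : FiniteDimensional ℝ Form2 :=
  Module.Finite.of_surjective ofMat.toLinearMap fun α => ⟨_, ofMat_coords α⟩

/-! ### Regularity of form-valued maps, coefficient by coefficient. -/

section Calculus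

variable {G : Type*} [NormedAddCommGroup G] [NormedSpace ℝ G]

/-- A form is recovered from its matrix by the continuous linear map `ofMat`, so regularity can be
tested on coefficients. -/
theorem contDiff_form2 {F : G → Form2} {n : WithTop ℕ∞}
    (h : ∀ i j, ContDiff ℝ n fun x => F x ![stdE i, stdE j]) : ContDiff ℝ n F := by
  have : F = fun x => ofMat (fun i j => F x ![stdE i, stdE j]) :=
    funext fun x => (ofMat_coords _).symm
  rw [this]
  exact ofMat.contDiff.comp (contDiff_pi.2 fun i => contDiff_pi.2 fun j => h i j)

theorem contDiffOn_form2 {F : G → Form2} {n : WithTop ℕ∞} {s : Set G}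
    (h : ∀ i j, ContDiffOn ℝ n (fun x => F x ![stdE i, stdE j]) s) : ContDiffOn ℝ n F s := by
  have : F = fun x => ofMat (fun i j => F x ![stdE i, stdE j]) :=
    funext fun x => (ofMat_coords _).symm
  rw [this]
  exact ofMat.contDiff.comp_contDiffOn (contDiffOn_pi.2 fun i => contDiffOn_pi.2 fun j => h i j)

theorem hasDerivAt_form2 {F : ℝ → Form2} {F' : Form2} {t : ℝ}
    (h : ∀ i j, HasDerivAt (fun x => F x ![stdE i, stdE j]) (F' ![stdE i, stdE j]) t) :
    HasDerivAt F F' t := by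
  have e : F = fun x => ofMat (fun i j => F x ![stdE i, stdE j]) :=
    funext fun x => (ofMat_coords _).symm
  rw [e, ← ofMat_coords F']
  exact ofMat.hasFDerivAt.comp_hasDerivAt t
    (hasDerivAt_pi.2 fun i => hasDerivAt_pi.2 fun j => h i j)

end Calculus

/-! ### The action of `SO(5)` -/

/-- The linear map of `ℝ⁵` given by a matrix. -/
abbrev act (A : Matrix (Fin 5) (Fin 5) ℝ) : R5 →L[ℝ] R5 :=
  Matrix.toEuclideanCLM (n := Fin 5) (𝕜 := ℝ) A

theorem act_apply (A : Matrix (Fin 5) (Fin 5) ℝ) (x : R5) (i : Fin 5) :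
    act A x i = ∑ j, A i j * x j := rfl

theorem act_mul (A B : Matrix (Fin 5) (Fin 5) ℝ) (x : R5) : act (A * B) x = act A (act B x) := by
  simp [act]

theorem act_one (x : R5) : act 1 x = x := by simp [act]

/-- `lift A` as a continuous linear map. -/
def liftL (A : Matrix (Fin 5) (Fin 5) ℝ) : Amb →L[ℝ] Amb :=
  ((act A).comp (ContinuousLinearMap.fst ℝ R5 Form2)).prod
    ((ContinuousAlternatingMap.compContinuousLinearMapCLM (act A.transpose)).comp
      (ContinuousLinearMap.snd ℝ R5 Form2))

theorem liftL_apply (A : Matrix (Fin 5) (Fin 5) ℝ) (p : Amb) : liftL A p = lift A p := rfl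

theorem lift_fst (A : Matrix (Fin 5) (Fin 5) ℝ) (p : Amb) : (lift A p).1 = act A p.1 := rfl

theorem comp_vec (α : Form2) (f : R5 →L[ℝ] R5) (u v : R5) :
    α.compContinuousLinearMap f ![u, v] = α ![f u, f v] := by
  rw [ContinuousAlternatingMap.compContinuousLinearMap_apply, form2_vec]; rfl

theorem lift_snd (A : Matrix (Fin 5) (Fin 5) ℝ) (p : Amb) (u v : R5) :
    (lift A p).2 ![u, v] = p.2 ![act A.transpose u, act A.transpose v] :=
  comp_vec _ _ _ _

theorem lift_mul (A B : Matrix (Fin 5) (Fin 5) ℝ) (p : Amb) : lift (A * B) p = lift A (lift B p) := by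
  refine Prod.ext (act_mul A B p.1) (form2_ext fun i j _ => ?_)
  simp only [lift_snd, Matrix.transpose_mul, act_mul]

theorem lift_one (p : Amb) : lift 1 p = p := by
  refine Prod.ext (act_one p.1) (form2_ext fun i j _ => ?_)
  simp only [lift_snd, Matrix.transpose_one, act_one]

/-- Special orthogonal matrices. -/
def IsSO (A : Matrix (Fin 5) (Fin 5) ℝ) : Prop := A.transpose * A = 1 ∧ A.det = 1

namespace IsSO

variable {A : Matrix (Fin 5) (Fin 5) ℝ}

theorem mul_transpose (h : IsSO A) : A * A.transpose = 1 := mul_eq_one_comm.mp h.1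

theorem transpose (h : IsSO A) : IsSO A.transpose :=
  ⟨by rw [Matrix.transpose_transpose, h.mul_transpose], by rw [Matrix.det_transpose, h.2]⟩

theorem act_transpose (h : IsSO A) (x : R5) : act A.transpose (act A x) = x := by
  rw [← act_mul, h.1, act_one]

theorem lift_transpose (h : IsSO A) (p : Amb) : lift A.transpose (lift A p) = p := by
  rw [← lift_mul, h.1, lift_one]

theorem lift_lift_transpose (h : IsSO A) (p : Amb) : lift A (lift A.transpose p) = p := by
  rw [← lift_mul, h.mul_transpose, lift_one]

end IsSO

theorem inner_R5 (u v : R5) : inner ℝ u v = ∑ i, u i * v i := by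
  rw [PiLp.inner_apply]; exact Finset.sum_congr rfl fun k _ => by simp [mul_comm]

theorem inner_act_left (A : Matrix (Fin 5) (Fin 5) ℝ) (u v : R5) :
    inner ℝ (act A u) v = inner ℝ u (act A.transpose v) := by
  simp only [inner_R5, act_apply, Finset.sum_mul, Finset.mul_sum, Matrix.transpose_apply]
  rw [Finset.sum_comm]
  exact Finset.sum_congr rfl fun k _ => Finset.sum_congr rfl fun l _ => by ring

theorem IsSO.inner_act {A : Matrix (Fin 5) (Fin 5) ℝ} (h : IsSO A) (u v : R5) :
    inner ℝ (act A u) (act A v) = inner ℝ u v := by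
  rw [inner_act_left, h.act_transpose]

theorem IsSO.norm_act {A : Matrix (Fin 5) (Fin 5) ℝ} (h : IsSO A) (u : R5) : ‖act A u‖ = ‖u‖ := by
  rw [← sq_eq_sq₀ (norm_nonneg _) (norm_nonneg _), ← real_inner_self_eq_norm_sq,
    ← real_inner_self_eq_norm_sq, h.inner_act]

theorem IsSO.orientedFrame {A : Matrix (Fin 5) (Fin 5) ℝ} (h : IsSO A) {x : R5} {e : Fin 4 → R5}
    (he : IsOrientedFrame x e) : IsOrientedFrame (act A x) (fun i => act A (e i)) := by
  refine ⟨?_, fun i => by rw [h.inner_act, he.2.1], ?_⟩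
  · refine orthonormal_iff_ite.2 fun i j => ?_
    rw [h.inner_act, orthonormal_iff_ite.1 he.1]
  · have : (Matrix.of fun i j => (Matrix.vecCons (act A x) (fun i => act A (e i)) : Fin 5 → R5) i j)
        = (Matrix.of fun i j => (Matrix.vecCons x e : Fin 5 → R5) i j) * A.transpose := by
      ext i j
      simp only [Matrix.of_apply, Matrix.mul_apply, Matrix.transpose_apply]
      refine Fin.cases ?_ (fun i => ?_) i
      · simp only [Matrix.cons_val_zero, act_apply]
        exact Finset.sum_congr rfl fun k _ => by ring
      · simp only [Matrix.cons_val_succ, act_apply]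
        exact Finset.sum_congr rfl fun k _ => by ring
    rw [this, Matrix.det_mul, he.2.2, Matrix.det_transpose, h.2, one_mul]

theorem IsSO.lift_mem_asd {A : Matrix (Fin 5) (Fin 5) ℝ} (h : IsSO A) {p : Amb} (hp : p ∈ asd) :
    lift A p ∈ asd := by
  refine ⟨by rw [lift_fst, h.norm_act]; exact hp.1, fun v => ?_, fun e he => ?_⟩
  · rw [lift_fst, lift_snd, h.act_transpose]; exact hp.2.1 _
  · rw [lift_snd, lift_snd]
    refine hp.2.2 (fun i => act A.transpose (e i)) ?_
    have := h.transpose.orientedFrame he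
    rwa [lift_fst, h.act_transpose] at this

theorem formMat_comp (A : Matrix (Fin 5) (Fin 5) ℝ) (α : Form2) :
    formMat stdE (α.compContinuousLinearMap (act A.transpose)) =
      A * formMat stdE α * A.transpose := by
  have hA : (Matrix.of fun i j => (fun i => act A.transpose (stdE i)) i j) = A := by
    ext i j
    simp [act_apply, stdE]
  have : formMat stdE (α.compContinuousLinearMap (act A.transpose)) =
      formMat (fun i => act A.transpose (stdE i)) α := by
    ext i j
    exact comp_vec _ _ _ _
  rw [this, formMat_eq, hA]

theorem fibreInner_eq_trace (α β : Form2) :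
    fibreInner α β = (1 / 4) * (formMat stdE α * (formMat stdE β).transpose).trace := by
  simp [fibreInner, Matrix.trace, Matrix.mul_apply, formMat]

theorem fibreVol_eq_trace (α β γ : Form2) :
    fibreVol α β γ = -(1 / 4) * (formMat stdE α * (formMat stdE β * formMat stdE γ)).trace := by
  simp [fibreVol, Matrix.trace, Matrix.mul_apply, formMat, Finset.mul_sum, mul_assoc]

theorem IsSO.fibreInner_comp {A : Matrix (Fin 5) (Fin 5) ℝ} (h : IsSO A) (α β : Form2) :
    fibreInner (α.compContinuousLinearMap (act A.transpose))
      (β.compContinuousLinearMap (act A.transpose)) = fibreInner α β := by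
  rw [fibreInner_eq_trace, fibreInner_eq_trace, formMat_comp, formMat_comp, trace_conj_two h.1]

theorem IsSO.fibreVol_comp {A : Matrix (Fin 5) (Fin 5) ℝ} (h : IsSO A) (α β γ : Form2) :
    fibreVol (α.compContinuousLinearMap (act A.transpose))
      (β.compContinuousLinearMap (act A.transpose))
      (γ.compContinuousLinearMap (act A.transpose)) = fibreVol α β γ := by
  rw [fibreVol_eq_trace, fibreVol_eq_trace, formMat_comp, formMat_comp, formMat_comp,
    trace_conj_three h.1]

theorem IsSO.rSq_lift {A : Matrix (Fin 5) (Fin 5) ℝ} (h : IsSO A) (p : Amb) :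
    rSq (lift A p) = rSq p := h.fibreInner_comp _ _

theorem IsSO.sFun_lift {A : Matrix (Fin 5) (Fin 5) ℝ} (h : IsSO A) (lam : ℝ) (p : Amb) :
    sFun lam (lift A p) = sFun lam p := by rw [sFun, sFun, h.rSq_lift]

/-- The orthogonal projection to the complement of a unit vector. -/
theorem starProjection_orthogonal {x : R5} (hx : ‖x‖ = 1) (u : R5) :
    (Submodule.span ℝ {x})ᗮ.starProjection u = u - inner ℝ x u • x := by
  rw [Submodule.starProjection_orthogonal_val, Submodule.starProjection_unit_singleton ℝ hx]

theorem vert_apply {p : Amb} (hp : ‖p.1‖ = 1) (X : Amb) (u v : R5) :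
    vert p X ![u, v] = X.2 ![u - inner ℝ p.1 u • p.1, v - inner ℝ p.1 v • p.1] := by
  rw [vert, comp_vec, starProjection_orthogonal hp, starProjection_orthogonal hp]

/-- Orthogonal maps commute with the projection to the complement of x, which is all the Levi-Civita
connection of the round sphere depends on. -/
theorem IsSO.vert_lift {A : Matrix (Fin 5) (Fin 5) ℝ} (h : IsSO A) {p : Amb} (hp : ‖p.1‖ = 1)
    (X : Amb) : vert (lift A p) (lift A X) =
      (vert p X).compContinuousLinearMap (act A.transpose) := by
  have hp' : ‖(lift A p).1‖ = 1 := by rw [lift_fst, h.norm_act, hp]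
  refine form2_ext fun i j _ => ?_
  rw [vert_apply hp', comp_vec, vert_apply hp, lift_snd, lift_fst]
  simp only [map_sub, map_smul, h.act_transpose, inner_act_left]

theorem IsSO.metric_lift {A : Matrix (Fin 5) (Fin 5) ℝ} (h : IsSO A) (lam : ℝ) {p : Amb}
    (hp : ‖p.1‖ = 1) (X Y : Amb) :
    metric lam (lift A p) (lift A X) (lift A Y) = metric lam p X Y := by
  rw [metric, metric, h.sFun_lift, h.vert_lift hp, h.vert_lift hp, h.fibreInner_comp, lift_fst,
    lift_fst, h.inner_act]

/-- The radius and the fibre volume are traces of matrix products, unchanged under conjugation by A;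
the `dτ` part pairs forms with vectors, and there A cancels its inverse. -/
theorem IsSO.phi_lift {A : Matrix (Fin 5) (Fin 5) ℝ} (h : IsSO A) (lam : ℝ) {p : Amb}
    (hp : ‖p.1‖ = 1) (X : Fin 3 → Amb) :
    phi lam (lift A p) (fun i => lift A (X i)) = phi lam p X := by
  rw [phi, phi, h.sFun_lift, h.vert_lift hp, h.vert_lift hp, h.vert_lift hp, h.fibreVol_comp,
    extDeriv_taut, extDeriv_taut]
  simp only [lift_snd, lift_fst, h.act_transpose]

theorem tangentVecs_map {E F : Type*} [NormedAddCommGroup E] [NormedSpace ℝ E]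
    [NormedAddCommGroup F] [NormedSpace ℝ F] {S : Set E} {T : Set F} {f : E → F} {f' : E →L[ℝ] F}
    {p v : E} (hf : ContDiffAt ℝ ∞ f p) (hf' : HasFDerivAt f f' p) (hST : MapsTo f S T)
    (hv : v ∈ tangentVecs S p) : f' v ∈ tangentVecs T (f p) := by
  obtain ⟨γ, h1, h2, h3, h4⟩ := hv
  refine ⟨f ∘ γ, ?_, by simp [h2], h3.mono fun t ht => hST ht, ?_⟩
  · exact ContDiffAt.comp 0 (by rwa [h2]) h1
  · exact HasFDerivAt.comp_hasDerivAt 0 (by rwa [h2]) h4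

theorem tangentVecs_lift {A : Matrix (Fin 5) (Fin 5) ℝ} {S T : Set Amb} {p v : Amb}
    (hST : MapsTo (lift A) S T) (hv : v ∈ tangentVecs S p) :
    lift A v ∈ tangentVecs T (lift A p) :=
  tangentVecs_map (f := liftL A) (liftL A).contDiff.contDiffAt (liftL A).hasFDerivAt hST hv

theorem IsSO.isG2Frame_lift {A : Matrix (Fin 5) (Fin 5) ℝ} (h : IsSO A) {lam : ℝ} {p : Amb}
    (hp : ‖p.1‖ = 1) {f : Fin 7 → Amb} (hf : IsG2Frame lam p f) :
    IsG2Frame lam (lift A p) (fun a => lift A (f a)) := by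
  refine ⟨fun a => tangentVecs_lift (fun q hq => h.lift_mem_asd hq) (hf.1 a), fun a b => ?_,
    fun I => ?_⟩
  · rw [h.metric_lift lam hp]; exact hf.2.1 a b
  · rw [← hf.2.2 I]; exact h.phi_lift lam hp (fun i => f (I i))

/-- A G₂ frame is carried to a G₂ frame with the same coefficients. This is what permits computing
only over x₅ = 0. -/
theorem IsSO.starPhiEq_lift {A : Matrix (Fin 5) (Fin 5) ℝ} (h : IsSO A) {lam : ℝ} {p : Amb}
    (hp : ‖p.1‖ = 1) {v : Fin 4 → Amb} {c : ℝ} (hv : StarPhiEq lam p v c) :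
    StarPhiEq lam (lift A p) (fun a => lift A (v a)) c := by
  obtain ⟨f, hf, w, hw, hc⟩ := hv
  refine ⟨_, h.isG2Frame_lift hp hf, w, fun i => ?_, hc⟩
  change lift A (v i) = _
  rw [hw i, ← liftL_apply, map_sum]
  exact Finset.sum_congr rfl fun a _ => by rw [map_smul, liftL_apply]

/-! ### Horizontal lifts -/

/-- The horizontal lift of `ξ ∈ T_x S⁴` at `p = (x, α)`. -/
def hor (p : Amb) (ξ : R5) : Amb :=
  (ξ, ofMat fun i j => -(p.1 i * p.2 ![ξ, stdE j]) - p.1 j * p.2 ![stdE i, ξ])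

/-- The formula is forced: differentiating α(x, ·) = 0 in the direction ξ gives η(x, v) = -α(ξ, v),
and horizontality makes η vanish on pairs tangent to the sphere. -/
theorem hor_snd_apply (p : Amb) (ξ u v : R5) :
    (hor p ξ).2 ![u, v] = -(inner ℝ p.1 u * p.2 ![ξ, v]) - inner ℝ p.1 v * p.2 ![u, ξ] := by
  have h1 : p.2 ![ξ, v] = ∑ j, v j * p.2 ![ξ, stdE j] := by
    conv_lhs => rw [sum_stdE v, form2_sum_right]
  have h2 : p.2 ![u, ξ] = -∑ j, u j * p.2 ![ξ, stdE j] := by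
    conv_lhs => rw [form2_anti, sum_stdE u, form2_sum_right]
  have h3 (i : Fin 5) : p.2 ![stdE i, ξ] = -p.2 ![ξ, stdE i] := form2_anti _ _ _
  rw [hor, ofMat_apply, h1, h2, inner_R5, inner_R5]
  simp only [h3, Fin.sum_univ_five]
  ring

/-- The rotation by the angle `t` in the oriented plane spanned by `x` and `ξ`. -/
def planeRot (x ξ : R5) (t : ℝ) : Matrix (Fin 5) (Fin 5) ℝ :=
  1 + Real.sin t • (Matrix.vecMulVec ξ x - Matrix.vecMulVec x ξ)
    - (1 - Real.cos t) • (Matrix.vecMulVec ξ ξ + Matrix.vecMulVec x x)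

theorem planeRot_transpose (x ξ : R5) (t : ℝ) : (planeRot x ξ t).transpose = planeRot x ξ (-t) := by
  simp only [planeRot, Matrix.transpose_sub, Matrix.transpose_add, Matrix.transpose_one,
    Matrix.transpose_smul, Matrix.transpose_vecMulVec, Real.sin_neg, Real.cos_neg]
  module

theorem planeRot_mul {x ξ : R5} (hx : ‖x‖ = 1) (hξ : ‖ξ‖ = 1) (h : inner ℝ x ξ = 0) (s t : ℝ) :
    planeRot x ξ s * planeRot x ξ t = planeRot x ξ (s + t) := by
  have d1 : (x : Fin 5 → ℝ) ⬝ᵥ x = 1 := by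
    rw [← one_pow 2, ← hx, ← real_inner_self_eq_norm_sq, inner_R5]; rfl
  have d2 : (ξ : Fin 5 → ℝ) ⬝ᵥ ξ = 1 := by
    rw [← one_pow 2, ← hξ, ← real_inner_self_eq_norm_sq, inner_R5]; rfl
  have d3 : (x : Fin 5 → ℝ) ⬝ᵥ ξ = 0 := by rw [← h, inner_R5]; rfl
  have d4 : (ξ : Fin 5 → ℝ) ⬝ᵥ x = 0 := by rw [dotProduct_comm, d3]
  simp only [planeRot, Real.sin_add, Real.cos_add, mul_add, add_mul, mul_sub, sub_mul, smul_add,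
    smul_sub, Matrix.smul_mul, Matrix.mul_smul, Matrix.vecMulVec_mul_vecMulVec, d1, d2, d3, d4,
    one_mul, mul_one, zero_smul, one_smul, smul_zero, Matrix.vecMulVec_zero]
  module

theorem planeRot_isSO {x ξ : R5} (hx : ‖x‖ = 1) (hξ : ‖ξ‖ = 1) (h : inner ℝ x ξ = 0) (t : ℝ) :
    IsSO (planeRot x ξ t) := by
  have key (t : ℝ) : (planeRot x ξ t).transpose * planeRot x ξ t = 1 := by
    rw [planeRot_transpose, planeRot_mul hx hξ h]; simp [planeRot]
  refine ⟨key t, ?_⟩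
  -- A rotation is the square of the rotation by half the angle, so its determinant is the square of
  -- ±1.
  have h1 := congrArg Matrix.det (key (t / 2))
  rw [Matrix.det_mul, Matrix.det_transpose, Matrix.det_one] at h1
  rw [← add_halves t, ← planeRot_mul hx hξ h, Matrix.det_mul, h1]

theorem act_planeRot (x ξ : R5) (t : ℝ) (u : R5) :
    act (planeRot x ξ t) u = u + (Real.sin t * inner ℝ x u - (1 - Real.cos t) * inner ℝ ξ u) • ξ
      + (-Real.sin t * inner ℝ ξ u - (1 - Real.cos t) * inner ℝ x u) • x := by
  have h1 (a b : R5) : Matrix.mulVec (Matrix.vecMulVec a b) u = inner ℝ b u • (a : Fin 5 → ℝ) := by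
    rw [Matrix.vecMulVec_mulVec, inner_R5]; ext i; simp [dotProduct, mul_comm]
  refine PiLp.ext fun i => ?_
  change ((planeRot x ξ t).mulVec u) i = _
  rw [planeRot, Matrix.sub_mulVec, Matrix.add_mulVec, Matrix.one_mulVec, Matrix.smul_mulVec,
    Matrix.smul_mulVec, Matrix.sub_mulVec, Matrix.add_mulVec, h1, h1, h1, h1]
  simp only [Pi.sub_apply, Pi.add_apply, Pi.smul_apply, smul_eq_mul, PiLp.add_apply,
    PiLp.smul_apply]
  ring

/-- Rotating p in the plane of x and ξ is parallel transport along a great circle; the orbit stays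
in `asd` and its velocity is the horizontal lift. -/
theorem hor_mem_tangentVecs {p : Amb} (hp : p ∈ asd) {ξ : R5} (hξ : ‖ξ‖ = 1)
    (h : inner ℝ p.1 ξ = 0) : hor p ξ ∈ tangentVecs asd p := by
  have hx : inner ℝ p.1 p.1 = (1 : ℝ) := by rw [real_inner_self_eq_norm_sq, hp.1]; norm_num
  have h' : inner ℝ ξ p.1 = (0 : ℝ) := by rw [real_inner_comm, h]
  have hx0 (v : R5) : p.2 ![v, p.1] = 0 := by rw [form2_anti, hp.2.1, neg_zero]
  -- The ξ-coefficient of the displacement of u under the inverse rotation; the x-coefficient is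
  -- killed by the form.
  let l (t : ℝ) (u : R5) : ℝ := -(Real.sin t * inner ℝ p.1 u) - (1 - Real.cos t) * inner ℝ ξ u
  have e1 : (fun t => (lift (planeRot p.1 ξ t) p).1) =
      fun t => Real.cos t • p.1 + Real.sin t • ξ := by
    funext t
    rw [lift_fst, act_planeRot, hx, h']
    module
  have e2 (u v : R5) : (fun t => (lift (planeRot p.1 ξ t) p).2 ![u, v]) =
      fun t => p.2 ![u, v] + l t v * p.2 ![u, ξ] + l t u * p.2 ![ξ, v] := by
    funext t
    rw [lift_snd, planeRot_transpose, act_planeRot, act_planeRot, Real.sin_neg, Real.cos_neg]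
    simp only [form2_add_left, form2_add_right, form2_smul_left, form2_smul_right, hx0, hp.2.1,
      form2_self, l]
    ring
  refine ⟨fun t => lift (planeRot p.1 ξ t) p, ?_, ?_, ?_, ?_⟩
  · refine ContDiff.contDiffAt (ContDiff.prodMk (f := fun t => (lift (planeRot p.1 ξ t) p).1)
      (g := fun t => (lift (planeRot p.1 ξ t) p).2) ?_ (contDiff_form2 fun i j => ?_))
    · rw [e1]
      exact (Real.contDiff_cos.smul contDiff_const).add (Real.contDiff_sin.smul contDiff_const)
    · rw [e2]
      have := Real.contDiff_cos (n := ∞)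
      have := Real.contDiff_sin (n := ∞)
      fun_prop
  · have : planeRot p.1 ξ 0 = 1 := by simp [planeRot]
    simp only [this, lift_one]
  · exact Eventually.of_forall fun t => (planeRot_isSO hp.1 hξ h t).lift_mem_asd hp
  · refine HasDerivAt.prodMk (f₁ := fun t => (lift (planeRot p.1 ξ t) p).1)
      (f₂ := fun t => (lift (planeRot p.1 ξ t) p).2) ?_ (hasDerivAt_form2 fun i j => ?_)
    · rw [e1]
      have := ((Real.hasDerivAt_cos 0).smul_const p.1).add ((Real.hasDerivAt_sin 0).smul_const ξ)
      convert! this using 1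
      simp
    · change HasDerivAt _ ((hor p ξ).2 ![stdE i, stdE j]) 0
      rw [e2, hor_snd_apply]
      have hl (u : R5) : HasDerivAt (fun t => l t u) (-inner ℝ p.1 u) 0 := by
        have := (((Real.hasDerivAt_sin 0).mul_const (inner ℝ p.1 u)).neg).sub
          (((Real.hasDerivAt_cos 0).const_sub 1).mul_const (inner ℝ ξ u))
        convert! this using 1
        simp
      have := (((hl (stdE j)).mul_const (p.2 ![stdE i, ξ])).const_add
        (p.2 ![stdE i, stdE j])).add ((hl (stdE i)).mul_const (p.2 ![ξ, stdE j]))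
      convert! this using 1
      ring

/-! ### `G₂` frames -/

theorem vert_vertical {p : Amb} (hp : ‖p.1‖ = 1) (X : Amb) (hX : ∀ v, X.2 ![p.1, v] = 0) :
    vert p X = X.2 := by
  refine form2_ext fun i j _ => ?_
  have h (v : R5) : X.2 ![v, p.1] = 0 := by rw [form2_anti, hX, neg_zero]
  simp [vert_apply hp, sub_eq_add_neg, ← neg_smul, form2_add_left, form2_add_right,
    form2_smul_left, form2_smul_right, hX, h]

theorem vert_hor {p : Amb} (hp : ‖p.1‖ = 1) (ξ : R5) : vert p (hor p ξ) = 0 := by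
  have hx : inner ℝ p.1 p.1 = (1 : ℝ) := by rw [real_inner_self_eq_norm_sq, hp]; norm_num
  refine form2_ext fun i j _ => ?_
  rw [vert_apply hp, hor_snd_apply]
  simp only [inner_sub_right, inner_smul_right, hx]
  simp

theorem vert_add (p X Y : Amb) : vert p (X + Y) = vert p X + vert p Y := rfl

theorem vert_smul (p : Amb) (c : ℝ) (X : Amb) : vert p (c • X) = c • vert p X := rfl

theorem mem_asd_add_smul {x : R5} {α β : Form2} (hα : (x, α) ∈ asd) (hβ : (x, β) ∈ asd) (c : ℝ) :
    (x, α + c • β) ∈ asd := by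
  refine ⟨hα.1, fun v => ?_, fun e he => ?_⟩
  · change α _ + c * β _ = 0
    rw [hα.2.1 v, hβ.2.1 v]; ring
  · change α _ + c * β _ = -(α _ + c * β _)
    rw [hα.2.2 e he, hβ.2.2 e he]; ring

theorem mem_asd_zero {x : R5} (hx : ‖x‖ = 1) : (x, (0 : Form2)) ∈ asd :=
  ⟨hx, fun _ => rfl, fun _ _ => by simp⟩

theorem mem_asd_smul {x : R5} {β : Form2} (hβ : (x, β) ∈ asd) (c : ℝ) : (x, c • β) ∈ asd := by
  simpa using mem_asd_add_smul (mem_asd_zero hβ.1) hβ c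

/-- Anti-self-dual forms in an oriented frame. -/
theorem asd_apply_frame {x : R5} {e : Fin 4 → R5} (he : IsOrientedFrame x e) {β : Form2}
    (hβ : (x, β) ∈ asd) (h k : Fin 4 → ℝ) :
    β ![∑ i, h i • e i, ∑ i, k i • e i] =
      asdCoord e β 0 * (h 0 * k 1 - h 1 * k 0 - (h 2 * k 3 - h 3 * k 2))
      + asdCoord e β 1 * (h 0 * k 2 - h 2 * k 0 - (h 3 * k 1 - h 1 * k 3))
      + asdCoord e β 2 * (h 0 * k 3 - h 3 * k 0 - (h 1 * k 2 - h 2 * k 1)) := by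
  have t (i j : Fin 4) := congrFun (congrFun (formMat_asd he hβ _ rfl) i.succ) j.succ
  simp only [formMat, Matrix.of_apply, Matrix.cons_val_succ] at t
  simp only [Fin.sum_univ_four, form2_add_left, form2_add_right, form2_smul_left, form2_smul_right,
    t]
  simp
  ring

theorem sFun_pos {lam : ℝ} (hlam : 0 < lam) (p : Amb) : 0 < sFun lam p := by
  refine Real.rpow_pos_of_pos (add_pos_of_pos_of_nonneg hlam ?_) _
  rw [rSq, fibreInner]
  exact mul_nonneg (by norm_num) (Finset.sum_nonneg fun i _ => Finset.sum_nonneg fun j _ =>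
    mul_self_nonneg _)

/-- The `G₂` frame of vertical vectors `s ωᵢ` and horizontal vectors `eᵢ / (√2 s)`. -/
def g2Frame (lam : ℝ) (p : Amb) (e : Fin 4 → R5) (Ω : Fin 3 → Form2) : Fin 7 → Amb :=
  ![(0, sFun lam p • Ω 0), (0, sFun lam p • Ω 1), (0, sFun lam p • Ω 2),
    (1 / (√2 * sFun lam p)) • hor p (e 0), (1 / (√2 * sFun lam p)) • hor p (e 1),
    (1 / (√2 * sFun lam p)) • hor p (e 2), (1 / (√2 * sFun lam p)) • hor p (e 3)]

section G2Frame

variable {lam : ℝ} {p : Amb} {e : Fin 4 → R5} {Ω : Fin 3 → Form2}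

theorem sum_g2Frame_fst (c : R7) : (∑ a, c a • g2Frame lam p e Ω a).1 =
    ∑ i, (![c 3, c 4, c 5, c 6] i / (√2 * sFun lam p)) • e i := by
  simp [Fin.sum_univ_seven, g2Frame, hor, Fin.sum_univ_four, smul_smul, div_eq_mul_inv]

theorem vert_sum_g2Frame (hp : p ∈ asd) (hΩ : ∀ a, (p.1, Ω a) ∈ asd) (c : R7) :
    vert p (∑ a, c a • g2Frame lam p e Ω a) =
      0 + (sFun lam p * c 0) • Ω 0 + (sFun lam p * c 1) • Ω 1 + (sFun lam p * c 2) • Ω 2 := by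
  have hv (a : Fin 3) : vert p (0, sFun lam p • Ω a) = sFun lam p • Ω a :=
    vert_vertical hp.1 _ fun v => by
      change sFun lam p * Ω a ![p.1, v] = 0
      rw [(hΩ a).2.1 v, mul_zero]
  simp only [Fin.sum_univ_seven, g2Frame, vert_add, vert_smul]
  simp [hv, vert_smul, vert_hor hp.1, smul_smul, mul_comm]

variable (hlam : 0 < lam) (hp : p ∈ asd) (he : IsOrientedFrame p.1 e)
  (hΩ : ∀ a, (p.1, Ω a) ∈ asd) (hc : ∀ a, asdCoord e (Ω a) = Pi.single a 1)

include hp hΩ in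
theorem vert_sum_g2Frame_mem (c : R7) :
    (p.1, vert p (∑ a, c a • g2Frame lam p e Ω a)) ∈ asd := by
  rw [vert_sum_g2Frame hp hΩ]
  exact mem_asd_add_smul (mem_asd_add_smul (mem_asd_add_smul (mem_asd_zero hp.1) (hΩ 0) _)
    (hΩ 1) _) (hΩ 2) _

theorem asdCoord_add (e : Fin 4 → R5) (α β : Form2) :
    asdCoord e (α + β) = asdCoord e α + asdCoord e β := by
  ext i; fin_cases i <;> simp [asdCoord]

theorem asdCoord_smul (e : Fin 4 → R5) (c : ℝ) (β : Form2) :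
    asdCoord e (c • β) = c • asdCoord e β := by
  ext i; fin_cases i <;> simp [asdCoord]

theorem asdCoord_zero (e : Fin 4 → R5) : asdCoord e 0 = 0 := by
  ext i; fin_cases i <;> simp [asdCoord]

include hp hΩ hc in
theorem asdCoord_sum_g2Frame (c : R7) :
    asdCoord e (vert p (∑ a, c a • g2Frame lam p e Ω a)) =
      ![sFun lam p * c 0, sFun lam p * c 1, sFun lam p * c 2] := by
  rw [vert_sum_g2Frame hp hΩ]
  simp only [asdCoord_add, asdCoord_smul, hc, asdCoord_zero]
  ext i; fin_cases i <;> simp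

include hlam hp he hΩ hc in
theorem metric_g2Frame (c d : R7) :
    metric lam p (∑ a, c a • g2Frame lam p e Ω a) (∑ a, d a • g2Frame lam p e Ω a) =
      ∑ a, c a * d a := by
  have hs := (sFun_pos hlam p).ne'
  have h2 : √2 ≠ 0 := by positivity
  have h22 : √2 ^ 2 = 2 := Real.sq_sqrt (by norm_num)
  rw [metric, fibreInner_eq he (vert_sum_g2Frame_mem hp hΩ c) (vert_sum_g2Frame_mem hp hΩ d),
    asdCoord_sum_g2Frame hp hΩ hc, asdCoord_sum_g2Frame hp hΩ hc, sum_g2Frame_fst, sum_g2Frame_fst,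
    he.1.inner_sum]
  simp [Fin.sum_univ_seven, Fin.sum_univ_four, Fin.sum_univ_three]
  field_simp
  rw [h22]
  ring

include hlam hp he hΩ hc in
-- The normalizations cancel: 2s · s · (√2 s)⁻² = 1 in the terms with one vertical and two
-- horizontal vectors, and s⁻³ · s³ = 1 in the purely vertical one.
theorem phi_g2Frame (c : Fin 3 → R7) :
    phi lam p (fun i => ∑ a, c i a • g2Frame lam p e Ω a) = phi0 c := by
  have hs := (sFun_pos hlam p).ne'
  have h2 : √2 ≠ 0 := by positivity
  have h22 : √2 ^ 2 = 2 := Real.sq_sqrt (by norm_num)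
  have hperp (c : R7) : inner ℝ p.1 (∑ a, c a • g2Frame lam p e Ω a).1 = (0 : ℝ) := by
    rw [sum_g2Frame_fst, inner_sum]
    exact Finset.sum_eq_zero fun i _ => by rw [inner_smul_right, he.2.1, mul_zero]
  -- Base components are orthogonal to x, so in `dτ` only the vertical part of the form component
  -- counts.
  have hval (c d d' : R7) : (∑ a, c a • g2Frame lam p e Ω a).2
      ![(∑ a, d a • g2Frame lam p e Ω a).1, (∑ a, d' a • g2Frame lam p e Ω a).1] =
      vert p (∑ a, c a • g2Frame lam p e Ω a)
      ![(∑ a, d a • g2Frame lam p e Ω a).1, (∑ a, d' a • g2Frame lam p e Ω a).1] := by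
    rw [vert_apply hp.1, hperp, hperp]; simp
  rw [phi, extDeriv_taut, hval, hval, hval, fibreVol_eq he (vert_sum_g2Frame_mem hp hΩ _)
    (vert_sum_g2Frame_mem hp hΩ _) (vert_sum_g2Frame_mem hp hΩ _)]
  simp only [sum_g2Frame_fst]
  rw [asd_apply_frame he (vert_sum_g2Frame_mem hp hΩ _),
    asd_apply_frame he (vert_sum_g2Frame_mem hp hΩ _),
    asd_apply_frame he (vert_sum_g2Frame_mem hp hΩ _)]
  simp only [asdCoord_sum_g2Frame hp hΩ hc]
  simp [phi0, covec, Matrix.det_fin_three]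
  field_simp
  rw [h22]
  ring

include hlam hp he hΩ hc in
theorem isG2Frame_g2Frame : IsG2Frame lam p (g2Frame lam p e Ω) := by
  have hsum (a : Fin 7) : g2Frame lam p e Ω a =
      ∑ b, (EuclideanSpace.single a 1 : R7) b • g2Frame lam p e Ω b := by
    simp
  -- `tangentVecs` is merely a set of velocities; closure under scaling comes from rescaling time.
  have hsm {v : Amb} (c : ℝ) (hv : v ∈ tangentVecs asd p) : c • v ∈ tangentVecs asd p := by
    obtain ⟨γ, h1, h2, h3, h4⟩ := hv
    have hm : HasDerivAt (fun t : ℝ => c * t) c 0 := by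
      simpa using (hasDerivAt_id (0 : ℝ)).const_mul c
    refine ⟨fun t => γ (c * t), ?_, by simp [h2], ?_, ?_⟩
    · exact ContDiffAt.comp (0 : ℝ) (by simpa using h1) (contDiffAt_const.mul contDiffAt_id)
    · have : Tendsto (fun t : ℝ => c * t) (𝓝 0) (𝓝 0) := by simpa using hm.continuousAt.tendsto
      exact this.eventually h3
    · exact HasDerivAt.scomp (0 : ℝ) (by simpa using h4) hm
  have hvt {β : Form2} (hβ : (p.1, β) ∈ asd) : ((0 : R5), β) ∈ tangentVecs asd p := by
    refine ⟨fun t => p + t • ((0 : R5), β), ?_, by simp, Eventually.of_forall fun t => ?_, ?_⟩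
    · exact (contDiff_const.add (contDiff_id.smul contDiff_const)).contDiffAt
    · have := mem_asd_add_smul (α := p.2) hp hβ t
      have e : p + t • ((0 : R5), β) = (p.1, p.2 + t • β) := by ext <;> simp
      change p + t • ((0 : R5), β) ∈ asd
      rwa [e]
    · simpa using ((hasDerivAt_id (0 : ℝ)).smul_const ((0 : R5), β)).const_add p
  refine ⟨fun a => ?_, fun a b => ?_, fun I => ?_⟩
  · have hh (i : Fin 4) := hsm (1 / (√2 * sFun lam p))
      (hor_mem_tangentVecs hp (he.1.1 i) (he.2.1 i))
    have hv (a : Fin 3) := hvt (mem_asd_smul (hΩ a) (sFun lam p))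
    fin_cases a
    exacts [hv 0, hv 1, hv 2, hh 0, hh 1, hh 2, hh 3]
  · rw [hsum a, hsum b, metric_g2Frame hlam hp he hΩ hc]
    simp [eq_comm]
  · rw [← phi_g2Frame hlam hp he hΩ hc]
    congr 1
    funext i
    exact hsum _

end G2Frame

/-- `*φ₀` on the hyperplane `e⁴ = 0`. -/
theorem starPhi0_of_coord_three_eq_zero (w : Fin 4 → R7) (hw : ∀ i, w i 3 = 0) (σ : Fin 4 → Fin 4 → ℝ)
    (hσ : ∀ i j, σ i j = (w i 0 * w j 4 - w j 0 * w i 4) + (w i 1 * w j 5 - w j 1 * w i 5)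
      + (w i 2 * w j 6 - w j 2 * w i 6)) :
    starPhi0 w = -(σ 0 1 * σ 2 3 - σ 0 2 * σ 1 3 + σ 0 3 * σ 1 2) := by
  -- The right-hand side is -(σ ∧ σ)/2, where the symplectic form σ pairs the coordinates 0, 1, 2
  -- with 4, 5, 6.
  simp [starPhi0, covec, hσ, Matrix.det_succ_row_zero, Fin.sum_univ_succ, hw, Fin.succAbove]
  ring

/-! ### Anti-self-dual forms over the sphere `x₅ = 0` -/

/-- The anti-self-dual form `α` over a point `x` with `x₅ = 0` for which `α(·, e₅) = z`. -/
def asdForm (x z : R5) : Form2 :=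
  ofMat ![![0, x 3 * z 2 - z 3 * x 2, -(x 3 * z 1 - z 3 * x 1), -(x 1 * z 2 - x 2 * z 1), z 0],
    ![-(x 3 * z 2 - z 3 * x 2), 0, x 3 * z 0 - z 3 * x 0, -(x 2 * z 0 - x 0 * z 2), z 1],
    ![x 3 * z 1 - z 3 * x 1, -(x 3 * z 0 - z 3 * x 0), 0, -(x 0 * z 1 - x 1 * z 0), z 2],
    ![x 1 * z 2 - x 2 * z 1, x 2 * z 0 - x 0 * z 2, x 0 * z 1 - x 1 * z 0, 0, z 3],
    ![-z 0, -z 1, -z 2, -z 3, 0]]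

theorem asdForm_apply (x z u v : R5) : asdForm x z ![u, v] =
    (x 3 * z 0 - z 3 * x 0) * (u 1 * v 2 - u 2 * v 1)
    + (x 3 * z 1 - z 3 * x 1) * (u 2 * v 0 - u 0 * v 2)
    + (x 3 * z 2 - z 3 * x 2) * (u 0 * v 1 - u 1 * v 0)
    - (x 1 * z 2 - x 2 * z 1) * (u 0 * v 3 - u 3 * v 0)
    - (x 2 * z 0 - x 0 * z 2) * (u 1 * v 3 - u 3 * v 1)
    - (x 0 * z 1 - x 1 * z 0) * (u 2 * v 3 - u 3 * v 2)
    + z 0 * (u 0 * v 4 - u 4 * v 0) + z 1 * (u 1 * v 4 - u 4 * v 1)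
    + z 2 * (u 2 * v 4 - u 4 * v 2) + z 3 * (u 3 * v 4 - u 4 * v 3) := by
  simp [asdForm, ofMat_apply, Fin.sum_univ_five]
  ring

/-- Together with `det_five_sparse'`, evaluates the matrices of inner products of (e₅, x, z, eᵢ, eⱼ)
with an oriented frame (x, e) in `asdForm_mem`. -/
theorem det_five_sparse (p q r s a b c d : ℝ) :
    Matrix.det !![0, p, q, r, s; 1, 0, 0, 0, 0; 0, a, b, c, d; 0, 1, 0, 0, 0; 0, 0, 1, 0, 0] =
      c * s - r * d := by
  simp [Matrix.det_succ_row_zero, Fin.sum_univ_succ, Fin.succAbove]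
  ring

theorem det_five_sparse' (p q r s a b c d : ℝ) :
    Matrix.det !![0, p, q, r, s; 1, 0, 0, 0, 0; 0, a, b, c, d; 0, 0, 0, 1, 0; 0, 0, 0, 0, 1] =
      a * q - p * b := by
  simp [Matrix.det_succ_row_zero, Fin.sum_univ_succ, Fin.succAbove]
  ring

theorem norm_sq_R5 (x : R5) : ‖x‖ ^ 2 = x 0 ^ 2 + x 1 ^ 2 + x 2 ^ 2 + x 3 ^ 2 + x 4 ^ 2 := by
  rw [EuclideanSpace.norm_sq_eq, Fin.sum_univ_five]; simp

/-- The form is β - ⋆β with β = z ∧ e₅: its value on (u, v) is ⟨z, u⟩v₅ - u₅⟨z, v⟩ - det(e₅, x, z,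
u, v). Expanding the determinant in an oriented frame shows that its values on (e₁, e₂) and (e₃, e₄)
are opposite. -/
theorem asdForm_mem {x z : R5} (hx : ‖x‖ = 1) (hx4 : x 4 = 0) (hz : inner ℝ x z = 0)
    (hz4 : z 4 = 0) : (x, asdForm x z) ∈ asd := by
  have hxx : inner ℝ x x = (1 : ℝ) := by rw [real_inner_self_eq_norm_sq, hx]; norm_num
  have hx2 := hxx
  have hz2 := hz
  rw [inner_R5, Fin.sum_univ_five] at hx2 hz2
  refine ⟨hx, fun v => ?_, fun e he => ?_⟩
  · rw [asdForm_apply]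
    simp only [hx4, hz4] at *
    linear_combination (z 3 * v 3 * 0 + v 4) * hz2
  · have hU := he.2.2
    have ho := orthonormal_iff_ite.1 he.1
    have hxe := he.2.1
    have hex (i : Fin 4) : inner ℝ (e i) x = (0 : ℝ) := by rw [real_inner_comm, hxe]
    set U := (Matrix.of fun i j => (Matrix.vecCons x e : Fin 5 → R5) i j) with hUdef
    let E : R5 := stdE 4
    have hEx : inner ℝ E x = (0 : ℝ) := by rw [inner_R5]; simp [E, stdE, hx4]
    have hEe (i : Fin 4) : inner ℝ E (e i) = e i 4 := by rw [inner_R5]; simp [E, stdE]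
    have hzx : inner ℝ z x = (0 : ℝ) := by rw [real_inner_comm, hz]
    have hmul (a b c d f : R5) : Matrix.of (fun i j => (![a, b, c, d, f] : Fin 5 → R5) i j) *
        U.transpose = Matrix.of (fun i j => inner ℝ ((![a, b, c, d, f] : Fin 5 → R5) i)
          ((Matrix.vecCons x e : Fin 5 → R5) j)) := by
      ext i j
      simp only [Matrix.mul_apply, Matrix.of_apply, Matrix.transpose_apply, hUdef, inner_R5]
    -- Multiplying by the frame matrix, which has determinant 1, replaces the entries by inner
    -- products with the frame.
    have hdet (a b c d f : R5) : (Matrix.of (fun i j => (![a, b, c, d, f] : Fin 5 → R5) i j)).det =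
        (Matrix.of (fun i j => inner ℝ ((![a, b, c, d, f] : Fin 5 → R5) i)
          ((Matrix.vecCons x e : Fin 5 → R5) j))).det := by
      rw [← hmul, Matrix.det_mul, Matrix.det_transpose, hU, mul_one]
    have c1 : (Matrix.vecCons x e : Fin 5 → R5) 1 = e 0 := rfl
    have c2 : (Matrix.vecCons x e : Fin 5 → R5) 2 = e 1 := rfl
    have c3 : (Matrix.vecCons x e : Fin 5 → R5) 3 = e 2 := rfl
    have c4 : (Matrix.vecCons x e : Fin 5 → R5) 4 = e 3 := rfl
    have d1 := hdet E x z (e 0) (e 1)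
    have d2 := hdet E x z (e 2) (e 3)
    have m1 : Matrix.of (fun i j => inner ℝ ((![E, x, z, e 0, e 1] : Fin 5 → R5) i)
          ((Matrix.vecCons x e : Fin 5 → R5) j)) =
        !![0, e 0 4, e 1 4, e 2 4, e 3 4; 1, 0, 0, 0, 0;
          0, inner ℝ z (e 0), inner ℝ z (e 1), inner ℝ z (e 2), inner ℝ z (e 3);
          0, 1, 0, 0, 0; 0, 0, 1, 0, 0] := by
      ext i j
      fin_cases i <;> fin_cases j <;>
        simp only [Fin.reduceFinMk, Fin.zero_eta, Fin.mk_one, Fin.isValue, Matrix.of_apply, Matrix.cons_val, Matrix.cons_val_zero, Matrix.cons_val_one, c1, c2, c3, c4,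
          hEx, hEe, hzx, hxx, hxe, hex, ho] <;> simp
    have m2 : Matrix.of (fun i j => inner ℝ ((![E, x, z, e 2, e 3] : Fin 5 → R5) i)
          ((Matrix.vecCons x e : Fin 5 → R5) j)) =
        !![0, e 0 4, e 1 4, e 2 4, e 3 4; 1, 0, 0, 0, 0;
          0, inner ℝ z (e 0), inner ℝ z (e 1), inner ℝ z (e 2), inner ℝ z (e 3);
          0, 0, 0, 1, 0; 0, 0, 0, 0, 1] := by
      ext i j
      fin_cases i <;> fin_cases j <;>
        simp only [Fin.reduceFinMk, Fin.zero_eta, Fin.mk_one, Fin.isValue, Matrix.of_apply, Matrix.cons_val, Matrix.cons_val_zero, Matrix.cons_val_one, c1, c2, c3, c4,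
          hEx, hEe, hzx, hxx, hxe, hex, ho] <;> simp
    rw [m1, det_five_sparse] at d1
    rw [m2, det_five_sparse'] at d2
    have hval (u v : R5) : asdForm x z ![u, v] = inner ℝ z u * v 4 - u 4 * inner ℝ z v -
        (Matrix.of (fun i j => (![E, x, z, u, v] : Fin 5 → R5) i j)).det := by
      rw [asdForm_apply, inner_R5, inner_R5]
      simp [Matrix.det_succ_row_zero, Fin.sum_univ_succ, Fin.succAbove, E, stdE, hz4]
      ring
    rw [hval, hval, d1, d2]
    ring

/-- The oriented frame `(-e₅, iq, jq, kq)` at a point `x = (q, 0)`, for `ℝ⁴ = ℍ`. -/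
def qFrame (x : R5) : Fin 4 → R5 :=
  ![!₂[0, 0, 0, 0, -1], !₂[-x 1, x 0, -x 3, x 2, 0], !₂[-x 2, x 3, x 0, -x 1, 0],
    !₂[-x 3, -x 2, x 1, x 0, 0]]

theorem qFrame_oriented {x : R5} (hx : ‖x‖ = 1) (hx4 : x 4 = 0) : IsOrientedFrame x (qFrame x) := by
  have hx2 : x 0 ^ 2 + x 1 ^ 2 + x 2 ^ 2 + x 3 ^ 2 = 1 := by
    have := norm_sq_R5 x
    rw [hx, hx4] at this; linarith
  refine ⟨orthonormal_iff_ite.2 fun i j => ?_, fun i => ?_, ?_⟩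
  · rw [inner_R5]
    fin_cases i <;> fin_cases j <;> simp [qFrame, Fin.sum_univ_five] <;>
      linarith
  · rw [inner_R5]
    fin_cases i <;> simp [qFrame, Fin.sum_univ_five, hx4] <;> ring
  · simp [qFrame, Matrix.det_succ_row_zero, Fin.sum_univ_succ, Fin.succAbove, hx4]
    linear_combination (x 0 ^ 2 + x 1 ^ 2 + x 2 ^ 2 + x 3 ^ 2 + 1) * hx2

theorem form2_eq_zero_of_fibreInner {α : Form2} (h : fibreInner α α = 0) : α = 0 := by
  have h1 : ∑ i, ∑ j, α ![stdE i, stdE j] * α ![stdE i, stdE j] = 0 := by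
    rw [fibreInner] at h; linarith
  refine form2_ext fun i j _ => ?_
  have h2 := (Finset.sum_eq_zero_iff_of_nonneg fun i _ => Finset.sum_nonneg fun j _ =>
    mul_self_nonneg (α ![stdE i, stdE j])).1 h1 i (Finset.mem_univ _)
  have h3 := (Finset.sum_eq_zero_iff_of_nonneg fun j _ =>
    mul_self_nonneg (α ![stdE i, stdE j])).1 h2 j (Finset.mem_univ _)
  simpa using h3

/-- The contraction of a 2-form with the last basis vector. -/
def contr (α : Form2) : R5 :=
  !₂[α ![stdE 0, stdE 4], α ![stdE 1, stdE 4], α ![stdE 2, stdE 4], α ![stdE 3, stdE 4], 0]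

theorem inner_contr (α : Form2) (u : R5) : inner ℝ u (contr α) = α ![u, stdE 4] := by
  conv_rhs => rw [sum_stdE u, form2_sum_left]
  simp [inner_R5, contr, Fin.sum_univ_five, form2_self]

/-- The difference of the two sides is anti-self-dual and annihilated by e₅. Since `qFrame` starts
with -e₅, all its coordinates in that frame vanish, and so does its fibre norm. -/
theorem asd_eq_asdForm {p : Amb} (hp : p ∈ asd) (hp4 : p.1 4 = 0) :
    inner ℝ p.1 (contr p.2) = (0 : ℝ) ∧ p.2 = asdForm p.1 (contr p.2) := by
  have h0 : inner ℝ p.1 (contr p.2) = (0 : ℝ) := by rw [inner_contr, hp.2.1]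
  have hm := mem_asd_add_smul (α := p.2) hp (asdForm_mem hp.1 hp4 h0 (by simp [contr])) (-1)
  refine ⟨h0, ?_⟩
  have hE (v : R5) : (p.2 + (-1 : ℝ) • asdForm p.1 (contr p.2)) ![stdE 4, v] = 0 := by
    change p.2 ![stdE 4, v] + (-1) * asdForm p.1 (contr p.2) ![stdE 4, v] = 0
    rw [form2_anti, ← inner_contr, asdForm_apply, inner_R5]
    simp [stdE, contr, Fin.sum_univ_five]; ring
  have he : !₂[0, 0, 0, 0, -1] = (-1 : ℝ) • stdE 4 := by
    ext i; fin_cases i <;> simp [stdE]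
  have hz : fibreInner (p.2 + (-1 : ℝ) • asdForm p.1 (contr p.2))
      (p.2 + (-1 : ℝ) • asdForm p.1 (contr p.2)) = 0 := by
    rw [fibreInner_eq (qFrame_oriented hp.1 hp4) hm hm]
    refine Finset.sum_eq_zero fun i _ => ?_
    have : asdCoord (qFrame p.1) (p.2 + (-1 : ℝ) • asdForm p.1 (contr p.2)) i = 0 := by
      have h (j : Fin 4) : (p.2 + (-1 : ℝ) • asdForm p.1 (contr p.2)) ![qFrame p.1 0, qFrame p.1 j]
          = 0 := by
        change (p.2 + (-1 : ℝ) • asdForm p.1 (contr p.2)) ![!₂[0, 0, 0, 0, -1], _] = 0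
        rw [he, form2_smul_left, hE, mul_zero]
      fin_cases i
      exacts [h 1, h 2, h 3]
    rw [this, zero_mul]
  have := form2_eq_zero_of_fibreInner hz
  refine form2_ext fun i j _ => ?_
  have h : p.2 ![stdE i, stdE j] + (-1) * asdForm p.1 (contr p.2) ![stdE i, stdE j] = 0 :=
    congrArg (fun β : Form2 => β ![stdE i, stdE j]) this
  linarith

/-- Contraction with e₅ is an isometry from the fibre to the vectors of ℝ⁴ orthogonal to x. -/
theorem rSq_asdForm {x z : R5} (hx : ‖x‖ = 1) (hx4 : x 4 = 0) (hz : inner ℝ x z = 0) :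
    rSq (x, asdForm x z) = z 0 ^ 2 + z 1 ^ 2 + z 2 ^ 2 + z 3 ^ 2 := by
  have hx2 := norm_sq_R5 x
  rw [inner_R5, Fin.sum_univ_five] at hz
  rw [hx, hx4] at hx2
  rw [hx4] at hz
  simp only [rSq, fibreInner, Fin.sum_univ_five, asdForm, ofMat_stdE]
  simp
  linear_combination (-(1 / 2 : ℝ) * (z 0 ^ 2 + z 1 ^ 2 + z 2 ^ 2 + z 3 ^ 2)) * hx2
    - (1 / 2 : ℝ) * (x 0 * z 0 + x 1 * z 1 + x 2 * z 2 + x 3 * z 3) * hz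

/-- The `G₂` frame over the sphere `x₅ = 0`. -/
def qG2Frame (lam : ℝ) (p : Amb) : Fin 7 → Amb :=
  g2Frame lam p (qFrame p.1) (fun a => asdForm p.1 (qFrame p.1 a.succ))

theorem qFrame_four (x : R5) (a : Fin 3) : qFrame x a.succ 4 = 0 := by
  fin_cases a <;> simp [qFrame]

theorem isG2Frame_qG2Frame {lam : ℝ} (hlam : 0 < lam) {p : Amb} (hp : p ∈ asd) (hp4 : p.1 4 = 0) :
    IsG2Frame lam p (qG2Frame lam p) := by
  have he := qFrame_oriented hp.1 hp4
  refine isG2Frame_g2Frame hlam hp he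
    (fun a => asdForm_mem hp.1 hp4 (he.2.1 _) (qFrame_four _ _)) fun a => ?_
  -- Contracting with the first frame vector -e₅ returns z, so the coordinates of `asdForm` are
  -- inner products with the rest of the frame.
  have hcon (z u : R5) (hz : z 4 = 0) : asdForm p.1 z ![qFrame p.1 0, u] = inner ℝ z u := by
    rw [asdForm_apply, inner_R5, Fin.sum_univ_five]
    simp [qFrame, hz]
  ext b
  have hb : asdCoord (qFrame p.1) (asdForm p.1 (qFrame p.1 a.succ)) b =
      asdForm p.1 (qFrame p.1 a.succ) ![qFrame p.1 0, qFrame p.1 b.succ] := by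
    fin_cases b <;> rfl
  rw [hb, hcon _ _ (qFrame_four _ _), orthonormal_iff_ite.1 he.1]
  simp [Pi.single_apply, eq_comm]

/-! ### Submanifolds: locality, images, regular level sets -/

section Submanifolds

variable {E F : Type*} [NormedAddCommGroup E] [NormedSpace ℝ E] [NormedAddCommGroup F]
  [NormedSpace ℝ F]

theorem IsSubmanifoldAt.congr {n : ℕ} {S S' U : Set E} {p : E} (h : IsSubmanifoldAt n S p)
    (hU : IsOpen U) (hp : p ∈ U) (hS : S ∩ U = S' ∩ U) : IsSubmanifoldAt n S' p := by
  obtain ⟨ψ, V, hV, h0, hψ0, hψ, W, ρ, hW, him, hρ, hinv⟩ := h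
  refine ⟨ψ, V ∩ ψ ⁻¹' U, hψ.continuousOn.isOpen_inter_preimage hV hU, ⟨h0, by simpa [hψ0]⟩, hψ0,
    hψ.mono inter_subset_left, W ∩ U, ρ, hW.inter hU, ?_, hρ.mono inter_subset_left,
    fun u hu => hinv u hu.1⟩
  rw [image_inter_preimage, him, inter_assoc, inter_comm W, ← inter_assoc, hS, inter_assoc,
    inter_comm U]

theorem tangentVecs_congr {S S' U : Set E} {p : E} (hU : IsOpen U) (hp : p ∈ U)
    (hS : S ∩ U = S' ∩ U) {v : E} (hv : v ∈ tangentVecs S p) : v ∈ tangentVecs S' p := by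
  obtain ⟨γ, h1, h2, h3, h4⟩ := hv
  refine ⟨γ, h1, h2, ?_, h4⟩
  have := h1.continuousAt.eventually_mem (hU.mem_nhds (by rwa [h2]))
  filter_upwards [h3, this] with t ht ht'
  have h : γ t ∈ S ∩ U := ⟨ht, ht'⟩
  rw [hS] at h
  exact h.1

/-- A linear left inverse pulls back both the ambient open set and the smooth inverse of the
parametrization. -/
theorem IsSubmanifoldAt.image {n : ℕ} {S : Set E} {p : E} (h : IsSubmanifoldAt n S p) {f : E → F}
    (hf : ContDiff ℝ ∞ f) (g : F →L[ℝ] E) (hg : ∀ x, g (f x) = x) :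
    IsSubmanifoldAt n (f '' S) (f p) := by
  obtain ⟨ψ, V, hV, h0, hψ0, hψ, W, ρ, hW, him, hρ, hinv⟩ := h
  refine ⟨f ∘ ψ, V, hV, h0, by simp [hψ0], hf.comp_contDiffOn hψ, g ⁻¹' W, ρ ∘ g,
    hW.preimage g.continuous, ?_, hρ.comp g.contDiff.contDiffOn fun _ hx => hx, fun u hu => ?_⟩
  · rw [image_comp, him]
    ext y
    constructor
    · rintro ⟨x, ⟨hx, hxW⟩, rfl⟩
      exact ⟨⟨x, hx, rfl⟩, by simpa [hg]⟩
    · rintro ⟨⟨x, hx, rfl⟩, hxW⟩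
      exact ⟨x, ⟨hx, by simpa [hg] using hxW⟩, rfl⟩
  · simp [hg, hinv u hu]

/-- A surjective linear map can be completed to an isomorphism. -/
theorem exists_complement_equiv [FiniteDimensional ℝ E] [FiniteDimensional ℝ F] {n : ℕ}
    (hn : Module.finrank ℝ E = n + Module.finrank ℝ F) (G' : E →L[ℝ] F)
    (hG' : Function.Surjective G') :
    ∃ (P : E →L[ℝ] EuclideanSpace ℝ (Fin n)) (e : E ≃L[ℝ] EuclideanSpace ℝ (Fin n) × F),
      (e : E →L[ℝ] EuclideanSpace ℝ (Fin n) × F) = P.prod G' := by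
  let K := LinearMap.ker (G' : E →ₗ[ℝ] F)
  have hK : Module.finrank ℝ K = n := by
    have h1 := LinearMap.finrank_range_add_finrank_ker (G' : E →ₗ[ℝ] F)
    have h2 : LinearMap.range (G' : E →ₗ[ℝ] F) = ⊤ := LinearMap.range_eq_top.2 hG'
    rw [h2, finrank_top, hn] at h1
    change Module.finrank ℝ (LinearMap.ker (G' : E →ₗ[ℝ] F)) = n
    omega
  -- A linear projection to the kernel of G' supplies the missing n coordinates.
  obtain ⟨π, hπ⟩ := LinearMap.exists_leftInverse_of_injective K.subtype
    (LinearMap.ker_eq_bot.2 K.injective_subtype)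
  let c : K ≃ₗ[ℝ] EuclideanSpace ℝ (Fin n) := LinearEquiv.ofFinrankEq _ _ (by simp [hK])
  let P : E →L[ℝ] EuclideanSpace ℝ (Fin n) := LinearMap.toContinuousLinearMap (c.toLinearMap ∘ₗ π)
  have hinj : Function.Injective (P.prod G' : E →ₗ[ℝ] EuclideanSpace ℝ (Fin n) × F) := by
    refine (injective_iff_map_eq_zero _).2 fun v hv => ?_
    have h1 : c (π v) = 0 := congrArg Prod.fst hv
    have h2 : G' v = 0 := congrArg Prod.snd hv
    have h3 : π v = ⟨v, h2⟩ := LinearMap.congr_fun hπ ⟨v, h2⟩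
    rw [LinearEquiv.map_eq_zero_iff, h3] at h1
    exact congrArg Subtype.val h1
  have hdim : Module.finrank ℝ E = Module.finrank ℝ (EuclideanSpace ℝ (Fin n) × F) := by
    rw [Module.finrank_prod, finrank_euclideanSpace_fin, hn]
  refine ⟨P, (LinearEquiv.ofInjectiveOfFinrankEq _ hinj hdim).toContinuousLinearEquiv, ?_⟩
  ext v <;> rfl

/-- Implicit function theorem: Φ = (P(· - p), G) is a local diffeomorphism that flattens the level
set to the slice where the second component is 0. Lines in that slice provide the curves with
velocities in the kernel. -/
theorem regularLevelSet [FiniteDimensional ℝ E] [FiniteDimensional ℝ F] {n : ℕ}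
    (hn : Module.finrank ℝ E = n + Module.finrank ℝ F) {G : E → F} (hG : ContDiff ℝ ∞ G) {p : E}
    (hp : G p = 0) {G' : E →L[ℝ] F} (hG' : HasFDerivAt G G' p) (hs : Function.Surjective G') :
    IsSubmanifoldAt n {q | G q = 0} p ∧ ∀ v, G' v = 0 → v ∈ tangentVecs {q | G q = 0} p := by
  obtain ⟨P, e, he⟩ := exists_complement_equiv hn G' hs
  let Φ : E → EuclideanSpace ℝ (Fin n) × F := fun q => (P (q - p), G q)
  have hP : ContDiff ℝ ∞ fun q => P (q - p) := P.contDiff.comp (contDiff_id.sub contDiff_const)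
  have hΦ : ContDiff ℝ ∞ Φ := hP.prodMk hG
  have hΦ' : HasFDerivAt Φ (e : E →L[ℝ] EuclideanSpace ℝ (Fin n) × F) p := by
    rw [he]
    refine HasFDerivAt.prodMk ?_ hG'
    exact P.hasFDerivAt.comp p ((hasFDerivAt_id p).sub_const p)
  have hn0 : (∞ : WithTop ℕ∞) ≠ 0 := by simp
  have hst : HasStrictFDerivAt Φ (e : E →L[ℝ] EuclideanSpace ℝ (Fin n) × F) p :=
    hΦ.contDiffAt.hasStrictFDerivAt' hΦ' hn0
  -- Restricting to points where dΦ is invertible makes the inverse smooth on its whole domain, not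
  -- only at the image of p.
  let O : Set E := {q | fderiv ℝ Φ q ∈
    range ((↑) : (E ≃L[ℝ] EuclideanSpace ℝ (Fin n) × F) → E →L[ℝ] EuclideanSpace ℝ (Fin n) × F)}
  have hO : IsOpen O := (ContinuousLinearEquiv.isOpen).preimage (hΦ.continuous_fderiv hn0)
  have hpO : p ∈ O := ⟨e, hΦ'.fderiv.symm⟩
  let H := (hst.toOpenPartialHomeomorph Φ).restrOpen O hO
  have hpH : p ∈ H.source := ⟨hst.mem_toOpenPartialHomeomorph_source, hpO⟩
  have hHΦ (q : E) : H q = Φ q := rfl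
  have hΦp : Φ p = 0 := by simp [Φ, hp]
  have hsymm {t} (ht : t ∈ H.target) : ContDiffAt ℝ ∞ H.symm t := by
    obtain ⟨e', he'⟩ : H.symm t ∈ O := (H.map_target ht).2
    refine H.contDiffAt_symm ht (f₀' := e') ?_ hΦ.contDiffAt
    rw [he']
    exact (hΦ.differentiable hn0 _).hasFDerivAt
  have h0t : ((0 : EuclideanSpace ℝ (Fin n)), (0 : F)) ∈ H.target := by
    have := H.map_source hpH
    rwa [hHΦ, hΦp] at this
  have hp0 : H.symm ((0 : EuclideanSpace ℝ (Fin n)), (0 : F)) = p := by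
    have := H.left_inv hpH
    rwa [hHΦ, hΦp] at this
  let V : Set (EuclideanSpace ℝ (Fin n)) := (fun u => (u, (0 : F))) ⁻¹' H.target
  have hV : IsOpen V := H.open_target.preimage (by fun_prop)
  let ψ : EuclideanSpace ℝ (Fin n) → E := fun u => H.symm (u, 0)
  have hψ {u} (hu : u ∈ V) : ContDiffAt ℝ ∞ ψ u :=
    ContDiffAt.comp u (hsymm hu) (contDiffAt_id.prodMk contDiffAt_const)
  have hΦψ {u} (hu : u ∈ V) : Φ (ψ u) = (u, 0) := H.right_inv hu
  have hGψ {u} (hu : u ∈ V) : G (ψ u) = 0 := congrArg Prod.snd (hΦψ hu)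
  refine ⟨⟨ψ, V, hV, h0t, hp0, fun u hu => (hψ hu).contDiffWithinAt, H.source,
    fun q => P (q - p), H.open_source, ?_, hP.contDiffOn, fun u hu => congrArg Prod.fst (hΦψ hu)⟩,
    fun v hv => ?_⟩
  · ext q
    constructor
    · rintro ⟨u, hu, rfl⟩
      exact ⟨hGψ hu, H.map_target hu⟩
    · rintro ⟨hq, hqH⟩
      have hq' : H q = (P (q - p), 0) := by rw [hHΦ]; exact Prod.ext rfl hq
      refine ⟨P (q - p), ?_, ?_⟩
      · change (P (q - p), (0 : F)) ∈ H.target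
        rw [← hq']; exact H.map_source hqH
      · change H.symm (P (q - p), 0) = q
        rw [← hq']; exact H.left_inv hqH
  · have hl : HasDerivAt (fun t : ℝ => t • P v) (P v) 0 := by
      simpa using (hasDerivAt_id (0 : ℝ)).smul_const (P v)
    have h0 : (0 : ℝ) • P v = 0 := zero_smul _ _
    have hψ0 : ContDiffAt ℝ ∞ ψ ((0 : ℝ) • P v) := by rw [h0]; exact hψ h0t
    refine ⟨fun t => ψ (t • P v), ?_, ?_, ?_, ?_⟩
    · exact ContDiffAt.comp (0 : ℝ) (g := ψ) hψ0 (contDiffAt_id.smul contDiffAt_const)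
    · change ψ ((0 : ℝ) • P v) = p
      rw [h0]; exact hp0
    · have : ∀ᶠ t : ℝ in 𝓝 0, t • P v ∈ V :=
        hl.continuousAt.eventually_mem (hV.mem_nhds (by rw [h0]; exact h0t))
      exact this.mono fun t ht => hGψ ht
    · have h1 : HasFDerivAt H.symm (e.symm : EuclideanSpace ℝ (Fin n) × F →L[ℝ] E)
          ((0 : EuclideanSpace ℝ (Fin n)), (0 : F)) := by
        refine H.hasFDerivAt_symm h0t ?_
        rw [hp0]; exact hΦ'
      have h2 : HasDerivAt (fun t : ℝ => (t • P v, (0 : F))) (P v, 0) 0 :=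
        hl.prodMk (hasDerivAt_const _ _)
      have h3 := HasFDerivAt.comp_hasDerivAt (0 : ℝ) (f := fun t : ℝ => (t • P v, (0 : F)))
        (by simpa using h1) h2
      have h4 : e v = (P v, 0) := by
        have := DFunLike.congr_fun he v
        simpa [hv] using this
      have h5 : (e.symm : EuclideanSpace ℝ (Fin n) × F →L[ℝ] E) (P v, 0) = v := by
        rw [← h4]; simp
      rw [h5] at h3
      exact h3

end Submanifolds

/-! ### Coassociativity at a point: locality and equivariance. -/

/-- The pointwise condition in the definition of coassociative submanifolds. -/
def IsCoassociativeAt (lam : ℝ) (L : Set Amb) (p : Amb) : Prop :=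
  IsSubmanifoldAt 4 L p ∧
    ∃ v : Fin 4 → Amb, (∀ i, v i ∈ tangentVecs L p) ∧
      (∀ i j, metric lam p (v i) (v j) = if i = j then 1 else 0) ∧ StarPhiEq lam p v 1

theorem IsCoassociativeAt.congr {lam : ℝ} {L L' U : Set Amb} {p : Amb}
    (h : IsCoassociativeAt lam L p) (hU : IsOpen U) (hp : p ∈ U) (hS : L ∩ U = L' ∩ U) :
    IsCoassociativeAt lam L' p := by
  obtain ⟨h1, v, h2, h3, h4⟩ := h
  exact ⟨h1.congr hU hp hS, v, fun i => tangentVecs_congr hU hp hS (h2 i), h3, h4⟩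

theorem IsCoassociativeAt.lift {lam : ℝ} {L : Set Amb} {p : Amb} (hp : ‖p.1‖ = 1)
    (h : IsCoassociativeAt lam L p) {A : Matrix (Fin 5) (Fin 5) ℝ} (hA : IsSO A) :
    IsCoassociativeAt lam (lift A '' L) (lift A p) := by
  obtain ⟨h1, v, h2, h3, h4⟩ := h
  refine ⟨h1.image (f := BryantSalamon.lift A) (liftL A).contDiff (liftL A.transpose)
    hA.lift_transpose, _, fun i => tangentVecs_lift (mapsTo_image _ _) (h2 i), fun i j => ?_,
    hA.starPhiEq_lift hp h4⟩
  rw [hA.metric_lift lam hp]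
  exact h3 i j

/-! ### Tangent vectors over the sphere `x₅ = 0` -/

theorem asdForm_add (x z z' : R5) : asdForm x (z + z') = asdForm x z + asdForm x z' := by
  refine form2_ext fun i j _ => ?_
  change _ = asdForm x z ![stdE i, stdE j] + asdForm x z' ![stdE i, stdE j]
  simp only [asdForm_apply, PiLp.add_apply]
  ring

theorem asdForm_smul (x z : R5) (c : ℝ) : asdForm x (c • z) = c • asdForm x z := by
  refine form2_ext fun i j _ => ?_
  change _ = c * asdForm x z ![stdE i, stdE j]
  simp only [asdForm_apply, PiLp.smul_apply, smul_eq_mul]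
  ring

theorem hor_add (p : Amb) (ξ ξ' : R5) : hor p (ξ + ξ') = hor p ξ + hor p ξ' := by
  refine Prod.ext rfl (form2_ext fun i j _ => ?_)
  change _ = (hor p ξ).2 ![stdE i, stdE j] + (hor p ξ').2 ![stdE i, stdE j]
  simp only [hor_snd_apply, form2_add_left, form2_add_right]
  ring

theorem hor_smul (p : Amb) (ξ : R5) (c : ℝ) : hor p (c • ξ) = c • hor p ξ := by
  refine Prod.ext rfl (form2_ext fun i j _ => ?_)
  change _ = c * (hor p ξ).2 ![stdE i, stdE j]
  simp only [hor_snd_apply, form2_smul_left, form2_smul_right]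
  ring

/-- The determinant of the first four coordinates. -/
def det4 (a b c d : R5) : ℝ :=
  (a 0 * b 1 - a 1 * b 0) * (c 2 * d 3 - c 3 * d 2) - (a 0 * b 2 - a 2 * b 0) * (c 1 * d 3 - c 3 * d 1)
  + (a 0 * b 3 - a 3 * b 0) * (c 1 * d 2 - c 2 * d 1) + (a 1 * b 2 - a 2 * b 1) * (c 0 * d 3 - c 3 * d 0)
  - (a 1 * b 3 - a 3 * b 1) * (c 0 * d 2 - c 2 * d 0) + (a 2 * b 3 - a 3 * b 2) * (c 0 * d 1 - c 1 * d 0)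

/-- The velocity of a curve `(x, asdForm x z)` splits into its horizontal and vertical parts. -/
theorem asdForm_deriv_eq {x z x' : R5} (z' : R5) (hx : ‖x‖ = 1) (hx4 : x 4 = 0) (hz4 : z 4 = 0)
    (hx'4 : x' 4 = 0) (hxz : inner ℝ x z = 0) (hxx' : inner ℝ x x' = 0) :
    asdForm x z' + (asdForm x' z - asdForm 0 z) =
      (hor (x, asdForm x z) x').2 + asdForm x (z' + inner ℝ z x' • x) := by
  have h1 := norm_sq_R5 x
  rw [hx] at h1
  refine form2_ext fun i j _ => ?_
  set u := stdE i
  set v := stdE j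
  change asdForm x z' ![u, v] + (asdForm x' z ![u, v] - asdForm 0 z ![u, v]) =
    (hor (x, asdForm x z) x').2 ![u, v] + asdForm x (z' + inner ℝ z x' • x) ![u, v]
  rw [hor_snd_apply]
  simp only [inner_R5, Fin.sum_univ_five, hx4, hz4, hx'4, asdForm_apply, PiLp.add_apply,
    PiLp.smul_apply, smul_eq_mul, PiLp.zero_apply] at h1 hxz hxx' ⊢
  -- The definition of `det4` is recorded as equations, so that `linear_combination` can use the
  -- determinants both as atoms and expanded.
  have d1 : det4 x' z u v = det4 x' z u v := rfl
  have d2 : det4 x z u v = det4 x z u v := rfl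
  have d3 : det4 x' x u v = det4 x' x u v := rfl
  conv_rhs at d1 => rw [det4]
  conv_rhs at d2 => rw [det4]
  conv_rhs at d3 => rw [det4]
  linear_combination (-det4 x' z u v) * h1 - det4 x z u v * hxx' - det4 x' x u v * hxz
    + (1 - x 0 ^ 2 - x 1 ^ 2 - x 2 ^ 2 - x 3 ^ 2) * d1
    + (x 0 * x' 0 + x 1 * x' 1 + x 2 * x' 2 + x 3 * x' 3) * d2
    + (x 0 * z 0 + x 1 * z 1 + x 2 * z 2 + x 3 * z 3) * d3

theorem qFrame_expand {x V : R5} (hx : ‖x‖ = 1) (hx4 : x 4 = 0) (hV4 : V 4 = 0)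
    (hV : inner ℝ x V = 0) : V = ∑ a : Fin 3, inner ℝ V (qFrame x a.succ) • qFrame x a.succ := by
  have h1 := norm_sq_R5 x
  rw [hx, hx4] at h1
  simp only [inner_R5, Fin.sum_univ_five, hx4] at hV
  simp only [inner_R5, Fin.sum_univ_five]
  ext i
  fin_cases i <;> simp [qFrame, Fin.sum_univ_three, hV4, Fin.succ]
  · linear_combination V 0 * h1 + x 0 * hV
  · linear_combination V 1 * h1 + x 1 * hV
  · linear_combination V 2 * h1 + x 2 * hV
  · linear_combination V 3 * h1 + x 3 * hV

section

variable {lam : ℝ} {p : Amb}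

/-- Coefficient vectors of tangent vectors of submanifolds over the sphere `x₅ = 0`. -/
def coef (v h : Fin 3 → ℝ) : R7 := !₂[v 0, v 1, v 2, 0, h 0, h 1, h 2]

/-- Slot 3 of the frame is the direction -e₅, so vectors with vanishing coefficient there are those
tangent to the bundle over x₅ = 0, split into horizontal and vertical part. -/
theorem sum_coef (v h : Fin 3 → ℝ) :
    ∑ a, coef v h a • qG2Frame lam p a =
      hor p (∑ a, (h a / (√2 * sFun lam p)) • qFrame p.1 a.succ) +
        (0, asdForm p.1 (∑ a, (sFun lam p * v a) • qFrame p.1 a.succ)) := by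
  have hv (β γ : Form2) : ((0 : R5), β + γ) = (0, β) + (0, γ) := by simp
  have hs (c : ℝ) (β : Form2) : ((0 : R5), c • β) = c • ((0 : R5), β) := by simp
  simp only [Fin.sum_univ_three, hor_add, hor_smul, asdForm_add, asdForm_smul, hv, hs]
  simp only [Fin.sum_univ_seven, coef, qG2Frame, g2Frame, div_eq_mul_inv, hs]
  simp [smul_smul, mul_comm]
  module

theorem metric_coef (hlam : 0 < lam) (hp : p ∈ asd) (hp4 : p.1 4 = 0) (v h v' h' : Fin 3 → ℝ) :
    metric lam p (∑ a, coef v h a • qG2Frame lam p a) (∑ a, coef v' h' a • qG2Frame lam p a) =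
      ∑ a, (v a * v' a + h a * h' a) := by
  have he := qFrame_oriented hp.1 hp4
  have hG := (isG2Frame_qG2Frame hlam hp hp4).2.1
  have hadd (X Y Z : Amb) : metric lam p (X + Y) Z = metric lam p X Z + metric lam p Y Z := by
    simp only [metric, vert_add, fibreInner, Prod.fst_add, inner_add_left,
      ContinuousAlternatingMap.add_apply, add_mul, Finset.sum_add_distrib]
    ring
  have hsmul (c : ℝ) (X Z : Amb) : metric lam p (c • X) Z = c * metric lam p X Z := by
    simp only [metric, vert_smul, fibreInner, Prod.smul_fst, inner_smul_left,
      ContinuousAlternatingMap.smul_apply, smul_eq_mul, mul_assoc, ← Finset.mul_sum]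
    simp
    ring
  have hsymm (X Z : Amb) : metric lam p X Z = metric lam p Z X := by
    simp only [metric, fibreInner, real_inner_comm Z.1, mul_comm (vert p X _)]
  simp only [Fin.sum_univ_seven, hadd, hsmul, hsymm _ (_ + _), hG]
  simp [coef, Fin.sum_univ_three]
  ring

theorem starPhi0_coef (v h : Fin 4 → Fin 3 → ℝ) (σ : Fin 4 → Fin 4 → ℝ)
    (hσ : ∀ i j, σ i j = ∑ a, (v i a * h j a - v j a * h i a)) :
    starPhi0 (fun i => coef (v i) (h i)) =
      -(σ 0 1 * σ 2 3 - σ 0 2 * σ 1 3 + σ 0 3 * σ 1 2) :=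
  starPhi0_of_coord_three_eq_zero _ (fun i => by simp [coef]) σ fun i j => by
    rw [hσ, Fin.sum_univ_three]; simp [coef]

end

/-- A complex linear equation in `ℂ³` has two orthonormal solutions. -/
theorem exists_orthonormal_solutions (p q : Fin 3 → ℝ) : ∃ v h v' h' : Fin 3 → ℝ,
    ∑ a, (p a * v a - q a * h a) = 0 ∧ ∑ a, (p a * h a + q a * v a) = 0 ∧
    ∑ a, (p a * v' a - q a * h' a) = 0 ∧ ∑ a, (p a * h' a + q a * v' a) = 0 ∧
    ∑ a, (v a * v a + h a * h a) = 1 ∧ ∑ a, (v' a * v' a + h' a * h' a) = 1 ∧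
    ∑ a, (v a * v' a + h a * h' a) = 0 ∧ ∑ a, (v a * h' a - v' a * h a) = 0 := by
  -- The conjugate p - iq is used because the inner product is conjugate linear on the left: ⟨c, v +
  -- ih⟩ = ∑ (p + iq)(v + ih).
  let c : EuclideanSpace ℂ (Fin 3) := WithLp.toLp 2 fun a => ⟨p a, -q a⟩
  let U := (Submodule.span ℂ {c})ᗮ
  have hU : 2 ≤ Module.finrank ℂ U := by
    have h1 := Submodule.finrank_add_finrank_orthogonal (Submodule.span ℂ {c})
    have h2 : Module.finrank ℂ (Submodule.span ℂ {c}) ≤ 1 := by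
      simpa using finrank_span_le_card ({c} : Set (EuclideanSpace ℂ (Fin 3)))
    have h3 : Module.finrank ℂ (EuclideanSpace ℂ (Fin 3)) = 3 := by simp
    change 2 ≤ Module.finrank ℂ (Submodule.span ℂ {c})ᗮ
    omega
  let b := stdOrthonormalBasis ℂ U
  let z : EuclideanSpace ℂ (Fin 3) := b ⟨0, by omega⟩
  let z' : EuclideanSpace ℂ (Fin 3) := b ⟨1, by omega⟩
  have hz : inner ℂ c z = 0 :=
    (Submodule.mem_orthogonal_singleton_iff_inner_right).1 (b ⟨0, by omega⟩).2
  have hz' : inner ℂ c z' = 0 :=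
    (Submodule.mem_orthogonal_singleton_iff_inner_right).1 (b ⟨1, by omega⟩).2
  have ho := orthonormal_iff_ite.1 b.orthonormal
  have h1 : inner ℂ z z = 1 := (ho ⟨0, by omega⟩ ⟨0, by omega⟩).trans (if_pos rfl)
  have h2 : inner ℂ z' z' = 1 := (ho ⟨1, by omega⟩ ⟨1, by omega⟩).trans (if_pos rfl)
  have h3 : inner ℂ z z' = 0 := (ho ⟨0, by omega⟩ ⟨1, by omega⟩).trans (if_neg (by simp))
  refine ⟨fun a => (z a).re, fun a => (z a).im, fun a => (z' a).re, fun a => (z' a).im, ?_⟩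
  rw [PiLp.inner_apply, Fin.sum_univ_three, Complex.ext_iff] at hz hz' h1 h2 h3
  simp only [RCLike.inner_apply, c, Complex.add_re, Complex.add_im, Complex.mul_re, Complex.mul_im,
    Complex.conj_re, Complex.conj_im, Complex.one_re, Complex.zero_re, Complex.zero_im]
    at hz hz' h1 h2 h3
  simp only [Fin.sum_univ_three]
  refine ⟨?_, ?_, ?_, ?_, ?_, ?_, ?_, ?_⟩
  · linarith [hz.1]
  · linarith [hz.2]
  · linarith [hz'.1]
  · linarith [hz'.2]
  · linarith [h1.1]
  · linarith [h2.1]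
  · linarith [h3.1]
  · linarith [h3.2]

/-- A submanifold over `x₅ = 0` is coassociative at a point `p` if its tangent space is given by a
complex linear equation in the coordinates of the `G₂` frame. -/
theorem isCoassociativeAt_of_tangentVecs {lam : ℝ} (hlam : 0 < lam) {L : Set Amb} {p : Amb}
    (hp : p ∈ asd) (hp4 : p.1 4 = 0) (hL : IsSubmanifoldAt 4 L p) (P Q : Fin 3 → ℝ)
    (hT : ∀ v h : Fin 3 → ℝ, ∑ a, (P a * v a - Q a * h a) = 0 → ∑ a, (P a * h a + Q a * v a) = 0 →
      ∑ a, coef v h a • qG2Frame lam p a ∈ tangentVecs L p) :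
    IsCoassociativeAt lam L p := by
  obtain ⟨v, h, v', h', e1, e2, e3, e4, n1, n2, o1, o2⟩ := exists_orthonormal_solutions P Q
  -- With ζ = v + ih and ζ' = v' + ih', the basis is (ζ, iζ, iζ', ζ'). The reversed second pair
  -- gives σ(ζ, iζ) = 1 and σ(iζ', ζ') = -1, so that -σ²/2 takes the value +1.
  let A : Fin 4 → Fin 3 → ℝ := ![v, fun a => -h a, fun a => -h' a, v']
  let B : Fin 4 → Fin 3 → ℝ := ![h, v, v', h']
  refine ⟨hL, fun i => ∑ a, coef (A i) (B i) a • qG2Frame lam p a, fun i => ?_, fun i j => ?_,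
    qG2Frame lam p, isG2Frame_qG2Frame hlam hp hp4, fun i => coef (A i) (B i), fun i => rfl, ?_⟩
  · simp only [Fin.sum_univ_three] at hT e1 e2 e3 e4
    fin_cases i <;> refine hT _ _ ?_ ?_ <;> simp [A, B] <;> linarith
  · rw [metric_coef hlam hp hp4]
    simp only [Fin.sum_univ_three] at n1 n2 o1 o2 ⊢
    fin_cases i <;> fin_cases j <;> simp [A, B] <;> linarith
  · rw [starPhi0_coef A B _ fun i j => rfl]
    simp only [Fin.sum_univ_three] at n1 n2 o1 o2 ⊢
    have s1 : A 0 0 * B 1 0 - A 1 0 * B 0 0 + (A 0 1 * B 1 1 - A 1 1 * B 0 1) +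
      (A 0 2 * B 1 2 - A 1 2 * B 0 2) = 1 := by simp [A, B]; linarith
    have s2 : A 2 0 * B 3 0 - A 3 0 * B 2 0 + (A 2 1 * B 3 1 - A 3 1 * B 2 1) +
      (A 2 2 * B 3 2 - A 3 2 * B 2 2) = -1 := by simp [A, B]; linarith
    have s3 : A 0 0 * B 2 0 - A 2 0 * B 0 0 + (A 0 1 * B 2 1 - A 2 1 * B 0 1) +
      (A 0 2 * B 2 2 - A 2 2 * B 0 2) = 0 := by simp [A, B]; linarith
    have s4 : A 0 0 * B 3 0 - A 3 0 * B 0 0 + (A 0 1 * B 3 1 - A 3 1 * B 0 1) +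
      (A 0 2 * B 3 2 - A 3 2 * B 0 2) = 0 := by simp [A, B]; linarith
    rw [s1, s2, s3, s4]
    norm_num

/-! ### The model level sets in `ℝ³ × ℝ³` -/

/-- `ℝ³`. -/
abbrev R3 : Type := EuclideanSpace ℝ (Fin 3)

/-- The point `(y, t, 0)` of `ℝ⁵`. -/
def xVec (y : R3) (t : ℝ) : R5 := !₂[y 0, y 1, y 2, t, 0]

theorem inner_R3 (u v : R3) : inner ℝ u v = u 0 * v 0 + u 1 * v 1 + u 2 * v 2 := by
  rw [PiLp.inner_apply, Fin.sum_univ_three]; simp [mul_comm]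

theorem norm_sq_R3 (u : R3) : ‖u‖ ^ 2 = u 0 ^ 2 + u 1 ^ 2 + u 2 ^ 2 := by
  rw [EuclideanSpace.norm_sq_eq, Fin.sum_univ_three]; simp

theorem inner_xVec (y w : R3) (s t : ℝ) : inner ℝ (xVec y s) (xVec w t) = inner ℝ y w + s * t := by
  rw [inner_R5, inner_R3, Fin.sum_univ_five]; simp [xVec]

theorem norm_xVec (y : R3) (t : ℝ) : ‖xVec y t‖ ^ 2 = ‖y‖ ^ 2 + t ^ 2 := by
  rw [norm_sq_R5, norm_sq_R3]; simp [xVec]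

/-- The function `X (λ + E² + |w|²)^{-1/4}`, the value of `x₄` on the component with
`x₄ (λ + r²)^{1/4} = X`. -/
def hFun (lam X E : ℝ) (w : R3) : ℝ := X * (lam + E ^ 2 + ‖w‖ ^ 2) ^ (-(1 / 4) : ℝ)

/-- The equations `|y|² = 1 - h²`, `⟨y, w⟩ = h E`. -/
def levelMap (lam X E : ℝ) (q : R3 × R3) : ℝ × ℝ :=
  (‖q.1‖ ^ 2 - 1 + hFun lam X E q.2 ^ 2, inner ℝ q.1 q.2 - hFun lam X E q.2 * E)

/-- The level set of `levelMap`. -/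
def K (lam X E : ℝ) : Set (R3 × R3) := {q | levelMap lam X E q = 0}

/-- The embedding of the level set `K` into `Λ²₋S⁴`. -/
def theta (lam X E : ℝ) (q : R3 × R3) : Amb :=
  (xVec q.1 (hFun lam X E q.2), asdForm (xVec q.1 (hFun lam X E q.2)) (xVec q.2 (-E)))

/-- The linear left inverse of `theta`. -/
def thetaInv : Amb →L[ℝ] R3 × R3 :=
  ((LinearMap.toContinuousLinearMap
    { toFun := fun x : R5 => (!₂[x 0, x 1, x 2] : R3)
      map_add' := fun x y => by ext i; fin_cases i <;> rfl
      map_smul' := fun c x => by ext i; fin_cases i <;> rfl }).comp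
        (ContinuousLinearMap.fst ℝ R5 Form2)).prod
  ((LinearMap.toContinuousLinearMap
    { toFun := fun α : Form2 =>
        (!₂[α ![stdE 0, stdE 4], α ![stdE 1, stdE 4], α ![stdE 2, stdE 4]] : R3)
      map_add' := fun x y => by ext i; fin_cases i <;> rfl
      map_smul' := fun c x => by ext i; fin_cases i <;> rfl }).comp
        (ContinuousLinearMap.snd ℝ R5 Form2))

theorem thetaInv_apply (p : Amb) : thetaInv p =
    (!₂[p.1 0, p.1 1, p.1 2],
      !₂[p.2 ![stdE 0, stdE 4], p.2 ![stdE 1, stdE 4], p.2 ![stdE 2, stdE 4]]) := rfl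

theorem thetaInv_asdForm (y w : R3) (s t : ℝ) :
    thetaInv (xVec y s, asdForm (xVec y s) (xVec w t)) = (y, w) := by
  rw [thetaInv_apply]
  refine Prod.ext ?_ ?_ <;> ext i <;> fin_cases i <;> simp [xVec, asdForm_apply, stdE]

theorem thetaInv_theta (lam X E : ℝ) (q : R3 × R3) : thetaInv (theta lam X E q) = q :=
  thetaInv_asdForm _ _ _ _

section Calculus

variable {G : Type*} [NormedAddCommGroup G] [NormedSpace ℝ G]

theorem contDiffOn_xVec {y : G → R3} {t : G → ℝ} {n : WithTop ℕ∞} {s : Set G}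
    (hy : ContDiffOn ℝ n y s) (ht : ContDiffOn ℝ n t s) :
    ContDiffOn ℝ n (fun g => xVec (y g) (t g)) s := by
  rw [contDiffOn_euclidean] at *
  intro i
  fin_cases i
  exacts [hy 0, hy 1, hy 2, ht, contDiffOn_const]

theorem contDiffOn_asdForm {x z : G → R5} {n : WithTop ℕ∞} {s : Set G}
    (hx : ContDiffOn ℝ n x s) (hz : ContDiffOn ℝ n z s) :
    ContDiffOn ℝ n (fun g => asdForm (x g) (z g)) s := by
  rw [contDiffOn_euclidean] at hx hz
  refine contDiffOn_form2 fun i j => ?_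
  simp only [asdForm_apply]
  fun_prop

theorem hasDerivAt_euclidean {n : ℕ} {f : ℝ → EuclideanSpace ℝ (Fin n)} {f' : EuclideanSpace ℝ (Fin n)}
    {a : ℝ} : HasDerivAt f f' a ↔ ∀ i, HasDerivAt (fun t => f t i) (f' i) a := by
  simp only [hasDerivAt_iff_hasFDerivAt, ← hasFDerivWithinAt_univ]
  rw [hasFDerivWithinAt_euclidean]
  refine forall_congr' fun i => ?_
  have : (PiLp.proj 2 (fun _ => ℝ) i).comp (ContinuousLinearMap.toSpanSingleton ℝ f') =
    ContinuousLinearMap.toSpanSingleton ℝ (f' i) := by ext; simp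
  rw [this]

theorem hasDerivAt_xVec {y : ℝ → R3} {t : ℝ → ℝ} {y' : R3} {t' a : ℝ} (hy : HasDerivAt y y' a)
    (ht : HasDerivAt t t' a) : HasDerivAt (fun g => xVec (y g) (t g)) (xVec y' t') a := by
  rw [hasDerivAt_euclidean] at hy ⊢
  intro i
  fin_cases i
  exacts [hy 0, hy 1, hy 2, ht, hasDerivAt_const _ _]

/-- `asdForm` is affine, not linear, in its base point, because of the z ∧ e₅ term. Subtracting the
value at base point 0 leaves the linear part. -/
theorem hasDerivAt_asdForm {x z : ℝ → R5} {x' z' : R5} {a : ℝ} (hx : HasDerivAt x x' a)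
    (hz : HasDerivAt z z' a) : HasDerivAt (fun t => asdForm (x t) (z t))
      (asdForm (x a) z' + (asdForm x' (z a) - asdForm 0 (z a))) a := by
  rw [hasDerivAt_euclidean] at hx hz
  refine hasDerivAt_form2 fun i j => ?_
  change HasDerivAt _ (asdForm (x a) z' ![stdE i, stdE j] +
    (asdForm x' (z a) ![stdE i, stdE j] - asdForm 0 (z a) ![stdE i, stdE j])) a
  generalize stdE i = u
  generalize stdE j = v
  simp only [asdForm_apply]
  have m (k l m n : Fin 5) (c : ℝ) := (((hx k).fun_mul (hz l)).fun_sub ((hz m).fun_mul (hx n))).mul_const c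
  have m' (k l m n : Fin 5) (c : ℝ) := (((hx k).fun_mul (hz l)).fun_sub ((hx m).fun_mul (hz n))).mul_const c
  have := (((((((((m 3 0 3 0 (u 1 * v 2 - u 2 * v 1)).fun_add
    (m 3 1 3 1 (u 2 * v 0 - u 0 * v 2))).fun_add
    (m 3 2 3 2 (u 0 * v 1 - u 1 * v 0))).fun_sub
    (m' 1 2 2 1 (u 0 * v 3 - u 3 * v 0))).fun_sub
    (m' 2 0 0 2 (u 1 * v 3 - u 3 * v 1))).fun_sub
    (m' 0 1 1 0 (u 2 * v 3 - u 3 * v 2))).fun_add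
    ((hz 0).mul_const (u 0 * v 4 - u 4 * v 0))).fun_add
    ((hz 1).mul_const (u 1 * v 4 - u 4 * v 1))).fun_add
    ((hz 2).mul_const (u 2 * v 4 - u 4 * v 2))).fun_add
    ((hz 3).mul_const (u 3 * v 4 - u 4 * v 3))
  refine this.congr_deriv ?_
  simp only [PiLp.zero_apply]
  ring

end Calculus

section

variable {lam X E : ℝ}

theorem base_pos (hlam : 0 < lam) (E : ℝ) (w : R3) : 0 < lam + E ^ 2 + ‖w‖ ^ 2 := by positivity

theorem hFun_nonneg (hlam : 0 < lam) (hX : 0 ≤ X) (w : R3) : 0 ≤ hFun lam X E w :=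
  mul_nonneg hX (Real.rpow_nonneg (base_pos hlam E w).le _)

theorem hFun_mul (hlam : 0 < lam) (X E : ℝ) (w : R3) :
    hFun lam X E w * (lam + E ^ 2 + ‖w‖ ^ 2) ^ (1 / 4 : ℝ) = X := by
  rw [hFun, mul_assoc, ← Real.rpow_add (base_pos hlam E w)]
  norm_num

theorem hFun_pow (hlam : 0 < lam) (X E : ℝ) (w : R3) :
    hFun lam X E w ^ 4 * (lam + E ^ 2 + ‖w‖ ^ 2) = X ^ 4 := by
  rw [← hFun_mul hlam X E w, mul_pow (hFun lam _ E w) _ 4, ← Real.rpow_natCast (_ ^ (1 / 4 : ℝ)),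
    ← Real.rpow_mul (base_pos hlam E w).le, hFun_mul hlam X E w]
  norm_num

theorem contDiff_hFun (hlam : 0 < lam) (X E : ℝ) : ContDiff ℝ ∞ (hFun lam X E) := by
  refine contDiff_const.mul (ContDiff.rpow_const_of_ne ?_ fun w => (base_pos hlam E w).ne')
  exact contDiff_const.add (contDiff_norm_sq ℝ)

theorem contDiff_levelMap (hlam : 0 < lam) (X E : ℝ) : ContDiff ℝ ∞ (levelMap lam X E) := by
  have h := (contDiff_hFun hlam X E).comp (contDiff_snd (E := R3) (F := R3))
  have h1 : ContDiff ℝ ∞ fun q : R3 × R3 => ‖q.1‖ ^ 2 := contDiff_fst.norm_sq ℝ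
  have h2 : ContDiff ℝ ∞ fun q : R3 × R3 => inner ℝ q.1 q.2 := contDiff_fst.inner ℝ contDiff_snd
  exact ((h1.sub contDiff_const).add (h.pow 2)).prodMk (h2.sub (h.mul contDiff_const))

theorem contDiff_theta (hlam : 0 < lam) (X E : ℝ) : ContDiff ℝ ∞ (theta lam X E) := by
  have hx : ContDiffOn ℝ ∞ (fun q : R3 × R3 => xVec q.1 (hFun lam X E q.2)) univ :=
    contDiffOn_xVec contDiffOn_fst ((contDiff_hFun hlam X E).comp contDiff_snd).contDiffOn
  have hz : ContDiffOn ℝ ∞ (fun q : R3 × R3 => xVec q.2 (-E)) univ :=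
    contDiffOn_xVec contDiffOn_snd contDiffOn_const
  exact contDiffOn_univ.1 (hx.prodMk (contDiffOn_asdForm hx hz))

/-- The differential of `hFun`. -/
def hDeriv (lam X E : ℝ) (w : R3) : R3 →L[ℝ] ℝ :=
  (-(hFun lam X E w / (2 * (lam + E ^ 2 + ‖w‖ ^ 2)))) • innerSL ℝ w

theorem hasFDerivAt_hFun (hlam : 0 < lam) (X E : ℝ) (w : R3) :
    HasFDerivAt (hFun lam X E) (hDeriv lam X E w) w := by
  have h0 := base_pos hlam E w
  have h1 : HasFDerivAt (fun w : R3 => lam + E ^ 2 + ‖w‖ ^ 2) (2 • innerSL ℝ w) w :=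
    ((hasStrictFDerivAt_norm_sq w).hasFDerivAt).const_add _
  have h2 := ((Real.hasDerivAt_rpow_const (p := -(1 / 4)) (Or.inl h0.ne')).comp_hasFDerivAt w
    h1).const_mul X
  refine h2.congr_fderiv ?_
  ext v
  simp only [hDeriv, hFun, smul_apply, smul_eq_mul, nsmul_eq_mul,
    innerSL_apply_apply]
  rw [show (-(1 / 4) - 1 : ℝ) = -(1 / 4) + -1 by ring, Real.rpow_add h0, Real.rpow_neg_one]
  field_simp
  simp
  ring

/-- The differential of `levelMap`. -/
def levelDeriv (lam X E : ℝ) (q : R3 × R3) : R3 × R3 →L[ℝ] ℝ × ℝ :=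
  ((2 : ℝ) • (innerSL ℝ q.1).comp (ContinuousLinearMap.fst ℝ R3 R3) +
    (2 * hFun lam X E q.2) • (hDeriv lam X E q.2).comp (ContinuousLinearMap.snd ℝ R3 R3)).prod
  ((innerSL ℝ q.2).comp (ContinuousLinearMap.fst ℝ R3 R3) +
    (innerSL ℝ q.1).comp (ContinuousLinearMap.snd ℝ R3 R3) -
    E • (hDeriv lam X E q.2).comp (ContinuousLinearMap.snd ℝ R3 R3))

theorem levelDeriv_apply (q v : R3 × R3) : levelDeriv lam X E q v =
    (2 * inner ℝ q.1 v.1 + 2 * hFun lam X E q.2 * hDeriv lam X E q.2 v.2,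
      inner ℝ q.2 v.1 + inner ℝ q.1 v.2 - E * hDeriv lam X E q.2 v.2) := rfl

theorem hasFDerivAt_levelMap (hlam : 0 < lam) (q : R3 × R3) :
    HasFDerivAt (levelMap lam X E) (levelDeriv lam X E q) q := by
  have h := (hasFDerivAt_hFun hlam X E q.2).comp q (hasFDerivAt_snd (𝕜 := ℝ) (E := R3) (F := R3))
  have h1 := (hasFDerivAt_fst (𝕜 := ℝ) (E := R3) (F := R3) (p := q)).norm_sq
  have h2 := (hasFDerivAt_fst (𝕜 := ℝ) (E := R3) (F := R3) (p := q)).inner ℝ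
    (hasFDerivAt_snd (𝕜 := ℝ) (E := R3) (F := R3) (p := q))
  have := ((h1.sub_const 1).add (h.pow 2)).prodMk (h2.sub (h.mul_const E))
  refine this.congr_fderiv ?_
  refine ContinuousLinearMap.ext fun v => ?_
  rw [levelDeriv_apply]
  refine Prod.ext ?_ ?_
  · simp [hDeriv]
  · simp [hDeriv, real_inner_comm v.1]; ring

/-- A proper range lies in the kernel of a nonzero functional; regularity thus becomes the absence
of Lagrange multipliers. -/
theorem surjective_of_forall_dual {V F : Type*} [AddCommGroup V] [Module ℝ V] [AddCommGroup F]
    [Module ℝ F] (T : V →ₗ[ℝ] F) (h : ∀ f : F →ₗ[ℝ] ℝ, (∀ v, f (T v) = 0) → f = 0) :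
    Function.Surjective T := by
  rw [← LinearMap.range_eq_top]
  by_contra hne
  obtain ⟨f, hf, hle⟩ := Submodule.exists_le_ker_of_lt_top _ (lt_top_iff_ne_top.2 hne)
  exact hf (h f fun v => hle ⟨v, rfl⟩)

/-- A multiplier (a, b) gives 2a y + b w = 0 and a second relation between w and y. If b = 0 ≠ a,
then y = 0, so h > 0 and w = 0, the excluded origin. If b ≠ 0, then w is a multiple of y, and the
equations of K force either 1 = 0 or a positive h to be nonpositive. -/
theorem levelDeriv_surjective (hlam : 0 < lam) (hX : 0 ≤ X) {q : R3 × R3} (hq : q ∈ K lam X E)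
    (hq0 : q ≠ 0) : Function.Surjective (levelDeriv lam X E q) := by
  refine surjective_of_forall_dual (levelDeriv lam X E q : R3 × R3 →ₗ[ℝ] ℝ × ℝ) fun f hf => ?_
  obtain ⟨y, w⟩ := q
  have hS := base_pos hlam E w
  have hh := hFun_nonneg (E := E) hlam hX w
  have e1 : ‖y‖ ^ 2 - 1 + hFun lam X E w ^ 2 = 0 := congrArg Prod.fst hq
  have e2 : inner ℝ y w - hFun lam X E w * E = 0 := congrArg Prod.snd hq
  set h := hFun lam X E w with hdef
  -- The differential of h at w is v ↦ -κ⟨w, v⟩.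
  set κ := h / (2 * (lam + E ^ 2 + ‖w‖ ^ 2)) with hκ
  have hκ0 : 0 ≤ κ := by positivity
  set a := f (1, 0)
  set b := f (0, 1)
  have hfab (s t : ℝ) : f (s, t) = a * s + b * t := by
    have : ((s, t) : ℝ × ℝ) = s • (1, 0) + t • (0, 1) := by simp
    rw [this, map_add, map_smul, map_smul, smul_eq_mul, smul_eq_mul]; ring
  have hv (v : R3 × R3) : a * (2 * inner ℝ y v.1 + 2 * h * (-κ * inner ℝ w v.2)) +
      b * (inner ℝ w v.1 + inner ℝ y v.2 - E * (-κ * inner ℝ w v.2)) = 0 := by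
    rw [← hfab]; exact hf v
  have k1 : (2 * a) • y + b • w = 0 := by
    refine ext_inner_right ℝ fun v => ?_
    have := hv (v, 0)
    simp only [inner_zero_right, mul_zero, add_zero, sub_zero] at this
    simp only [inner_add_left, inner_smul_left, inner_zero_left, conj_trivial]
    linarith
  have k2 : (-(2 * a * h * κ) + b * E * κ) • w + b • y = 0 := by
    refine ext_inner_right ℝ fun v => ?_
    have := hv (0, v)
    simp only [inner_zero_right, mul_zero, zero_add] at this
    simp only [inner_add_left, inner_smul_left, inner_zero_left, conj_trivial]
    linarith
  have hab : a = 0 ∧ b = 0 := by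
    by_cases hb : b = 0
    · refine ⟨?_, hb⟩
      by_contra ha
      simp only [hb, zero_smul, add_zero, zero_mul] at k1 k2
      have hy : y = 0 := by simpa [ha] using k1
      have hh1 : 0 < h := by
        rcases hh.eq_or_lt with h0 | h0
        · rw [hy, ← h0] at e1; norm_num at e1
        · exact h0
      have hκ1 : 0 < κ := by positivity
      have hw : w = 0 := by simpa [ha, hh1.ne', hκ1.ne'] using k2
      exact hq0 (by rw [hy, hw]; rfl)
    · exfalso
      set c := 2 * a / b with hc
      have hw : w = (-c) • y := by
        have : b • w = b • ((-c) • y) := by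
          rw [smul_smul, ← sub_eq_zero, ← k1, hc]
          have : b * -(2 * a / b) = -(2 * a) := by field_simp
          rw [this]; module
        exact smul_right_injective _ hb this
      have hy : y ≠ 0 := fun hy => hq0 (by rw [hw, hy, smul_zero]; rfl)
      have k3 : (-(2 * a * h * κ) + b * E * κ) * (-c) + b = 0 := by
        rw [hw, smul_smul, ← add_smul] at k2
        exact (smul_eq_zero.1 k2).resolve_right hy
      have k4 : 1 = c * κ * E - c ^ 2 * κ * h := by
        have : 2 * a = c * b := by rw [hc]; field_simp
        rw [this] at k3
        have : b * (1 - (c * κ * E - c ^ 2 * κ * h)) = 0 := by linear_combination k3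
        have := (mul_eq_zero.1 this).resolve_left hb
        linarith
      have k5 : -c * ‖y‖ ^ 2 = h * E := by
        rw [hw, inner_smul_right, real_inner_self_eq_norm_sq] at e2
        linarith
      rcases hh.eq_or_lt with h0 | h0
      · have : κ = 0 := by rw [hκ, ← h0, zero_div]
        rw [this] at k4; norm_num at k4
      -- Multiplying by h lets the equation ⟨y, w⟩ = hE eliminate E; the right side becomes minus a
      -- sum of squares.
      · have : h = c * κ * (h * E) - c ^ 2 * κ * h ^ 2 := by linear_combination h * k4
        rw [← k5] at this
        have : h = -(c ^ 2 * κ * ‖y‖ ^ 2) - c ^ 2 * κ * h ^ 2 := by linear_combination this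
        have h3 : 0 ≤ c ^ 2 * κ * ‖y‖ ^ 2 := by positivity
        have h4 : 0 ≤ c ^ 2 * κ * h ^ 2 := by positivity
        linarith
  ext <;> simp
  exacts [hab.1, hab.2]

theorem K_regular (hlam : 0 < lam) (hX : 0 ≤ X) {q : R3 × R3} (hq : q ∈ K lam X E) (hq0 : q ≠ 0) :
    IsSubmanifoldAt 4 (K lam X E) q ∧
      ∀ v, levelDeriv lam X E q v = 0 → v ∈ tangentVecs (K lam X E) q :=
  regularLevelSet (by simp [Module.finrank_prod]) (contDiff_levelMap hlam X E) hq
    (hasFDerivAt_levelMap hlam q) (levelDeriv_surjective hlam hX hq hq0)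

theorem mem_K {q : R3 × R3} : q ∈ K lam X E ↔
    ‖q.1‖ ^ 2 = 1 - hFun lam X E q.2 ^ 2 ∧ inner ℝ q.1 q.2 = hFun lam X E q.2 * E := by
  change ((_, _) : ℝ × ℝ) = (0, 0) ↔ _
  rw [Prod.mk.injEq]
  constructor <;> rintro ⟨h1, h2⟩ <;> constructor <;> linarith

theorem norm_xVec_of_mem {q : R3 × R3} (hq : q ∈ K lam X E) :
    ‖xVec q.1 (hFun lam X E q.2)‖ = 1 := by
  rw [← sq_eq_sq₀ (norm_nonneg _) zero_le_one, norm_xVec, (mem_K.1 hq).1]; ring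

theorem inner_xVec_of_mem {q : R3 × R3} (hq : q ∈ K lam X E) :
    inner ℝ (xVec q.1 (hFun lam X E q.2)) (xVec q.2 (-E)) = (0 : ℝ) := by
  rw [inner_xVec, (mem_K.1 hq).2]; ring

theorem theta_mem_asd {q : R3 × R3} (hq : q ∈ K lam X E) : theta lam X E q ∈ asd :=
  asdForm_mem (norm_xVec_of_mem hq) rfl (inner_xVec_of_mem hq) rfl

theorem rSq_theta {q : R3 × R3} (hq : q ∈ K lam X E) :
    rSq (theta lam X E q) = ‖q.2‖ ^ 2 + E ^ 2 := by
  rw [theta, rSq_asdForm (norm_xVec_of_mem hq) rfl (inner_xVec_of_mem hq), norm_sq_R3]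
  simp [xVec]

theorem sFun_theta (hlam : 0 < lam) {q : R3 × R3} (hq : q ∈ K lam X E) :
    sFun lam (theta lam X E q) ^ 4 = lam + E ^ 2 + ‖q.2‖ ^ 2 := by
  rw [sFun, rSq_theta hq, ← Real.rpow_natCast, ← Real.rpow_mul (by positivity)]
  norm_num
  ring

/-- Velocities of curves in the image of `K`. -/
theorem velocity_theta (hlam : 0 < lam) {γ : ℝ → R3 × R3} {v : R3 × R3}
    (hγ : γ 0 ∈ K lam X E) (hK : levelDeriv lam X E (γ 0) v = 0) (hv : HasDerivAt γ v 0) :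
    HasDerivAt (fun t => theta lam X E (γ t))
      (hor (theta lam X E (γ 0)) (xVec v.1 (hDeriv lam X E (γ 0).2 v.2)) +
        (0, asdForm (theta lam X E (γ 0)).1 (xVec v.2 0 +
          inner ℝ (xVec (γ 0).2 (-E)) (xVec v.1 (hDeriv lam X E (γ 0).2 v.2)) •
            (theta lam X E (γ 0)).1))) 0 := by
  have h1 : HasDerivAt (fun t => (γ t).1) v.1 0 := hv.fst
  have h2 : HasDerivAt (fun t => (γ t).2) v.2 0 := hv.snd
  have hx := hasDerivAt_xVec h1 ((hasFDerivAt_hFun hlam X E (γ 0).2).comp_hasDerivAt 0 h2)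
  have hz := hasDerivAt_xVec h2 (hasDerivAt_const 0 (-E))
  have e1 := norm_xVec_of_mem hγ
  have e2 := inner_xVec_of_mem hγ
  have e3 : inner ℝ (xVec (γ 0).1 (hFun lam X E (γ 0).2))
      (xVec v.1 (hDeriv lam X E (γ 0).2 v.2)) = (0 : ℝ) := by
    rw [inner_xVec]
    have := congrArg Prod.fst hK
    rw [levelDeriv_apply] at this
    simp only [Prod.fst_zero] at this
    linarith
  refine (hx.prodMk (hasDerivAt_asdForm hx hz)).congr_deriv (Prod.ext ?_ ?_)
  · change _ = _ + (0 : R5)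
    rw [add_zero]; rfl
  · exact asdForm_deriv_eq (xVec v.2 0) e1 rfl rfl rfl e2 e3

/-- The image of the level set is coassociative at its regular points. -/
theorem isCoassociativeAt_theta (hlam : 0 < lam) (hX : 0 ≤ X) {q : R3 × R3} (hq : q ∈ K lam X E)
    (hq0 : q ≠ 0) : IsCoassociativeAt lam (theta lam X E '' K lam X E) (theta lam X E q) := by
  obtain ⟨hsub, htan⟩ := K_regular hlam hX hq hq0
  have hp := theta_mem_asd hq
  have hs := sFun_pos hlam (theta lam X E q)
  have hs4 := sFun_theta hlam hq
  have hS := base_pos hlam E q.2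
  set p := theta lam X E q with hpdef
  set s := sFun lam p with hsdef
  have hp1 : p.1 = xVec q.1 (hFun lam X E q.2) := rfl
  have hx1 : ‖p.1‖ = 1 := hp.1
  have ho := qFrame_oriented hp.1 (x := p.1) rfl
  have h2 : √2 ≠ 0 := by positivity
  have h22 : √2 ^ 2 = 2 := Real.sq_sqrt (by norm_num)
  let z := xVec q.2 (-E)
  -- With P and Q as given, the real part of the complex equation says that z₄ = -E is constant
  -- (`c1`), and the imaginary part that x₄⁴(λ + r²) is constant (`c2`). The powers of s and √2 come
  -- from the normalization of the frame.
  refine isCoassociativeAt_of_tangentVecs hlam hp rfl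
    (hsub.image (contDiff_theta hlam X E) thetaInv (thetaInv_theta lam X E))
    (fun a => s * qFrame p.1 a.succ 3)
    (fun a => p.1 3 * inner ℝ z (qFrame p.1 a.succ) / (√2 * s)) fun v h e1 e2 => ?_
  rw [sum_coef]
  set H : R5 := ∑ a, (h a / (√2 * s)) • qFrame p.1 a.succ with hH
  set V : R5 := ∑ a, (s * v a) • qFrame p.1 a.succ with hV
  have hH4 : H 4 = 0 := by
    simp only [hH, Fin.sum_univ_three, PiLp.add_apply, PiLp.smul_apply, qFrame_four, smul_zero, add_zero]
  have hV4 : V 4 = 0 := by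
    simp only [hV, Fin.sum_univ_three, PiLp.add_apply, PiLp.smul_apply, qFrame_four, smul_zero, add_zero]
  have hxH : inner ℝ p.1 H = (0 : ℝ) := by
    rw [hH, inner_sum]
    exact Finset.sum_eq_zero fun a _ => by rw [inner_smul_right, ho.2.1, mul_zero]
  have hxV : inner ℝ p.1 V = (0 : ℝ) := by
    rw [hV, inner_sum]
    exact Finset.sum_eq_zero fun a _ => by rw [inner_smul_right, ho.2.1, mul_zero]
  have hH3 : H 3 = ∑ a, h a / (√2 * s) * qFrame p.1 a.succ 3 := by
    simp [hH, Fin.sum_univ_three]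
  have hV3 : V 3 = ∑ a, s * v a * qFrame p.1 a.succ 3 := by
    simp [hV, Fin.sum_univ_three]
  have hzH : inner ℝ z H = ∑ a, h a / (√2 * s) * inner ℝ z (qFrame p.1 a.succ) := by
    rw [hH, inner_sum]
    exact Finset.sum_congr rfl fun a _ => by rw [inner_smul_right]
  have hzV : inner ℝ z V = ∑ a, s * v a * inner ℝ z (qFrame p.1 a.succ) := by
    rw [hV, inner_sum]
    exact Finset.sum_congr rfl fun a _ => by rw [inner_smul_right]
  have c1 : V 3 = p.1 3 * inner ℝ z H := by
    rw [hV3, hzH]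
    simp only [Fin.sum_univ_three] at e1 ⊢
    linear_combination e1
  have c2 : H 3 * (2 * s ^ 4) = -(p.1 3 * inner ℝ z V) := by
    rw [hH3, hzV]
    simp only [Fin.sum_univ_three] at e2 ⊢
    field_simp at e2 ⊢
    linear_combination √2 * e2 - s ^ 2 * (qFrame p.1 (Fin.succ 0) 3 * h 0 +
      qFrame p.1 (Fin.succ 1) 3 * h 1 + qFrame p.1 (Fin.succ 2) 3 * h 2) * h22
  -- V is the covariant derivative of z; removing its x-component gives back the ordinary derivative
  -- z', whose fourth coordinate must vanish.
  let W : R5 := V - inner ℝ z H • p.1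
  have hW3 : W 3 = 0 := by
    simp only [W, PiLp.sub_apply, PiLp.smul_apply, smul_eq_mul, c1]; ring
  have hW4 : W 4 = 0 := by
    simp only [W, PiLp.sub_apply, PiLp.smul_apply, smul_eq_mul, hV4, hp1]; simp [xVec]
  let v' : R3 × R3 := (!₂[H 0, H 1, H 2], !₂[W 0, W 1, W 2])
  have hWe : xVec v'.2 0 = W := by
    ext i; fin_cases i <;> simp [xVec, v', hW3, hW4]
  have hHe : xVec v'.1 (H 3) = H := by
    ext i; fin_cases i <;> simp [xVec, v', hH4]
  have hzx : inner ℝ z p.1 = (0 : ℝ) := by rw [real_inner_comm]; exact inner_xVec_of_mem hq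
  have hzW : inner ℝ z W = inner ℝ z V := by
    simp only [W, inner_sub_right, inner_smul_right, hzx]; ring
  have hwv : inner ℝ q.2 v'.2 = inner ℝ z V := by
    rw [← hzW, ← hWe, inner_xVec]; ring
  have hd : hDeriv lam X E q.2 v'.2 = H 3 := by
    have hx3 : p.1 3 = hFun lam X E q.2 := rfl
    change -(hFun lam X E q.2 / (2 * (lam + E ^ 2 + ‖q.2‖ ^ 2))) * inner ℝ q.2 v'.2 = _
    rw [hwv, ← hx3, ← hs4]
    field_simp
    linarith
  have hlev : levelDeriv lam X E q v' = 0 := by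
    rw [levelDeriv_apply, hd]
    refine Prod.ext ?_ ?_
    · have := inner_xVec q.1 v'.1 (hFun lam X E q.2) (H 3)
      rw [hHe, ← hp1, hxH] at this
      simp only [Prod.fst_zero]
      linear_combination (-2 : ℝ) * this
    · have i1 := inner_xVec q.2 v'.1 (-E) (H 3)
      have i2 := inner_xVec q.1 v'.2 (hFun lam X E q.2) 0
      rw [hHe] at i1
      rw [hWe, ← hp1] at i2
      simp only [W, inner_sub_right, inner_smul_right, hxV, real_inner_self_eq_norm_sq, hx1] at i2
      simp only [Prod.snd_zero]
      linear_combination -i1 - i2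
  obtain ⟨γ, g1, g2, g3, g4⟩ := htan v' hlev
  have hvel := velocity_theta hlam (by rwa [g2]) (by rwa [g2]) g4
  rw [g2, hd, hHe, hWe] at hvel
  refine ⟨fun t => theta lam X E (γ t), ?_, by simp [g2, hpdef], g3.mono fun t ht => ⟨_, ht, rfl⟩, ?_⟩
  · exact (contDiff_theta hlam X E).contDiffAt.comp (0 : ℝ) g1
  · have hV : W + inner ℝ (xVec q.2 (-E)) H • (theta lam X E q).1 = V := by
      change V - inner ℝ z H • p.1 + inner ℝ z H • p.1 = V
      rw [sub_add_cancel]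
    rw [hV] at hvel
    exact hvel

end

/-! ### The subgroup `SO(3) × SO(2)` -/

/-- The rotation of the last two coordinates with cosine `c` and sine `d`. -/
def rot34 (c d : ℝ) : Matrix (Fin 5) (Fin 5) ℝ :=
  !![1, 0, 0, 0, 0; 0, 1, 0, 0, 0; 0, 0, 1, 0, 0; 0, 0, 0, c, -d; 0, 0, 0, d, c]

theorem rot34_isSO {c d : ℝ} (h : c ^ 2 + d ^ 2 = 1) : IsSO (rot34 c d) := by
  constructor
  · ext i j
    fin_cases i <;> fin_cases j <;> simp [rot34, Matrix.mul_apply, Fin.sum_univ_five] <;> linarith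
  · simp [rot34, Matrix.det_succ_row_zero, Fin.sum_univ_succ, Fin.succAbove]
    linarith

theorem act_rot34 (c d : ℝ) (x : R5) :
    act (rot34 c d) x = !₂[x 0, x 1, x 2, c * x 3 - d * x 4, d * x 3 + c * x 4] := by
  ext i
  rw [act_apply, Fin.sum_univ_five]
  fin_cases i <;> simp [rot34] <;> ring

theorem act_rot34_transpose (c d : ℝ) (x : R5) :
    act (rot34 c d).transpose x = !₂[x 0, x 1, x 2, c * x 3 + d * x 4, -d * x 3 + c * x 4] := by
  ext i
  rw [act_apply, Fin.sum_univ_five]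
  fin_cases i <;> simp [rot34]

theorem so3Block_eq (g : SO3) : so3Block g =
    !![g.1 0 0, g.1 0 1, g.1 0 2, 0, 0; g.1 1 0, g.1 1 1, g.1 1 2, 0, 0;
      g.1 2 0, g.1 2 1, g.1 2 2, 0, 0; 0, 0, 0, 1, 0; 0, 0, 0, 0, 1] := by
  ext i j
  fin_cases i <;> fin_cases j <;> rfl

theorem SO3.mul_transpose (g : SO3) : g.1 * g.1.transpose = 1 :=
  (Matrix.mem_orthogonalGroup_iff _ _).1 (Matrix.mem_specialOrthogonalGroup_iff.1 g.2).1

theorem SO3.transpose_mul (g : SO3) : g.1.transpose * g.1 = 1 := mul_eq_one_comm.mp g.mul_transpose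

theorem SO3.det (g : SO3) : g.1.det = 1 := (Matrix.mem_specialOrthogonalGroup_iff.1 g.2).2

theorem so3Block_isSO (g : SO3) : IsSO (so3Block g) := by
  constructor
  · rw [so3Block, Matrix.reindex_apply, Matrix.transpose_submatrix, Matrix.submatrix_mul_equiv,
      Matrix.fromBlocks_transpose, Matrix.fromBlocks_multiply]
    simp [SO3.transpose_mul]
  · rw [so3Block, Matrix.det_reindex_self, Matrix.det_fromBlocks_zero₁₂, SO3.det]
    simp

/-- The transpose of an element of `SO(3)`. -/
def SO3.tr (g : SO3) : SO3 :=
  ⟨g.1.transpose, Matrix.mem_specialOrthogonalGroup_iff.2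
    ⟨(Matrix.mem_orthogonalGroup_iff _ _).2 (SO3.transpose_mul g),
      by rw [Matrix.det_transpose, SO3.det]⟩⟩

theorem so3Block_tr (g : SO3) : so3Block g.tr = (so3Block g).transpose := by
  rw [so3Block_eq, so3Block_eq]
  ext i j
  fin_cases i <;> fin_cases j <;> rfl

theorem act_so3Block (g : SO3) (x : R5) : act (so3Block g) x =
    !₂[g.1 0 0 * x 0 + g.1 0 1 * x 1 + g.1 0 2 * x 2, g.1 1 0 * x 0 + g.1 1 1 * x 1 + g.1 1 2 * x 2,
      g.1 2 0 * x 0 + g.1 2 1 * x 1 + g.1 2 2 * x 2, x 3, x 4] := by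
  rw [so3Block_eq]
  ext i
  rw [act_apply, Fin.sum_univ_five]
  fin_cases i <;> simp

/-- The cross product. -/
def cross (u v : R3) : R3 := !₂[u 1 * v 2 - u 2 * v 1, u 2 * v 0 - u 0 * v 2, u 0 * v 1 - u 1 * v 0]

/-- An orthonormal pair extends to an element of `SO(3)`. -/
theorem exists_so3 {u v : R3} (hu : ‖u‖ = 1) (hv : ‖v‖ = 1) (huv : inner ℝ u v = 0) :
    ∃ g : SO3, (∀ i, g.1 i 0 = u i) ∧ (∀ i, g.1 i 1 = v i) ∧ ∀ i, g.1 i 2 = cross u v i := by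
  have h1 := norm_sq_R3 u
  have h2 := norm_sq_R3 v
  rw [inner_R3] at huv
  rw [hu] at h1
  rw [hv] at h2
  let A : Matrix (Fin 3) (Fin 3) ℝ := Matrix.of fun i => ![u i, v i, cross u v i]
  have hl : (u 0 ^ 2 + u 1 ^ 2 + u 2 ^ 2) * (v 0 ^ 2 + v 1 ^ 2 + v 2 ^ 2) =
    (u 1 * v 2 - u 2 * v 1) ^ 2 + (u 2 * v 0 - u 0 * v 2) ^ 2 + (u 0 * v 1 - u 1 * v 0) ^ 2 := by
    linear_combination (u 0 * v 0 + u 1 * v 1 + u 2 * v 2) * huv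
  rw [← h1, ← h2] at hl
  have hA : A.transpose * A = 1 := by
    ext i j
    fin_cases i <;> fin_cases j <;>
      simp [A, cross, Matrix.mul_apply, Fin.sum_univ_three] <;> linarith
  have hdet : A.det = 1 := by
    simp [A, cross, Matrix.det_fin_three]
    linarith
  exact ⟨⟨A, Matrix.mem_specialOrthogonalGroup_iff.2 ⟨(Matrix.mem_orthogonalGroup_iff' _ _).2 hA,
    hdet⟩⟩, fun i => rfl, fun i => rfl, fun i => rfl⟩

theorem exists_unit_orthogonal (u v : R3) : ∃ b : R3, ‖b‖ = 1 ∧ inner ℝ u b = 0 ∧ inner ℝ v b = 0 := by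
  let S := Submodule.span ℝ ({u, v} : Set R3)
  have h1 := Submodule.finrank_add_finrank_orthogonal S
  have h2 : Module.finrank ℝ S ≤ 2 := by
    classical
    have := finrank_span_finset_le_card (R := ℝ) ({u, v} : Finset R3)
    rw [Finset.coe_pair] at this
    exact this.trans Finset.card_le_two
  have h3 : Module.finrank ℝ R3 = 3 := by simp
  have h4 : 0 < Module.finrank ℝ Sᗮ := by omega
  have := Module.finrank_pos_iff.1 h4
  obtain ⟨w, hw⟩ := exists_ne (0 : Sᗮ)
  have hw0 : (w : R3) ≠ 0 := by simpa using hw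
  have hS := (Submodule.mem_orthogonal S (w : R3)).1 w.2
  refine ⟨‖(w : R3)‖⁻¹ • (w : R3), norm_smul_inv_norm hw0, ?_, ?_⟩
  · rw [inner_smul_right, hS u (Submodule.subset_span (by simp)), mul_zero]
  · rw [inner_smul_right, hS v (Submodule.subset_span (by simp)), mul_zero]

theorem norm_cross {u v : R3} (hu : ‖u‖ = 1) (hv : ‖v‖ = 1) (huv : inner ℝ u v = 0) :
    ‖cross u v‖ = 1 := by
  have h1 := norm_sq_R3 u
  have h2 := norm_sq_R3 v
  rw [inner_R3] at huv
  rw [hu] at h1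
  rw [hv] at h2
  rw [← sq_eq_sq₀ (norm_nonneg _) zero_le_one, norm_sq_R3]
  simp only [cross]
  simp
  linear_combination -(u 0 ^ 2 + u 1 ^ 2 + u 2 ^ 2) * h2 - h1 -
    (u 0 * v 0 + u 1 * v 1 + u 2 * v 2) * huv

theorem inner_cross_left (u v : R3) : inner ℝ u (cross u v) = 0 := by
  rw [inner_R3]; simp [cross]; ring

theorem inner_cross_right (u v : R3) : inner ℝ v (cross u v) = 0 := by
  rw [inner_R3]; simp [cross]; ring

/-! ### `M` as a level set -/

/-- Every anti-self-dual form lies over a rotation of a point with `x₅ = 0`. -/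
theorem exists_rot34 (x : R5) : ∃ c d : ℝ, c ^ 2 + d ^ 2 = 1 ∧
    act (rot34 c d).transpose x 4 = 0 := by
  by_cases h : x 3 ^ 2 + x 4 ^ 2 = 0
  · refine ⟨1, 0, by norm_num, ?_⟩
    have : x 4 = 0 := by nlinarith [sq_nonneg (x 3), sq_nonneg (x 4)]
    rw [act_rot34_transpose]; simp [this]
  · have h0 : 0 < x 3 ^ 2 + x 4 ^ 2 := lt_of_le_of_ne (by positivity) (Ne.symm h)
    have hn : √(x 3 ^ 2 + x 4 ^ 2) ≠ 0 := (Real.sqrt_pos.2 h0).ne'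
    refine ⟨x 3 / √(x 3 ^ 2 + x 4 ^ 2), x 4 / √(x 3 ^ 2 + x 4 ^ 2), ?_, ?_⟩
    · rw [div_pow, div_pow, Real.sq_sqrt h0.le, ← add_div, div_self h]
    · rw [act_rot34_transpose]; simp; ring

/-- The value on (e₄, e₅) is the coefficient of the area form of the rotated plane, hence unchanged.
-/
theorem lift_rot34_snd_three_four {c d : ℝ} (h : c ^ 2 + d ^ 2 = 1) (p : Amb) :
    (lift (rot34 c d) p).2 ![stdE 3, stdE 4] = p.2 ![stdE 3, stdE 4] := by
  have e3 : act (rot34 c d).transpose (stdE 3) = c • stdE 3 + (-d) • stdE 4 := by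
    rw [act_rot34_transpose]; ext i; fin_cases i <;> simp [stdE]
  have e4 : act (rot34 c d).transpose (stdE 4) = d • stdE 3 + c • stdE 4 := by
    rw [act_rot34_transpose]; ext i; fin_cases i <;> simp [stdE]
  rw [lift_snd, e3, e4]
  simp only [form2_add_left, form2_add_right, form2_smul_left, form2_smul_right, form2_self,
    form2_anti p.2 (stdE 4) (stdE 3)]
  linear_combination p.2 ![stdE 3, stdE 4] * h

/-- Both sides are invariant under rotations of the (x₄, x₅)-plane, so x₅ = 0 may be assumed. There
the explicit form reduces the claim to |x| = 1 and x ⟂ z. The right side makes the SO(3)-invariance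
evident. -/
theorem asd_moment {p : Amb} (hp : p ∈ asd) :
    p.1 0 * p.2 ![stdE 1, stdE 2] + p.1 1 * p.2 ![stdE 2, stdE 0] + p.1 2 * p.2 ![stdE 0, stdE 1] =
      -p.2 ![stdE 3, stdE 4] := by
  obtain ⟨c, d, hcd, h4⟩ := exists_rot34 p.1
  have hR := rot34_isSO hcd
  set p' := lift (rot34 c d).transpose p with hp'
  have hpp : p = lift (rot34 c d) p' := (hR.lift_lift_transpose p).symm
  have hp'm : p' ∈ asd := hR.transpose.lift_mem_asd hp
  obtain ⟨h0, he⟩ := asd_eq_asdForm hp'm h4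
  have hn := norm_sq_R5 p'.1
  have h44 : p'.1 4 = 0 := h4
  rw [hp'm.1, h44] at hn
  rw [inner_R5, Fin.sum_univ_five, h44] at h0
  have hE (i : Fin 5) (hi : i < 3) : act (rot34 c d).transpose (stdE i) = stdE i := by
    rw [act_rot34_transpose]
    ext k
    fin_cases i <;> first | (exfalso; revert hi; decide) | (fin_cases k <;> simp [stdE])
  obtain ⟨z, hz⟩ : ∃ z, z = contr p'.2 := ⟨_, rfl⟩
  rw [← hz] at h0 he
  rw [hpp, lift_rot34_snd_three_four hcd]
  simp only [lift_snd, lift_fst, hE 0 (by decide), hE 1 (by decide), hE 2 (by decide)]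
  have a0 : act (rot34 c d) p'.1 0 = p'.1 0 := by rw [act_rot34]; rfl
  have a1 : act (rot34 c d) p'.1 1 = p'.1 1 := by rw [act_rot34]; rfl
  have a2 : act (rot34 c d) p'.1 2 = p'.1 2 := by rw [act_rot34]; rfl
  rw [a0, a1, a2, he]
  clear_value p'
  clear he hz hpp hp'
  simp only [asdForm_apply]
  simp [stdE]
  linear_combination z 3 * hn + p'.1 3 * h0

/-- The level set description of `M`. -/
def levelSet (lam C D E : ℝ) : Set Amb :=
  {p | p ∈ asd ∧ p.1 3 ^ 4 * (lam + rSq p) = C ∧ p.1 4 ^ 4 * (lam + rSq p) = D ∧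
    p.2 ![stdE 3, stdE 4] = -E}

/-- In the slice the first two frame vectors are an orthonormal basis of the (x₂, x₃)-plane with its
orientation, so a₁ = α(e₂, e₃) and `asd_moment` applies. At the poles x₁ = 0 and the frame does not
matter. -/
theorem coordA_zero_mul {p : Amb} (hp : p ∈ asd) (h1 : p.1 1 = 0) (h2 : p.1 2 = 0) :
    coordA p 0 * p.1 0 = -p.2 ![stdE 3, stdE 4] := by
  have hm := asd_moment hp
  have hn := norm_sq_R5 p.1
  rw [hp.1, h1, h2] at hn
  rw [h1, h2, zero_mul, zero_mul, add_zero, add_zero] at hm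
  rw [← hm]
  by_cases h4 : p.1 4 ^ 2 = 1
  · have : p.1 0 = 0 := by nlinarith [sq_nonneg (p.1 0), sq_nonneg (p.1 3)]
    rw [this]; ring
  · have hpos : 0 < 1 - p.1 4 ^ 2 := by
      refine lt_of_le_of_ne ?_ (fun h => h4 (by linarith))
      nlinarith [sq_nonneg (p.1 0), sq_nonneg (p.1 3)]
    have hc : coordA p 0 = p.2 ![stdE 1, stdE 2] := by
      simp only [coordA, asdCoord, frame, if_neg h4, Matrix.cons_val_zero, Matrix.cons_val_one,
        form2_smul_left, form2_smul_right, h1, h2]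
      have f1 : (!₂[-0, p.1 0, -p.1 3, 0, 0] : R5) = p.1 0 • stdE 1 + (-p.1 3) • stdE 2 := by
        ext i; fin_cases i <;> simp [stdE]
      have f2 : (!₂[-0, p.1 3, p.1 0, -0, 0] : R5) = p.1 3 • stdE 1 + p.1 0 • stdE 2 := by
        ext i; fin_cases i <;> simp [stdE]
      rw [f1, f2]
      simp only [form2_add_left, form2_add_right, form2_smul_left, form2_smul_right, form2_self,
        form2_anti p.2 (stdE 2) (stdE 1)]
      have hs := Real.sq_sqrt hpos.le
      have hs0 := (Real.sqrt_pos.2 hpos).ne'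
      field_simp
      rw [hs]
      linear_combination (-p.2 ![stdE 1, stdE 2]) * hn
    rw [hc]; ring

/-- The fourth frame vector is proportional to e₅ - x₅x and α annihilates x, so a₃ is a combination
of α(e₂, e₅) and α(e₃, e₅). -/
theorem coordA_two_of_ne {p : Amb} (hp : p ∈ asd) (h1 : p.1 1 = 0) (h2 : p.1 2 = 0)
    (h4 : p.1 4 ^ 2 ≠ 1)
    (h : p.1 0 * p.2 ![stdE 1, stdE 4] - p.1 3 * p.2 ![stdE 2, stdE 4] = 0) : coordA p 2 = 0 := by
  have f1 : (!₂[-0, p.1 0, -p.1 3, 0, 0] : R5) = p.1 0 • stdE 1 + (-p.1 3) • stdE 2 := by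
    ext i; fin_cases i <;> simp [stdE]
  have f2 : (!₂[-(p.1 0 * p.1 4), -(0 * p.1 4), -(0 * p.1 4), -(p.1 3 * p.1 4), 1 - p.1 4 ^ 2] : R5)
      = (-p.1 4) • p.1 + stdE 4 := by
    ext i; fin_cases i <;> simp [stdE, h1, h2] <;> ring
  have hx (v : R5) : p.2 ![v, p.1] = 0 := by rw [form2_anti, hp.2.1, neg_zero]
  simp only [coordA, asdCoord, frame, if_neg h4]
  simp only [Matrix.cons_val_zero, Matrix.cons_val, h1, h2]
  simp only [form2_smul_left, form2_smul_right]
  rw [f1, f2]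
  simp only [form2_add_left, form2_add_right, form2_smul_left, form2_smul_right, hx]
  have : p.1 0 * p.2 ![stdE 1, stdE 4] + -p.1 3 * p.2 ![stdE 2, stdE 4] = 0 := by linarith
  simp only [mul_zero, zero_add, this]

theorem coordA_two_of_eq {p : Amb} (h4 : p.1 4 ^ 2 = 1) (h : p.2 ![stdE 0, stdE 3] = 0) :
    coordA p 2 = 0 := by
  have f1 : (!₂[1, 0, 0, 0, 0] : R5) = stdE 0 := by ext i; fin_cases i <;> simp [stdE]
  have f2 : (!₂[0, 0, 0, p.1 4, 0] : R5) = p.1 4 • stdE 3 := by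
    ext i; fin_cases i <;> simp [stdE]
  simp only [coordA, asdCoord, frame, if_pos h4]
  simp only [Matrix.cons_val_zero, Matrix.cons_val]
  rw [f1, f2, form2_smul_right, h, mul_zero]

theorem levelSet_lift (g : SO3) {lam C D E : ℝ} {p : Amb} (hp : p ∈ levelSet lam C D E) :
    lift (so3Block g) p ∈ levelSet lam C D E := by
  have hg := so3Block_isSO g
  have h3 (i : Fin 5) (hi : 3 ≤ i) : act (so3Block g).transpose (stdE i) = stdE i := by
    rw [← so3Block_tr, act_so3Block]
    ext k
    fin_cases i <;> first | (exfalso; revert hi; decide) | (fin_cases k <;> simp [stdE])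
  refine ⟨hg.lift_mem_asd hp.1, ?_, ?_, ?_⟩
  · rw [hg.rSq_lift, lift_fst, act_so3Block]; exact hp.2.1
  · rw [hg.rSq_lift, lift_fst, act_so3Block]; exact hp.2.2.1
  · rw [lift_snd, h3 3 (by decide), h3 4 (by decide)]; exact hp.2.2.2

theorem form2_sum_three (α : Form2) (b : R3) (j : Fin 5) :
    α ![!₂[b 0, b 1, b 2, 0, 0], stdE j] =
      inner ℝ (!₂[α ![stdE 0, stdE j], α ![stdE 1, stdE j], α ![stdE 2, stdE j]] : R3) b := by
  conv_lhs => rw [sum_stdE !₂[b 0, b 1, b 2, 0, 0], form2_sum_left]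
  rw [inner_R3, Fin.sum_univ_five]
  simp [mul_comm]

/-- Every point of the level set can be rotated into the slice. -/
theorem exists_rotation_to_slice {lam C D E : ℝ} {p : Amb} (hp : p ∈ levelSet lam C D E) :
    ∃ g : SO3, lift (so3Block g) p ∈ slice lam C D E := by
  let y : R3 := !₂[p.1 0, p.1 1, p.1 2]
  let m (j : Fin 5) : R3 := !₂[p.2 ![stdE 0, stdE j], p.2 ![stdE 1, stdE j], p.2 ![stdE 2, stdE j]]
  have hny := norm_sq_R3 y
  have hn := norm_sq_R5 p.1
  rw [hp.1.1] at hn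
  have hy2 : ‖y‖ ^ 2 = 1 - p.1 3 ^ 2 - p.1 4 ^ 2 := by rw [hny]; simp [y]; linarith
  -- The rotation whose inverse has columns b0, b1, b0 × b1 takes y to the positive first axis. The
  -- last two conditions are a₃ = 0 away from the poles and at them.
  suffices h : ∃ b0 b1 : R3, ‖b0‖ = 1 ∧ ‖b1‖ = 1 ∧ inner ℝ b0 b1 = 0 ∧ y = ‖y‖ • b0 ∧
      (p.1 4 ^ 2 ≠ 1 → ‖y‖ * inner ℝ (m 4) b1 - p.1 3 * inner ℝ (m 4) (cross b0 b1) = 0) ∧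
      (p.1 4 ^ 2 = 1 → inner ℝ (m 3) b0 = 0) by
    obtain ⟨b0, b1, n0, n1, o, hy, h1, h2⟩ := h
    obtain ⟨g, g0, g1, g2⟩ := exists_so3 n0 n1 o
    have hq := levelSet_lift g.tr hp
    refine ⟨g.tr, hq.1, ?_, ?_, ?_, hq.2.1, hq.2.2.1, ?_⟩
    · rw [lift_fst, act_so3Block]
      have : inner ℝ b1 y = 0 := by rw [hy, inner_smul_right, real_inner_comm, o, mul_zero]
      rw [inner_R3] at this
      simpa [SO3.tr, g1, y] using this
    · rw [lift_fst, act_so3Block]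
      have : inner ℝ (cross b0 b1) y = 0 := by
        rw [hy, inner_smul_right, real_inner_comm, inner_cross_left, mul_zero]
      rw [inner_R3] at this
      simpa [SO3.tr, g2, y] using this
    all_goals
      have c1 : (lift (so3Block g.tr) p).1 1 = 0 := by
        rw [lift_fst, act_so3Block]
        have : inner ℝ b1 y = 0 := by rw [hy, inner_smul_right, real_inner_comm, o, mul_zero]
        rw [inner_R3] at this
        simpa [SO3.tr, g1, y] using this
      have c2 : (lift (so3Block g.tr) p).1 2 = 0 := by
        rw [lift_fst, act_so3Block]
        have : inner ℝ (cross b0 b1) y = 0 := by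
          rw [hy, inner_smul_right, real_inner_comm, inner_cross_left, mul_zero]
        rw [inner_R3] at this
        simpa [SO3.tr, g2, y] using this
    · have hE (j : Fin 5) (hj : 3 ≤ j) : act (so3Block g) (stdE j) = stdE j := by
        rw [act_so3Block]
        ext k
        fin_cases j <;> first | (exfalso; revert hj; decide) | (fin_cases k <;> simp [stdE])
      have hT : (so3Block g.tr).transpose = so3Block g := by
        rw [so3Block_tr, Matrix.transpose_transpose]
      have a0 : act (so3Block g) (stdE 0) = !₂[b0 0, b0 1, b0 2, 0, 0] := by
        rw [act_so3Block]; ext k; fin_cases k <;> simp [stdE, g0]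
      have a1 : act (so3Block g) (stdE 1) = !₂[b1 0, b1 1, b1 2, 0, 0] := by
        rw [act_so3Block]; ext k; fin_cases k <;> simp [stdE, g1]
      have a2 : act (so3Block g) (stdE 2) = !₂[cross b0 b1 0, cross b0 b1 1, cross b0 b1 2, 0, 0] := by
        rw [act_so3Block]; ext k; fin_cases k <;> simp [stdE, g2]
      have x4 : (lift (so3Block g.tr) p).1 4 = p.1 4 := by rw [lift_fst, act_so3Block]; rfl
      have x3 : (lift (so3Block g.tr) p).1 3 = p.1 3 := by rw [lift_fst, act_so3Block]; rfl
      have x0 : (lift (so3Block g.tr) p).1 0 = ‖y‖ := by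
        rw [lift_fst, act_so3Block]
        have : inner ℝ b0 y = ‖y‖ := by
          conv_lhs => rw [hy, inner_smul_right, real_inner_self_eq_norm_sq, n0]
          ring
        rw [inner_R3] at this
        simpa [SO3.tr, g0, y] using this
      by_cases h4 : p.1 4 ^ 2 = 1
      · refine coordA_two_of_eq (by rw [x4, h4]) ?_
        rw [lift_snd, hT, a0, hE 3 (by decide), form2_sum_three]
        exact h2 h4
      · refine coordA_two_of_ne hq.1 c1 c2 (by rwa [x4]) ?_
        rw [x0, x3, lift_snd, lift_snd, hT, a1, a2, hE 4 (by decide), form2_sum_three,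
          form2_sum_three]
        exact h1 h4
    · rw [coordA_zero_mul hq.1 c1 c2, hq.2.2.2, neg_neg]
  -- At a pole y = 0, so b0 is only constrained by a₃ = 0.
  by_cases h4 : p.1 4 ^ 2 = 1
  · have hy0 : ‖y‖ = 0 := by
      have : ‖y‖ ^ 2 ≤ 0 := by rw [hy2, h4]; nlinarith [sq_nonneg (p.1 3)]
      nlinarith [sq_nonneg ‖y‖]
    obtain ⟨b0, n0, o0, -⟩ := exists_unit_orthogonal (m 3) (m 3)
    obtain ⟨b1, n1, o1, -⟩ := exists_unit_orthogonal b0 b0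
    exact ⟨b0, b1, n0, n1, o1, by rw [hy0, zero_smul]; exact norm_eq_zero.1 hy0,
      fun h => absurd h4 h, fun _ => o0⟩
  -- Take b orthogonal to y and to m 4. Turning it in the plane normal to b0 by the angle with
  -- cosine |y|/N and sine x₄/N makes the two terms of a₃ cancel.
  · obtain ⟨b, nb, ob, ob'⟩ := exists_unit_orthogonal y (m 4)
    obtain ⟨b0, n0, o0, hy⟩ : ∃ b0 : R3, ‖b0‖ = 1 ∧ inner ℝ b0 b = 0 ∧ y = ‖y‖ • b0 := by
      by_cases hy : y = 0
      · obtain ⟨b0, n0, o0, -⟩ := exists_unit_orthogonal b b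
        exact ⟨b0, n0, by rw [real_inner_comm, o0], by rw [hy, norm_zero, zero_smul]⟩
      · refine ⟨‖y‖⁻¹ • y, norm_smul_inv_norm hy, by rw [inner_smul_left, ob, mul_zero], ?_⟩
        rw [smul_smul, mul_inv_cancel₀ (norm_ne_zero_iff.2 hy), one_smul]
    have hN : 0 < ‖y‖ ^ 2 + p.1 3 ^ 2 := by
      refine lt_of_le_of_ne (by positivity) fun h => h4 ?_
      linarith
    set N := √(‖y‖ ^ 2 + p.1 3 ^ 2) with hNdef
    have hN0 : N ≠ 0 := (Real.sqrt_pos.2 hN).ne'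
    have hN2 : N ^ 2 = ‖y‖ ^ 2 + p.1 3 ^ 2 := Real.sq_sqrt hN.le
    have oc := inner_cross_right b0 b
    have oc0 := inner_cross_left b0 b
    have nc := norm_cross n0 nb o0
    refine ⟨b0, (‖y‖ / N) • b + (p.1 3 / N) • cross b0 b, n0, ?_, ?_, hy, fun _ => ?_,
      fun h => absurd h h4⟩
    · rw [← sq_eq_sq₀ (norm_nonneg _) zero_le_one, ← real_inner_self_eq_norm_sq]
      simp only [inner_add_left, inner_add_right, inner_smul_left, inner_smul_right, oc,
        real_inner_comm b, real_inner_self_eq_norm_sq, nb, nc, conj_trivial]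
      field_simp
      linarith
    · rw [inner_add_right, inner_smul_right, inner_smul_right, o0, oc0]; ring
    · have hcc : cross b0 ((‖y‖ / N) • b + (p.1 3 / N) • cross b0 b) =
          (‖y‖ / N) • cross b0 b - (p.1 3 / N) • b := by
        have s0 := norm_sq_R3 b0
        rw [inner_R3] at o0
        rw [n0] at s0
        ext i
        fin_cases i <;> simp [cross]
        · linear_combination (p.1 3 / N) * b 0 * s0 + (p.1 3 / N) * b0 0 * o0
        · linear_combination (p.1 3 / N) * b 1 * s0 + (p.1 3 / N) * b0 1 * o0
        · linear_combination (p.1 3 / N) * b 2 * s0 + (p.1 3 / N) * b0 2 * o0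
      rw [hcc, inner_add_right, inner_sub_right, inner_smul_right, inner_smul_right,
        inner_smul_right, inner_smul_right, ob']
      ring

/-- The three defining functions are SO(3)-invariant, and each orbit in their level set meets the
slice. From here on neither the frame nor the orbit is needed. -/
theorem M_eq_levelSet (lam C D E : ℝ) : M lam C D E = levelSet lam C D E := by
  ext q
  constructor
  · rintro ⟨g, p, hp, rfl⟩
    refine levelSet_lift g ⟨hp.1, hp.2.2.2.2.1, hp.2.2.2.2.2.1, ?_⟩
    rw [← hp.2.2.2.2.2.2, coordA_zero_mul hp.1 hp.2.1 hp.2.2.1, neg_neg]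
  · intro hq
    obtain ⟨g, hg⟩ := exists_rotation_to_slice hq
    refine ⟨g.tr, _, hg, ?_⟩
    rw [so3Block_tr, (so3Block_isSO g).lift_transpose]

/-! ### The components of `M` -/

theorem rSq_nonneg (p : Amb) : 0 ≤ rSq p := by
  unfold rSq fibreInner
  exact mul_nonneg (by norm_num) (Finset.sum_nonneg fun i _ => Finset.sum_nonneg fun j _ =>
    mul_self_nonneg _)

theorem continuous_form2 (u v : R5) : Continuous fun p : Amb => p.2 ![u, v] :=
  (ev u v).continuous.comp continuous_snd

theorem continuous_rSq : Continuous rSq := by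
  unfold rSq fibreInner
  exact continuous_const.mul (continuous_finsetSum _ fun i _ => continuous_finsetSum _ fun j _ =>
    (continuous_form2 _ _).mul (continuous_form2 _ _))

theorem continuous_sFun {lam : ℝ} (hlam : 0 < lam) : Continuous (sFun lam) :=
  (continuous_const.add continuous_rSq).rpow_const fun p =>
    Or.inl (by linarith [rSq_nonneg p] : 0 < lam + rSq p).ne'

theorem sFun_pow {lam : ℝ} (hlam : 0 < lam) (p : Amb) : sFun lam p ^ 4 = lam + rSq p := by
  have : 0 ≤ lam + rSq p := by linarith [rSq_nonneg p]
  rw [sFun, ← Real.rpow_natCast, ← Real.rpow_mul this]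
  norm_num

/-- The pair `(x₄ s, x₅ s)`, which is locally constant on `M`. -/
def axisValues (lam : ℝ) (p : Amb) : ℝ × ℝ := (p.1 3 * sFun lam p, p.1 4 * sFun lam p)

theorem continuous_axisValues {lam : ℝ} (hlam : 0 < lam) : Continuous (axisValues lam) := by
  have h := continuous_sFun hlam
  unfold axisValues
  fun_prop

/-- The radius of the point `(P, Q)`. -/
def rad (P Q : ℝ) : ℝ := √(P ^ 2 + Q ^ 2)

theorem rad_nonneg (P Q : ℝ) : 0 ≤ rad P Q := Real.sqrt_nonneg _

theorem rad_sq (P Q : ℝ) : rad P Q ^ 2 = P ^ 2 + Q ^ 2 := Real.sq_sqrt (by positivity)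

/-- The cosine of the argument of `(P, Q)`. -/
def argCos (P Q : ℝ) : ℝ := if rad P Q = 0 then 1 else P / rad P Q

/-- The sine of the argument of `(P, Q)`. -/
def argSin (P Q : ℝ) : ℝ := Q / rad P Q

theorem argCos_sq_add_argSin_sq (P Q : ℝ) : argCos P Q ^ 2 + argSin P Q ^ 2 = 1 := by
  unfold argCos argSin
  -- For (P, Q) = (0, 0) the angle is 0 by convention: the cosine is set to 1, and the sine is a
  -- division by zero, hence 0.
  split_ifs with h
  · rw [h]; simp
  · have := rad_sq P Q
    field_simp
    linarith

theorem rad_mul_argCos (P Q : ℝ) : rad P Q * argCos P Q = P := by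
  unfold argCos
  split_ifs with h
  · have := rad_sq P Q
    rw [h] at this ⊢
    nlinarith [sq_nonneg P, sq_nonneg Q]
  · field_simp

theorem rad_mul_argSin (P Q : ℝ) : rad P Q * argSin P Q = Q := by
  unfold argSin
  by_cases h : rad P Q = 0
  · have := rad_sq P Q
    rw [h] at this ⊢
    nlinarith [sq_nonneg P, sq_nonneg Q]
  · field_simp

/-- The rotation which takes the positive `x₄`-axis to the direction of `(P, Q)`. -/
def argRot (P Q : ℝ) : Matrix (Fin 5) (Fin 5) ℝ := rot34 (argCos P Q) (argSin P Q)

theorem argRot_isSO (P Q : ℝ) : IsSO (argRot P Q) := rot34_isSO (argCos_sq_add_argSin_sq P Q)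

/-- The parametrization of the component of `M` with axis values `(P, Q)` by `K`. -/
def emb (lam P Q E : ℝ) (q : R3 × R3) : Amb := lift (argRot P Q) (theta lam (rad P Q) E q)

/-- A linear left inverse of `emb`. -/
def embInv (P Q : ℝ) : Amb →L[ℝ] R3 × R3 := thetaInv.comp (liftL (argRot P Q).transpose)

theorem embInv_emb (lam P Q E : ℝ) (q : R3 × R3) : embInv P Q (emb lam P Q E q) = q := by
  change thetaInv (lift _ (lift _ _)) = q
  rw [(argRot_isSO P Q).lift_transpose, thetaInv_theta]

theorem contDiff_emb {lam : ℝ} (hlam : 0 < lam) (P Q E : ℝ) : ContDiff ℝ ∞ (emb lam P Q E) := by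
  have h : emb lam P Q E = liftL (argRot P Q) ∘ theta lam (rad P Q) E := rfl
  rw [h]
  exact (ContinuousLinearMap.contDiff _).comp (contDiff_theta hlam _ E)

section

variable {lam P Q E : ℝ}

theorem emb_mem_asd {q : R3 × R3} (hq : q ∈ K lam (rad P Q) E) : emb lam P Q E q ∈ asd :=
  (argRot_isSO P Q).lift_mem_asd (theta_mem_asd hq)

theorem sFun_theta_eq (hlam : 0 < lam) {X : ℝ} {q : R3 × R3} (hq : q ∈ K lam X E) :
    hFun lam X E q.2 * sFun lam (theta lam X E q) = X := by
  rw [sFun, rSq_theta hq, add_comm (‖q.2‖ ^ 2), ← add_assoc, hFun_mul hlam]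

theorem axisValues_emb (hlam : 0 < lam) {q : R3 × R3} (hq : q ∈ K lam (rad P Q) E) :
    axisValues lam (emb lam P Q E q) = (P, Q) := by
  have h := sFun_theta_eq hlam hq
  rw [axisValues, emb, (argRot_isSO P Q).sFun_lift, lift_fst, argRot, act_rot34]
  have h4 : (theta lam (rad P Q) E q).1 4 = 0 := rfl
  have h3 : (theta lam (rad P Q) E q).1 3 = hFun lam (rad P Q) E q.2 := rfl
  simp only [h3, h4]
  refine Prod.ext ?_ ?_
  · change (_ * _ - _ * 0) * _ = P
    linear_combination argCos P Q * h + rad_mul_argCos P Q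
  · change (_ * _ + _ * 0) * _ = Q
    linear_combination argSin P Q * h + rad_mul_argSin P Q

theorem emb_snd_three_four (lam P Q E : ℝ) (q : R3 × R3) :
    (emb lam P Q E q).2 ![stdE 3, stdE 4] = -E := by
  rw [emb, argRot, lift_rot34_snd_three_four (argCos_sq_add_argSin_sq P Q), theta, asdForm_apply]
  simp [stdE, xVec]

/-- Undoing the rotation gives x₄s = rad P Q and x₅s = 0, hence x₅ = 0, so the form is an `asdForm`
with z₄ = -E. The first three coordinates of x and z are then the sought point of K. -/
theorem exists_emb_eq (hlam : 0 < lam) {p : Amb} (hp : p ∈ asd) (hv : axisValues lam p = (P, Q))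
    (hE : p.2 ![stdE 3, stdE 4] = -E) : ∃ q ∈ K lam (rad P Q) E, emb lam P Q E q = p := by
  have hR := argRot_isSO P Q
  obtain ⟨p', hp'⟩ : ∃ p', p' = lift (argRot P Q).transpose p := ⟨_, rfl⟩
  have hpp : lift (argRot P Q) p' = p := by rw [hp', hR.lift_lift_transpose]
  have hpa : p' ∈ asd := by rw [hp']; exact hR.transpose.lift_mem_asd hp
  have hs : sFun lam p' = sFun lam p := by rw [← hpp, hR.sFun_lift]
  have hs0 := sFun_pos hlam p'
  have hv1 : p.1 3 * sFun lam p = P := congrArg Prod.fst hv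
  have hv2 : p.1 4 * sFun lam p = Q := congrArg Prod.snd hv
  have hc := argCos_sq_add_argSin_sq P Q
  have hP := rad_mul_argCos P Q
  have hQ := rad_mul_argSin P Q
  have h3 : p'.1 3 * sFun lam p' = rad P Q := by
    rw [hs, hp', lift_fst, argRot, act_rot34_transpose]
    change (argCos P Q * p.1 3 + argSin P Q * p.1 4) * _ = _
    linear_combination argCos P Q * hv1 + argSin P Q * hv2 - argCos P Q * hP - argSin P Q * hQ +
      rad P Q * hc
  have h4 : p'.1 4 = 0 := by
    have : p'.1 4 * sFun lam p' = 0 := by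
      rw [hs, hp', lift_fst, argRot, act_rot34_transpose]
      change (-argSin P Q * p.1 3 + argCos P Q * p.1 4) * _ = _
      linear_combination -argSin P Q * hv1 + argCos P Q * hv2 + argSin P Q * hP - argCos P Q * hQ
    exact (mul_eq_zero.1 this).resolve_right hs0.ne'
  obtain ⟨h0, he⟩ := asd_eq_asdForm hpa h4
  obtain ⟨z, hz⟩ : ∃ z, z = contr p'.2 := ⟨_, rfl⟩
  have hz4 : z 4 = 0 := by
    rw [hz]; simp [contr]
  have hz3 : z 3 = -E := by
    rw [hz, ← hE, ← hpp, argRot, lift_rot34_snd_three_four hc]; rfl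
  rw [← hz] at h0 he
  let q : R3 × R3 := (!₂[p'.1 0, p'.1 1, p'.1 2], !₂[z 0, z 1, z 2])
  have hzx : xVec q.2 (-E) = z := by
    ext i; fin_cases i <;> simp [xVec, q, hz3, hz4]
  have hr : rSq p' = ‖q.2‖ ^ 2 + E ^ 2 := by
    have : p' = (p'.1, asdForm p'.1 z) := Prod.ext rfl he
    rw [this, rSq_asdForm hpa.1 h4 h0, norm_sq_R3, hz3]
    simp [q]
  have hh : p'.1 3 = hFun lam (rad P Q) E q.2 := by
    have := hFun_mul hlam (rad P Q) E q.2
    have hs' : sFun lam p' = (lam + E ^ 2 + ‖q.2‖ ^ 2) ^ (1 / 4 : ℝ) := by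
      rw [sFun, hr]; ring_nf
    rw [← hs'] at this
    exact mul_right_cancel₀ hs0.ne' (h3.trans this.symm)
  have hxx : xVec q.1 (hFun lam (rad P Q) E q.2) = p'.1 := by
    rw [← hh]; ext i; fin_cases i <;> simp [xVec, q, h4]
  refine ⟨q, mem_K.2 ⟨?_, ?_⟩, ?_⟩
  · have := norm_xVec q.1 (hFun lam (rad P Q) E q.2)
    rw [hxx, hpa.1] at this
    linarith
  · have := inner_xVec q.1 q.2 (hFun lam (rad P Q) E q.2) (-E)
    rw [hxx, hzx, h0] at this
    linarith
  · rw [emb, theta, hzx, hxx, ← he]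
    exact hpp

end

/-- The pairs `(P i, Q i)` are the solutions of `P⁴ = C`, `Q⁴ = D`, without repetition. -/
structure IsRootFamily (C D : ℝ) {n : ℕ} (P Q : Fin n → ℝ) : Prop where
  left : ∀ i, P i ^ 4 = C
  right : ∀ i, Q i ^ 4 = D
  exists_eq : ∀ a b : ℝ, a ^ 4 = C → b ^ 4 = D → ∃ i, P i = a ∧ Q i = b
  injective : Function.Injective fun i => (P i, Q i)

section

variable {lam C D E : ℝ} {n : ℕ} {P Q : Fin n → ℝ}

/-- All roots have the same P² = √C and Q² = √D, so all pieces of M are modelled on the same K. -/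
theorem IsRootFamily.rad_sq (h : IsRootFamily C D P Q) (i : Fin n) :
    rad (P i) (Q i) ^ 2 = √C + √D := by
  rw [BryantSalamon.rad_sq, ← h.left i, ← h.right i, show P i ^ 4 = (P i ^ 2) ^ 2 by ring,
    show Q i ^ 4 = (Q i ^ 2) ^ 2 by ring, Real.sqrt_sq (sq_nonneg _), Real.sqrt_sq (sq_nonneg _)]

theorem emb_mem_M (hlam : 0 < lam) (h : IsRootFamily C D P Q) (i : Fin n) {q : R3 × R3}
    (hq : q ∈ K lam (rad (P i) (Q i)) E) : emb lam (P i) (Q i) E q ∈ M lam C D E := by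
  rw [M_eq_levelSet]
  have hv := axisValues_emb hlam hq
  refine ⟨emb_mem_asd hq, ?_, ?_, emb_snd_three_four _ _ _ _ _⟩
  · rw [← sFun_pow hlam, ← mul_pow, ← h.left i]
    exact congrArg (· ^ 4) (congrArg Prod.fst hv)
  · rw [← sFun_pow hlam, ← mul_pow, ← h.right i]
    exact congrArg (· ^ 4) (congrArg Prod.snd hv)

theorem exists_index (hlam : 0 < lam) (h : IsRootFamily C D P Q) {p : Amb} (hp : p ∈ M lam C D E) :
    ∃ i, axisValues lam p = (P i, Q i) := by
  rw [M_eq_levelSet] at hp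
  obtain ⟨i, h1, h2⟩ := h.exists_eq (p.1 3 * sFun lam p) (p.1 4 * sFun lam p)
    (by rw [mul_pow, sFun_pow hlam]; exact hp.2.1) (by rw [mul_pow, sFun_pow hlam]; exact hp.2.2.1)
  exact ⟨i, by rw [h1, h2]; rfl⟩

theorem exists_emb_eq_of_mem_M (hlam : 0 < lam) {p : Amb}
    (hp : p ∈ M lam C D E) {i : Fin n} (hi : axisValues lam p = (P i, Q i)) :
    ∃ q ∈ K lam (rad (P i) (Q i)) E, emb lam (P i) (Q i) E q = p := by
  rw [M_eq_levelSet] at hp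
  exact exists_emb_eq hlam hp.1 hi hp.2.2.2

/-- The components of `M` are relatively open. -/
theorem exists_open_inter_eq (hlam : 0 < lam) (h : IsRootFamily C D P Q) (i : Fin n) (E : ℝ) :
    ∃ U : Set Amb, IsOpen U ∧
      M lam C D E ∩ U = emb lam (P i) (Q i) E '' K lam (rad (P i) (Q i)) E := by
  -- The open set avoids the finitely many axis values of the other pieces.
  refine ⟨axisValues lam ⁻¹' (((fun j => (P j, Q j)) '' {j | j ≠ i})ᶜ),
    (((toFinite {j | j ≠ i}).image _).isClosed.isOpen_compl).preimage
      (continuous_axisValues hlam), ?_⟩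
  ext p
  constructor
  · rintro ⟨hp, hU⟩
    obtain ⟨j, hj⟩ := exists_index hlam h hp
    have hji : j = i := by
      by_contra hne
      exact hU ⟨j, hne, hj.symm⟩
    subst hji
    exact exists_emb_eq_of_mem_M hlam hp hj
  · rintro ⟨q', hq', rfl⟩
    refine ⟨emb_mem_M hlam h i hq', ?_⟩
    rw [mem_preimage, axisValues_emb hlam hq']
    rintro ⟨j, hj, hj'⟩
    exact hj (h.injective hj')

theorem isCoassociativeAt_M (hlam : 0 < lam) (h : IsRootFamily C D P Q) (i : Fin n)
    {q : R3 × R3} (hq : q ∈ K lam (rad (P i) (Q i)) E) (hq0 : q ≠ 0) :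
    IsCoassociativeAt lam (M lam C D E) (emb lam (P i) (Q i) E q) := by
  obtain ⟨U, hU, hUM⟩ := exists_open_inter_eq hlam h i E
  have h1 := (isCoassociativeAt_theta hlam (rad_nonneg _ _) hq hq0).lift (theta_mem_asd hq).1
    (argRot_isSO (P i) (Q i))
  rw [image_image] at h1
  have hmem : emb lam (P i) (Q i) E q ∈ M lam C D E ∩ U := by rw [hUM]; exact ⟨q, hq, rfl⟩
  refine h1.congr hU hmem.2 ?_
  change emb lam (P i) (Q i) E '' K lam (rad (P i) (Q i)) E ∩ U = _
  rw [← hUM, inter_assoc, inter_self]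

/-- At the origin the equations read h² = 1 and hE = 0, with h = X(λ + E²)^{-1/4}. -/
theorem zero_mem_K_iff (hlam : 0 < lam) {X : ℝ} :
    (0 : R3 × R3) ∈ K lam X E ↔ E = 0 ∧ X ^ 2 = √lam := by
  have hp := hFun_pow hlam X E 0
  have hl := Real.sq_sqrt hlam.le
  rw [mem_K]
  simp only [Prod.fst_zero, Prod.snd_zero, norm_zero, inner_zero_right]
  rw [norm_zero] at hp
  constructor
  · rintro ⟨h1, h2⟩
    have h3 : hFun lam X E 0 ^ 2 = 1 := by linarith
    have hE : E = 0 := by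
      rcases mul_eq_zero.1 h2.symm with h | h
      · rw [h] at h3; norm_num at h3
      · exact h
    refine ⟨hE, ?_⟩
    rw [show hFun lam X E 0 ^ 4 = (hFun lam X E 0 ^ 2) ^ 2 by ring, h3, hE] at hp
    rw [← sq_eq_sq₀ (sq_nonneg _) (Real.sqrt_nonneg _), hl]
    linarith
  · rintro ⟨rfl, h⟩
    have h4 : X ^ 4 = lam := by rw [show X ^ 4 = (X ^ 2) ^ 2 by ring, h, hl]
    have h5 : hFun lam X 0 0 ^ 4 = 1 := by
      rw [h4] at hp
      have : hFun lam X 0 0 ^ 4 * lam = 1 * lam := by linarith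
      exact mul_right_cancel₀ hlam.ne' this
    have h6 : hFun lam X 0 0 ^ 2 = 1 := by nlinarith [sq_nonneg (hFun lam X 0 0)]
    rw [h6]
    norm_num

theorem M_subset_asd : M lam C D E ⊆ asd := by
  rw [M_eq_levelSet]; exact fun p hp => hp.1

theorem isCoassociative_M (hlam : 0 < lam) (h : IsRootFamily C D P Q)
    (hne : ¬ (E = 0 ∧ √C + √D = √lam)) : IsCoassociative lam (M lam C D E) := by
  refine ⟨M_subset_asd, fun p hp => ?_⟩
  obtain ⟨i, hi⟩ := exists_index hlam h hp
  obtain ⟨q, hq, rfl⟩ := exists_emb_eq_of_mem_M hlam hp hi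
  refine isCoassociativeAt_M hlam h i hq fun h0 => hne ?_
  rw [h0, zero_mem_K_iff hlam, h.rad_sq] at hq
  exact hq

theorem emb_zero_apply (lam P Q : ℝ) :
    (emb lam P Q 0 0).1 0 = 0 ∧ (emb lam P Q 0 0).1 1 = 0 ∧ (emb lam P Q 0 0).1 2 = 0 ∧
      (emb lam P Q 0 0).2 = 0 := by
  have h2 : (theta lam (rad P Q) 0 0).2 = 0 := by
    refine form2_ext fun i j _ => ?_
    rw [theta, asdForm_apply]
    simp [xVec]
  refine ⟨?_, ?_, ?_, ?_⟩
  · rw [emb, lift_fst, argRot, act_rot34]; rfl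
  · rw [emb, lift_fst, argRot, act_rot34]; rfl
  · rw [emb, lift_fst, argRot, act_rot34]; rfl
  · refine form2_ext fun i j _ => ?_
    rw [emb, lift_snd, h2]; rfl

theorem eq_zero_of_mem_apexes {P Q : ℝ} {q : R3 × R3} (hq : q ∈ K lam (rad P Q) E)
    (h : emb lam P Q E q ∈ apexes lam C D E) : q = 0 := by
  obtain ⟨-, h0, h1, h2, h3⟩ := h
  rw [emb, lift_fst, argRot, act_rot34] at h0 h1 h2
  refine Prod.ext ?_ ?_
  · ext i; fin_cases i
    exacts [h0, h1, h2]
  · have hr : rSq (emb lam P Q E q) = 0 := by rw [rSq, h3]; simp [fibreInner]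
    rw [emb, (argRot_isSO P Q).rSq_lift, rSq_theta hq] at hr
    have : ‖q.2‖ ^ 2 = 0 := by nlinarith [sq_nonneg ‖q.2‖, sq_nonneg E]
    simpa using this

theorem apexes_eq (hlam : 0 < lam) (h : IsRootFamily C D P Q) (hX : √C + √D = √lam) :
    apexes lam C D 0 = range fun i => emb lam (P i) (Q i) 0 0 := by
  have h0 (i : Fin n) : (0 : R3 × R3) ∈ K lam (rad (P i) (Q i)) 0 :=
    (zero_mem_K_iff hlam).2 ⟨rfl, by rw [h.rad_sq, hX]⟩
  ext p
  constructor
  · intro hp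
    obtain ⟨i, hi⟩ := exists_index hlam h hp.1
    obtain ⟨q, hq, rfl⟩ := exists_emb_eq_of_mem_M hlam hp.1 hi
    exact ⟨i, by rw [eq_zero_of_mem_apexes hq hp]⟩
  · rintro ⟨i, rfl⟩
    exact ⟨emb_mem_M hlam h i (h0 i), emb_zero_apply _ _ _⟩

theorem isCoassociative_diff_apexes (hlam : 0 < lam) (h : IsRootFamily C D P Q)
    (hX : √C + √D = √lam) : IsCoassociative lam (M lam C D 0 \ apexes lam C D 0) := by
  refine ⟨sdiff_subset.trans M_subset_asd, fun p hp => ?_⟩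
  obtain ⟨i, hi⟩ := exists_index hlam h hp.1
  obtain ⟨q, hq, rfl⟩ := exists_emb_eq_of_mem_M hlam hp.1 hi
  have hq0 : q ≠ 0 := fun h0 => hp.2 (by rw [apexes_eq hlam h hX, h0]; exact ⟨i, rfl⟩)
  have hfin : (apexes lam C D 0).Finite := by rw [apexes_eq hlam h hX]; exact finite_range _
  refine (isCoassociativeAt_M hlam h i hq hq0).congr hfin.isClosed.isOpen_compl hp.2 ?_
  rw [sdiff_eq, inter_assoc, inter_self]

theorem continuous_fin_apply {A B Y : Type*} [TopologicalSpace A] [TopologicalSpace B]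
    [TopologicalSpace Y] (f : Fin n → A → B) (hf : ∀ i, Continuous (f i)) {idx : Y → Fin n}
    (hi : Continuous idx) {g : Y → A} (hg : Continuous g) : Continuous fun y => f (idx y) (g y) :=
  (continuous_prod_of_discrete_left (f := fun x : Fin n × A => f x.1 x.2).2 hf).comp
    (hi.prodMk hg)

/-- `M` is a disjoint union of copies of `K`. -/
theorem nonempty_homeomorph_K (hlam : 0 < lam) (h : IsRootFamily C D P Q) {X : ℝ}
    (hX : 0 ≤ X) (hXC : X ^ 2 = √C + √D) :
    Nonempty (M lam C D E ≃ₜ Fin n × K lam X E) := by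
  have hr (i : Fin n) : rad (P i) (Q i) = X := by
    rw [← sq_eq_sq₀ (rad_nonneg _ _) hX, h.rad_sq, hXC]
  choose idx hidx using fun p : M lam C D E => exists_index hlam h p.2
  have hci : Continuous idx := by
    -- The finitely many pairs of roots form a discrete set, so the index is continuous because the
    -- axis values are.
    have he : IsClosedEmbedding fun i => (P i, Q i) :=
      (continuous_of_discreteTopology).isClosedEmbedding h.injective
    rw [he.isEmbedding.continuous_iff]
    have : (fun i => (P i, Q i)) ∘ idx = fun p => axisValues lam p.1 := funext fun p => (hidx p).symm
    rw [this]
    exact (continuous_axisValues hlam).comp continuous_subtype_val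
  have hK (p : M lam C D E) : embInv (P (idx p)) (Q (idx p)) p.1 ∈ K lam X E ∧
      emb lam (P (idx p)) (Q (idx p)) E (embInv (P (idx p)) (Q (idx p)) p.1) = p.1 := by
    obtain ⟨q, hq, he⟩ := exists_emb_eq_of_mem_M hlam p.2 (hidx p)
    rw [← he, embInv_emb]
    exact ⟨by rw [← hr (idx p)]; exact hq, rfl⟩
  have hmem (i : Fin n) (q : K lam X E) : q.1 ∈ K lam (rad (P i) (Q i)) E := by
    rw [hr i]; exact q.2
  have hc1 : Continuous fun p : M lam C D E => embInv (P (idx p)) (Q (idx p)) p.1 := by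
    have hf (i : Fin n) : Continuous fun p : Amb => embInv (P i) (Q i) p :=
      ContinuousLinearMap.continuous _
    exact continuous_fin_apply (fun i p => embInv (P i) (Q i) p) hf hci continuous_subtype_val
  have hc2 : Continuous fun y : Fin n × K lam X E => emb lam (P y.1) (Q y.1) E y.2.1 :=
    continuous_fin_apply (fun i => emb lam (P i) (Q i) E)
      (fun i => (contDiff_emb hlam (P i) (Q i) E).continuous) continuous_fst
      (continuous_subtype_val.comp continuous_snd)
  let f : M lam C D E → Fin n × K lam X E := fun p => (idx p, ⟨_, (hK p).1⟩)
  let g : Fin n × K lam X E → M lam C D E := fun y => ⟨_, emb_mem_M hlam h y.1 (hmem y.1 y.2)⟩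
  have hf : Continuous f := hci.prodMk (hc1.subtype_mk _)
  have hg : Continuous g := hc2.subtype_mk _
  have hgf (p : M lam C D E) : g (f p) = p := Subtype.ext (hK p).2
  have hfg (y : Fin n × K lam X E) : f (g y) = y := by
    have hi : idx (g y) = y.1 :=
      h.injective ((hidx _).symm.trans (axisValues_emb hlam (hmem y.1 y.2)))
    refine Prod.ext hi (Subtype.ext ?_)
    change embInv (P (idx (g y))) (Q (idx (g y))) _ = _
    rw [hi]
    exact embInv_emb _ _ _ _ _
  exact ⟨⟨⟨f, g, hgf, hfg⟩, hf, hg⟩⟩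

end

/-! ### Fourth roots -/

theorem fourth_root_cases {C c a : ℝ} (hC : c ^ 4 = C) (ha : a ^ 4 = C) : a = c ∨ a = -c := by
  have : (a ^ 2) ^ 2 = (c ^ 2) ^ 2 := by rw [← pow_mul, ← pow_mul, ha, hC]
  have := (sq_eq_sq₀ (sq_nonneg a) (sq_nonneg c)).1 this
  exact sq_eq_sq_iff_eq_or_eq_neg.1 this

theorem sqrt_sqrt_pow {C : ℝ} (hC : 0 ≤ C) : √√C ^ 4 = C := by
  rw [show √√C ^ 4 = (√√C ^ 2) ^ 2 by ring, Real.sq_sqrt (Real.sqrt_nonneg _), Real.sq_sqrt hC]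

theorem isRootFamily_four {C D : ℝ} (hC : 0 < C) (hD : 0 < D) :
    IsRootFamily C D ![√√C, √√C, -√√C, -√√C] ![√√D, -√√D, √√D, -√√D] := by
  have hc : 0 < √√C := Real.sqrt_pos.2 (Real.sqrt_pos.2 hC)
  have hd : 0 < √√D := Real.sqrt_pos.2 (Real.sqrt_pos.2 hD)
  have hc4 := sqrt_sqrt_pow hC.le
  have hd4 := sqrt_sqrt_pow hD.le
  refine ⟨fun i => ?_, fun i => ?_, fun a b ha hb => ?_, fun i j hij => ?_⟩
  · fin_cases i <;> simp [Even.neg_pow (show Even 4 by decide), hc4]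
  · fin_cases i <;> simp [Even.neg_pow (show Even 4 by decide), hd4]
  · rcases fourth_root_cases hc4 ha with rfl | rfl <;> rcases fourth_root_cases hd4 hb with rfl | rfl
    exacts [⟨0, rfl, rfl⟩, ⟨1, rfl, rfl⟩, ⟨2, rfl, rfl⟩, ⟨3, rfl, rfl⟩]
  · obtain ⟨h1, h2⟩ := Prod.mk.inj hij
    fin_cases i <;> fin_cases j <;> first | rfl | (exfalso; simp at h1 h2; linarith)

theorem isRootFamily_left {C : ℝ} (hC : 0 < C) :
    IsRootFamily C 0 ![√√C, -√√C] ![0, 0] := by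
  have hc : 0 < √√C := Real.sqrt_pos.2 (Real.sqrt_pos.2 hC)
  have hc4 := sqrt_sqrt_pow hC.le
  refine ⟨fun i => ?_, fun i => ?_, fun a b ha hb => ?_, fun i j hij => ?_⟩
  · fin_cases i <;> simp [Even.neg_pow (show Even 4 by decide), hc4]
  · fin_cases i <;> simp
  · have hb0 : b = 0 := by simpa using hb
    subst hb0
    rcases fourth_root_cases hc4 ha with rfl | rfl
    exacts [⟨0, rfl, rfl⟩, ⟨1, rfl, rfl⟩]
  · obtain ⟨h1, h2⟩ := Prod.mk.inj hij
    fin_cases i <;> fin_cases j <;> first | rfl | (exfalso; simp at h1; linarith)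

theorem IsRootFamily.swap {C D : ℝ} {n : ℕ} {P Q : Fin n → ℝ} (h : IsRootFamily C D P Q) :
    IsRootFamily D C Q P where
  left := h.right
  right := h.left
  exists_eq a b ha hb := by
    obtain ⟨i, h1, h2⟩ := h.exists_eq b a hb ha
    exact ⟨i, h2, h1⟩
  injective i j hij := h.injective (Prod.ext (congrArg Prod.snd hij) (congrArg Prod.fst hij))

theorem isRootFamily_zero : IsRootFamily 0 0 ![(0 : ℝ)] ![0] := by
  refine ⟨fun i => by simp, fun i => by simp, fun a b ha hb => ⟨0, ?_, ?_⟩, fun i j _ => ?_⟩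
  · simpa using (pow_eq_zero_iff (by norm_num)).1 ha |>.symm
  · simpa using (pow_eq_zero_iff (by norm_num)).1 hb |>.symm
  · exact Subsingleton.elim _ _

theorem exists_isRootFamily {C D : ℝ} (hC : 0 ≤ C) (hD : 0 ≤ D) :
    ∃ (n : ℕ) (P Q : Fin n → ℝ), IsRootFamily C D P Q ∧ 0 < n := by
  rcases hC.eq_or_lt with rfl | hC <;> rcases hD.eq_or_lt with rfl | hD
  exacts [⟨_, _, _, isRootFamily_zero, by norm_num⟩, ⟨_, _, _, (isRootFamily_left hD).swap, by norm_num⟩,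
    ⟨_, _, _, isRootFamily_left hC, by norm_num⟩, ⟨_, _, _, isRootFamily_four hC hD, by norm_num⟩]

/-! ### The topology of `K` -/

section

variable {lam X E : ℝ}

theorem continuous_hFun (hlam : 0 < lam) (X E : ℝ) : Continuous (hFun lam X E) :=
  (contDiff_hFun hlam X E).continuous

theorem hFun_sq_zero_lt (hlam : 0 < lam) {w : R3} (h : X ^ 4 < lam + ‖w‖ ^ 2) :
    hFun lam X 0 w ^ 2 < 1 := by
  have hp := hFun_pow hlam X 0 w
  have hb := base_pos hlam 0 w
  by_contra! hc
  have h4 : 1 ≤ hFun lam X 0 w ^ 4 := by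
    rw [show hFun lam X 0 w ^ 4 = (hFun lam X 0 w ^ 2) ^ 2 by ring]; nlinarith
  have : 1 * (lam + 0 ^ 2 + ‖w‖ ^ 2) ≤ X ^ 4 := by
    rw [← hp]; exact mul_le_mul_of_nonneg_right h4 hb.le
  linarith

/-- The zero section is met in a sphere. -/
theorem homeomorph_of_lt (hlam : 0 < lam) (hX : X ^ 4 < lam) : Nonempty (K lam X 0 ≃ₜ TS2) := by
  have hlt (w : R3) : 0 < 1 - hFun lam X 0 w ^ 2 := by
    have := hFun_sq_zero_lt hlam (w := w) (X := X) (by nlinarith [sq_nonneg ‖w‖])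
    linarith
  have hy (q : K lam X 0) : 0 < ‖q.1.1‖ := by
    have := (mem_K.1 q.2).1
    have h2 := hlt q.1.2
    rw [← this] at h2
    exact (norm_nonneg _).lt_of_ne fun h0 => by rw [← h0] at h2; norm_num at h2
  have hn (q : K lam X 0) : ‖q.1.1‖ = √(1 - hFun lam X 0 q.1.2 ^ 2) := by
    rw [← (mem_K.1 q.2).1, Real.sqrt_sq (norm_nonneg _)]
  -- Here h < 1 everywhere, so y ≠ 0 and |y| is a function of w: the point is determined by the
  -- direction of y and by w.
  let f : K lam X 0 → TS2 := fun q => ⟨(‖q.1.1‖⁻¹ • q.1.1, q.1.2), by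
    rw [norm_smul, norm_inv, norm_norm, inv_mul_cancel₀ (hy q).ne'], by
    rw [inner_smul_left, (mem_K.1 q.2).2]; simp⟩
  let g : TS2 → K lam X 0 := fun y => ⟨(√(1 - hFun lam X 0 y.1.2 ^ 2) • y.1.1, y.1.2), by
    refine mem_K.2 ⟨?_, ?_⟩
    · simp only [norm_smul, y.2.1, mul_one, Real.norm_eq_abs, sq_abs, Real.sq_sqrt (hlt _).le]
    · simp only [inner_smul_left, y.2.2]; simp⟩
  have hf : Continuous f := by
    refine Continuous.subtype_mk (.prodMk (.smul (.inv₀ (by fun_prop) fun q => (hy q).ne')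
      (by fun_prop)) (by fun_prop)) _
  have hg : Continuous g := by
    have := continuous_hFun hlam X 0
    refine Continuous.subtype_mk ?_ _
    fun_prop
  refine ⟨⟨⟨f, g, fun q => Subtype.ext (Prod.ext ?_ rfl), fun y => Subtype.ext (Prod.ext ?_ rfl)⟩,
    hf, hg⟩⟩
  · change √(1 - hFun lam X 0 q.1.2 ^ 2) • ‖q.1.1‖⁻¹ • q.1.1 = q.1.1
    rw [← hn, smul_smul, mul_inv_cancel₀ (hy q).ne', one_smul]
  · have h0 : 0 < √(1 - hFun lam X 0 y.1.2 ^ 2) := Real.sqrt_pos.2 (hlt _)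
    change ‖√(1 - hFun lam X 0 y.1.2 ^ 2) • y.1.1‖⁻¹ • √(1 - hFun lam X 0 y.1.2 ^ 2) • y.1.1 = y.1.1
    rw [norm_smul, y.2.1, mul_one, Real.norm_of_nonneg h0.le, smul_smul, inv_mul_cancel₀ h0.ne',
      one_smul]

theorem hFun_pos (hlam : 0 < lam) (hX : 0 < X) (w : R3) : 0 < hFun lam X E w :=
  mul_pos hX (Real.rpow_pos_of_pos (base_pos hlam E w) _)

/-- `h = X (λ + E² + |w|²)^{-1/4}` is characterized by its fourth power. -/
theorem hFun_eq_iff (hlam : 0 < lam) (hX : 0 ≤ X) {w : R3} {t : ℝ} (ht : 0 ≤ t) :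
    hFun lam X E w = t ↔ t ^ 4 * (lam + E ^ 2 + ‖w‖ ^ 2) = X ^ 4 := by
  have hp := hFun_pow hlam X E w
  have hb := base_pos hlam E w
  constructor
  · rintro rfl; exact hp
  · intro h
    rw [← h] at hp
    exact (pow_left_inj₀ (hFun_nonneg hlam hX w) ht four_ne_zero).1
      (mul_right_cancel₀ hb.ne' hp)

/-- The zero section is not met, and `w ≠ 0`. -/
theorem homeomorph_of_gt (hlam : 0 < lam) (hX0 : 0 ≤ X) (hX : lam < X ^ 4) :
    Nonempty (K lam X 0 ≃ₜ TS2) := by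
  have hXp : 0 < X := by
    rcases hX0.eq_or_lt with rfl | h
    · norm_num at hX; linarith
    · exact h
  have hh (w : R3) := hFun_pos (E := 0) hlam hXp w
  have hw (q : K lam X 0) : 0 < ‖q.1.2‖ := by
    refine (norm_nonneg _).lt_of_ne fun h0 => ?_
    have hp := hFun_pow hlam X 0 q.1.2
    have h1 : hFun lam X 0 q.1.2 ^ 2 ≤ 1 := by
      have := (mem_K.1 q.2).1
      nlinarith [sq_nonneg ‖q.1.1‖]
    have h4 : hFun lam X 0 q.1.2 ^ 4 ≤ 1 := by
      rw [show hFun lam X 0 q.1.2 ^ 4 = (hFun lam X 0 q.1.2 ^ 2) ^ 2 by ring]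
      exact pow_le_one₀ (sq_nonneg _) h1
    rw [← h0] at hp
    nlinarith
  -- With v = y/h one has 1 + |v|² = h⁻², and λ + |w|² = X⁴h⁻⁴; this expresses |w| through v.
  let R : R3 → ℝ := fun v => √(X ^ 4 * (1 + ‖v‖ ^ 2) ^ 2 - lam)
  have hR0 (v : R3) : 0 < X ^ 4 * (1 + ‖v‖ ^ 2) ^ 2 - lam := by
    have h1 : 1 ≤ (1 + ‖v‖ ^ 2) ^ 2 := one_le_pow₀ (by nlinarith [sq_nonneg ‖v‖])
    have := mul_le_mul_of_nonneg_left h1 (by positivity : 0 ≤ X ^ 4)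
    linarith
  have hR (v : R3) : R v ^ 2 = X ^ 4 * (1 + ‖v‖ ^ 2) ^ 2 - lam := Real.sq_sqrt (hR0 v).le
  have hRp (v : R3) : 0 < R v := Real.sqrt_pos.2 (hR0 v)
  have hk (v u : R3) (hu : ‖u‖ = 1) : hFun lam X 0 (R v • u) = (√(1 + ‖v‖ ^ 2))⁻¹ := by
    rw [hFun_eq_iff hlam hX0 (by positivity), norm_smul, hu, mul_one, Real.norm_eq_abs, sq_abs, hR]
    have : √(1 + ‖v‖ ^ 2) ^ 4 = (1 + ‖v‖ ^ 2) ^ 2 := by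
      rw [show √(1 + ‖v‖ ^ 2) ^ 4 = (√(1 + ‖v‖ ^ 2) ^ 2) ^ 2 by ring, Real.sq_sqrt (by positivity)]
    rw [inv_pow, this]
    field_simp
    ring
  let f : K lam X 0 → TS2 := fun q => ⟨(‖q.1.2‖⁻¹ • q.1.2, (hFun lam X 0 q.1.2)⁻¹ • q.1.1), by
    rw [norm_smul, norm_inv, norm_norm, inv_mul_cancel₀ (hw q).ne'], by
    rw [inner_smul_left, inner_smul_right, real_inner_comm, (mem_K.1 q.2).2]; simp⟩
  let g : TS2 → K lam X 0 := fun y => ⟨((√(1 + ‖y.1.2‖ ^ 2))⁻¹ • y.1.2, R y.1.2 • y.1.1), by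
    refine mem_K.2 ⟨?_, ?_⟩
    · simp only [hk _ _ y.2.1, norm_smul, norm_inv, Real.norm_eq_abs, mul_pow, inv_pow, sq_abs]
      rw [Real.sq_sqrt (by positivity)]
      field_simp
      ring
    · rw [inner_smul_left, inner_smul_right, real_inner_comm, y.2.2]; simp⟩
  have hf : Continuous f := by
    have h := continuous_hFun hlam X 0
    refine Continuous.subtype_mk (.prodMk (.smul (.inv₀ (by fun_prop) fun q => (hw q).ne')
      (by fun_prop)) (.smul (.inv₀ (by fun_prop) fun q => (hh _).ne') (by fun_prop))) _
  have hg : Continuous g := by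
    have hRc : Continuous R := by fun_prop
    have h1 : Continuous fun y : TS2 => (√(1 + ‖y.1.2‖ ^ 2))⁻¹ :=
      Continuous.inv₀ (by fun_prop) fun y => (Real.sqrt_pos.2 (by positivity)).ne'
    exact Continuous.subtype_mk (by fun_prop) _
  refine ⟨⟨⟨f, g, fun q => Subtype.ext ?_, fun y => Subtype.ext ?_⟩, hf, hg⟩⟩
  · have h1 := (mem_K.1 q.2).1
    have h2 := hh q.1.2
    have h3 : 1 + ‖(hFun lam X 0 q.1.2)⁻¹ • q.1.1‖ ^ 2 = (hFun lam X 0 q.1.2)⁻¹ ^ 2 := by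
      rw [norm_smul, mul_pow, h1, norm_inv, Real.norm_of_nonneg h2.le]
      field_simp
      ring
    have h4 : √(1 + ‖(hFun lam X 0 q.1.2)⁻¹ • q.1.1‖ ^ 2) = (hFun lam X 0 q.1.2)⁻¹ := by
      rw [h3, Real.sqrt_sq (by positivity)]
    have h5 : R ((hFun lam X 0 q.1.2)⁻¹ • q.1.1) = ‖q.1.2‖ := by
      rw [← sq_eq_sq₀ (hRp _).le (norm_nonneg _), hR, h3, ← hFun_pow hlam X 0 q.1.2]
      field_simp
      ring
    refine Prod.ext ?_ ?_
    · change (√(1 + ‖(hFun lam X 0 q.1.2)⁻¹ • q.1.1‖ ^ 2))⁻¹ • (hFun lam X 0 q.1.2)⁻¹ • q.1.1 = q.1.1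
      rw [h4, inv_inv, smul_smul, mul_inv_cancel₀ h2.ne', one_smul]
    · change R ((hFun lam X 0 q.1.2)⁻¹ • q.1.1) • ‖q.1.2‖⁻¹ • q.1.2 = q.1.2
      rw [h5, smul_smul, mul_inv_cancel₀ (hw q).ne', one_smul]
  · have h0 := hRp y.1.2
    have h1 : 0 < √(1 + ‖y.1.2‖ ^ 2) := Real.sqrt_pos.2 (by positivity)
    refine Prod.ext ?_ ?_
    · change ‖R y.1.2 • y.1.1‖⁻¹ • R y.1.2 • y.1.1 = y.1.1
      rw [norm_smul, y.2.1, mul_one, Real.norm_of_nonneg h0.le, smul_smul, inv_mul_cancel₀ h0.ne',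
        one_smul]
    · change (hFun lam X 0 (R y.1.2 • y.1.1))⁻¹ • (√(1 + ‖y.1.2‖ ^ 2))⁻¹ • y.1.2 = y.1.2
      rw [hk _ _ y.2.1, inv_inv, smul_smul, mul_inv_cancel₀ h1.ne', one_smul]

/-! ### The topology of K for E ≠ 0. -/

/-- The equation `h⁴ (A (1 - h²) + h² E²) = X⁴ (1 - h²)` has a root in `[0, 1]`. -/
theorem exists_root (A X E : ℝ) : ∃ h : ℝ, h ∈ Icc (0 : ℝ) 1 ∧
    h ^ 4 * (A * (1 - h ^ 2) + h ^ 2 * E ^ 2) = X ^ 4 * (1 - h ^ 2) := by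
  have hc : ContinuousOn (fun h : ℝ => h ^ 4 * (A * (1 - h ^ 2) + h ^ 2 * E ^ 2) -
      X ^ 4 * (1 - h ^ 2)) (Icc 0 1) := by fun_prop
  have := intermediate_value_Icc zero_le_one hc (show (0 : ℝ) ∈ _ from ⟨by simp; positivity, by
    simp; positivity⟩)
  obtain ⟨h, hh, h0⟩ := this
  exact ⟨h, hh, by simpa [sub_eq_zero] using h0⟩

/-- At h = 1 the equation reduces to E² = 0. -/
theorem root_lt_one {A h : ℝ} (hE : E ≠ 0) (hh : h ∈ Icc (0 : ℝ) 1)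
    (h0 : h ^ 4 * (A * (1 - h ^ 2) + h ^ 2 * E ^ 2) = X ^ 4 * (1 - h ^ 2)) : h < 1 := by
  refine hh.2.lt_of_ne fun h1 => hE ?_
  rw [h1] at h0
  norm_num at h0
  exact h0

/-- After division by 1 - h² the equation is h⁴(A + E²h²/(1 - h²)) = X⁴, whose left side is strictly
increasing on [0, 1). -/
theorem root_unique {A h h' : ℝ} (hA : 0 < A) (hE : E ≠ 0) (hh : h ∈ Icc (0 : ℝ) 1)
    (hh' : h' ∈ Icc (0 : ℝ) 1)
    (h0 : h ^ 4 * (A * (1 - h ^ 2) + h ^ 2 * E ^ 2) = X ^ 4 * (1 - h ^ 2))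
    (h0' : h' ^ 4 * (A * (1 - h' ^ 2) + h' ^ 2 * E ^ 2) = X ^ 4 * (1 - h' ^ 2)) : h = h' := by
  wlog hlt : h < h' generalizing h h'
  · rcases lt_trichotomy h h' with h1 | h1 | h1
    exacts [absurd h1 hlt, h1, (this hh' hh h0' h0 h1).symm]
  exfalso
  have l1 := root_lt_one hE hh h0
  have l2 := root_lt_one hE hh' h0'
  have p1 : 0 < 1 - h ^ 2 := by nlinarith [hh.1]
  have p2 : 0 < 1 - h' ^ 2 := by nlinarith [hh'.1]
  have e1 : h ^ 4 * (A + E ^ 2 * (h ^ 2 / (1 - h ^ 2))) = X ^ 4 := by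
    field_simp; linarith
  have e2 : h' ^ 4 * (A + E ^ 2 * (h' ^ 2 / (1 - h' ^ 2))) = X ^ 4 := by
    field_simp; linarith
  have m1 : h ^ 4 < h' ^ 4 := pow_lt_pow_left₀ hlt hh.1 four_ne_zero
  have m2 : h ^ 2 / (1 - h ^ 2) ≤ h' ^ 2 / (1 - h' ^ 2) := by
    have : h ^ 2 ≤ h' ^ 2 := pow_le_pow_left₀ hh.1 hlt.le 2
    gcongr
  have m3 : 0 ≤ h ^ 2 / (1 - h ^ 2) := by positivity
  have m4 : A + E ^ 2 * (h ^ 2 / (1 - h ^ 2)) ≤ A + E ^ 2 * (h' ^ 2 / (1 - h' ^ 2)) := by gcongr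
  have m5 : 0 < A + E ^ 2 * (h' ^ 2 / (1 - h' ^ 2)) := by nlinarith [sq_nonneg E]
  have : h ^ 4 * (A + E ^ 2 * (h ^ 2 / (1 - h ^ 2))) < h' ^ 4 * (A + E ^ 2 * (h' ^ 2 / (1 - h' ^ 2))) :=
    lt_of_le_of_lt (mul_le_mul_of_nonneg_left m4 (by positivity)) (mul_lt_mul_of_pos_right m1 m5)
  linarith

/-- A function into a compact set with closed graph is continuous. -/
theorem continuous_of_graph {Y : Type*} [TopologicalSpace Y] {f : Y → ℝ} (hf : ∀ y, f y ∈ Icc (0 : ℝ) 1)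
    {F : Y × ℝ → ℝ} (hF : Continuous F) (h : ∀ y, ∀ t ∈ Icc (0 : ℝ) 1, F (y, t) = 0 ↔ t = f y) :
    Continuous f := by
  let g : Y → Icc (0 : ℝ) 1 := fun y => ⟨f y, hf y⟩
  suffices hg : Continuous g from continuous_subtype_val.comp hg
  refine continuous_iff_isClosed.2 fun s hs => ?_
  have : g ⁻¹' s = Prod.fst '' ({p : Y × Icc (0 : ℝ) 1 | F (p.1, p.2) = 0} ∩ Prod.snd ⁻¹' s) := by
    ext y
    constructor
    · intro hy
      exact ⟨(y, g y), ⟨(h y _ (hf y)).2 rfl, hy⟩, rfl⟩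
    · rintro ⟨⟨y', t⟩, ⟨h1, h2⟩, rfl⟩
      have : t = g y' := Subtype.ext ((h y' _ t.2).1 h1)
      rw [mem_preimage, ← this]
      exact h2
  rw [this]
  refine isClosedMap_fst_of_compactSpace _ (IsClosed.inter ?_ (hs.preimage continuous_snd))
  exact isClosed_eq (by fun_prop) continuous_const

/-- y = 0 would give h² = 1 and hE = 0, so u = y/|y| is defined and w = v + (hE/|y|)u with v ⟂ u.
The pair (u, v) determines the point once h is recovered from |v|. -/
theorem homeomorph_of_ne (hlam : 0 < lam) (hX : 0 ≤ X) (hE : E ≠ 0) :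
    Nonempty (K lam X E ≃ₜ TS2) := by
  have hA (v : R3) : 0 < lam + E ^ 2 + ‖v‖ ^ 2 := base_pos hlam E v
  -- Substituting |w|² = |v|² + h²E²/(1 - h²) into h⁴(λ + E² + |w|²) = X⁴ and clearing the
  -- denominator gives the equation for h = H(v).
  choose H hH hH0 using fun v : R3 => exists_root (lam + E ^ 2 + ‖v‖ ^ 2) X E
  have hHc : Continuous H := by
    -- H is continuous as the unique solution of a closed condition in the compact interval [0, 1].
    refine continuous_of_graph hH (F := fun p => p.2 ^ 4 * ((lam + E ^ 2 + ‖p.1‖ ^ 2) *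
      (1 - p.2 ^ 2) + p.2 ^ 2 * E ^ 2) - X ^ 4 * (1 - p.2 ^ 2)) (by fun_prop) fun v t ht => ?_
    constructor
    · intro h
      exact root_unique (hA v) hE ht (hH v) (by linarith) (hH0 v)
    · rintro rfl
      have := hH0 v
      simp only
      linarith
  have hlt (v : R3) : 0 < 1 - H v ^ 2 := by
    have := root_lt_one hE (hH v) (hH0 v)
    nlinarith [(hH v).1]
  let ρ : R3 → ℝ := fun v => √(1 - H v ^ 2)
  have hρ (v : R3) : 0 < ρ v := Real.sqrt_pos.2 (hlt v)
  have hρ2 (v : R3) : ρ v ^ 2 = 1 - H v ^ 2 := Real.sq_sqrt (hlt v).le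
  have hρc : Continuous ρ := by fun_prop
  have hy (q : K lam X E) : 0 < ‖q.1.1‖ := by
    refine (norm_nonneg _).lt_of_ne fun h0 => ?_
    obtain ⟨h1, h2⟩ := mem_K.1 q.2
    rw [norm_eq_zero.1 h0.symm, inner_zero_left] at h2
    rw [← h0] at h1
    rcases mul_eq_zero.1 h2.symm with h | h
    · rw [h] at h1; norm_num at h1
    · exact hE h
  let u : K lam X E → R3 := fun q => ‖q.1.1‖⁻¹ • q.1.1
  have hu (q : K lam X E) : ‖u q‖ = 1 := by
    rw [norm_smul, norm_inv, norm_norm, inv_mul_cancel₀ (hy q).ne']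
  have huc : Continuous u := .smul (.inv₀ (by fun_prop) fun q => (hy q).ne') (by fun_prop)
  have huw (q : K lam X E) : inner ℝ (u q) q.1.2 = ‖q.1.1‖⁻¹ * (hFun lam X E q.1.2 * E) := by
    rw [inner_smul_left, (mem_K.1 q.2).2]; rfl
  let f : K lam X E → TS2 := fun q => ⟨(u q, q.1.2 - (inner ℝ (u q) q.1.2 : ℝ) • u q), hu q, by
    rw [inner_sub_right, inner_smul_right, real_inner_self_eq_norm_sq, hu]; ring⟩
  have hnorm (v a : R3) (ha : ‖a‖ = 1) (hav : inner ℝ a v = (0 : ℝ)) (c : ℝ) :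
      ‖v + c • a‖ ^ 2 = ‖v‖ ^ 2 + c ^ 2 := by
    rw [norm_add_sq_real, inner_smul_right, real_inner_comm, hav, norm_smul, ha, Real.norm_eq_abs,
      mul_one, sq_abs]
    ring
  have hhH (v a : R3) (ha : ‖a‖ = 1) (hav : inner ℝ a v = (0 : ℝ)) :
      hFun lam X E (v + (H v * E / ρ v) • a) = H v := by
    rw [hFun_eq_iff hlam hX (hH v).1, hnorm v a ha hav, div_pow, hρ2]
    have := hH0 v
    have h1 := (hlt v).ne'
    field_simp
    linarith
  let g : TS2 → K lam X E := fun y =>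
    ⟨(ρ y.1.2 • y.1.1, y.1.2 + (H y.1.2 * E / ρ y.1.2) • y.1.1), by
      have h0 := (hρ y.1.2).ne'
      refine mem_K.2 ⟨?_, ?_⟩
      · simp only [hhH _ _ y.2.1 y.2.2, norm_smul, y.2.1, mul_one, Real.norm_eq_abs, sq_abs, hρ2]
      · simp only [hhH _ _ y.2.1 y.2.2, inner_smul_left, inner_add_right, inner_smul_right, y.2.2,
          real_inner_self_eq_norm_sq, y.2.1, conj_trivial]
        field_simp
        ring⟩
  have hf : Continuous f := Continuous.subtype_mk (by fun_prop) _
  have hg : Continuous g := by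
    refine Continuous.subtype_mk (.prodMk (by fun_prop) (.add (by fun_prop) (.smul (.div (by fun_prop)
      (by fun_prop) fun y => (hρ _).ne') (by fun_prop)))) _
  refine ⟨⟨⟨f, g, fun q => Subtype.ext ?_, fun y => Subtype.ext ?_⟩, hf, hg⟩⟩
  · obtain ⟨h1, h2⟩ := mem_K.1 q.2
    have h3 : ‖q.1.2 - (inner ℝ (u q) q.1.2 : ℝ) • u q‖ ^ 2 =
        ‖q.1.2‖ ^ 2 - (‖q.1.1‖⁻¹ * (hFun lam X E q.1.2 * E)) ^ 2 := by
      rw [norm_sub_sq_real, inner_smul_right, real_inner_comm (u q), norm_smul, hu, Real.norm_eq_abs,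
        mul_one, sq_abs, ← huw]
      ring
    have hpos := hy q
    have h4 : H (q.1.2 - (inner ℝ (u q) q.1.2 : ℝ) • u q) = hFun lam X E q.1.2 := by
      have hn := hFun_nonneg (E := E) hlam hX q.1.2
      refine root_unique (hA _) hE (hH _) ⟨hn, ?_⟩ (hH0 _) ?_
      · nlinarith [sq_nonneg ‖q.1.1‖]
      · rw [h3, ← h1, ← hFun_pow hlam X E q.1.2]
        field_simp
        ring
    have h5 : ρ (q.1.2 - (inner ℝ (u q) q.1.2 : ℝ) • u q) = ‖q.1.1‖ := by
      rw [← sq_eq_sq₀ (hρ _).le hpos.le, hρ2, h4, h1]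
    refine Prod.ext ?_ ?_
    · change ρ (q.1.2 - (inner ℝ (u q) q.1.2 : ℝ) • u q) • ‖q.1.1‖⁻¹ • q.1.1 = q.1.1
      rw [h5, smul_smul, mul_inv_cancel₀ hpos.ne', one_smul]
    · change q.1.2 - (inner ℝ (u q) q.1.2 : ℝ) • u q +
        (H (q.1.2 - (inner ℝ (u q) q.1.2 : ℝ) • u q) * E /
          ρ (q.1.2 - (inner ℝ (u q) q.1.2 : ℝ) • u q)) • u q = q.1.2
      rw [h4, h5, huw, div_eq_inv_mul, sub_add_cancel]
  · have h0 := hρ y.1.2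
    have h1 : u (g y) = y.1.1 := by
      change ‖ρ y.1.2 • y.1.1‖⁻¹ • ρ y.1.2 • y.1.1 = y.1.1
      rw [norm_smul, y.2.1, mul_one, Real.norm_of_nonneg h0.le, smul_smul, inv_mul_cancel₀ h0.ne',
        one_smul]
    refine Prod.ext h1 ?_
    change (g y).1.2 - (inner ℝ (u (g y)) (g y).1.2 : ℝ) • u (g y) = y.1.2
    rw [h1]
    change y.1.2 + (H y.1.2 * E / ρ y.1.2) • y.1.1 -
      (inner ℝ y.1.1 (y.1.2 + (H y.1.2 * E / ρ y.1.2) • y.1.1) : ℝ) • y.1.1 = y.1.2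
    rw [inner_add_right, inner_smul_right, y.2.2, real_inner_self_eq_norm_sq, y.2.1]
    simp

/-! ### The singular case -/

/-- Needed for the properness of the projection ℝ≥0 × SO(3) → ℝ≥0, which makes the cone
parametrization a quotient map. -/
instance : CompactSpace SO3 := by
  refine isCompact_iff_compactSpace.1 ?_
  have hb : IsCompact {A : Matrix (Fin 3) (Fin 3) ℝ | ∀ i j, A i j ∈ Icc (-1 : ℝ) 1} := by
    have := isCompact_univ_pi fun _ : Fin 3 => isCompact_univ_pi fun _ : Fin 3 =>
      isCompact_Icc (a := (-1 : ℝ)) (b := 1)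
    refine (congrArg IsCompact (Set.ext fun A => ?_)).mpr this
    exact ⟨fun h i _ j _ => h i j, fun h i j => h i trivial j trivial⟩
  refine hb.of_isClosed_subset ?_ ?_
  · have : (Matrix.specialOrthogonalGroup (Fin 3) ℝ : Set (Matrix (Fin 3) (Fin 3) ℝ)) =
        {A | A * A.transpose = 1} ∩ {A | A.det = 1} := by
      ext A
      simp [Matrix.mem_specialOrthogonalGroup_iff, Matrix.mem_orthogonalGroup_iff]
    rw [this]
    refine IsClosed.inter (isClosed_eq ?_ continuous_const) (isClosed_eq ?_ continuous_const)
    · exact continuous_id.matrix_mul continuous_id.matrix_transpose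
    · exact continuous_id.matrix_det
  · intro A hA i j
    have h := congrFun (congrFun (SO3.mul_transpose ⟨A, hA⟩) i) i
    rw [Matrix.mul_apply, Fin.sum_univ_three] at h
    simp only [Matrix.transpose_apply, Matrix.one_apply_eq] at h
    have : A i j ^ 2 ≤ 1 := by
      have h0 := sq_nonneg (A i 0)
      have h1 := sq_nonneg (A i 1)
      have h2 := sq_nonneg (A i 2)
      fin_cases j <;> simp only [Fin.zero_eta, Fin.mk_one, Fin.reduceFinMk] <;> nlinarith
    exact abs_le.1 ((sq_le_one_iff_abs_le_one _).1 this)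

/-- A column of an element of `SO(3)`. -/
def SO3.col (g : SO3) (j : Fin 3) : R3 := !₂[g.1 0 j, g.1 1 j, g.1 2 j]

theorem SO3.inner_col (g : SO3) (i j : Fin 3) : inner ℝ (g.col i) (g.col j) = if i = j then (1 : ℝ) else 0 := by
  have h := congrFun (congrFun g.transpose_mul i) j
  rw [Matrix.mul_apply, Fin.sum_univ_three] at h
  rw [inner_R3, ← Matrix.one_apply, ← h]
  rfl

theorem SO3.norm_col (g : SO3) (i : Fin 3) : ‖g.col i‖ = 1 := by
  have := g.inner_col i i
  rw [real_inner_self_eq_norm_sq, if_pos rfl] at this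
  rwa [← sq_eq_sq₀ (norm_nonneg _) zero_le_one, one_pow]

theorem SO3.continuous_col (j : Fin 3) : Continuous fun g : SO3 => g.col j := by
  refine (PiLp.continuous_toLp 2 _).comp (continuous_pi fun i => ?_)
  fin_cases i <;> exact (continuous_apply_apply _ _).comp continuous_subtype_val

/-- For a rotation the adjugate is the transpose, so the third column is the cross product of the
other two. -/
theorem SO3.ext_col {g g' : SO3} (h0 : g.col 0 = g'.col 0) (h1 : g.col 1 = g'.col 1) : g = g' := by
  have key (g : SO3) (i : Fin 3) : g.1 i 2 = cross (g.col 0) (g.col 1) i := by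
    have hd := g.det
    have hadj : g.1.adjugate = g.1.transpose := by
      have : g.1.adjugate = g.1.transpose * (g.1 * g.1.adjugate) := by
        rw [← Matrix.mul_assoc, g.transpose_mul, Matrix.one_mul]
      rw [this, Matrix.mul_adjugate, hd, one_smul, Matrix.mul_one]
    have : g.1 i 2 = g.1.adjugate 2 i := by rw [hadj]; rfl
    rw [this, Matrix.adjugate_fin_three]
    fin_cases i <;> simp [cross, SO3.col] <;> ring
  refine Subtype.ext (Matrix.ext fun i j => ?_)
  fin_cases j
  · have := congrArg (fun v : R3 => v i) h0
    fin_cases i <;> exact this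
  · have := congrArg (fun v : R3 => v i) h1
    fin_cases i <;> exact this
  · change g.1 i 2 = g'.1 i 2
    rw [key, key, h0, h1]

/-- The apex is attained, and `K` is a cone over `SO(3)`. -/
theorem homeomorph_of_eq (hlam : 0 < lam) (hX0 : 0 ≤ X) (hX : X ^ 4 = lam) :
    Nonempty (K lam X 0 ≃ₜ ConeSO3) := by
  have hXp : 0 < X := by
    rcases hX0.eq_or_lt with rfl | h
    · norm_num at hX; linarith
    · exact h
  -- The cone radius is r = |y|/h. Then 1 + r² = h⁻², which gives |y| = a r, and |w|² = λ(h⁻⁴ - 1) =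
  -- λr²(2 + r²) gives |w| = b r.
  let b : NNReal → ℝ := fun r => √lam * (r * √(2 + (r : ℝ) ^ 2))
  let a : NNReal → ℝ := fun r => r * (√(1 + (r : ℝ) ^ 2))⁻¹
  have hs (r : NNReal) : √(1 + (r : ℝ) ^ 2) ^ 2 = 1 + (r : ℝ) ^ 2 := Real.sq_sqrt (by positivity)
  have hsp (r : NNReal) : 0 < √(1 + (r : ℝ) ^ 2) := Real.sqrt_pos.2 (by positivity)
  have hb0 (r : NNReal) : 0 ≤ b r := by positivity
  have ha0 (r : NNReal) : 0 ≤ a r := by positivity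
  have hb2 (r : NNReal) : b r ^ 2 = lam * ((r : ℝ) ^ 2 * (2 + (r : ℝ) ^ 2)) := by
    simp only [b, mul_pow]
    rw [Real.sq_sqrt hlam.le, Real.sq_sqrt (by positivity)]
  have hac : Continuous a := by
    have : Continuous fun r : NNReal => (√(1 + (r : ℝ) ^ 2))⁻¹ :=
      Continuous.inv₀ (by fun_prop) fun r => (hsp r).ne'
    fun_prop
  have hbc : Continuous b := by fun_prop
  have hk (r : NNReal) (v : R3) (hv : ‖v‖ = 1) : hFun lam X 0 (b r • v) = (√(1 + (r : ℝ) ^ 2))⁻¹ := by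
    rw [hFun_eq_iff hlam hX0 (by positivity), norm_smul, hv, mul_one, Real.norm_eq_abs, sq_abs, hb2,
      hX, inv_pow, show √(1 + (r : ℝ) ^ 2) ^ 4 = (√(1 + (r : ℝ) ^ 2) ^ 2) ^ 2 by ring, hs]
    field_simp
    ring
  let F : NNReal × SO3 → K lam X 0 := fun p => ⟨(a p.1 • p.2.col 0, b p.1 • p.2.col 1), by
    refine mem_K.2 ⟨?_, ?_⟩
    · simp only [hk _ _ (p.2.norm_col 1), norm_smul, p.2.norm_col, mul_one, Real.norm_eq_abs, sq_abs,
        a, mul_pow, inv_pow, hs]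
      field_simp
      ring
    · simp only [inner_smul_left, inner_smul_right, p.2.inner_col]; simp⟩
  have hF : Continuous F := by
    have h0 := SO3.continuous_col 0
    have h1 := SO3.continuous_col 1
    exact Continuous.subtype_mk (by fun_prop) _
  let G : K lam X 0 → NNReal := fun q => Real.toNNReal (‖q.1.1‖ * (hFun lam X 0 q.1.2)⁻¹)
  have hG : Continuous G := by
    have hc := continuous_hFun hlam X 0
    have : Continuous fun q : K lam X 0 => (hFun lam X 0 q.1.2)⁻¹ :=
      Continuous.inv₀ (by fun_prop) fun q => (hFun_pos hlam hXp _).ne'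
    exact continuous_real_toNNReal.comp (by fun_prop)
  have hGF (p : NNReal × SO3) : G (F p) = p.1 := by
    change Real.toNNReal (‖a p.1 • p.2.col 0‖ * (hFun lam X 0 (b p.1 • p.2.col 1))⁻¹) = p.1
    rw [hk _ _ (p.2.norm_col 1), norm_smul, p.2.norm_col, mul_one, Real.norm_of_nonneg (ha0 _), inv_inv]
    simp only [a]
    rw [mul_assoc, inv_mul_cancel₀ (hsp _).ne', mul_one, Real.toNNReal_coe]
  -- The radius is a continuous function on K whose composition with F is a proper projection; hence
  -- F is proper, so closed, so a quotient map once it is surjective.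
  have hprop : IsProperMap F := by
    refine isProperMap_of_comp_of_t2 hF hG ?_
    rw [show G ∘ F = Prod.fst from funext hGF]
    exact isProperMap_fst_of_compactSpace
  have hsurj : Function.Surjective F := by
    intro q
    obtain ⟨h1, h2⟩ := mem_K.1 q.2
    rw [mul_zero] at h2
    have hh := hFun_pos (E := 0) hlam hXp q.1.2
    have hp := hFun_pow hlam X 0 q.1.2
    set h := hFun lam X 0 q.1.2 with hdef
    let r : NNReal := ⟨‖q.1.1‖ * h⁻¹, by positivity⟩
    have hr : (1 + (r : ℝ) ^ 2) = (h⁻¹) ^ 2 := by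
      change 1 + (‖q.1.1‖ * h⁻¹) ^ 2 = _
      rw [mul_pow, h1]
      field_simp
      ring
    have hra : a r = ‖q.1.1‖ := by
      change ‖q.1.1‖ * h⁻¹ * (√(1 + (r : ℝ) ^ 2))⁻¹ = _
      rw [hr, Real.sqrt_sq (by positivity)]
      field_simp
    have hrb : b r = ‖q.1.2‖ := by
      rw [← sq_eq_sq₀ (hb0 _) (norm_nonneg _), hb2]
      have hr2 : (r : ℝ) ^ 2 = (h⁻¹) ^ 2 - 1 := by linarith
      rw [hr2]
      rw [hX] at hp
      field_simp
      linarith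
    suffices hs : ∃ g : SO3, q.1.1 = ‖q.1.1‖ • g.col 0 ∧ q.1.2 = ‖q.1.2‖ • g.col 1 by
      obtain ⟨g, g0, g1⟩ := hs
      refine ⟨(r, g), Subtype.ext (Prod.ext ?_ ?_)⟩
      · change a r • g.col 0 = _
        rw [hra, ← g0]
      · change b r • g.col 1 = _
        rw [hrb, ← g1]
    have key (u v : R3) (hu : ‖u‖ = 1) (hv : ‖v‖ = 1) (huv : inner ℝ u v = 0)
        (h1 : q.1.1 = ‖q.1.1‖ • u) (h2 : q.1.2 = ‖q.1.2‖ • v) :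
        ∃ g : SO3, q.1.1 = ‖q.1.1‖ • g.col 0 ∧ q.1.2 = ‖q.1.2‖ • g.col 1 := by
      obtain ⟨g, g0, g1, -⟩ := exists_so3 hu hv huv
      have e0 : g.col 0 = u := by ext i; fin_cases i <;> simp [SO3.col, g0]
      have e1 : g.col 1 = v := by ext i; fin_cases i <;> simp [SO3.col, g1]
      exact ⟨g, by rw [e0]; exact h1, by rw [e1]; exact h2⟩
    have hh2 : h ^ 4 = (h ^ 2) ^ 2 := by ring
    -- y and w vanish simultaneously; at the apex any rotation serves.
    by_cases hy : q.1.1 = 0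
    · have hw : q.1.2 = 0 := by
        rw [hy, norm_zero] at h1
        have h3 : h ^ 2 = 1 := by linarith
        rw [hh2, h3, hX] at hp
        have : ‖q.1.2‖ ^ 2 = 0 := by linarith
        simpa using this
      obtain ⟨v, hv, -, -⟩ := exists_unit_orthogonal 0 0
      obtain ⟨v', hv', hvv, -⟩ := exists_unit_orthogonal v v
      exact key v v' hv hv' hvv (by rw [hy]; simp) (by rw [hw]; simp)
    · have hw : q.1.2 ≠ 0 := by
        intro hw
        rw [hw, norm_zero, hX, hh2] at hp
        have h3 : h ^ 2 = 1 := by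
          have : (h ^ 2) ^ 2 = 1 := mul_right_cancel₀ hlam.ne' (by linarith : (h ^ 2) ^ 2 * lam = 1 * lam)
          nlinarith [sq_nonneg h]
        rw [h3, sub_self] at h1
        exact hy (by simpa using h1)
      have ny := norm_ne_zero_iff.2 hy
      have nw := norm_ne_zero_iff.2 hw
      refine key (‖q.1.1‖⁻¹ • q.1.1) (‖q.1.2‖⁻¹ • q.1.2) (norm_smul_inv_norm hy) (norm_smul_inv_norm hw)
        ?_ ?_ ?_
      · rw [inner_smul_left, inner_smul_right, h2]; simp
      · rw [smul_smul, mul_inv_cancel₀ ny, one_smul]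
      · rw [smul_smul, mul_inv_cancel₀ nw, one_smul]
  have hquot : IsQuotientMap F := hprop.isClosedMap.isQuotientMap hF hsurj
  have hker : Setoid.ker F = coneSetoid := by
    refine Setoid.ext fun p p' => ?_
    change F p = F p' ↔ p = p' ∨ (p.1 = 0 ∧ p'.1 = 0)
    constructor
    · intro h
      have hr : p.1 = p'.1 := by rw [← hGF p, h, hGF]
      by_cases h0 : p.1 = 0
      · exact Or.inr ⟨h0, by rw [← hr, h0]⟩
      · left
        have hpos : 0 < (p.1 : ℝ) := NNReal.coe_pos.2 (pos_iff_ne_zero.2 h0)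
        have hap : a p.1 ≠ 0 := by positivity
        have hbp : b p.1 ≠ 0 := by positivity
        refine Prod.ext hr (SO3.ext_col ?_ ?_)
        · have : a p.1 • p.2.col 0 = a p'.1 • p'.2.col 0 := congrArg (fun q => q.1.1) h
          rw [← hr] at this
          exact smul_right_injective _ hap this
        · have : b p.1 • p.2.col 1 = b p'.1 • p'.2.col 1 := congrArg (fun q => q.1.2) h
          rw [← hr] at this
          exact smul_right_injective _ hbp this
    · rintro (rfl | ⟨h1, h2⟩)
      · rfl
      · refine Subtype.ext (Prod.ext ?_ ?_)
        · change a p.1 • _ = a p'.1 • _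
          rw [h1, h2]; simp [a]
        · change b p.1 • _ = b p'.1 • _
          rw [h1, h2]; simp [b]
  have e := IsQuotientMap.homeomorph (f := ⟨F, hF⟩) hquot
  change Quotient (Setoid.ker F) ≃ₜ _ at e
  rw [hker] at e
  exact ⟨e.symm⟩

/-! ### Non-compactness -/

/-- For w = (t, 0, 0) the second equation fixes the first coordinate of y as hE/t, and the first one
can be solved if h is small, that is, if t is large. Hence r is unbounded on M. -/
theorem exists_mem_K_large (hlam : 0 < lam) (X E R : ℝ) : ∃ q ∈ K lam X E, R ≤ ‖q.2‖ := by
  -- From h²t ≤ X² and t ≥ X²(1 + E²) one gets h²(1 + E²) ≤ 1, which with t ≥ 1 keeps the square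
  -- root real.
  obtain ⟨t, ht⟩ : ∃ t, t = max R (1 + X ^ 2 * (1 + E ^ 2)) := ⟨_, rfl⟩
  have htR : R ≤ t := ht ▸ le_max_left _ _
  have ht1 : 1 + X ^ 2 * (1 + E ^ 2) ≤ t := ht ▸ le_max_right _ _
  have hX2 : 0 ≤ X ^ 2 * (1 + E ^ 2) := by positivity
  have hX3 : 0 ≤ X ^ 2 * E ^ 2 := by positivity
  have t1 : 1 ≤ t := by linarith
  have hw : ‖(!₂[t, 0, 0] : R3)‖ = t := by
    rw [← sq_eq_sq₀ (norm_nonneg _) (by linarith), norm_sq_R3]; simp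
  have hp := hFun_pow hlam X E !₂[t, 0, 0]
  rw [hw] at hp
  set h := hFun lam X E !₂[t, 0, 0] with hh
  have h2 : h ^ 2 * t ≤ X ^ 2 := by
    rw [← pow_le_pow_iff_left₀ (by positivity) (by positivity) two_ne_zero]
    have : h ^ 4 * t ^ 2 ≤ h ^ 4 * (lam + E ^ 2 + t ^ 2) :=
      mul_le_mul_of_nonneg_left (by nlinarith [sq_nonneg E]) (by positivity)
    calc (h ^ 2 * t) ^ 2 = h ^ 4 * t ^ 2 := by ring
      _ ≤ X ^ 4 := by rw [← hp]; exact this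
      _ = (X ^ 2) ^ 2 := by ring
  have h3 : h ^ 2 * E ^ 2 / t ^ 2 ≤ h ^ 2 * E ^ 2 :=
    div_le_self (by positivity) (one_le_pow₀ t1)
  have h4 : h ^ 2 * (1 + E ^ 2) * t ≤ 1 * t := by
    have := mul_le_mul_of_nonneg_right h2 (by positivity : 0 ≤ 1 + E ^ 2)
    linarith
  have h5 : h ^ 2 * (1 + E ^ 2) ≤ 1 := le_of_mul_le_mul_right h4 (by linarith)
  have h6 : 0 ≤ 1 - h ^ 2 - h ^ 2 * E ^ 2 / t ^ 2 := by linarith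
  refine ⟨(!₂[h * E / t, √(1 - h ^ 2 - h ^ 2 * E ^ 2 / t ^ 2), 0], !₂[t, 0, 0]), mem_K.2 ⟨?_, ?_⟩, ?_⟩
  · rw [norm_sq_R3, ← hh]
    simp only [Matrix.cons_val_zero, Matrix.cons_val_one, Matrix.cons_val,
      Real.sq_sqrt h6]
    ring
  · rw [inner_R3, ← hh]
    simp
    field_simp
  · rw [hw]; exact htR

theorem not_isCompact_M {C D : ℝ} (hlam : 0 < lam) (hC : 0 ≤ C) (hD : 0 ≤ D) (E : ℝ) :
    ¬ IsCompact (M lam C D E) := by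
  intro hc
  obtain ⟨n, P, Q, h, hn⟩ := exists_isRootFamily hC hD
  obtain ⟨B, hB⟩ := (hc.image continuous_rSq).bddAbove
  obtain ⟨q, hq, hqB⟩ := exists_mem_K_large hlam (rad (P ⟨0, hn⟩) (Q ⟨0, hn⟩)) E (|B| + 1)
  have h1 : rSq (emb lam (P ⟨0, hn⟩) (Q ⟨0, hn⟩) E q) ≤ B := hB ⟨_, emb_mem_M hlam h _ hq, rfl⟩
  rw [emb, (argRot_isSO _ _).rSq_lift, rSq_theta hq] at h1
  nlinarith [abs_nonneg B, le_abs_self B, sq_nonneg E, norm_nonneg q.2]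

end

/-! ### A chart of `Λ²₋S⁴` at a point of the zero section -/

theorem rot34_transpose (c d : ℝ) : (rot34 c d).transpose = rot34 c (-d) := by
  ext i j; fin_cases i <;> fin_cases j <;> simp [rot34]

section

variable {G : Type*} [NormedAddCommGroup G] [NormedSpace ℝ G]

theorem contDiffOn_form2_apply {F : G → Form2} {u v : G → R5} {n : WithTop ℕ∞} {s : Set G}
    (hF : ContDiffOn ℝ n F s) (hu : ContDiffOn ℝ n u s) (hv : ContDiffOn ℝ n v s) :
    ContDiffOn ℝ n (fun g => F g ![u g, v g]) s := by
  rw [contDiffOn_euclidean] at hu hv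
  have he (i j : Fin 5) : ContDiffOn ℝ n (fun g => F g ![stdE i, stdE j]) s :=
    (ev (stdE i) (stdE j)).contDiff.comp_contDiffOn hF
  have : (fun g => F g ![u g, v g]) =
      fun g => ∑ i, u g i * ∑ j, v g j * F g ![stdE i, stdE j] := by
    funext g
    conv_lhs => rw [sum_stdE (u g), form2_sum_left]
    refine Finset.sum_congr rfl fun i _ => ?_
    conv_lhs => rw [sum_stdE (v g), form2_sum_right]
  rw [this]
  exact ContDiffOn.sum fun i _ => (hu i).mul (ContDiffOn.sum fun j _ => (hv j).mul (he i j))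

theorem contDiffOn_lift_rot34 {c d : G → ℝ} {p : G → Amb} {n : WithTop ℕ∞} {s : Set G}
    (hc : ContDiffOn ℝ n c s) (hd : ContDiffOn ℝ n d s) (hp : ContDiffOn ℝ n p s) :
    ContDiffOn ℝ n (fun g => lift (rot34 (c g) (d g)) (p g)) s := by
  have h1 := contDiffOn_euclidean.1 hp.fst
  refine ContDiffOn.prodMk ?_ (contDiffOn_form2 fun i j => ?_)
  · change ContDiffOn ℝ n (fun g => act (rot34 (c g) (d g)) (p g).1) s
    simp only [act_rot34]
    rw [contDiffOn_euclidean]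
    intro i
    fin_cases i
    exacts [h1 0, h1 1, h1 2, (hc.mul (h1 3)).sub (hd.mul (h1 4)),
      (hd.mul (h1 3)).add (hc.mul (h1 4))]
  · have ha (k : Fin 5) : ContDiffOn ℝ n (fun g => act (rot34 (c g) (d g)).transpose (stdE k)) s := by
      simp only [act_rot34_transpose]
      rw [contDiffOn_euclidean]
      intro i
      fin_cases i
      exacts [contDiffOn_const, contDiffOn_const, contDiffOn_const,
        (hc.mul contDiffOn_const).add (hd.mul contDiffOn_const),
        (hd.neg.mul contDiffOn_const).add (hc.mul contDiffOn_const)]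
    change ContDiffOn ℝ n (fun g => (lift (rot34 (c g) (d g)) (p g)).2 ![stdE i, stdE j]) s
    simp only [lift_snd]
    exact contDiffOn_form2_apply hp.snd (ha i) (ha j)

end

/-- The factor which straightens the level set to a cone. -/
def coneScale (y : R3) : ℝ := √(1 - ‖y‖ ^ 2 / 2) / (1 - ‖y‖ ^ 2)

theorem coneScale_pos {y : R3} (hy : ‖y‖ < 1) : 0 < coneScale y := by
  have : ‖y‖ ^ 2 < 1 := by nlinarith [norm_nonneg y]
  exact div_pos (Real.sqrt_pos.2 (by linarith)) (by linarith)

/-- This value of k² is what straightens K: for E = 0 and X⁴ = λ the equation is (1 - |y|²)²(λ +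
|kw|²) = λ, that is, k²(1 - |y|²)²|w|² = 2λ|y|²(1 - |y|²/2), which becomes |w|² = 2λ|y|². -/
theorem coneScale_sq {y : R3} (hy : ‖y‖ < 1) :
    coneScale y ^ 2 * (1 - ‖y‖ ^ 2) ^ 2 = 1 - ‖y‖ ^ 2 / 2 := by
  have : ‖y‖ ^ 2 < 1 := by nlinarith [norm_nonneg y]
  rw [coneScale, div_pow, Real.sq_sqrt (by linarith)]
  have h : (1 - ‖y‖ ^ 2) ≠ 0 := by linarith
  field_simp

theorem contDiffOn_coneScale : ContDiffOn ℝ ∞ coneScale {y | ‖y‖ < 1} := by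
  have hn : ContDiffOn ℝ ∞ (fun y : R3 => ‖y‖ ^ 2) {y | ‖y‖ < 1} := (contDiff_norm_sq ℝ).contDiffOn
  have hy (y : R3) (hy : y ∈ {y : R3 | ‖y‖ < 1}) : ‖y‖ ^ 2 < 1 := by
    have : ‖y‖ < 1 := hy
    nlinarith [norm_nonneg y]
  refine ContDiffOn.div (ContDiffOn.sqrt (contDiffOn_const.sub (hn.div_const 2)) fun y h => ?_)
    (contDiffOn_const.sub hn) fun y h => ?_
  · have := hy y h; linarith
  · have := hy y h; linarith

/-- The chart for the fibre coordinate `w`, base coordinate `y` and angle `0`. -/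
def coneBase (y w : R3) : Amb :=
  (xVec y √(1 - ‖y‖ ^ 2), asdForm (xVec y √(1 - ‖y‖ ^ 2))
    (xVec (coneScale y • w) (-(coneScale y * inner ℝ y w / √(1 - ‖y‖ ^ 2)))))

/-- The last coordinate of z is the solution of ⟨x, z⟩ = 0 for the given y and w. -/
theorem coneBase_mem {y w : R3} (hy : ‖y‖ < 1) : coneBase y w ∈ asd := by
  have : ‖y‖ ^ 2 < 1 := by nlinarith [norm_nonneg y]
  have hs := Real.sq_sqrt (show 0 ≤ 1 - ‖y‖ ^ 2 by linarith)
  have hp := Real.sqrt_pos.2 (show 0 < 1 - ‖y‖ ^ 2 by linarith)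
  refine asdForm_mem ?_ rfl ?_ rfl
  · rw [← sq_eq_sq₀ (norm_nonneg _) zero_le_one, norm_xVec, hs]; ring
  · rw [inner_xVec, inner_smul_right]
    field_simp
    ring

/-- The linear coordinates on `ℝ⁷` adapted to the `G₂` frame; `s` is the value of `s_λ`. -/
def yPart (s : ℝ) : R7 →L[ℝ] R3 := LinearMap.toContinuousLinearMap
  { toFun := fun c => (√2 * s)⁻¹ • !₂[-c 6, c 5, -c 4]
    map_add' := fun x y => by ext i; fin_cases i <;> simp <;> ring
    map_smul' := fun c x => by ext i; fin_cases i <;> simp <;> ring }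

/-- See `yPart`. -/
def wPart (s : ℝ) : R7 →L[ℝ] R3 := LinearMap.toContinuousLinearMap
  { toFun := fun c => s • !₂[-c 2, c 1, -c 0]
    map_add' := fun x y => by ext i; fin_cases i <;> simp <;> ring
    map_smul' := fun c x => by ext i; fin_cases i <;> simp <;> ring }

/-- See `yPart`. -/
def ηPart (s : ℝ) : R7 →L[ℝ] ℝ := (-(√2 * s)⁻¹) • (EuclideanSpace.proj 3 : R7 →L[ℝ] ℝ)

theorem yPart_apply (s : ℝ) (c : R7) : yPart s c = (√2 * s)⁻¹ • !₂[-c 6, c 5, -c 4] := rfl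

theorem wPart_apply (s : ℝ) (c : R7) : wPart s c = s • !₂[-c 2, c 1, -c 0] := rfl

theorem ηPart_apply (s : ℝ) (c : R7) : ηPart s c = -(√2 * s)⁻¹ * c 3 := rfl

/-- The point of `ℝ⁷` with given coordinates. -/
def ofParts (s : ℝ) (y w : R3) (η : ℝ) : R7 :=
  !₂[-(s⁻¹ * w 2), s⁻¹ * w 1, -(s⁻¹ * w 0), -(√2 * s * η), -(√2 * s * y 2), √2 * s * y 1,
    -(√2 * s * y 0)]

section

variable {s : ℝ}

theorem ofParts_parts (hs : 0 < s) (c : R7) : ofParts s (yPart s c) (wPart s c) (ηPart s c) = c := by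
  rw [yPart_apply, wPart_apply, ηPart_apply]
  ext i
  fin_cases i <;> simp [ofParts] <;> field_simp

theorem yPart_ofParts (hs : 0 < s) (y w : R3) (η : ℝ) : yPart s (ofParts s y w η) = y := by
  rw [yPart_apply]
  ext i
  fin_cases i <;> simp [ofParts] <;> field_simp

theorem wPart_ofParts (hs : 0 < s) (y w : R3) (η : ℝ) : wPart s (ofParts s y w η) = w := by
  rw [wPart_apply]
  ext i
  fin_cases i <;> simp [ofParts] <;> field_simp

theorem ηPart_ofParts (hs : 0 < s) (y w : R3) (η : ℝ) : ηPart s (ofParts s y w η) = η := by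
  rw [ηPart_apply]
  simp [ofParts]
  field_simp

/-- The domain of the chart. -/
def coneDomain (s : ℝ) : Set R7 := {c | ‖yPart s c‖ < 1 ∧ |ηPart s c| < Real.pi / 2}

theorem isOpen_coneDomain (s : ℝ) : IsOpen (coneDomain s) :=
  (isOpen_lt (yPart s).continuous.norm continuous_const).inter
    (isOpen_lt (ηPart s).continuous.abs continuous_const)

/-- The chart. -/
def coneChart (s : ℝ) (c : R7) : Amb :=
  lift (rot34 (Real.cos (ηPart s c)) (Real.sin (ηPart s c))) (coneBase (yPart s c) (wPart s c))

theorem contDiffOn_coneChart (s : ℝ) : ContDiffOn ℝ ∞ (coneChart s) (coneDomain s) := by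
  have hη : ContDiffOn ℝ ∞ (ηPart s) (coneDomain s) := (ηPart s).contDiff.contDiffOn
  have hy : ContDiffOn ℝ ∞ (yPart s) (coneDomain s) := (yPart s).contDiff.contDiffOn
  have hw : ContDiffOn ℝ ∞ (wPart s) (coneDomain s) := (wPart s).contDiff.contDiffOn
  have h1 (c : R7) (hc : c ∈ coneDomain s) : 0 < 1 - ‖yPart s c‖ ^ 2 := by
    have := hc.1
    nlinarith [norm_nonneg (yPart s c)]
  have hr : ContDiffOn ℝ ∞ (fun c => √(1 - ‖yPart s c‖ ^ 2)) (coneDomain s) :=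
    (contDiffOn_const.sub (hy.norm_sq ℝ)).sqrt fun c hc => (h1 c hc).ne'
  have hk : ContDiffOn ℝ ∞ (fun c => coneScale (yPart s c)) (coneDomain s) :=
    contDiffOn_coneScale.comp hy fun c hc => hc.1
  have hx := contDiffOn_xVec hy hr
  refine contDiffOn_lift_rot34 (Real.contDiff_cos.comp_contDiffOn hη)
    (Real.contDiff_sin.comp_contDiffOn hη) (hx.prodMk (contDiffOn_asdForm hx
      (contDiffOn_xVec (hk.smul hw) ?_)))
  exact ((hk.mul (hy.inner ℝ hw)).div hr fun c hc => (Real.sqrt_pos.2 (h1 c hc)).ne').neg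

/-- The first three coordinates of the base point. -/
def basePart : Amb →L[ℝ] R3 := (ContinuousLinearMap.fst ℝ R3 R3).comp thetaInv

/-- The distance from the plane of the first three coordinates. -/
def axisDist (p : Amb) : ℝ := √(p.1 3 ^ 2 + p.1 4 ^ 2)

/-- The point of the sphere `x₅ = 0` obtained by a rotation. -/
def unrotate (p : Amb) : Amb := lift (rot34 (p.1 3 / axisDist p) (-(p.1 4 / axisDist p))) p

/-- The range of the chart. -/
def coneRange : Set Amb := {p | 0 < p.1 3 ∧ ‖basePart p‖ < 1}

theorem continuous_coord (i : Fin 5) : Continuous fun p : Amb => p.1 i := by fun_prop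

theorem isOpen_coneRange : IsOpen coneRange :=
  (isOpen_lt continuous_const (continuous_coord 3)).inter
    (isOpen_lt basePart.continuous.norm continuous_const)

theorem axisDist_pos {p : Amb} (hp : 0 < p.1 3) : 0 < axisDist p := Real.sqrt_pos.2 (by positivity)

theorem axisDist_sq (p : Amb) : axisDist p ^ 2 = p.1 3 ^ 2 + p.1 4 ^ 2 :=
  Real.sq_sqrt (by positivity)

/-- The inverse of the chart. -/
def coneChartInv (s : ℝ) (p : Amb) : R7 :=
  ofParts s (basePart p) ((coneScale (basePart p))⁻¹ • (thetaInv (unrotate p)).2)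
    (Real.arctan (p.1 4 / p.1 3))

theorem contDiffOn_coneChartInv (s : ℝ) : ContDiffOn ℝ ∞ (coneChartInv s) coneRange := by
  have hx (i : Fin 5) : ContDiffOn ℝ ∞ (fun p : Amb => p.1 i) coneRange :=
    contDiffOn_euclidean.1 contDiffOn_fst i
  have hb : ContDiffOn ℝ ∞ basePart coneRange := basePart.contDiff.contDiffOn
  have hd : ContDiffOn ℝ ∞ axisDist coneRange :=
    (((hx 3).pow 2).add ((hx 4).pow 2)).sqrt fun p hp => by
      have := hp.1
      positivity
  have hd0 (p : Amb) (hp : p ∈ coneRange) : axisDist p ≠ 0 := (axisDist_pos hp.1).ne'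
  have hu : ContDiffOn ℝ ∞ unrotate coneRange :=
    contDiffOn_lift_rot34 ((hx 3).div hd hd0) ((hx 4).div hd hd0).neg contDiffOn_id
  have hk : ContDiffOn ℝ ∞ (fun p => (coneScale (basePart p))⁻¹) coneRange :=
    (contDiffOn_coneScale.comp hb fun p hp => hp.2).inv fun p hp => (coneScale_pos hp.2).ne'
  have hw : ContDiffOn ℝ ∞ (fun p => (coneScale (basePart p))⁻¹ • (thetaInv (unrotate p)).2)
      coneRange := hk.smul (thetaInv.contDiff.comp_contDiffOn hu).snd
  have ha : ContDiffOn ℝ ∞ (fun p : Amb => Real.arctan (p.1 4 / p.1 3)) coneRange :=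
    Real.contDiff_arctan.comp_contDiffOn ((hx 4).div (hx 3) fun p hp => hp.1.ne')
  rw [contDiffOn_euclidean] at hb hw ⊢
  intro i
  fin_cases i
  exacts [(contDiffOn_const.mul (hw 2)).neg, contDiffOn_const.mul (hw 1),
    (contDiffOn_const.mul (hw 0)).neg, (contDiffOn_const.mul ha).neg,
    (contDiffOn_const.mul (hb 2)).neg, contDiffOn_const.mul (hb 1),
    (contDiffOn_const.mul (hb 0)).neg]

theorem cos_pos_of_mem {c : R7} (hc : c ∈ coneDomain s) : 0 < Real.cos (ηPart s c) :=
  Real.cos_pos_of_mem_Ioo (abs_lt.1 hc.2)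

theorem coneChart_fst (s : ℝ) (c : R7) : (coneChart s c).1 =
    !₂[yPart s c 0, yPart s c 1, yPart s c 2, Real.cos (ηPart s c) * √(1 - ‖yPart s c‖ ^ 2),
      Real.sin (ηPart s c) * √(1 - ‖yPart s c‖ ^ 2)] := by
  rw [coneChart, lift_fst, act_rot34]
  ext i
  fin_cases i <;> simp [coneBase, xVec]

theorem basePart_coneChart (s : ℝ) (c : R7) : basePart (coneChart s c) = yPart s c := by
  change (!₂[(coneChart s c).1 0, (coneChart s c).1 1, (coneChart s c).1 2] : R3) = _
  rw [coneChart_fst]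
  ext i
  fin_cases i <;> rfl

theorem coneChart_mem {c : R7} (hc : c ∈ coneDomain s) : coneChart s c ∈ asd ∩ coneRange := by
  have h1 : 0 < 1 - ‖yPart s c‖ ^ 2 := by
    have := hc.1
    nlinarith [norm_nonneg (yPart s c)]
  refine ⟨(rot34_isSO (Real.cos_sq_add_sin_sq _)).lift_mem_asd (coneBase_mem hc.1), ?_, ?_⟩
  · rw [coneChart_fst]
    exact mul_pos (cos_pos_of_mem hc) (Real.sqrt_pos.2 h1)
  · rw [basePart_coneChart]; exact hc.1

theorem unrotate_coneChart {c : R7} (hc : c ∈ coneDomain s) :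
    unrotate (coneChart s c) = coneBase (yPart s c) (wPart s c) := by
  have h1 : 0 < 1 - ‖yPart s c‖ ^ 2 := by
    have := hc.1
    nlinarith [norm_nonneg (yPart s c)]
  have hr := Real.sqrt_pos.2 h1
  have hcs := Real.cos_sq_add_sin_sq (ηPart s c)
  have hd : axisDist (coneChart s c) = √(1 - ‖yPart s c‖ ^ 2) := by
    rw [← sq_eq_sq₀ (show 0 ≤ axisDist _ from Real.sqrt_nonneg _) hr.le, axisDist_sq, coneChart_fst]
    change (Real.cos _ * _) ^ 2 + (Real.sin _ * _) ^ 2 = _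
    linear_combination √(1 - ‖yPart s c‖ ^ 2) ^ 2 * hcs
  have e3 : (coneChart s c).1 3 = Real.cos (ηPart s c) * √(1 - ‖yPart s c‖ ^ 2) := by
    rw [coneChart_fst]; rfl
  have e4 : (coneChart s c).1 4 = Real.sin (ηPart s c) * √(1 - ‖yPart s c‖ ^ 2) := by
    rw [coneChart_fst]; rfl
  rw [unrotate, hd, e3, e4, mul_div_cancel_right₀ _ hr.ne', mul_div_cancel_right₀ _ hr.ne',
    ← rot34_transpose, coneChart]
  exact (rot34_isSO hcs).lift_transpose _

theorem coneChartInv_coneChart (hs : 0 < s) {c : R7} (hc : c ∈ coneDomain s) :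
    coneChartInv s (coneChart s c) = c := by
  have h1 : 0 < 1 - ‖yPart s c‖ ^ 2 := by
    have := hc.1
    nlinarith [norm_nonneg (yPart s c)]
  have hr := Real.sqrt_pos.2 h1
  have e : (coneChart s c).1 4 / (coneChart s c).1 3 = Real.tan (ηPart s c) := by
    rw [coneChart_fst, Real.tan_eq_sin_div_cos]
    exact mul_div_mul_right _ _ hr.ne'
  have hw : (coneScale (yPart s c))⁻¹ • (thetaInv (coneBase (yPart s c) (wPart s c))).2 =
      wPart s c := by
    rw [coneBase, thetaInv_asdForm, smul_smul, inv_mul_cancel₀ (coneScale_pos hc.1).ne', one_smul]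
  rw [coneChartInv, unrotate_coneChart hc, basePart_coneChart, hw, e,
    Real.arctan_tan (abs_lt.1 hc.2).1 (abs_lt.1 hc.2).2, ofParts_parts hs]

/-- On the range x₄ > 0, so the angle in the (x₄, x₅)-plane is an arctangent. Rotating back by it
leaves a point over x₅ = 0, determined by `asd_eq_asdForm`. -/
theorem coneChart_coneChartInv (hs : 0 < s) {p : Amb} (hp : p ∈ asd) (hp' : p ∈ coneRange) :
    coneChartInv s p ∈ coneDomain s ∧ coneChart s (coneChartInv s p) = p := by
  have hd := axisDist_pos hp'.1
  have hd2 := axisDist_sq p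
  have h3 := hp'.1
  have hcd : (p.1 3 / axisDist p) ^ 2 + (p.1 4 / axisDist p) ^ 2 = 1 := by
    rw [div_pow, div_pow, ← add_div, ← hd2, div_self (by positivity)]
  have hR := rot34_isSO hcd
  have htan : √(1 + (p.1 4 / p.1 3) ^ 2) = axisDist p / p.1 3 := by
    rw [← sq_eq_sq₀ (Real.sqrt_nonneg _) (by positivity), Real.sq_sqrt (by positivity), div_pow, div_pow, hd2]
    field_simp
  have hcos : Real.cos (Real.arctan (p.1 4 / p.1 3)) = p.1 3 / axisDist p := by
    rw [Real.cos_arctan, htan, one_div_div]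
  have hsin : Real.sin (Real.arctan (p.1 4 / p.1 3)) = p.1 4 / axisDist p := by
    rw [Real.sin_arctan, htan]
    field_simp
  have hdom : coneChartInv s p ∈ coneDomain s := by
    constructor
    · rw [coneChartInv, yPart_ofParts hs]; exact hp'.2
    · rw [coneChartInv, ηPart_ofParts hs, abs_lt]
      exact ⟨Real.neg_pi_div_two_lt_arctan _, Real.arctan_lt_pi_div_two _⟩
  refine ⟨hdom, ?_⟩
  have hbase : coneBase (basePart p) ((coneScale (basePart p))⁻¹ • (thetaInv (unrotate p)).2) =
      unrotate p := by
    have hu : unrotate p = lift (rot34 (p.1 3 / axisDist p) (p.1 4 / axisDist p)).transpose p := by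
      rw [rot34_transpose]; rfl
    have hua : unrotate p ∈ asd := by rw [hu]; exact hR.transpose.lift_mem_asd hp
    have hx : (unrotate p).1 = xVec (basePart p) (axisDist p) := by
      rw [hu, lift_fst, act_rot34_transpose]
      have k3 : p.1 3 / axisDist p * p.1 3 + p.1 4 / axisDist p * p.1 4 = axisDist p := by
        field_simp; linarith
      have k4 : -(p.1 4 / axisDist p) * p.1 3 + p.1 3 / axisDist p * p.1 4 = 0 := by ring
      rw [k3, k4]
      rfl
    obtain ⟨h0, he⟩ := asd_eq_asdForm hua (by rw [hx]; rfl)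
    have hz : contr (unrotate p).2 = xVec (thetaInv (unrotate p)).2 (contr (unrotate p).2 3) := by
      ext i; fin_cases i <;> rfl
    have hn : ‖basePart p‖ ^ 2 + axisDist p ^ 2 = 1 := by
      rw [← norm_xVec, ← hx, hua.1]; norm_num
    have hr : √(1 - ‖basePart p‖ ^ 2) = axisDist p := by
      rw [show 1 - ‖basePart p‖ ^ 2 = axisDist p ^ 2 by linarith, Real.sqrt_sq hd.le]
    have hk := (coneScale_pos hp'.2).ne'
    have hz3 : contr (unrotate p).2 3 =
        -(inner ℝ (basePart p) (thetaInv (unrotate p)).2 / axisDist p) := by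
      rw [hx, hz, inner_xVec] at h0
      field_simp
      have : (xVec (thetaInv (unrotate p)).2 (contr (unrotate p).2 3)) 3 = contr (unrotate p).2 3 := rfl
      linarith
    rw [coneBase, hr, smul_smul, mul_inv_cancel₀ hk, one_smul, inner_smul_right, ← mul_assoc,
      mul_inv_cancel₀ hk, one_mul, ← hz3, ← hz, ← hx]
    exact Prod.ext rfl he.symm
  rw [coneChart, coneChartInv, yPart_ofParts hs, wPart_ofParts hs, ηPart_ofParts hs, hcos, hsin, hbase]
  have hu : unrotate p = lift (rot34 (p.1 3 / axisDist p) (p.1 4 / axisDist p)).transpose p := by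
    rw [rot34_transpose]; rfl
  rw [hu]
  exact hR.lift_lift_transpose p

theorem coneChart_zero (s : ℝ) : coneChart s 0 = (stdE 3, 0) := by
  rw [coneChart, map_zero, map_zero, map_zero]
  refine Prod.ext ?_ (form2_ext fun i j _ => ?_)
  · rw [lift_fst, act_rot34]
    ext i; fin_cases i <;> simp [coneBase, xVec, stdE]
  · rw [lift_snd, coneBase, asdForm_apply]
    simp [xVec]

theorem contDiff_lift (A : Matrix (Fin 5) (Fin 5) ℝ) : ContDiff ℝ ∞ (lift A) := (liftL A).contDiff

theorem isParamAt_coneChart (hs : 0 < s) {A : Matrix (Fin 5) (Fin 5) ℝ} (hA : IsSO A) :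
    IsParamAt 7 asd (lift A (stdE 3, 0)) (fun c => lift A (coneChart s c)) (coneDomain s) := by
  refine ⟨isOpen_coneDomain s, by simp [coneDomain]; positivity, congrArg (lift A) (coneChart_zero s),
    (contDiff_lift A).comp_contDiffOn (contDiffOn_coneChart s), lift A.transpose ⁻¹' coneRange,
    fun p => coneChartInv s (lift A.transpose p),
    isOpen_coneRange.preimage (contDiff_lift A.transpose).continuous, ?_,
    (contDiffOn_coneChartInv s).comp (contDiff_lift A.transpose).contDiffOn fun p hp => hp,
    fun c hc => ?_⟩
  · ext p
    constructor
    · rintro ⟨c, hc, rfl⟩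
      refine ⟨hA.lift_mem_asd (coneChart_mem hc).1, ?_⟩
      change lift A.transpose (lift A _) ∈ coneRange
      rw [hA.lift_transpose]
      exact (coneChart_mem hc).2
    · rintro ⟨hp, hp'⟩
      obtain ⟨h1, h2⟩ := coneChart_coneChartInv hs (hA.transpose.lift_mem_asd hp) hp'
      refine ⟨_, h1, ?_⟩
      change lift A (coneChart s _) = p
      rw [h2, hA.lift_lift_transpose]
  · change coneChartInv s (lift A.transpose (lift A _)) = c
    rw [hA.lift_transpose, coneChartInv_coneChart hs hc]

end

/-! ### The conical singularities -/

section

variable {lam X s : ℝ}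

theorem lift_rot34_one_zero (p : Amb) : lift (rot34 1 0) p = p := by
  have : rot34 1 0 = 1 := by ext i j; fin_cases i <;> fin_cases j <;> simp [rot34]
  rw [this, lift_one]

theorem coneChart_of_η {c : R7} (h : ηPart s c = 0) :
    coneChart s c = coneBase (yPart s c) (wPart s c) := by
  rw [coneChart, h, Real.cos_zero, Real.sin_zero, lift_rot34_one_zero]

theorem coneBase_zero_left (w : R3) : coneBase 0 w = (stdE 3, asdForm (stdE 3) (xVec w 0)) := by
  have h1 : xVec 0 1 = stdE 3 := by ext i; fin_cases i <;> simp [xVec, stdE]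
  have h2 : coneScale 0 = 1 := by simp [coneScale]
  simp [coneBase, h1, h2]

theorem asdForm_zero (x : R5) : asdForm x 0 = 0 := by
  have := asdForm_smul x 0 0
  rwa [zero_smul, zero_smul] at this

theorem coneBase_zero_right (y : R3) : coneBase y 0 = (xVec y √(1 - ‖y‖ ^ 2), 0) := by
  have : xVec 0 0 = 0 := by ext i; fin_cases i <;> simp [xVec]
  simp [coneBase, this, asdForm_zero]

/-- Along the fibre over the apex the chart is linear. -/
theorem hasDerivAt_coneChart_w {c : R7} (hy : yPart s c = 0) (hη : ηPart s c = 0) :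
    HasDerivAt (fun t : ℝ => coneChart s (t • c))
      (0, asdForm (stdE 3) (xVec (wPart s c) 0)) 0 := by
  have : (fun t : ℝ => coneChart s (t • c)) =
      fun t => (stdE 3, t • asdForm (stdE 3) (xVec (wPart s c) 0)) := by
    funext t
    rw [coneChart_of_η (by rw [map_smul, hη, smul_zero]), map_smul, hy, smul_zero, map_smul,
      coneBase_zero_left, ← asdForm_smul]
    congr 2
    ext i; fin_cases i <;> simp [xVec]
  rw [this]
  have h := (hasDerivAt_id (0 : ℝ)).smul_const (asdForm (stdE 3) (xVec (wPart s c) 0))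
  rw [one_smul] at h
  exact (hasDerivAt_const _ _).prodMk h

/-- Along the zero section only the √(1 - t²|y|²) in the x₄-coordinate is nonlinear, and its
derivative at t = 0 vanishes. -/
theorem hasDerivAt_coneChart_y {c : R7} (hw : wPart s c = 0) (hη : ηPart s c = 0) :
    HasDerivAt (fun t : ℝ => coneChart s (t • c)) (xVec (yPart s c) 0, 0) 0 := by
  have : (fun t : ℝ => coneChart s (t • c)) =
      fun t => (xVec (t • yPart s c) √(1 - t ^ 2 * ‖yPart s c‖ ^ 2), 0) := by
    funext t
    rw [coneChart_of_η (by rw [map_smul, hη, smul_zero]), map_smul, map_smul, hw, smul_zero,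
      coneBase_zero_right, norm_smul, mul_pow, Real.norm_eq_abs, sq_abs]
  rw [this]
  have h := (hasDerivAt_id (0 : ℝ)).smul_const (yPart s c)
  rw [one_smul] at h
  have h1 : HasDerivAt (fun t : ℝ => 1 - t ^ 2 * ‖yPart s c‖ ^ 2) 0 0 := by
    have := ((hasDerivAt_pow 2 (0 : ℝ)).mul_const (‖yPart s c‖ ^ 2)).const_sub 1
    refine this.congr_deriv (by simp)
  have h2 := h1.sqrt (by simp)
  rw [zero_div] at h2
  exact (hasDerivAt_xVec h h2).prodMk (hasDerivAt_const _ _)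

/-- In this direction the chart moves the apex along the circle in the (x₄, x₅)-plane, within the
zero section. -/
theorem hasDerivAt_coneChart_η {c : R7} (hy : yPart s c = 0) (hw : wPart s c = 0) :
    HasDerivAt (fun t : ℝ => coneChart s (t • c)) (ηPart s c • stdE 4, 0) 0 := by
  have : (fun t : ℝ => coneChart s (t • c)) =
      fun t => (!₂[0, 0, 0, Real.cos (t * ηPart s c), Real.sin (t * ηPart s c)], 0) := by
    funext t
    rw [coneChart, map_smul, map_smul, map_smul, hy, hw, smul_zero, coneBase_zero_left]
    refine Prod.ext ?_ (form2_ext fun i j _ => ?_)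
    · rw [lift_fst, act_rot34]
      ext i; fin_cases i <;> simp [stdE]
    · rw [lift_snd, asdForm_apply]
      simp [xVec]
  rw [this]
  have h0 : HasDerivAt (fun t : ℝ => t * ηPart s c) (ηPart s c) 0 := by
    simpa using (hasDerivAt_id (0 : ℝ)).mul_const (ηPart s c)
  have h1 := h0.cos
  have h2 := h0.sin
  rw [zero_mul, Real.sin_zero, neg_zero, zero_mul] at h1
  rw [zero_mul, Real.cos_zero, one_mul] at h2
  refine HasDerivAt.prodMk (hasDerivAt_euclidean.2 fun i => ?_) (hasDerivAt_const _ _)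
  fin_cases i
  · simpa [stdE] using hasDerivAt_const (0 : ℝ) (0 : ℝ)
  · simpa [stdE] using hasDerivAt_const (0 : ℝ) (0 : ℝ)
  · simpa [stdE] using hasDerivAt_const (0 : ℝ) (0 : ℝ)
  · simpa [stdE] using h1
  · simpa [stdE] using h2

theorem hor_zero_form (x ξ : R5) : hor (x, 0) ξ = (ξ, 0) :=
  Prod.ext rfl (form2_ext fun i j _ => by rw [hor_snd_apply]; simp)

/-- The differential of the chart is the standard `G₂` frame. -/
theorem hasDerivAt_coneChart (hs : s = sFun lam (stdE 3, 0)) (a : Fin 7) :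
    HasDerivAt (fun t : ℝ => coneChart s (t • EuclideanSpace.single a (1 : ℝ)))
      (qG2Frame lam (stdE 3, 0) a) 0 := by
  have hw (a : Fin 3) : qFrame (stdE 3) a.succ = ![-stdE 2, stdE 1, -stdE 0] a := by
    fin_cases a <;> ext i <;> fin_cases i <;> simp [qFrame, stdE]
  have hw0 : qFrame (stdE 3) 0 = -stdE 4 := by ext i; fin_cases i <;> simp [qFrame, stdE]
  have e0 : qFrame (stdE 3) 1 = -stdE 2 := hw 0
  have e1 : qFrame (stdE 3) 2 = stdE 1 := hw 1
  have e2 : qFrame (stdE 3) 3 = -stdE 0 := hw 2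
  have hh (a : Fin 4) : (1 / (√2 * sFun lam (stdE 3, 0))) • hor (stdE 3, 0) (qFrame (stdE 3) a) =
      ((√2 * s)⁻¹ • qFrame (stdE 3) a, 0) := by
    rw [hor_zero_form, hs, one_div, Prod.smul_mk, smul_zero]
  have key (a : Fin 7) : (a < 3 → yPart s (EuclideanSpace.single a 1) = 0) ∧
      (a ≠ 3 → ηPart s (EuclideanSpace.single a 1) = 0) ∧
      (3 ≤ a → wPart s (EuclideanSpace.single a 1) = 0) ∧
      (a = 3 → yPart s (EuclideanSpace.single a 1) = 0) := by
    simp only [yPart_apply, wPart_apply, ηPart_apply]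
    refine ⟨fun h => ?_, fun h => ?_, fun h => ?_, fun h => ?_⟩
    · fin_cases a <;> first | (exfalso; revert h; decide) | (ext i; fin_cases i <;> simp)
    · fin_cases a <;> first | (exfalso; exact h rfl) | simp
    · fin_cases a <;> first | (exfalso; revert h; decide) | (ext i; fin_cases i <;> simp)
    · subst h; ext i; fin_cases i <;> simp
  have vec3 (a : Fin 3) (b : Fin 7) (hb : b = ![0, 1, 2] a) :
      xVec (wPart s (EuclideanSpace.single b 1)) 0 = s • qFrame (stdE 3) a.succ := by
    rw [hw, wPart_apply, hb]
    fin_cases a <;> ext i <;> fin_cases i <;> simp [xVec, stdE]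
  have hvec3 (a : Fin 3) (b : Fin 7) (hb : b = ![4, 5, 6] a) :
      xVec (yPart s (EuclideanSpace.single b 1)) 0 = (√2 * s)⁻¹ • qFrame (stdE 3) a.succ := by
    rw [hw, yPart_apply, hb]
    fin_cases a <;> ext i <;> fin_cases i <;> simp [xVec, stdE]
  have hv (a : Fin 3) (b : Fin 7) (hb : b = ![0, 1, 2] a) (hb3 : b < 3) :
      HasDerivAt (fun t : ℝ => coneChart s (t • EuclideanSpace.single b (1 : ℝ)))
        (0, sFun lam (stdE 3, 0) • asdForm (stdE 3) (qFrame (stdE 3) a.succ)) 0 := by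
    have := hasDerivAt_coneChart_w ((key b).1 hb3) ((key b).2.1 hb3.ne)
    rw [vec3 a b hb, asdForm_smul] at this
    rw [← hs]
    exact this
  have hy (a : Fin 3) (b : Fin 7) (hb : b = ![4, 5, 6] a) (hb3 : 3 < b) :
      HasDerivAt (fun t : ℝ => coneChart s (t • EuclideanSpace.single b (1 : ℝ)))
        ((1 / (√2 * sFun lam (stdE 3, 0))) • hor (stdE 3, 0) (qFrame (stdE 3) a.succ)) 0 := by
    have := hasDerivAt_coneChart_y ((key b).2.2.1 hb3.le) ((key b).2.1 hb3.ne')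
    rwa [hvec3 a b hb, ← hh] at this
  fin_cases a
  · exact hv 0 0 rfl (by decide)
  · exact hv 1 1 rfl (by decide)
  · exact hv 2 2 rfl (by decide)
  · have := hasDerivAt_coneChart_η ((key 3).2.2.2 rfl) ((key 3).2.2.1 le_rfl)
    have e : ((ηPart s (EuclideanSpace.single 3 1) • stdE 4, 0) : Amb) =
        (1 / (√2 * sFun lam (stdE 3, 0))) • hor (stdE 3, 0) (qFrame (stdE 3) 0) := by
      rw [hh, hw0, ηPart_apply]
      simp
    rw [e] at this
    exact this
  · exact hy 0 4 rfl (by decide)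
  · exact hy 1 5 rfl (by decide)
  · exact hy 2 6 rfl (by decide)

theorem fderiv_zero_apply {V W : Type*} [NormedAddCommGroup V] [NormedSpace ℝ V]
    [NormedAddCommGroup W] [NormedSpace ℝ W] {f : V → W} (hf : DifferentiableAt ℝ f 0) {v : V} {w : W}
    (h : HasDerivAt (fun t : ℝ => f (t • v)) w 0) : fderiv ℝ f 0 v = w := by
  have hl : HasDerivAt (fun t : ℝ => t • v) v 0 := by
    simpa using (hasDerivAt_id (0 : ℝ)).smul_const v
  have h1 := hf.hasFDerivAt
  rw [← zero_smul ℝ v] at h1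
  have h2 := h1.comp_hasDerivAt (0 : ℝ) hl
  rw [zero_smul] at h2
  exact h2.unique h

theorem hasDerivAt_lift (A : Matrix (Fin 5) (Fin 5) ℝ) {γ : ℝ → Amb} {v : Amb} {t : ℝ}
    (h : HasDerivAt γ v t) : HasDerivAt (fun t => lift A (γ t)) (lift A v) t :=
  (liftL A).hasFDerivAt.comp_hasDerivAt t h

theorem differentiableAt_lift_coneChart (s : ℝ) (A : Matrix (Fin 5) (Fin 5) ℝ) :
    DifferentiableAt ℝ (fun c => lift A (coneChart s c)) 0 := by
  have h0 : (0 : R7) ∈ coneDomain s := by simp [coneDomain]; positivity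
  have h1 : ContDiffAt ℝ ∞ (coneChart s) 0 :=
    (contDiffOn_coneChart s).contDiffAt ((isOpen_coneDomain s).mem_nhds h0)
  have h2 : ContDiffAt ℝ ∞ (fun c => lift A (coneChart s c)) 0 := (contDiff_lift A).contDiffAt.comp 0 h1
  exact h2.differentiableAt (by simp)

theorem fderiv_lift_coneChart (hs : s = sFun lam (stdE 3, 0)) (A : Matrix (Fin 5) (Fin 5) ℝ) (a : Fin 7) :
    fderiv ℝ (fun c => lift A (coneChart s c)) 0 (EuclideanSpace.single a 1) =
      lift A (qG2Frame lam (stdE 3, 0) a) :=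
  fderiv_zero_apply (differentiableAt_lift_coneChart s A)
    (hasDerivAt_lift A (hasDerivAt_coneChart hs a))

/-! ### The quadric cone and its link. -/

/-- The cone `c₃ = 0`, `|v|² = |h|²`, `⟨v, h⟩ = 0` in `ℝ⁷`. -/
def quadricCone : Set R7 :=
  {c | c 3 = 0 ∧ c 0 ^ 2 + c 1 ^ 2 + c 2 ^ 2 = c 4 ^ 2 + c 5 ^ 2 + c 6 ^ 2 ∧
    c 0 * c 4 + c 1 * c 5 + c 2 * c 6 = 0}

theorem quadricCone_smul {c : R7} (hc : c ∈ quadricCone) (t : ℝ) : t • c ∈ quadricCone := by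
  obtain ⟨h1, h2, h3⟩ := hc
  refine ⟨by simp [h1], ?_, ?_⟩ <;> simp only [PiLp.smul_apply, smul_eq_mul]
  · linear_combination t ^ 2 * h2
  · linear_combination t ^ 2 * h3

/-- Lying over x₅ = 0 means η = 0, hence c₃ = 0; the orthogonality of y and w is ⟨v, h⟩ = 0 up to
the factor √2. By the choice of `coneScale` the norm equation becomes |w|² = 2λ|y|², which is |v|² =
|h|² since s⁴ = λ. -/
theorem coneChart_mem_iff (hlam : 0 < lam) (hX0 : 0 ≤ X) (hX : X ^ 4 = lam) (hs0 : 0 < s)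
    (hs : s ^ 4 = lam) {c : R7} (hc : c ∈ coneDomain s) :
    coneChart s c ∈ theta lam X 0 '' K lam X 0 ↔ c ∈ quadricCone := by
  have hy1 : ‖yPart s c‖ ^ 2 < 1 := by
    have := hc.1
    nlinarith [norm_nonneg (yPart s c)]
  have h2 : √2 ^ 2 = 2 := Real.sq_sqrt (by norm_num)
  have h20 : 0 < √2 := by positivity
  have hr := Real.sqrt_pos.2 (show 0 < 1 - ‖yPart s c‖ ^ 2 by linarith)
  have hr2 := Real.sq_sqrt (show 0 ≤ 1 - ‖yPart s c‖ ^ 2 by linarith)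
  have hk := coneScale_pos hc.1
  have hk2 := coneScale_sq hc.1
  have ny : ‖yPart s c‖ ^ 2 * (2 * s ^ 2) = c 4 ^ 2 + c 5 ^ 2 + c 6 ^ 2 := by
    rw [yPart_apply, norm_smul, mul_pow, norm_sq_R3, norm_inv, inv_pow, Real.norm_eq_abs, sq_abs,
      mul_pow, h2]
    simp
    field_simp
    ring
  have nw : ‖wPart s c‖ ^ 2 = s ^ 2 * (c 0 ^ 2 + c 1 ^ 2 + c 2 ^ 2) := by
    rw [wPart_apply, norm_smul, mul_pow, norm_sq_R3, Real.norm_eq_abs, sq_abs]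
    simp only [Matrix.cons_val]
    ring
  have iyw : inner ℝ (yPart s c) (wPart s c) * √2 = c 0 * c 4 + c 1 * c 5 + c 2 * c 6 := by
    rw [yPart_apply, wPart_apply, inner_smul_left, inner_smul_right, inner_R3]
    simp
    field_simp
    ring
  have hη : ηPart s c = 0 ↔ c 3 = 0 := by
    rw [ηPart_apply, mul_eq_zero, neg_eq_zero, inv_eq_zero]
    exact or_iff_right (by positivity)
  have hn : ‖wPart s c‖ ^ 2 = 2 * lam * ‖yPart s c‖ ^ 2 ↔
      c 0 ^ 2 + c 1 ^ 2 + c 2 ^ 2 = c 4 ^ 2 + c 5 ^ 2 + c 6 ^ 2 := by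
    rw [nw, ← ny, ← hs, show 2 * s ^ 4 * ‖yPart s c‖ ^ 2 = s ^ 2 * (‖yPart s c‖ ^ 2 * (2 * s ^ 2)) by ring]
    exact mul_right_inj' (by positivity)
  have hh : hFun lam X 0 (coneScale (yPart s c) • wPart s c) = √(1 - ‖yPart s c‖ ^ 2) ↔
      ‖wPart s c‖ ^ 2 = 2 * lam * ‖yPart s c‖ ^ 2 := by
    rw [hFun_eq_iff hlam hX0 hr.le, norm_smul, mul_pow, Real.norm_eq_abs, sq_abs, hX,
      show √(1 - ‖yPart s c‖ ^ 2) ^ 4 = (√(1 - ‖yPart s c‖ ^ 2) ^ 2) ^ 2 by ring, hr2]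
    have hp : (1 - ‖yPart s c‖ ^ 2 / 2) ≠ 0 := by linarith
    constructor
    · intro h
      refine mul_left_cancel₀ hp ?_
      linear_combination h - ‖wPart s c‖ ^ 2 * hk2
    · intro h
      linear_combination ‖wPart s c‖ ^ 2 * hk2 + (1 - ‖yPart s c‖ ^ 2 / 2) * h
  constructor
  · rintro ⟨q, hq, he⟩
    have hη0 : ηPart s c = 0 := by
      have h4 : (coneChart s c).1 4 = 0 := by rw [← he]; rfl
      rw [coneChart_fst] at h4
      have h5 := (mul_eq_zero.1 (show Real.sin _ * _ = 0 from h4)).resolve_right hr.ne'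
      have := abs_lt.1 hc.2
      exact (Real.sin_eq_zero_iff_of_lt_of_lt (by linarith [Real.pi_pos]) (by linarith [Real.pi_pos])).1 h5
    have hq' : q = (yPart s c, coneScale (yPart s c) • wPart s c) := by
      rw [← thetaInv_theta lam X 0 q, he, coneChart_of_η hη0, coneBase, thetaInv_asdForm]
    obtain ⟨k1, k2⟩ := mem_K.1 hq
    rw [hq'] at k1 k2
    simp only [inner_smul_right, mul_zero] at k1 k2
    have hi := (mul_eq_zero.1 k2).resolve_left hk.ne'
    refine ⟨hη.1 hη0, hn.1 (hh.1 ?_), ?_⟩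
    · rw [k1, sub_sub_cancel, Real.sqrt_sq (hFun_nonneg hlam hX0 _)]
    · rw [← iyw, hi, zero_mul]
  · rintro ⟨c1, c2, c3⟩
    have hi : inner ℝ (yPart s c) (wPart s c) = (0 : ℝ) :=
      (mul_eq_zero.1 (iyw.trans c3)).resolve_right h20.ne'
    have hf := hh.2 (hn.2 c2)
    refine ⟨(yPart s c, coneScale (yPart s c) • wPart s c), mem_K.2 ⟨?_, ?_⟩, ?_⟩
    · simp only [hf, hr2]; ring
    · simp only [inner_smul_right, hi]; ring
    · rw [coneChart_of_η (hη.2 c1), theta, coneBase, hf, hi]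
      simp

/-- The link of the cone. -/
def coneLink : Set R7 := {c | c ∈ quadricCone ∧ ‖c‖ = 1}

theorem norm_sq_R7 (c : R7) : ‖c‖ ^ 2 = c 0 ^ 2 + c 1 ^ 2 + c 2 ^ 2 + c 3 ^ 2 + c 4 ^ 2 + c 5 ^ 2 + c 6 ^ 2 := by
  rw [EuclideanSpace.norm_sq_eq, Fin.sum_univ_seven]; simp

theorem isCompact_coneLink : IsCompact coneLink := by
  refine (isCompact_sphere (0 : R7) 1).of_isClosed_subset ?_ fun c hc => by simp [hc.2]
  refine IsClosed.inter (IsClosed.inter ?_ (IsClosed.inter ?_ ?_)) ?_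
  all_goals exact isClosed_eq (by fun_prop) (by fun_prop)

/-- Defining functions of the link. -/
def linkMap (c : R7) : (ℝ × ℝ) × (ℝ × ℝ) :=
  ((c 3, c 0 ^ 2 + c 1 ^ 2 + c 2 ^ 2 - 1 / 2),
    (c 4 ^ 2 + c 5 ^ 2 + c 6 ^ 2 - 1 / 2, c 0 * c 4 + c 1 * c 5 + c 2 * c 6))

/-- When c₃ = 0, a unit vector whose two halves have equal norm has half the squared norm in each.
-/
theorem mem_coneLink_iff {c : R7} : c ∈ coneLink ↔ linkMap c = 0 := by
  have hn := norm_sq_R7 c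
  constructor
  · rintro ⟨⟨h1, h2, h3⟩, h4⟩
    rw [h4, h1] at hn
    refine Prod.ext (Prod.ext h1 ?_) (Prod.ext ?_ h3)
    · change _ - _ = (0 : ℝ); linarith
    · change _ - _ = (0 : ℝ); linarith
  · intro h
    have h1 : c 3 = 0 := congrArg (fun p => p.1.1) h
    have h2 : c 0 ^ 2 + c 1 ^ 2 + c 2 ^ 2 - 1 / 2 = 0 := congrArg (fun p => p.1.2) h
    have h3 : c 4 ^ 2 + c 5 ^ 2 + c 6 ^ 2 - 1 / 2 = 0 := congrArg (fun p => p.2.1) h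
    have h4 : c 0 * c 4 + c 1 * c 5 + c 2 * c 6 = 0 := congrArg (fun p => p.2.2) h
    refine ⟨⟨h1, by linarith, h4⟩, ?_⟩
    rw [← sq_eq_sq₀ (norm_nonneg _) zero_le_one, hn, h1]
    linarith

theorem isSubmanifoldAt_coneLink {c : R7} (hc : c ∈ coneLink) : IsSubmanifoldAt 3 coneLink c := by
  have hL : coneLink = {c | linkMap c = 0} := Set.ext fun c => mem_coneLink_iff
  rw [mem_coneLink_iff] at hc
  have h2 : c 0 ^ 2 + c 1 ^ 2 + c 2 ^ 2 - 1 / 2 = 0 := congrArg (fun p => p.1.2) hc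
  have h3 : c 4 ^ 2 + c 5 ^ 2 + c 6 ^ 2 - 1 / 2 = 0 := congrArg (fun p => p.2.1) hc
  have h4 : c 0 * c 4 + c 1 * c 5 + c 2 * c 6 = 0 := congrArg (fun p => p.2.2) hc
  rw [hL]
  have hsm : ContDiff ℝ ∞ linkMap := by unfold linkMap; fun_prop
  have hd := (hsm.differentiable (by simp)).differentiableAt (x := c) |>.hasFDerivAt
  refine (regularLevelSet (by simp) hsm hc hd fun T => ?_).1
  obtain ⟨⟨a, b⟩, ⟨d, e⟩⟩ := T
  -- A preimage of ((a, b), (d, e)): the two halves of c are orthogonal of squared norm 1/2, so each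
  -- coefficient affects exactly one equation.
  let v : R7 := !₂[b * c 0 + 2 * e * c 4, b * c 1 + 2 * e * c 5, b * c 2 + 2 * e * c 6, a,
    d * c 4, d * c 5, d * c 6]
  refine ⟨v, ?_⟩
  have hl : HasDerivAt (fun t : ℝ => c + t • v) v 0 := by
    simpa using ((hasDerivAt_id (0 : ℝ)).smul_const v).const_add c
  have h1 := hd
  rw [show c = c + (0 : ℝ) • v by simp] at h1
  have h5 := h1.comp_hasDerivAt (0 : ℝ) hl
  simp only [zero_smul, add_zero] at h5
  have hi (i : Fin 7) : HasDerivAt (fun t : ℝ => c i + t * v i) (v i) 0 := by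
    simpa using ((hasDerivAt_id (0 : ℝ)).mul_const (v i)).const_add (c i)
  refine h5.unique ?_
  change HasDerivAt (fun t : ℝ => (((c 3 + t * v 3, (c 0 + t * v 0) ^ 2 + (c 1 + t * v 1) ^ 2 +
    (c 2 + t * v 2) ^ 2 - 1 / 2), ((c 4 + t * v 4) ^ 2 + (c 5 + t * v 5) ^ 2 + (c 6 + t * v 6) ^ 2 - 1 / 2,
    (c 0 + t * v 0) * (c 4 + t * v 4) + (c 1 + t * v 1) * (c 5 + t * v 5) +
      (c 2 + t * v 2) * (c 6 + t * v 6))) : (ℝ × ℝ) × (ℝ × ℝ))) _ 0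
  refine HasDerivAt.prodMk (HasDerivAt.prodMk (hi 3) ?_) (HasDerivAt.prodMk ?_ ?_)
  · refine (((((hi 0).fun_pow 2).fun_add ((hi 1).fun_pow 2)).fun_add ((hi 2).fun_pow 2)).sub_const _).congr_deriv ?_
    simp [v]
    linear_combination 2 * b * h2 + 4 * e * h4
  · refine (((((hi 4).fun_pow 2).fun_add ((hi 5).fun_pow 2)).fun_add ((hi 6).fun_pow 2)).sub_const _).congr_deriv ?_
    simp [v]
    linear_combination 2 * d * h3
  · refine ((((hi 0).fun_mul (hi 4)).fun_add ((hi 1).fun_mul (hi 5))).fun_add ((hi 2).fun_mul (hi 6))).congr_deriv ?_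
    simp [v]
    linear_combination (b + d) * h4 + 2 * e * h3

end

section

variable {lam X s : ℝ}

theorem theta_zero (hlam : 0 < lam) (hX0 : 0 ≤ X) (hX : X ^ 4 = lam) :
    theta lam X 0 0 = (stdE 3, 0) := by
  have hh : hFun lam X 0 (0 : R3 × R3).2 = 1 := by
    rw [hFun_eq_iff hlam hX0 zero_le_one, hX]; simp
  have h1 : xVec (0 : R3 × R3).1 1 = stdE 3 := by ext i; fin_cases i <;> simp [xVec, stdE]
  have h2 : xVec (0 : R3 × R3).2 (-0) = 0 := by ext i; fin_cases i <;> simp [xVec]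
  rw [theta, hh, h1, h2, asdForm_zero]

theorem stdE_three_mem : ((stdE 3, 0) : Amb) ∈ asd := by
  have := asdForm_mem (x := stdE 3) (z := 0) (by simp [stdE]) (by simp [stdE]) (by simp) (by simp)
  rwa [asdForm_zero] at this

theorem sFun_stdE_three_pow (hlam : 0 < lam) : sFun lam (stdE 3, 0) ^ 4 = lam := by
  rw [sFun_pow hlam]
  simp [rSq, fibreInner]

theorem exists_coneLink_smul {c : R7} (hc : c ∈ quadricCone) (h0 : c ≠ 0) :
    ∃ σ ∈ coneLink, c = ‖c‖ • σ := by
  have hn := norm_ne_zero_iff.2 h0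
  exact ⟨‖c‖⁻¹ • c, ⟨quadricCone_smul hc _, norm_smul_inv_norm h0⟩,
    by rw [smul_smul, mul_inv_cancel₀ hn, one_smul]⟩

variable {C D : ℝ} {n : ℕ} {P Q : Fin n → ℝ}

theorem IsRootFamily.rad_pow (h : IsRootFamily C D P Q) (hlam : 0 < lam) (hX : √C + √D = √lam)
    (i : Fin n) : rad (P i) (Q i) ^ 4 = lam := by
  rw [show rad (P i) (Q i) ^ 4 = (rad (P i) (Q i) ^ 2) ^ 2 by ring, h.rad_sq, hX, Real.sq_sqrt hlam.le]

theorem lift_coneChart_mem_iff (hlam : 0 < lam) {P Q : ℝ} (hX : rad P Q ^ 4 = lam) {c : R7}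
    (hc : c ∈ coneDomain (sFun lam (stdE 3, 0))) :
    lift (argRot P Q) (coneChart (sFun lam (stdE 3, 0)) c) ∈ emb lam P Q 0 '' K lam (rad P Q) 0 ↔
      c ∈ quadricCone := by
  rw [← coneChart_mem_iff hlam (rad_nonneg P Q) hX (sFun_pos hlam _) (sFun_stdE_three_pow hlam) hc]
  have he : emb lam P Q 0 '' K lam (rad P Q) 0 =
      lift (argRot P Q) '' (theta lam (rad P Q) 0 '' K lam (rad P Q) 0) := by
    rw [image_image]; rfl
  have hinj : Function.Injective (lift (argRot P Q)) :=
    Function.LeftInverse.injective (argRot_isSO P Q).lift_transpose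
  rw [he, hinj.mem_set_image]

theorem emb_zero (hlam : 0 < lam) {P Q : ℝ} (hX : rad P Q ^ 4 = lam) :
    emb lam P Q 0 0 = lift (argRot P Q) (stdE 3, 0) := by
  rw [emb, theta_zero hlam (rad_nonneg _ _) hX]

theorem zero_mem_quadricCone : (0 : R7) ∈ quadricCone := ⟨rfl, by simp, by simp⟩

theorem coneLink_nonempty : coneLink.Nonempty := by
  obtain ⟨σ, hσ, -⟩ := exists_coneLink_smul (c := !₂[1, 0, 0, 0, 0, 1, 0])
    ⟨by simp, by simp, by simp⟩ (fun h => by simpa using congrArg (fun c : R7 => c 0) h)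
  exact ⟨σ, hσ⟩

/-! ### Sets that are the quadric cone in a chart. -/

section Chart

variable {M : Set Amb} {z : Amb} {χ : R7 → Amb} {V : Set R7} {U₁ : Set Amb}

/-- A set which is the quadric cone in a `G₂` chart has a conical singularity. -/
theorem isConicalSingularity_of_chart (hM : M ⊆ asd) (hpar : IsParamAt 7 asd z χ V)
    (hG : IsG2Frame lam z fun a => fderiv ℝ χ 0 (EuclideanSpace.single a 1)) (hU₁ : IsOpen U₁)
    (hiff : ∀ c ∈ V, χ c ∈ M ∩ U₁ ↔ c ∈ quadricCone) : IsConicalSingularity lam M z := by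
  have hpar' := hpar
  obtain ⟨hV, h0, hz0, hχ, U, ρ, hU, him, hρ, hinv⟩ := hpar'
  obtain ⟨ε, hε, hball⟩ := Metric.isOpen_iff.1 hV 0 h0
  have hcone {r : ℝ} (hr : r ∈ Ioo 0 ε) {σ : R7} (hσ : σ ∈ coneLink) :
      r • σ ∈ Metric.ball (0 : R7) ε ∧ r • σ ≠ 0 ∧ r • σ ∈ quadricCone := by
    refine ⟨?_, smul_ne_zero hr.1.ne' fun h0 => ?_, quadricCone_smul hσ.1 r⟩
    · rw [mem_ball_zero_iff, norm_smul, hσ.2, mul_one, Real.norm_of_nonneg hr.1.le]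
      exact hr.2
    · have := hσ.2
      rw [h0, norm_zero] at this
      exact zero_ne_one this
  have hinj : InjOn χ V := fun c hc c' hc' he => by rw [← hinv c hc, he, hinv c' hc']
  have hmU {c : R7} (hc : c ∈ V) : χ c ∈ U := by
    have : χ c ∈ asd ∩ U := by rw [← him]; exact ⟨c, hc, rfl⟩
    exact this.2
  -- The set is exactly conical in the chart, so Ψ is the identity; any rate in (1, 2) is
  -- admissible, and 3/2 is an arbitrary choice.
  refine ⟨χ, V, hpar, hG, coneLink, fun σ hσ => by simp [hσ.2], isCompact_coneLink, coneLink_nonempty,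
    fun σ hσ => isSubmanifoldAt_coneLink hσ, ε, 3 / 2, id, hε, by norm_num, by norm_num, contDiffOn_id,
    fun j => ⟨0, fun y _ _ => ?_⟩, U₁ ∩ (U ∩ ρ ⁻¹' Metric.ball 0 ε),
    hU₁.inter (hρ.continuousOn.isOpen_inter_preimage hU Metric.isOpen_ball), ?_, ⟨?_, ?_, ?_⟩, ?_⟩
  · have : (fun y : R7 => id y - y) = fun _ => 0 := by funext y; simp
    rw [this, zero_mul]
    simp [iteratedFDeriv_fun_zero]
  · rw [← hz0]
    refine ⟨((hiff 0 h0).2 zero_mem_quadricCone).2, hmU h0, ?_⟩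
    rw [mem_preimage, hinv 0 h0]
    exact Metric.mem_ball_self hε
  · rintro c ⟨r, hr, σ, hσ, rfl⟩
    obtain ⟨c1, c2, c3⟩ := hcone hr hσ
    have hm := (hiff _ (hball c1)).2 c3
    refine ⟨⟨hm.1, fun he => c2 (hinj (hball c1) h0 (Eq.trans he hz0.symm))⟩, hm.2, hmU (hball c1), ?_⟩
    change ρ (χ (r • σ)) ∈ Metric.ball (0 : R7) ε
    rw [hinv _ (hball c1)]
    exact c1
  · rintro c ⟨r, hr, σ, hσ, rfl⟩ c' ⟨r', hr', σ', hσ', rfl⟩ he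
    exact hinj (hball (hcone hr hσ).1) (hball (hcone hr' hσ').1) he
  · rintro p ⟨⟨hpM, hpz⟩, hpU₁, hpU, hpb⟩
    obtain ⟨c, hc, hcp⟩ : p ∈ χ '' V := by rw [him]; exact ⟨hM hpM, hpU⟩
    subst hcp
    rw [mem_preimage, hinv c hc] at hpb
    have hc0 : c ≠ 0 := by
      rintro rfl
      exact hpz hz0
    obtain ⟨σ, hσ, hcσ⟩ := exists_coneLink_smul ((hiff c hc).1 ⟨hpM, hpU₁⟩) hc0
    exact ⟨c, ⟨‖c‖, ⟨norm_pos_iff.2 hc0, mem_ball_zero_iff.1 hpb⟩, σ, hσ, hcσ⟩, rfl⟩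
  · rintro c ⟨r, hr, σ, hσ, rfl⟩
    exact hball (hcone hr hσ).1

/-- Velocities of curves in a submanifold lie in the range of the differential of a
parametrization. -/
theorem mem_range_fderiv_of_mem_tangentVecs {E : Type*} [NormedAddCommGroup E] [NormedSpace ℝ E]
    {n : ℕ} {S : Set E} {p : E} {ψ : EuclideanSpace ℝ (Fin n) → E} {V : Set (EuclideanSpace ℝ (Fin n))}
    (h : IsParamAt n S p ψ V) {v : E} (hv : v ∈ tangentVecs S p) :
    v ∈ LinearMap.range (fderiv ℝ ψ 0 : EuclideanSpace ℝ (Fin n) →ₗ[ℝ] E) := by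
  obtain ⟨hV, h0, hψ0, hψ, U, ρ, hU, him, hρ, hinv⟩ := h
  obtain ⟨γ, g1, g2, g3, g4⟩ := hv
  have hpU : p ∈ U := by
    have : p ∈ S ∩ U := by rw [← him]; exact ⟨0, h0, hψ0⟩
    exact this.2
  have hρp : ρ (γ 0) = 0 := by rw [g2, ← hψ0, hinv 0 h0]
  have hd1 : DifferentiableAt ℝ ψ (ρ (γ 0)) := by
    rw [hρp]
    exact (hψ.contDiffAt (hV.mem_nhds h0)).differentiableAt (by simp)
  have hd2 : DifferentiableAt ℝ ρ (γ 0) := by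
    rw [g2]
    exact (hρ.contDiffAt (hU.mem_nhds hpU)).differentiableAt (by simp)
  have h1 := hd2.hasFDerivAt.comp_hasDerivAt (0 : ℝ) g4
  have h2 := hd1.hasFDerivAt.comp_hasDerivAt (0 : ℝ) h1
  have he : (ψ ∘ (ρ ∘ γ)) =ᶠ[𝓝 0] γ := by
    have hγU : ∀ᶠ t in 𝓝 (0 : ℝ), γ t ∈ U :=
      g1.continuousAt.eventually_mem (hU.mem_nhds (by rwa [g2]))
    filter_upwards [g3, hγU] with t ht ht'
    obtain ⟨u, hu, hut⟩ : γ t ∈ ψ '' V := by rw [him]; exact ⟨ht, ht'⟩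
    change ψ (ρ (γ t)) = γ t
    rw [← hut, hinv u hu]
  have h3 := (h2.congr_of_eventuallyEq he.symm).unique g4
  rw [hρp] at h3
  exact ⟨_, h3⟩

/-- A set which is the quadric cone in a chart is not a submanifold. -/
theorem not_isSubmanifoldAt_of_chart (hpar : IsParamAt 7 asd z χ V)
    (hiff : ∀ c ∈ V, χ c ∈ M ∩ U₁ ↔ c ∈ quadricCone) : ¬ IsSubmanifoldAt 4 M z := by
  obtain ⟨hV, h0, hz0, hχ, U, ρ, hU, him, hρ, hinv⟩ := hpar
  rintro ⟨ψ, V', hψ⟩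
  have hχ0 : ContDiffAt ℝ ∞ χ 0 := hχ.contDiffAt (hV.mem_nhds h0)
  have hχd : HasFDerivAt χ (fderiv ℝ χ 0) 0 := (hχ0.differentiableAt (by simp)).hasFDerivAt
  obtain ⟨T, hT⟩ : ∃ T, T = fderiv ℝ χ 0 := ⟨_, rfl⟩
  rw [← hT] at hχd
  -- If M were a submanifold, the velocities at z would lie in this space of dimension at most 4.
  -- Every ray of the cone contributes a velocity.
  obtain ⟨W, hW⟩ : ∃ W, W = LinearMap.range (fderiv ℝ ψ 0 : EuclideanSpace ℝ (Fin 4) →ₗ[ℝ] Amb) := ⟨_, rfl⟩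
  have hWdim : Module.finrank ℝ W ≤ 4 := by
    rw [hW]
    exact (LinearMap.finrank_range_le _).trans (by simp)
  have hWfin : FiniteDimensional ℝ W := by rw [hW]; infer_instance
  have hcone {c : R7} (hc : c ∈ quadricCone) : T c ∈ W := by
    have hl : HasDerivAt (fun t : ℝ => t • c) c 0 := by
      simpa using (hasDerivAt_id (0 : ℝ)).smul_const c
    rw [hW]
    refine mem_range_fderiv_of_mem_tangentVecs hψ ⟨fun t : ℝ => χ (t • c), ?_, ?_, ?_, ?_⟩
    · rw [← zero_smul ℝ c] at hχ0
      exact hχ0.comp (0 : ℝ) (contDiffAt_id.smul contDiffAt_const)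
    · beta_reduce
      rw [zero_smul, hz0]
    · have hcont : ContinuousAt (fun t : ℝ => t • c) 0 := by fun_prop
      have := hcont.eventually_mem (hV.mem_nhds (by rwa [zero_smul]))
      filter_upwards [this] with t ht
      exact ((hiff _ ht).2 (quadricCone_smul hc t)).1
    · exact HasFDerivAt.comp_hasDerivAt_of_eq (0 : ℝ) hχd hl (by rw [zero_smul])
  have he (a : Fin 7) (ha : a ≠ 3) : T (EuclideanSpace.single a 1) ∈ W := by
    -- The cone contains e_a ± e_b for suitable pairs with one index in each half, so W contains the
    -- images of all six e_a with a ≠ 3.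
    have key (a b : Fin 7) (h1 : EuclideanSpace.single a 1 + EuclideanSpace.single b 1 ∈ quadricCone)
        (h2 : EuclideanSpace.single a 1 - EuclideanSpace.single b 1 ∈ quadricCone) :
        T (EuclideanSpace.single a 1) ∈ W := by
      have e : (EuclideanSpace.single a 1 : R7) =
          (1 / 2 : ℝ) • ((EuclideanSpace.single a 1 + EuclideanSpace.single b 1) +
            (EuclideanSpace.single a 1 - EuclideanSpace.single b 1)) := by module
      rw [e, map_smul, map_add]
      exact W.smul_mem _ (W.add_mem (hcone h1) (hcone h2))
    fin_cases a
    · exact key 0 5 (by simp [quadricCone]) (by simp [quadricCone])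
    · exact key 1 4 (by simp [quadricCone]) (by simp [quadricCone])
    · exact key 2 4 (by simp [quadricCone]) (by simp [quadricCone])
    · exact absurd rfl ha
    · exact key 4 1 (by simp [quadricCone]) (by simp [quadricCone])
    · exact key 5 0 (by simp [quadricCone]) (by simp [quadricCone])
    · exact key 6 0 (by simp [quadricCone]) (by simp [quadricCone])
  have hinj : Function.Injective T := by
    have hzU : χ 0 ∈ U := by
      have : χ 0 ∈ asd ∩ U := by rw [← him]; exact ⟨0, h0, rfl⟩
      exact this.2
    have hρd := ((hρ.contDiffAt (hU.mem_nhds hzU)).differentiableAt (by simp)).hasFDerivAt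
    have h2 := HasFDerivAt.comp (0 : R7) hρd hχd
    have h3 : ρ ∘ χ =ᶠ[𝓝 0] id := by
      filter_upwards [hV.mem_nhds h0] with c hc using hinv c hc
    have h4 := (h2.congr_of_eventuallyEq h3.symm).unique (hasFDerivAt_id _)
    intro u v huv
    have h5 := DFunLike.congr_fun h4 u
    have h6 := DFunLike.congr_fun h4 v
    rw [ContinuousLinearMap.comp_apply] at h5 h6
    rw [huv] at h5
    exact h5.symm.trans h6
  have h1 : LinearIndependent ℝ fun a : Fin 7 => (EuclideanSpace.single a (1 : ℝ) : R7) := by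
    have h := (EuclideanSpace.basisFun (Fin 7) ℝ).toBasis.linearIndependent
    have e : ⇑(EuclideanSpace.basisFun (Fin 7) ℝ).toBasis =
        fun a : Fin 7 => (EuclideanSpace.single a (1 : ℝ) : R7) := by funext a; simp
    rwa [e] at h
  have hli : LinearIndependent ℝ fun a : {a : Fin 7 // a ≠ 3} => T (EuclideanSpace.single a.1 1) :=
    (h1.map' (T : R7 →ₗ[ℝ] Amb) (LinearMap.ker_eq_bot.2 hinj)).comp _ Subtype.val_injective
  have hli' : LinearIndependent ℝ
      fun a : {a : Fin 7 // a ≠ 3} => (⟨T (EuclideanSpace.single a.1 1), he a.1 a.2⟩ : W) :=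
    LinearIndependent.of_comp W.subtype hli
  have := hli'.fintype_card_le_finrank
  have hcard : Fintype.card {a : Fin 7 // a ≠ 3} = 6 := by decide
  omega

end Chart

theorem isConicalSingularity_M (hlam : 0 < lam) (h : IsRootFamily C D P Q) (hX : √C + √D = √lam)
    (i : Fin n) : IsConicalSingularity lam (M lam C D 0) (emb lam (P i) (Q i) 0 0) ∧
      ¬ IsSubmanifoldAt 4 (M lam C D 0) (emb lam (P i) (Q i) 0 0) := by
  have hX4 := h.rad_pow hlam hX i
  obtain ⟨U₁, hU₁, hMU⟩ := exists_open_inter_eq hlam h i 0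
  have hSO := argRot_isSO (P i) (Q i)
  have hpar := isParamAt_coneChart (sFun_pos hlam (stdE 3, 0)) hSO
  rw [emb_zero hlam hX4]
  have hiff : ∀ c ∈ coneDomain (sFun lam (stdE 3, 0)),
      lift (argRot (P i) (Q i)) (coneChart (sFun lam (stdE 3, 0)) c) ∈ M lam C D 0 ∩ U₁ ↔
        c ∈ quadricCone := fun c hc => by
    rw [hMU]
    exact lift_coneChart_mem_iff hlam hX4 hc
  refine ⟨isConicalSingularity_of_chart M_subset_asd hpar ?_ hU₁ hiff,
    not_isSubmanifoldAt_of_chart hpar hiff⟩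
  simp only [fderiv_lift_coneChart rfl]
  exact hSO.isG2Frame_lift stdE_three_mem.1
    (isG2Frame_qG2Frame hlam stdE_three_mem (by simp [stdE]))

theorem isConicallySingularCoassociative_M (hlam : 0 < lam) (h : IsRootFamily C D P Q) (hn : 0 < n)
    (hX : √C + √D = √lam) :
    IsConicallySingularCoassociative lam (M lam C D 0) (apexes lam C D 0) := by
  refine ⟨fun p hp => hp.1, ?_, ?_, isCoassociative_diff_apexes hlam h hX, fun z hz => ?_⟩
  · rw [apexes_eq hlam h hX]; exact finite_range _
  · rw [apexes_eq hlam h hX]; exact ⟨_, ⟨0, hn⟩, rfl⟩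
  · rw [apexes_eq hlam h hX] at hz
    obtain ⟨i, rfl⟩ := hz
    exact isConicalSingularity_M hlam h hX i

end

/-! ### The orientation of the level sets -/

section

variable {lam X : ℝ}

/-- The image of the velocity `v` under the differential of `theta` (for `E = 0`). -/
def vel (lam X : ℝ) (q v : R3 × R3) : Amb :=
  hor (theta lam X 0 q) (xVec v.1 (hDeriv lam X 0 q.2 v.2)) +
    (0, asdForm (theta lam X 0 q).1 (xVec v.2 0 +
      inner ℝ (xVec q.2 (-0)) (xVec v.1 (hDeriv lam X 0 q.2 v.2)) • (theta lam X 0 q).1))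

/-- The value of `*φ` on four velocities, through the symplectic form `dw ∧ dy`. -/
theorem starPhiEq_vel (hlam : 0 < lam) {q : R3 × R3} (hq : q ∈ K lam X 0) (v : Fin 4 → R3 × R3)
    (hv : ∀ i, levelDeriv lam X 0 q (v i) = 0) (Ω : Fin 4 → Fin 4 → ℝ)
    (hΩ : ∀ i j, Ω i j = inner ℝ (v i).2 (v j).1 - inner ℝ (v j).2 (v i).1) :
    StarPhiEq lam (theta lam X 0 q) (fun i => vel lam X q (v i))
      (-2 * (Ω 0 1 * Ω 2 3 - Ω 0 2 * Ω 1 3 + Ω 0 3 * Ω 1 2)) := by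
  have hp := theta_mem_asd hq
  have hs := sFun_pos hlam (theta lam X 0 q)
  set p := theta lam X 0 q with hpdef
  set s := sFun lam p with hsdef
  have hp1 : p.1 = xVec q.1 (hFun lam X 0 q.2) := rfl
  have h2 : 0 < √2 := by positivity
  have h22 : √2 ^ 2 = 2 := Real.sq_sqrt (by norm_num)
  let x' : Fin 4 → R5 := fun i => xVec (v i).1 (hDeriv lam X 0 q.2 (v i).2)
  let V : Fin 4 → R5 := fun i => xVec (v i).2 0 + inner ℝ (xVec q.2 (-0)) (x' i) • p.1
  have hx' (i : Fin 4) : inner ℝ p.1 (x' i) = (0 : ℝ) := by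
    have h := congrArg Prod.fst (hv i)
    rw [levelDeriv_apply] at h
    simp only [Prod.fst_zero] at h
    rw [hp1, inner_xVec]
    linarith
  have hV (i : Fin 4) : inner ℝ p.1 (V i) = (0 : ℝ) := by
    have h := congrArg Prod.snd (hv i)
    rw [levelDeriv_apply] at h
    simp only [Prod.snd_zero, zero_mul, sub_zero] at h
    have hn : ‖xVec q.1 (hFun lam X 0 q.2)‖ = 1 := hp.1
    simp only [V, x', inner_add_right, inner_smul_right, real_inner_self_eq_norm_sq, hp1,
      inner_xVec, hn]
    linarith
  have hV4 (i : Fin 4) : V i 4 = 0 := by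
    simp only [V, PiLp.add_apply, PiLp.smul_apply, smul_eq_mul, hp1]; simp [xVec]
  have ex (i : Fin 4) := qFrame_expand hp.1 (x := p.1) rfl (V := x' i) rfl (hx' i)
  have eV (i : Fin 4) := qFrame_expand hp.1 (x := p.1) rfl (hV4 i) (hV i)
  -- Coordinates in the G₂ frame: horizontal frame vectors are scaled by 1/(√2 s), vertical ones by
  -- s.
  let h : Fin 4 → Fin 3 → ℝ := fun i a => √2 * s * inner ℝ (x' i) (qFrame p.1 a.succ)
  let c : Fin 4 → Fin 3 → ℝ := fun i a => s⁻¹ * inner ℝ (V i) (qFrame p.1 a.succ)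
  refine ⟨qG2Frame lam p, isG2Frame_qG2Frame hlam hp rfl, fun i => coef (c i) (h i), fun i => ?_, ?_⟩
  · rw [sum_coef]
    have e1 : ∑ a, (h i a / (√2 * sFun lam p)) • qFrame p.1 a.succ = x' i := by
      conv_rhs => rw [ex i]
      refine Finset.sum_congr rfl fun a _ => ?_
      congr 1
      rw [← hsdef]
      simp only [h]
      field_simp
    have e2 : ∑ a, (sFun lam p * c i a) • qFrame p.1 a.succ = V i := by
      conv_rhs => rw [eV i]
      refine Finset.sum_congr rfl fun a _ => ?_
      congr 1
      rw [← hsdef]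
      simp only [c]
      field_simp
    rw [e1, e2]
    rfl
  · have hin (i j : Fin 4) : inner ℝ (V i) (x' j) =
        ∑ a : Fin 3, inner ℝ (V i) (qFrame p.1 a.succ) * inner ℝ (x' j) (qFrame p.1 a.succ) := by
      conv_lhs => rw [ex j, inner_sum]
      exact Finset.sum_congr rfl fun a _ => by rw [inner_smul_right]; ring
    -- The x-component of V is orthogonal to the velocity of x, and the derivative of z has no
    -- x₄-component; only the ℝ³ parts remain.
    have hin' (i j : Fin 4) : inner ℝ (V i) (x' j) = inner ℝ (v i).2 (v j).1 := by
      simp only [V, inner_add_left, inner_smul_left, hx', mul_zero, add_zero]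
      rw [inner_xVec]; ring
    -- The scalings s⁻¹ and √2 s combine to σ = √2 Ω, whence the factor 2 in the value.
    rw [starPhi0_coef c h (fun i j => √2 * Ω i j)]
    · linear_combination (-(Ω 0 1 * Ω 2 3 - Ω 0 2 * Ω 1 3 + Ω 0 3 * Ω 1 2)) * h22
    · intro i j
      rw [hΩ, ← hin', ← hin', hin, hin, ← Finset.sum_sub_distrib, Finset.mul_sum]
      refine Finset.sum_congr rfl fun a _ => ?_
      simp only [h, c]
      field_simp

end

/-! ### Euler angles -/

open Real (cos sin)

/-- The first column of the rotation with Euler angles `a, b, c`. -/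
def eulerU (b a c : ℝ) : R3 :=
  !₂[cos a * cos c - sin a * cos b * sin c, sin a * cos c + cos a * cos b * sin c, sin b * sin c]

/-- The second column of the rotation with Euler angles `a, b, c`. -/
def eulerV (b a c : ℝ) : R3 :=
  !₂[-(cos a * sin c) - sin a * cos b * cos c, -(sin a * sin c) + cos a * cos b * cos c,
    sin b * cos c]

/-- The partial derivatives of `eulerU`. -/
def eulerU' (b a c : ℝ) : Fin 3 → R3 :=
  ![!₂[sin a * sin b * sin c, -(cos a * sin b * sin c), cos b * sin c],
    !₂[-(sin a * cos c) - cos a * cos b * sin c, cos a * cos c - sin a * cos b * sin c, 0],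
    eulerV b a c]

/-- The partial derivatives of `eulerV`. -/
def eulerV' (b a c : ℝ) : Fin 3 → R3 :=
  ![!₂[sin a * sin b * cos c, -(cos a * sin b * cos c), cos b * cos c],
    !₂[sin a * sin c - cos a * cos b * cos c, -(cos a * sin c) - sin a * cos b * cos c, 0],
    -eulerU b a c]

section

variable (b a c : ℝ)

theorem norm_eulerU : ‖eulerU b a c‖ = 1 := by
  rw [← sq_eq_sq₀ (norm_nonneg _) zero_le_one, norm_sq_R3]
  simp only [eulerU, Matrix.cons_val_zero, Matrix.cons_val_one, Matrix.cons_val]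
  have ha := Real.sin_sq_add_cos_sq a
  have hb := Real.sin_sq_add_cos_sq b
  have hc := Real.sin_sq_add_cos_sq c
  linear_combination (cos c ^ 2 + cos b ^ 2 * sin c ^ 2) * ha + sin c ^ 2 * hb + hc

theorem norm_eulerV : ‖eulerV b a c‖ = 1 := by
  rw [← sq_eq_sq₀ (norm_nonneg _) zero_le_one, norm_sq_R3]
  simp only [eulerV, Matrix.cons_val_zero, Matrix.cons_val_one, Matrix.cons_val]
  have ha := Real.sin_sq_add_cos_sq a
  have hb := Real.sin_sq_add_cos_sq b
  have hc := Real.sin_sq_add_cos_sq c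
  linear_combination (sin c ^ 2 + cos b ^ 2 * cos c ^ 2) * ha + cos c ^ 2 * hb + hc

theorem inner_eulerU_eulerV : inner ℝ (eulerU b a c) (eulerV b a c) = (0 : ℝ) := by
  rw [inner_R3]
  simp only [eulerU, eulerV, Matrix.cons_val_zero, Matrix.cons_val_one, Matrix.cons_val]
  have ha := Real.sin_sq_add_cos_sq a
  have hb := Real.sin_sq_add_cos_sq b
  linear_combination (-(cos c * sin c) + cos b ^ 2 * sin c * cos c) * ha + sin c * cos c * hb

/-- The components of `du` along `u` vanish. -/
theorem inner_eulerU_eulerU' (i : Fin 3) : inner ℝ (eulerU b a c) (eulerU' b a c i) = (0 : ℝ) := by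
  have ha := Real.sin_sq_add_cos_sq a
  have hb := Real.sin_sq_add_cos_sq b
  fin_cases i
  · rw [inner_R3]
    simp [eulerU, eulerU']
    linear_combination (-(cos b * sin b * sin c ^ 2)) * ha
  · rw [inner_R3]
    simp [eulerU, eulerU']
    ring
  · exact inner_eulerU_eulerV b a c

theorem inner_eulerV_eulerV' (i : Fin 3) : inner ℝ (eulerV b a c) (eulerV' b a c i) = (0 : ℝ) := by
  have ha := Real.sin_sq_add_cos_sq a
  fin_cases i
  · rw [inner_R3]
    simp [eulerV, eulerV']
    linear_combination (-(cos b * sin b * cos c ^ 2)) * ha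
  · rw [inner_R3]
    simp [eulerV, eulerV']
    ring
  · change inner ℝ (eulerV b a c) (-eulerU b a c) = (0 : ℝ)
    rw [inner_neg_right, real_inner_comm, inner_eulerU_eulerV, neg_zero]

/-- The source of the Haar density sin b in the Euler angles, with its sign; it decides the
orientation of the parametrization. -/
theorem inner_eulerV'_eulerU' :
    inner ℝ (eulerV' b a c 0) (eulerU' b a c 1) - inner ℝ (eulerV' b a c 1) (eulerU' b a c 0) =
      -sin b := by
  have ha := Real.sin_sq_add_cos_sq a
  have hc := Real.sin_sq_add_cos_sq c
  rw [inner_R3, inner_R3]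
  simp [eulerV', eulerU']
  linear_combination (-(sin b * cos c ^ 2) - sin b * sin c ^ 2) * ha - sin b * hc

theorem hasDerivAt_eulerU :
    HasDerivAt (fun t => eulerU (b + t) a c) (eulerU' b a c 0) 0 ∧
    HasDerivAt (fun t => eulerU b (a + t) c) (eulerU' b a c 1) 0 ∧
    HasDerivAt (fun t => eulerU b a (c + t)) (eulerU' b a c 2) 0 := by
  have hs (x : ℝ) : HasDerivAt (fun t : ℝ => sin (x + t)) (cos x) 0 := by
    simpa using ((hasDerivAt_id (0 : ℝ)).const_add x).sin
  have hc (x : ℝ) : HasDerivAt (fun t : ℝ => cos (x + t)) (-sin x) 0 := by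
    simpa using ((hasDerivAt_id (0 : ℝ)).const_add x).cos
  refine ⟨hasDerivAt_euclidean.2 fun i => ?_, hasDerivAt_euclidean.2 fun i => ?_,
    hasDerivAt_euclidean.2 fun i => ?_⟩
  · fin_cases i
    · refine ((((hc b).const_mul (sin a)).mul_const (sin c)).const_sub (cos a * cos c)).congr_deriv ?_
      simp [eulerU']
    · refine ((((hc b).const_mul (cos a)).mul_const (sin c)).const_add (sin a * cos c)).congr_deriv ?_
      simp [eulerU']
    · exact (hs b).mul_const (sin c)
  · fin_cases i
    · refine (((hc a).mul_const (cos c)).fun_sub (((hs a).mul_const (cos b)).mul_const (sin c))).congr_deriv ?_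
      simp [eulerU']
    · refine (((hs a).mul_const (cos c)).fun_add (((hc a).mul_const (cos b)).mul_const (sin c))).congr_deriv ?_
      simp [eulerU']; ring
    · exact hasDerivAt_const _ _
  · fin_cases i
    · refine (((hc c).const_mul (cos a)).fun_sub ((hs c).const_mul (sin a * cos b))).congr_deriv ?_
      simp [eulerU', eulerV]
    · refine (((hc c).const_mul (sin a)).fun_add ((hs c).const_mul (cos a * cos b))).congr_deriv ?_
      simp [eulerU', eulerV]
    · exact (hs c).const_mul (sin b)

theorem hasDerivAt_eulerV :
    HasDerivAt (fun t => eulerV (b + t) a c) (eulerV' b a c 0) 0 ∧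
    HasDerivAt (fun t => eulerV b (a + t) c) (eulerV' b a c 1) 0 ∧
    HasDerivAt (fun t => eulerV b a (c + t)) (eulerV' b a c 2) 0 := by
  have hs (x : ℝ) : HasDerivAt (fun t : ℝ => sin (x + t)) (cos x) 0 := by
    simpa using ((hasDerivAt_id (0 : ℝ)).const_add x).sin
  have hc (x : ℝ) : HasDerivAt (fun t : ℝ => cos (x + t)) (-sin x) 0 := by
    simpa using ((hasDerivAt_id (0 : ℝ)).const_add x).cos
  refine ⟨hasDerivAt_euclidean.2 fun i => ?_, hasDerivAt_euclidean.2 fun i => ?_,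
    hasDerivAt_euclidean.2 fun i => ?_⟩
  · fin_cases i
    · refine ((((hc b).const_mul (sin a)).mul_const (cos c)).const_sub (-(cos a * sin c))).congr_deriv ?_
      simp [eulerV']
    · refine ((((hc b).const_mul (cos a)).mul_const (cos c)).const_add (-(sin a * sin c))).congr_deriv ?_
      simp [eulerV']
    · exact (hs b).mul_const (cos c)
  · fin_cases i
    · refine (((hc a).mul_const (sin c)).fun_neg.fun_sub (((hs a).mul_const (cos b)).mul_const (cos c))).congr_deriv ?_
      simp [eulerV']
    · refine (((hs a).mul_const (sin c)).fun_neg.fun_add (((hc a).mul_const (cos b)).mul_const (cos c))).congr_deriv ?_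
      simp [eulerV']; ring
    · exact hasDerivAt_const _ _
  · fin_cases i
    · refine (((hs c).const_mul (cos a)).fun_neg.fun_sub ((hc c).const_mul (sin a * cos b))).congr_deriv ?_
      simp [eulerV', eulerU]; ring
    · refine (((hs c).const_mul (sin a)).fun_neg.fun_add ((hc c).const_mul (cos a * cos b))).congr_deriv ?_
      simp [eulerV', eulerU]; ring
    · refine ((hc c).const_mul (sin b)).congr_deriv ?_
      simp [eulerV', eulerU]

end

/-- A point of the unit circle has an angle in `(-π, π]`. -/
theorem exists_angle {p q : ℝ} (h : p ^ 2 + q ^ 2 = 1) :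
    ∃ θ ∈ Ioc (-Real.pi) Real.pi, cos θ = p ∧ sin θ = q := by
  have hn : ‖(⟨p, q⟩ : ℂ)‖ = 1 := by
    rw [Complex.norm_def, Complex.normSq_mk, ← sq, ← sq, h, Real.sqrt_one]
  have h0 : (⟨p, q⟩ : ℂ) ≠ 0 := fun h => by rw [h, norm_zero] at hn; exact zero_ne_one hn
  refine ⟨Complex.arg ⟨p, q⟩, Complex.arg_mem_Ioc _, ?_, ?_⟩
  · rw [Complex.cos_arg h0, hn, div_one]
  · rw [Complex.sin_arg, hn, div_one]

/-- Angles are recovered as arguments of complex numbers. -/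
theorem angle_unique {θ θ' : ℝ} (h : θ ∈ Ioo (-Real.pi) Real.pi) (h' : θ' ∈ Ioo (-Real.pi) Real.pi)
    (hc : cos θ = cos θ') (hs : sin θ = sin θ') : θ = θ' := by
  rw [← Complex.arg_cos_add_sin_mul_I (Ioo_subset_Ioc_self h),
    ← Complex.arg_cos_add_sin_mul_I (Ioo_subset_Ioc_self h'), ← Complex.ofReal_cos,
    ← Complex.ofReal_cos, ← Complex.ofReal_sin, ← Complex.ofReal_sin, hc, hs]

theorem cross_eulerU_eulerV (b a c : ℝ) :
    cross (eulerU b a c) (eulerV b a c) = !₂[sin a * sin b, -(cos a * sin b), cos b] := by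
  have ha := Real.sin_sq_add_cos_sq a
  have hc := Real.sin_sq_add_cos_sq c
  ext i
  fin_cases i <;> simp [cross, eulerU, eulerV]
  · linear_combination sin a * sin b * hc
  · linear_combination -(cos a * sin b) * hc
  · linear_combination (cos c ^ 2 * cos b + sin c ^ 2 * cos b) * ha + cos b * hc

/-- The third column u × v determines cos b and, as sin b > 0, then a; the third entries of u and v
determine c. -/
theorem euler_injective {b a c b' a' c' : ℝ} (hb : b ∈ Ioo 0 Real.pi) (hb' : b' ∈ Ioo 0 Real.pi)
    (ha : a ∈ Ioo (-Real.pi) Real.pi) (ha' : a' ∈ Ioo (-Real.pi) Real.pi)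
    (hc : c ∈ Ioo (-Real.pi) Real.pi) (hc' : c' ∈ Ioo (-Real.pi) Real.pi)
    (hU : eulerU b a c = eulerU b' a' c') (hV : eulerV b a c = eulerV b' a' c') :
    b = b' ∧ a = a' ∧ c = c' := by
  have hx := cross_eulerU_eulerV b a c
  rw [hU, hV, cross_eulerU_eulerV] at hx
  have x0 : sin a' * sin b' = sin a * sin b := congrArg (fun v : R3 => v 0) hx
  have x1 : -(cos a' * sin b') = -(cos a * sin b) := congrArg (fun v : R3 => v 1) hx
  have x2 : cos b' = cos b := congrArg (fun v : R3 => v 2) hx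
  have u2 : sin b * sin c = sin b' * sin c' := congrArg (fun v : R3 => v 2) hU
  have v2 : sin b * cos c = sin b' * cos c' := congrArg (fun v : R3 => v 2) hV
  have hbb : b = b' := Real.injOn_cos (Ioo_subset_Icc_self hb) (Ioo_subset_Icc_self hb') x2.symm
  subst hbb
  have hs : sin b ≠ 0 := (Real.sin_pos_of_mem_Ioo hb).ne'
  exact ⟨rfl, angle_unique ha ha' (mul_right_cancel₀ hs (neg_injective x1)).symm
    (mul_right_cancel₀ hs x0).symm,
    angle_unique hc hc' (mul_left_cancel₀ hs v2) (mul_left_cancel₀ hs u2)⟩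

/-- With n = u × v, take b = arccos n₂; then a is the angle of (-n₁, n₀)/sin b and c that of (v₂,
u₂)/sin b. -/
theorem exists_euler_coord {u₀ u₁ u₂ v₀ v₁ v₂ : ℝ} (nu : u₀ ^ 2 + u₁ ^ 2 + u₂ ^ 2 = 1)
    (nv : v₀ ^ 2 + v₁ ^ 2 + v₂ ^ 2 = 1) (huv : u₀ * v₀ + u₁ * v₁ + u₂ * v₂ = 0) :
    ∃ b ∈ Icc 0 Real.pi, ∃ a ∈ Ioc (-Real.pi) Real.pi, ∃ c ∈ Ioc (-Real.pi) Real.pi,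
      (cos a * cos c - sin a * cos b * sin c = u₀ ∧ sin a * cos c + cos a * cos b * sin c = u₁ ∧
        sin b * sin c = u₂) ∧
      -(cos a * sin c) - sin a * cos b * cos c = v₀ ∧
        -(sin a * sin c) + cos a * cos b * cos c = v₁ ∧ sin b * cos c = v₂ := by
  obtain ⟨n₀, hn0⟩ : ∃ n₀, n₀ = u₁ * v₂ - u₂ * v₁ := ⟨_, rfl⟩
  obtain ⟨n₁, hn1⟩ : ∃ n₁, n₁ = u₂ * v₀ - u₀ * v₂ := ⟨_, rfl⟩
  obtain ⟨n₂, hn2⟩ : ∃ n₂, n₂ = u₀ * v₁ - u₁ * v₀ := ⟨_, rfl⟩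
  have e1 : n₀ ^ 2 + n₁ ^ 2 + n₂ ^ 2 = 1 := by
    rw [hn0, hn1, hn2]
    linear_combination (u₀ ^ 2 + u₁ ^ 2 + u₂ ^ 2) * nv + nu - (u₀ * v₀ + u₁ * v₁ + u₂ * v₂) * huv
  have e2 : n₂ ^ 2 + (u₂ ^ 2 + v₂ ^ 2) = 1 := by
    rw [hn2]
    linear_combination (u₀ ^ 2 + u₁ ^ 2) * nv + (1 - v₂ ^ 2) * nu -
      (u₀ * v₀ + u₁ * v₁ - u₂ * v₂) * huv
  have u0 : u₀ = v₁ * n₂ - v₂ * n₁ := by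
    rw [hn1, hn2]; linear_combination -u₀ * nv + v₀ * huv
  have u1 : u₁ = v₂ * n₀ - v₀ * n₂ := by
    rw [hn0, hn2]; linear_combination -u₁ * nv + v₁ * huv
  have v0 : v₀ = n₁ * u₂ - n₂ * u₁ := by
    rw [hn1, hn2]; linear_combination -v₀ * nu + u₀ * huv
  have v1 : v₁ = n₂ * u₀ - n₀ * u₂ := by
    rw [hn0, hn2]; linear_combination -v₁ * nu + u₁ * huv
  clear hn0 hn1 hn2
  have hn2le : n₂ ^ 2 ≤ 1 := by linarith [sq_nonneg u₂, sq_nonneg v₂]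
  obtain ⟨l1, l2⟩ := abs_le.1 ((sq_le_one_iff_abs_le_one _).1 hn2le)
  have hcb : cos (Real.arccos n₂) = n₂ := Real.cos_arccos l1 l2
  have hsb : sin (Real.arccos n₂) ^ 2 = 1 - n₂ ^ 2 := by rw [Real.sin_sq, hcb]
  refine ⟨Real.arccos n₂, ⟨Real.arccos_nonneg _, Real.arccos_le_pi _⟩, ?_⟩
  rw [hcb]
  generalize sin (Real.arccos n₂) = s at hsb ⊢
  -- If sin b = 0, only a sum or difference of a and c is determined; c = 0 is chosen.
  by_cases h0 : s = 0
  · have hn : u₂ ^ 2 + v₂ ^ 2 = 0 := by rw [h0] at hsb; linarith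
    have hu2 : u₂ = 0 := pow_eq_zero_iff two_ne_zero |>.1 (by linarith [sq_nonneg u₂, sq_nonneg v₂])
    have hv2 : v₂ = 0 := pow_eq_zero_iff two_ne_zero |>.1 (by linarith [sq_nonneg u₂, sq_nonneg v₂])
    obtain ⟨a, ha, hca, hsa⟩ := exists_angle (p := u₀) (q := u₁) (by rw [hu2] at nu; linarith)
    refine ⟨a, ha, 0, ⟨by linarith [Real.pi_pos], Real.pi_pos.le⟩, ?_⟩
    rw [hca, hsa, Real.cos_zero, Real.sin_zero, h0, hv2, hu2]
    rw [hu2] at v0 v1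
    refine ⟨⟨by ring, by ring, by ring⟩, by linarith, by linarith, by ring⟩
  · have hs2 : s ^ 2 = n₀ ^ 2 + n₁ ^ 2 := by rw [hsb]; linarith
    have hs3 : s ^ 2 = u₂ ^ 2 + v₂ ^ 2 := by rw [hsb]; linarith
    obtain ⟨a, ha, hca, hsa⟩ := exists_angle (p := -n₁ / s) (q := n₀ / s) (by
      field_simp; linarith)
    obtain ⟨c, hc, hcc, hsc⟩ := exists_angle (p := v₂ / s) (q := u₂ / s) (by
      field_simp; linarith)
    refine ⟨a, ha, c, hc, ?_⟩
    rw [hca, hsa, hcc, hsc]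
    refine ⟨⟨?_, ?_, by field_simp⟩, ?_, ?_, by field_simp⟩ <;> field_simp <;> rw [hsb]
    · linear_combination -u0 - n₂ * v1
    · linear_combination -u1 + n₂ * v0
    · linear_combination -v0 + n₂ * u1
    · linear_combination -v1 - n₂ * u0

theorem exists_euler {u v : R3} (hu : ‖u‖ = 1) (hv : ‖v‖ = 1) (huv : inner ℝ u v = 0) :
    ∃ b ∈ Icc 0 Real.pi, ∃ a ∈ Ioc (-Real.pi) Real.pi, ∃ c ∈ Ioc (-Real.pi) Real.pi,
      eulerU b a c = u ∧ eulerV b a c = v := by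
  have nu := norm_sq_R3 u
  have nv := norm_sq_R3 v
  rw [inner_R3] at huv
  rw [hu, one_pow] at nu
  rw [hv, one_pow] at nv
  obtain ⟨b, hb, a, ha, c, hc, ⟨h0, h1, h2⟩, h3, h4, h5⟩ := exists_euler_coord nu.symm nv.symm huv
  refine ⟨b, hb, a, ha, c, hc, ?_, ?_⟩
  · ext i
    fin_cases i
    exacts [h0, h1, h2]
  · ext i
    fin_cases i
    exacts [h3, h4, h5]

/-! ### The radial functions -/

/-- `√(A + τ²)`. -/
def hyp (A τ : ℝ) : ℝ := √(A + τ ^ 2)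

/-- The derivative of `hyp A`. -/
def hypDeriv (A τ : ℝ) : ℝ := τ / hyp A τ

theorem hyp_nonneg (A τ : ℝ) : 0 ≤ hyp A τ := Real.sqrt_nonneg _

section

variable {A B τ : ℝ}

theorem hyp_sq (hA : 0 ≤ A) (τ : ℝ) : hyp A τ ^ 2 = A + τ ^ 2 := Real.sq_sqrt (by positivity)

theorem hyp_pos (hA : 0 ≤ A) (hτ : τ ≠ 0) : 0 < hyp A τ := Real.sqrt_pos.2 (by positivity)

theorem hyp_mono (h : A ≤ B) (τ : ℝ) : hyp A τ ≤ hyp B τ :=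
  Real.sqrt_le_sqrt (by linarith)

theorem le_hyp (hA : 0 ≤ A) (τ : ℝ) : τ ≤ hyp A τ := by
  refine (le_abs_self τ).trans (Real.abs_le_sqrt ?_)
  linarith

theorem hasDerivAt_hyp (hA : 0 ≤ A) (hτ : τ ≠ 0) :
    HasDerivAt (fun s => hyp A (τ + s)) (hypDeriv A τ) 0 := by
  have h1 : HasDerivAt (fun s : ℝ => A + (τ + s) ^ 2) (2 * τ) 0 := by
    refine ((((hasDerivAt_id (0 : ℝ)).const_add τ).fun_pow 2).const_add A).congr_deriv ?_
    simp
  have h0 : A + (τ + 0) ^ 2 ≠ 0 := by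
    rw [add_zero]; positivity
  refine (h1.sqrt h0).congr_deriv ?_
  rw [add_zero, hypDeriv, hyp]
  field_simp

theorem contDiffOn_hyp (hA : 0 ≤ A) : ContDiffOn ℝ ∞ (hyp A) (Ioi 0) := by
  intro x hx
  have : A + x ^ 2 ≠ 0 := by have := pow_pos (mem_Ioi.1 hx) 2; linarith
  exact ((contDiffAt_const.add (contDiffAt_id.pow 2)).sqrt this).contDiffWithinAt

theorem hypDeriv_nonneg (hτ : 0 ≤ τ) : 0 ≤ hypDeriv A τ := div_nonneg hτ (hyp_nonneg _ _)

/-- The bound does not depend on A, not even as A → 0. This is why τ is a good variable across the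
singular value of X. -/
theorem hypDeriv_le_one (hA : 0 ≤ A) (τ : ℝ) : hypDeriv A τ ≤ 1 :=
  div_le_one_of_le₀ (le_hyp hA τ) (hyp_nonneg _ _)

end

/-- The value at `τ = 0` of `S = (λ + |w|²)^{1/2}`. -/
def baseS (lam X : ℝ) : ℝ := max (X ^ 2) √lam

/-- `|w|` as a function of `τ`. -/
def radT (lam X τ : ℝ) : ℝ := hyp (baseS lam X - √lam) τ * hyp (baseS lam X + √lam) τ

/-- `|y|` as a function of `τ`. -/
def radY (lam X τ : ℝ) : ℝ := hyp (baseS lam X - X ^ 2) τ / hyp (baseS lam X) τ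

/-- The derivative of `radT`. -/
def radT' (lam X τ : ℝ) : ℝ :=
  hypDeriv (baseS lam X - √lam) τ * hyp (baseS lam X + √lam) τ +
    hyp (baseS lam X - √lam) τ * hypDeriv (baseS lam X + √lam) τ

/-- The derivative of `radY`. -/
def radY' (lam X τ : ℝ) : ℝ :=
  (hypDeriv (baseS lam X - X ^ 2) τ * hyp (baseS lam X) τ -
    hyp (baseS lam X - X ^ 2) τ * hypDeriv (baseS lam X) τ) / hyp (baseS lam X) τ ^ 2

section

variable {lam X τ : ℝ}

theorem baseS_pos (hlam : 0 < lam) (X : ℝ) : 0 < baseS lam X := lt_max_of_lt_right (Real.sqrt_pos.2 hlam)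

theorem le_baseS (lam X : ℝ) : 0 ≤ baseS lam X - √lam := sub_nonneg.2 (le_max_right _ _)

theorem le_baseS' (lam X : ℝ) : 0 ≤ baseS lam X - X ^ 2 := sub_nonneg.2 (le_max_left _ _)

theorem baseS_add_nonneg (hlam : 0 < lam) (X : ℝ) : 0 ≤ baseS lam X + √lam :=
  add_nonneg (baseS_pos hlam X).le (Real.sqrt_nonneg _)

theorem radT_nonneg (lam X τ : ℝ) : 0 ≤ radT lam X τ := mul_nonneg (hyp_nonneg _ _) (hyp_nonneg _ _)

theorem radY_nonneg (lam X τ : ℝ) : 0 ≤ radY lam X τ := div_nonneg (hyp_nonneg _ _) (hyp_nonneg _ _)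

/-- √(λ + |w|²) = S with S = `baseS` + τ², and S² - λ = (S - √λ)(S + √λ) factors into two squares of
`hyp`. -/
theorem radT_sq (hlam : 0 < lam) (X τ : ℝ) :
    lam + radT lam X τ ^ 2 = (baseS lam X + τ ^ 2) ^ 2 := by
  rw [radT, mul_pow, hyp_sq (le_baseS _ _), hyp_sq (baseS_add_nonneg hlam X)]
  linear_combination -Real.sq_sqrt hlam.le

theorem radY_sq (hlam : 0 < lam) (X τ : ℝ) :
    radY lam X τ ^ 2 = 1 - X ^ 2 / (baseS lam X + τ ^ 2) := by
  have := baseS_pos hlam X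
  rw [radY, div_pow, hyp_sq (le_baseS' _ _), hyp_sq this.le]
  field_simp
  ring

theorem radT_pos (hlam : 0 < lam) (X : ℝ) (hτ : τ ≠ 0) : 0 < radT lam X τ :=
  mul_pos (hyp_pos (le_baseS _ _) hτ) (hyp_pos (baseS_add_nonneg hlam X) hτ)

theorem radY_pos (hlam : 0 < lam) (X : ℝ) (hτ : τ ≠ 0) : 0 < radY lam X τ :=
  div_pos (hyp_pos (le_baseS' _ _) hτ) (hyp_pos (baseS_pos hlam X).le hτ)

theorem hasDerivAt_radT (hlam : 0 < lam) (X : ℝ) (hτ : τ ≠ 0) :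
    HasDerivAt (fun s => radT lam X (τ + s)) (radT' lam X τ) 0 := by
  have h := (hasDerivAt_hyp (le_baseS lam X) hτ).fun_mul (hasDerivAt_hyp (baseS_add_nonneg hlam X) hτ)
  rw [add_zero] at h
  exact h

theorem hasDerivAt_radY (hlam : 0 < lam) (X : ℝ) (hτ : τ ≠ 0) :
    HasDerivAt (fun s => radY lam X (τ + s)) (radY' lam X τ) 0 := by
  have h := (hasDerivAt_hyp (le_baseS' lam X) hτ).fun_div (hasDerivAt_hyp (baseS_pos hlam X).le hτ)
    (by rw [add_zero]; exact (hyp_pos (baseS_pos hlam X).le hτ).ne')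
  rw [add_zero] at h
  exact h

theorem contDiffOn_radT (hlam : 0 < lam) (X : ℝ) : ContDiffOn ℝ ∞ (radT lam X) (Ioi 0) :=
  (contDiffOn_hyp (le_baseS lam X)).mul (contDiffOn_hyp (baseS_add_nonneg hlam X))

theorem contDiffOn_radY (hlam : 0 < lam) (X : ℝ) : ContDiffOn ℝ ∞ (radY lam X) (Ioi 0) :=
  (contDiffOn_hyp (le_baseS' lam X)).div (contDiffOn_hyp (baseS_pos hlam X).le)
    fun _ hx => (hyp_pos (baseS_pos hlam X).le (ne_of_gt hx)).ne'

theorem radT'_pos (hlam : 0 < lam) (X : ℝ) (hτ : 0 < τ) : 0 < radT' lam X τ :=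
  add_pos_of_pos_of_nonneg
    (mul_pos (div_pos hτ (hyp_pos (le_baseS _ _) hτ.ne')) (hyp_pos (baseS_add_nonneg hlam X) hτ.ne'))
    (mul_nonneg (hyp_nonneg _ _) (hypDeriv_nonneg hτ.le))

/-- A ratio √((A + τ²)/(B + τ²)) with A ≤ B is nondecreasing in τ ≥ 0. -/
theorem radY'_nonneg (hlam : 0 < lam) (X : ℝ) (hτ : 0 < τ) : 0 ≤ radY' lam X τ := by
  refine div_nonneg (sub_nonneg.2 ?_) (sq_nonneg _)
  have h1 := hyp_pos (le_baseS' lam X) hτ.ne'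
  have h2 := hyp_pos (baseS_pos hlam X).le hτ.ne'
  have h3 : hyp (baseS lam X - X ^ 2) τ ≤ hyp (baseS lam X) τ := hyp_mono (by linarith [sq_nonneg X]) τ
  rw [hypDeriv, hypDeriv, div_mul_eq_mul_div, mul_div_assoc']
  exact div_le_div₀ (by positivity)
    (by rw [mul_comm]; exact mul_le_mul_of_nonneg_left h3 hτ.le) h1 h3

theorem radY_le_one (lam X τ : ℝ) : radY lam X τ ≤ 1 :=
  div_le_one_of_le₀ (hyp_mono (by linarith [sq_nonneg X]) τ) (hyp_nonneg _ _)

/-- Lets a compact support in the fibre variable bound τ, independently of X. -/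
theorem le_radT (hlam : 0 < lam) (X τ : ℝ) : τ ^ 2 ≤ radT lam X τ := by
  have h := radT_sq hlam X τ
  have h1 := le_baseS lam X
  have h2 := Real.sq_sqrt hlam.le
  have h3 := Real.sqrt_nonneg lam
  refine abs_le_of_sq_le_sq' ?_ (radT_nonneg _ _ _) |>.2
  nlinarith [sq_nonneg τ]

theorem radT_le (lam X τ : ℝ) :
    radT lam X τ ≤ hyp (baseS lam X + √lam) τ ^ 2 := by
  rw [sq]
  exact mul_le_mul_of_nonneg_right (hyp_mono (by linarith [Real.sqrt_nonneg lam]) _) (hyp_nonneg _ _)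

theorem radT'_le (hlam : 0 < lam) (X : ℝ) (hτ : 0 < τ) :
    radT' lam X τ ≤ 2 * hyp (baseS lam X + √lam) τ := by
  have h1 : hyp (baseS lam X - √lam) τ ≤ hyp (baseS lam X + √lam) τ :=
    hyp_mono (by linarith [Real.sqrt_nonneg lam]) _
  have h2 := hypDeriv_le_one (le_baseS lam X) τ
  have h3 := hypDeriv_le_one (baseS_add_nonneg hlam X) τ
  have h4 : 0 ≤ hypDeriv (baseS lam X + √lam) τ := hypDeriv_nonneg hτ.le
  have h5 := hyp_nonneg (baseS lam X - √lam) τ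
  have h6 := hyp_nonneg (baseS lam X + √lam) τ
  rw [radT']
  nlinarith [mul_le_mul_of_nonneg_right h2 h6, mul_le_mul_of_nonneg_left h3 h5]

/-- The denominator is at least √λ, which keeps the derivative bounded even when |y| vanishes at τ =
0. -/
theorem radY'_le (hlam : 0 < lam) (X : ℝ) (hτ : 0 < τ) :
    radY' lam X τ ≤ hyp (baseS lam X + √lam) τ / √lam := by
  have h2 := hypDeriv_le_one (le_baseS' lam X) τ
  have h4 : 0 ≤ hypDeriv (baseS lam X) τ := hypDeriv_nonneg hτ.le
  have h5 := hyp_nonneg (baseS lam X - X ^ 2) τ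
  have h6 := hyp_nonneg (baseS lam X) τ
  have h7 : hyp (baseS lam X) τ ≤ hyp (baseS lam X + √lam) τ :=
    hyp_mono (by linarith [Real.sqrt_nonneg lam]) _
  have h8 : 0 < √lam := Real.sqrt_pos.2 hlam
  have h9 : √lam ≤ hyp (baseS lam X) τ ^ 2 := by
    rw [hyp_sq (baseS_pos hlam X).le]
    linarith [le_baseS lam X, sq_nonneg τ]
  refine div_le_div₀ (hyp_nonneg _ _) ?_ h8 h9
  nlinarith [mul_le_mul_of_nonneg_right h2 h6, mul_nonneg h5 h4]

/-- The functions of `τ` and `X`, for a fixed `τ ≠ 0`, are continuous in `X`. -/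
theorem continuous_hyp {f : ℝ → ℝ} (hf : Continuous f) (τ : ℝ) : Continuous fun x => hyp (f x) τ :=
  (hf.add continuous_const).sqrt

theorem continuous_hypDeriv {f : ℝ → ℝ} (hf : Continuous f) (h0 : ∀ x, 0 ≤ f x) (hτ : τ ≠ 0) :
    Continuous fun x => hypDeriv (f x) τ :=
  continuous_const.div (continuous_hyp hf τ) fun x => (hyp_pos (h0 x) hτ).ne'

theorem continuous_baseS (lam : ℝ) : Continuous (baseS lam) :=
  (continuous_pow 2).max continuous_const

theorem continuous_rad_fun (hlam : 0 < lam) (hτ : τ ≠ 0) :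
    (Continuous fun X => radT lam X τ) ∧ (Continuous fun X => radY lam X τ) ∧
      (Continuous fun X => radT' lam X τ) ∧ Continuous fun X => radY' lam X τ := by
  have hS := continuous_baseS lam
  have c1 := hS.sub (continuous_const (y := √lam))
  have c2 := hS.add (continuous_const (y := √lam))
  have c3 := hS.sub (continuous_pow 2)
  have k1 := continuous_hyp c1 τ
  have k2 := continuous_hyp c2 τ
  have k3 := continuous_hyp c3 τ
  have k4 := continuous_hyp hS τ
  have d1 := continuous_hypDeriv c1 (le_baseS lam) hτ
  have d2 := continuous_hypDeriv c2 (baseS_add_nonneg hlam) hτ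
  have d3 := continuous_hypDeriv c3 (le_baseS' lam) hτ
  have d4 := continuous_hypDeriv hS (fun X => (baseS_pos hlam X).le) hτ
  have h0 (X : ℝ) : hyp (baseS lam X) τ ≠ 0 := (hyp_pos (baseS_pos hlam X).le hτ).ne'
  exact ⟨k1.mul k2, k3.div k4 h0, (d1.mul k2).add (k1.mul d2),
    ((d3.mul k4).sub (k3.mul d4)).div (k4.pow 2) fun X => pow_ne_zero 2 (h0 X)⟩

end

/-! ### The parametrization of the level set by `τ` and the Euler angles -/

abbrev R4 : Type := EuclideanSpace ℝ (Fin 4)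

/-- The point of the level set with parameters `(τ, b, a, c)`. -/
def kap (lam X : ℝ) (u : R4) : R3 × R3 :=
  (radY lam X (u 0) • eulerU (u 1) (u 2) (u 3), radT lam X (u 0) • eulerV (u 1) (u 2) (u 3))

/-- The partial derivatives of `kap`. -/
def kapDeriv (lam X : ℝ) (u : R4) : Fin 4 → R3 × R3 :=
  ![(radY' lam X (u 0) • eulerU (u 1) (u 2) (u 3), radT' lam X (u 0) • eulerV (u 1) (u 2) (u 3)),
    (radY lam X (u 0) • eulerU' (u 1) (u 2) (u 3) 0, radT lam X (u 0) • eulerV' (u 1) (u 2) (u 3) 0),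
    (radY lam X (u 0) • eulerU' (u 1) (u 2) (u 3) 1, radT lam X (u 0) • eulerV' (u 1) (u 2) (u 3) 1),
    (radY lam X (u 0) • eulerU' (u 1) (u 2) (u 3) 2, radT lam X (u 0) • eulerV' (u 1) (u 2) (u 3) 2)]

section

variable {lam X : ℝ}

theorem norm_kap_fst (lam X : ℝ) (u : R4) : ‖(kap lam X u).1‖ = radY lam X (u 0) := by
  rw [kap, norm_smul, norm_eulerU, mul_one, Real.norm_of_nonneg (radY_nonneg _ _ _)]

theorem norm_kap_snd (lam X : ℝ) (u : R4) : ‖(kap lam X u).2‖ = radT lam X (u 0) := by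
  rw [kap, norm_smul, norm_eulerV, mul_one, Real.norm_of_nonneg (radT_nonneg _ _ _)]

/-- In terms of S = √(λ + |w|²) one has h = X/√S, so the fourth roots disappear. -/
theorem mem_K_iff_norm (hlam : 0 < lam) (hX : 0 ≤ X) {q : R3 × R3} {S : ℝ} (hS : 0 < S)
    (hq : lam + ‖q.2‖ ^ 2 = S ^ 2) :
    q ∈ K lam X 0 ↔ ‖q.1‖ ^ 2 = 1 - X ^ 2 / S ∧ inner ℝ q.1 q.2 = (0 : ℝ) := by
  have hh : hFun lam X 0 q.2 = X / √S := by
    rw [hFun_eq_iff hlam hX (by positivity)]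
    have h4 : √S ^ 4 = S ^ 2 := by rw [show √S ^ 4 = (√S ^ 2) ^ 2 by ring, Real.sq_sqrt hS.le]
    rw [div_pow, h4]
    field_simp
    linear_combination X ^ 4 * hq
  rw [mem_K, hh, div_pow, Real.sq_sqrt hS.le, mul_zero]

theorem kap_mem (hlam : 0 < lam) (hX : 0 ≤ X) (u : R4) : kap lam X u ∈ K lam X 0 := by
  have hS : 0 < baseS lam X + u 0 ^ 2 := by have := baseS_pos hlam X; positivity
  rw [mem_K_iff_norm hlam hX hS (by rw [norm_kap_snd]; exact radT_sq hlam X _), norm_kap_fst,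
    radY_sq hlam]
  refine ⟨rfl, ?_⟩
  rw [kap, inner_smul_left, inner_smul_right, inner_eulerU_eulerV]
  simp

theorem hasDerivAt_kap (hlam : 0 < lam) (X : ℝ) {u : R4} (hu : u 0 ≠ 0) (i : Fin 4) :
    HasDerivAt (fun s : ℝ => kap lam X (u + s • EuclideanSpace.single i 1)) (kapDeriv lam X u i) 0 := by
  have hU := hasDerivAt_eulerU (u 1) (u 2) (u 3)
  have hV := hasDerivAt_eulerV (u 1) (u 2) (u 3)
  fin_cases i
  · have e : (fun s : ℝ => kap lam X (u + s • EuclideanSpace.single 0 1)) = fun s =>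
        (radY lam X (u 0 + s) • eulerU (u 1) (u 2) (u 3), radT lam X (u 0 + s) • eulerV (u 1) (u 2) (u 3)) := by
      funext s; simp [kap]
    change HasDerivAt (fun s : ℝ => kap lam X (u + s • EuclideanSpace.single 0 1)) _ 0
    rw [e]
    exact ((hasDerivAt_radY hlam X hu).smul_const _).prodMk ((hasDerivAt_radT hlam X hu).smul_const _)
  · have e : (fun s : ℝ => kap lam X (u + s • EuclideanSpace.single 1 1)) = fun s =>
        (radY lam X (u 0) • eulerU (u 1 + s) (u 2) (u 3), radT lam X (u 0) • eulerV (u 1 + s) (u 2) (u 3)) := by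
      funext s; simp [kap]
    change HasDerivAt (fun s : ℝ => kap lam X (u + s • EuclideanSpace.single 1 1)) _ 0
    rw [e]
    exact (hU.1.fun_const_smul (radY lam X (u 0))).prodMk (hV.1.fun_const_smul (radT lam X (u 0)))
  · have e : (fun s : ℝ => kap lam X (u + s • EuclideanSpace.single 2 1)) = fun s =>
        (radY lam X (u 0) • eulerU (u 1) (u 2 + s) (u 3), radT lam X (u 0) • eulerV (u 1) (u 2 + s) (u 3)) := by
      funext s; simp [kap]
    change HasDerivAt (fun s : ℝ => kap lam X (u + s • EuclideanSpace.single 2 1)) _ 0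
    rw [e]
    exact (hU.2.1.fun_const_smul (radY lam X (u 0))).prodMk (hV.2.1.fun_const_smul (radT lam X (u 0)))
  · have e : (fun s : ℝ => kap lam X (u + s • EuclideanSpace.single 3 1)) = fun s =>
        (radY lam X (u 0) • eulerU (u 1) (u 2) (u 3 + s), radT lam X (u 0) • eulerV (u 1) (u 2) (u 3 + s)) := by
      funext s; simp [kap]
    change HasDerivAt (fun s : ℝ => kap lam X (u + s • EuclideanSpace.single 3 1)) _ 0
    rw [e]
    exact (hU.2.2.fun_const_smul (radY lam X (u 0))).prodMk (hV.2.2.fun_const_smul (radT lam X (u 0)))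

/-- The coordinate curves stay in K, where `levelMap` is constant. -/
theorem levelDeriv_kapDeriv (hlam : 0 < lam) (hX : 0 ≤ X) {u : R4} (hu : u 0 ≠ 0) (i : Fin 4) :
    levelDeriv lam X 0 (kap lam X u) (kapDeriv lam X u i) = 0 := by
  have h0 : kap lam X (u + (0 : ℝ) • EuclideanSpace.single i 1) = kap lam X u := by
    rw [zero_smul, add_zero]
  have h1 := (hasFDerivAt_levelMap (X := X) (E := 0) hlam
    (kap lam X (u + (0 : ℝ) • EuclideanSpace.single i 1))).comp_hasDerivAt (0 : ℝ) (hasDerivAt_kap hlam X hu i)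
  rw [h0] at h1
  have e : levelMap lam X 0 ∘ (fun s : ℝ => kap lam X (u + s • EuclideanSpace.single i 1)) = fun _ => 0 :=
    funext fun s => kap_mem hlam hX _
  rw [e] at h1
  exact h1.unique (hasDerivAt_const _ _)

/-- With r = |y| and t = |w|, the pairings reduce the value of *φ to 2(t'r + tr') · tr · sin b,
which is positive since t' > 0 and r' ≥ 0. -/
theorem starPhiEq_kap (hlam : 0 < lam) (hX : 0 ≤ X) {u : R4} (h0 : 0 < u 0)
    (hb : u 1 ∈ Ioo 0 Real.pi) : ∃ c > 0, StarPhiEq lam (theta lam X 0 (kap lam X u))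
      (fun i => vel lam X (kap lam X u) (kapDeriv lam X u i)) c := by
  have hs := Real.sin_pos_of_mem_Ioo hb
  have h1 := radT_pos hlam X h0.ne'
  have h2 := radY_pos hlam X h0.ne'
  have h3 := radT'_pos hlam X h0
  have h4 := radY'_nonneg hlam X h0
  refine ⟨_, ?_, starPhiEq_vel hlam (kap_mem hlam hX u) (kapDeriv lam X u)
    (levelDeriv_kapDeriv hlam hX h0.ne') _ fun i j => rfl⟩
  have huu := real_inner_self_eq_norm_sq (eulerU (u 1) (u 2) (u 3))
  have hvv := real_inner_self_eq_norm_sq (eulerV (u 1) (u 2) (u 3))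
  rw [norm_eulerU] at huu
  rw [norm_eulerV] at hvv
  have hU := inner_eulerU_eulerU' (u 1) (u 2) (u 3)
  have hV := inner_eulerV_eulerV' (u 1) (u 2) (u 3)
  have hVU := inner_eulerV'_eulerU' (u 1) (u 2) (u 3)
  have e2 : eulerU' (u 1) (u 2) (u 3) 2 = eulerV (u 1) (u 2) (u 3) := rfl
  have e3 : eulerV' (u 1) (u 2) (u 3) 2 = -eulerU (u 1) (u 2) (u 3) := rfl
  simp only [kapDeriv, Matrix.cons_val_zero, Matrix.cons_val_one, Matrix.cons_val, e2, e3,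
    inner_smul_left, inner_smul_right, inner_neg_left, huu, hvv, hU, hV,
    real_inner_comm (eulerV (u 1) (u 2) (u 3)) (eulerV' _ _ _ _), RCLike.conj_to_real]
  generalize radT lam X (u 0) = t at *
  generalize radY lam X (u 0) = r at *
  generalize radT' lam X (u 0) = t' at *
  generalize radY' lam X (u 0) = r' at *
  have key : 0 < 2 * (t' * r + t * r') * (t * r * Real.sin (u 1)) := by positivity
  refine key.trans_eq ?_
  linear_combination (2 * (t' * r + t * r') * (t * r)) * hVU

end

theorem exists_unit_smul (y : R3) : ∃ u : R3, ‖u‖ = 1 ∧ ‖y‖ • u = y := by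
  by_cases hy : y = 0
  · obtain ⟨u, hu, -⟩ := exists_unit_orthogonal (0 : R3) 0
    exact ⟨u, hu, by rw [hy, norm_zero, zero_smul]⟩
  · exact ⟨‖y‖⁻¹ • y, norm_smul_inv_norm hy, by rw [smul_smul, mul_inv_cancel₀ (norm_ne_zero_iff.2 hy), one_smul]⟩

theorem exists_orthonormal_smul {y w : R3} (h : inner ℝ y w = 0) :
    ∃ u v : R3, ‖u‖ = 1 ∧ ‖v‖ = 1 ∧ inner ℝ u v = 0 ∧ ‖y‖ • u = y ∧ ‖w‖ • v = w := by
  obtain ⟨u, hu, huy⟩ := exists_unit_smul y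
  obtain ⟨v, hv, hvw⟩ := exists_unit_smul w
  by_cases hy : y = 0
  · obtain ⟨u', hu', ho, -⟩ := exists_unit_orthogonal v v
    exact ⟨u', v, hu', hv, by rwa [real_inner_comm], by rw [hy, norm_zero, zero_smul], hvw⟩
  · by_cases hw : w = 0
    · obtain ⟨v', hv', ho, -⟩ := exists_unit_orthogonal u u
      exact ⟨u, v', hu, hv', ho, huy, by rw [hw, norm_zero, zero_smul]⟩
    · refine ⟨u, v, hu, hv, ?_, huy, hvw⟩
      rw [← huy, ← hvw, inner_smul_left, inner_smul_right] at h
      simpa [hy, hw] using h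

section

variable {lam X : ℝ}

/-- Since |y|² ≥ 0, S ≥ X², and always S ≥ √λ; hence S ≥ `baseS` and τ = √(S - `baseS`). The Euler
angles are those of the directions of y and w. -/
theorem exists_kap_eq (hlam : 0 < lam) (hX : 0 ≤ X) {q : R3 × R3} (hq : q ∈ K lam X 0) :
    ∃ u : R4, kap lam X u = q ∧ 0 ≤ u 0 ∧ u 1 ∈ Icc 0 Real.pi ∧ u 2 ∈ Ioc (-Real.pi) Real.pi ∧
      u 3 ∈ Ioc (-Real.pi) Real.pi := by
  obtain ⟨S, hS⟩ : ∃ S, S = √(lam + ‖q.2‖ ^ 2) := ⟨_, rfl⟩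
  have hS0 : 0 < S := by rw [hS]; positivity
  have hS2 : lam + ‖q.2‖ ^ 2 = S ^ 2 := by rw [hS, Real.sq_sqrt (by positivity)]
  obtain ⟨h1, h2⟩ := (mem_K_iff_norm hlam hX hS0 hS2).1 hq
  have hSX : X ^ 2 ≤ S := by
    have : X ^ 2 / S ≤ 1 := by linarith [sq_nonneg ‖q.1‖]
    rwa [div_le_one hS0] at this
  have hSl : √lam ≤ S := by rw [hS]; exact Real.sqrt_le_sqrt (by linarith [sq_nonneg ‖q.2‖])
  have hSb : 0 ≤ S - baseS lam X := sub_nonneg.2 (max_le hSX hSl)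
  obtain ⟨U, V, hU, hV, hUV, hqU, hqV⟩ := exists_orthonormal_smul h2
  obtain ⟨b, hb, a, ha, c, hc, rfl, rfl⟩ := exists_euler hU hV hUV
  have hτ : baseS lam X + √(S - baseS lam X) ^ 2 = S := by rw [Real.sq_sqrt hSb]; ring
  refine ⟨!₂[√(S - baseS lam X), b, a, c], ?_, Real.sqrt_nonneg _, hb, ha, hc⟩
  have e1 : radY lam X √(S - baseS lam X) = ‖q.1‖ := by
    rw [← sq_eq_sq₀ (radY_nonneg _ _ _) (norm_nonneg _), radY_sq hlam, hτ, h1]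
  have e2 : radT lam X √(S - baseS lam X) = ‖q.2‖ := by
    rw [← sq_eq_sq₀ (radT_nonneg _ _ _) (norm_nonneg _)]
    have := radT_sq hlam X √(S - baseS lam X)
    rw [hτ] at this
    linarith
  change (radY lam X √(S - baseS lam X) • eulerU b a c, radT lam X √(S - baseS lam X) • eulerV b a c) = q
  rw [e1, e2, hqU, hqV]

/-- The domain of the parameters `(τ, b, a, c)`. -/
def eulerBox : Set R4 := {u | 0 < u 0 ∧ u 1 ∈ Ioo 0 Real.pi ∧ u 2 ∈ Ioo (-Real.pi) Real.pi ∧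
  u 3 ∈ Ioo (-Real.pi) Real.pi}

theorem isOpen_eulerBox : IsOpen eulerBox := by
  have h (i : Fin 4) : Continuous fun u : R4 => u i := by fun_prop
  exact (isOpen_Ioi.preimage (h 0)).inter ((isOpen_Ioo.preimage (h 1)).inter
    ((isOpen_Ioo.preimage (h 2)).inter (isOpen_Ioo.preimage (h 3))))

theorem injOn_kap (hlam : 0 < lam) (X : ℝ) : InjOn (kap lam X) eulerBox := by
  intro u hu u' hu' h
  have h1 := congrArg Prod.fst h
  have h2 := congrArg Prod.snd h
  have n2 : radT lam X (u 0) = radT lam X (u' 0) := by rw [← norm_kap_snd, h, norm_kap_snd]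
  have hτ : u 0 = u' 0 := by
    have e1 := radT_sq hlam X (u 0)
    have e2 := radT_sq hlam X (u' 0)
    rw [n2, e2] at e1
    have hb := baseS_pos hlam X
    have := (sq_eq_sq₀ (by positivity) (by positivity)).1 e1
    exact ((sq_eq_sq₀ hu'.1.le hu.1.le).1 (by linarith)).symm
  simp only [kap, ← hτ] at h1 h2
  have k1 := smul_right_injective R3 (radY_pos hlam X hu.1.ne').ne' h1
  have k2 := smul_right_injective R3 (radT_pos hlam X hu.1.ne').ne' h2
  obtain ⟨q1, q2, q3⟩ := euler_injective hu.2.1 hu'.2.1 hu.2.2.1 hu'.2.2.1 hu.2.2.2 hu'.2.2.2 k1 k2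
  ext i
  fin_cases i
  exacts [hτ, q1, q2, q3]

section

variable {G : Type*} [NormedAddCommGroup G] [NormedSpace ℝ G] {b a c : G → ℝ} {n : WithTop ℕ∞}
  {s : Set G}

theorem contDiffOn_eulerU (hb : ContDiffOn ℝ n b s) (ha : ContDiffOn ℝ n a s)
    (hc : ContDiffOn ℝ n c s) : ContDiffOn ℝ n (fun g => eulerU (b g) (a g) (c g)) s := by
  rw [contDiffOn_euclidean]
  intro i
  fin_cases i
  · exact (ha.cos.mul hc.cos).sub ((ha.sin.mul hb.cos).mul hc.sin)
  · exact (ha.sin.mul hc.cos).add ((ha.cos.mul hb.cos).mul hc.sin)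
  · exact hb.sin.mul hc.sin

theorem contDiffOn_eulerV (hb : ContDiffOn ℝ n b s) (ha : ContDiffOn ℝ n a s)
    (hc : ContDiffOn ℝ n c s) : ContDiffOn ℝ n (fun g => eulerV (b g) (a g) (c g)) s := by
  rw [contDiffOn_euclidean]
  intro i
  fin_cases i
  · exact (ha.cos.mul hc.sin).neg.sub ((ha.sin.mul hb.cos).mul hc.cos)
  · exact (ha.sin.mul hc.sin).neg.add ((ha.cos.mul hb.cos).mul hc.cos)
  · exact hb.sin.mul hc.cos

end

theorem contDiff_coord (i : Fin 4) : ContDiff ℝ ∞ fun u : R4 => u i := by fun_prop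

theorem contDiffOn_kap (hlam : 0 < lam) (X : ℝ) : ContDiffOn ℝ ∞ (kap lam X) {u | 0 < u 0} := by
  have h (i : Fin 4) : ContDiffOn ℝ ∞ (fun u : R4 => u i) {u | 0 < u 0} := (contDiff_coord i).contDiffOn
  exact (((contDiffOn_radY hlam X).comp (h 0) fun u hu => hu).smul
    (contDiffOn_eulerU (h 1) (h 2) (h 3))).prodMk
    (((contDiffOn_radT hlam X).comp (h 0) fun u hu => hu).smul (contDiffOn_eulerV (h 1) (h 2) (h 3)))

/-- The coordinate hyperplanes of `ℝ⁴` have dimension at most 3. -/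
theorem dimH_hyperplane_le (i : Fin 4) (k : ℝ) : dimH {u : R4 | u i = k} ≤ 3 := by
  let f : R3 → R4 := fun v => WithLp.toLp 2 (i.insertNth k (fun j => v j) : Fin 4 → ℝ)
  have hf : ContDiff ℝ 1 f := by
    rw [contDiff_euclidean]
    intro j
    change ContDiff ℝ 1 fun v : R3 => (i.insertNth k (fun j => v j) : Fin 4 → ℝ) j
    refine Fin.succAboveCases i ?_ (fun j => ?_) j
    · simp only [Fin.insertNth_apply_same]; exact contDiff_const
    · simp only [Fin.insertNth_apply_succAbove]; fun_prop
  refine (dimH_mono ?_).trans (hf.dimH_range_le.trans_eq (by simp))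
  intro u hu
  refine ⟨WithLp.toLp 2 fun j => u (i.succAbove j), ?_⟩
  ext j
  change (i.insertNth k (fun j => u (i.succAbove j)) : Fin 4 → ℝ) j = u j
  refine Fin.succAboveCases i ?_ (fun j => ?_) j
  · rw [Fin.insertNth_apply_same]; exact (mem_ofPred_eq ▸ hu).symm
  · rw [Fin.insertNth_apply_succAbove]

/-- Almost all of the level set is parametrized by `kap`. -/
theorem dimH_compl_kap_le (hlam : 0 < lam) (hX : 0 ≤ X) :
    dimH (K lam X 0 \ kap lam X '' eulerBox) ≤ 3 := by
  -- The faces where an Euler angle reaches an end of its range.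
  let H : Set R4 := {u | u 1 = 0} ∪ {u | u 1 = Real.pi} ∪ {u | u 2 = Real.pi} ∪ {u | u 3 = Real.pi}
  -- The radii need not be differentiable at τ = 0, so the face τ = 0 is treated as the image under
  -- this smooth map with radii frozen at τ = 0.
  let k₀ : R4 → R3 × R3 := fun u =>
    (radY lam X 0 • eulerU (u 1) (u 2) (u 3), radT lam X 0 • eulerV (u 1) (u 2) (u 3))
  have hk₀ : ContDiffOn ℝ ∞ k₀ univ := by
    have h (i : Fin 4) : ContDiffOn ℝ ∞ (fun u : R4 => u i) univ := (contDiff_coord i).contDiffOn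
    exact ((contDiffOn_eulerU (h 1) (h 2) (h 3)).const_smul _).prodMk
      ((contDiffOn_eulerV (h 1) (h 2) (h 3)).const_smul _)
  have hsub : K lam X 0 \ kap lam X '' eulerBox ⊆
      k₀ '' {u | u 0 = 0} ∪ kap lam X '' (H ∩ {u | 0 < u 0}) := by
    rintro q ⟨hq, hq'⟩
    obtain ⟨u, rfl, h0, h1, h2, h3⟩ := exists_kap_eq hlam hX hq
    rcases h0.eq_or_lt with h | h
    · exact Or.inl ⟨u, h.symm, by simp only [k₀, kap, ← h]⟩
    · refine Or.inr ⟨u, ⟨?_, h⟩, rfl⟩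
      by_contra hH
      simp only [H, mem_union, mem_ofPred_eq, not_or] at hH
      exact hq' ⟨u, ⟨h, ⟨h1.1.lt_of_ne' hH.1.1.1, h1.2.lt_of_ne hH.1.1.2⟩,
        ⟨h2.1, h2.2.lt_of_ne hH.1.2⟩, h3.1, h3.2.lt_of_ne hH.2⟩, rfl⟩
  have hconv : Convex ℝ {u : R4 | 0 < u 0} :=
    (convex_Ioi (0 : ℝ)).linear_preimage (EuclideanSpace.proj (0 : Fin 4) : R4 →L[ℝ] ℝ).toLinearMap
  have hH : dimH H ≤ 3 := by
    simp only [H, dimH_union]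
    exact max_le (max_le (max_le (dimH_hyperplane_le _ _) (dimH_hyperplane_le _ _))
      (dimH_hyperplane_le _ _)) (dimH_hyperplane_le _ _)
  refine (dimH_mono hsub).trans ?_
  rw [dimH_union]
  refine max_le ?_ ?_
  · exact ((hk₀.of_le (by simp)).dimH_image_le convex_univ (subset_univ _)).trans
      (dimH_hyperplane_le _ _)
  · exact (((contDiffOn_kap hlam X).of_le (by simp)).dimH_image_le hconv inter_subset_right).trans
      ((dimH_mono inter_subset_left).trans hH)

end

/-! ### The parametrizations of `M` and the integrands of currents -/

/-- The family of all parametrizations, as a smooth map on `ℝ⁸`; its arguments are `X`, the cosine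
and the sine of a rotation, `|y|`, `|w|`, and the Euler angles. -/
def param (lam : ℝ) (z : Fin 8 → ℝ) : Amb :=
  lift (rot34 (z 1) (z 2))
    (theta lam (z 0) 0 (z 3 • eulerU (z 5) (z 6) (z 7), z 4 • eulerV (z 5) (z 6) (z 7)))

/-- The arguments of `param` as functions of `(τ, b, a, c)`. -/
def paramArg (lam X c d : ℝ) (u : R4) : Fin 8 → ℝ :=
  ![X, c, d, radY lam X (u 0), radT lam X (u 0), u 1, u 2, u 3]

/-- The partial derivatives of `paramArg`. -/
def argDeriv (r t : ℝ) : Fin 4 → Fin 8 → ℝ :=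
  ![![0, 0, 0, r, t, 0, 0, 0], ![0, 0, 0, 0, 0, 1, 0, 0], ![0, 0, 0, 0, 0, 0, 1, 0],
    ![0, 0, 0, 0, 0, 0, 0, 1]]

/-- The parametrization of a component of `M`. -/
def piece (lam P Q : ℝ) (u : R4) : Amb := emb lam P Q 0 (kap lam (rad P Q) u)

/-- The value of a 4-form on the velocities of `param`. -/
def integrand (lam : ℝ) (α : Amb → Amb [⋀^Fin 4]→L[ℝ] ℝ) (z : Fin 8 → ℝ) (r t : ℝ) : ℝ :=
  α (param lam z) fun i => fderiv ℝ (param lam) z (argDeriv r t i)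

/-- The value of a 4-form on the velocities of a parametrization of `M`. -/
def pieceForm (lam : ℝ) (α : Amb → Amb [⋀^Fin 4]→L[ℝ] ℝ) (P Q : ℝ) (u : R4) : ℝ :=
  α (piece lam P Q u) fun i => fderiv ℝ (piece lam P Q) u (EuclideanSpace.single i 1)

section

variable {lam : ℝ}

/-- Treating X, the rotation and the two radii as independent variables makes the family smooth
everywhere; all singular behaviour is confined to `radY` and `radT`. -/
theorem contDiff_param (hlam : 0 < lam) : ContDiff ℝ ∞ (param lam) := by
  have h (i : Fin 8) : ContDiffOn ℝ ∞ (fun z : Fin 8 → ℝ => z i) univ :=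
    (contDiff_apply ℝ ℝ i).contDiffOn
  have hU := (h 3).smul (contDiffOn_eulerU (h 5) (h 6) (h 7))
  have hV := (h 4).smul (contDiffOn_eulerV (h 5) (h 6) (h 7))
  have hb : ContDiffOn ℝ ∞ (fun z : Fin 8 → ℝ =>
      (lam + 0 ^ 2 + ‖z 4 • eulerV (z 5) (z 6) (z 7)‖ ^ 2) ^ (-(1 / 4) : ℝ)) univ :=
    (contDiffOn_const.add (hV.norm_sq ℝ)).rpow_const_of_ne fun z _ => (base_pos hlam 0 _).ne'
  have hx := contDiffOn_xVec hU ((h 0).mul hb)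
  exact contDiffOn_univ.1 (contDiffOn_lift_rot34 (h 1) (h 2)
    (hx.prodMk (contDiffOn_asdForm hx (contDiffOn_xVec hV contDiffOn_const))))

theorem contDiffOn_piece (hlam : 0 < lam) (P Q : ℝ) :
    ContDiffOn ℝ ∞ (piece lam P Q) {u | 0 < u 0} :=
  (contDiff_emb hlam P Q 0).comp_contDiffOn (contDiffOn_kap hlam _)

theorem isOpen_pos : IsOpen {u : R4 | 0 < u 0} :=
  isOpen_Ioi.preimage (contDiff_coord 0).continuous

theorem differentiableAt_piece (hlam : 0 < lam) (P Q : ℝ) {u : R4} (hu : 0 < u 0) :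
    DifferentiableAt ℝ (piece lam P Q) u :=
  ((contDiffOn_piece hlam P Q).contDiffAt (isOpen_pos.mem_nhds hu)).differentiableAt (by simp)

theorem fderiv_piece (hlam : 0 < lam) (P Q : ℝ) {u : R4} (hu : 0 < u 0) (i : Fin 4) :
    fderiv ℝ (piece lam P Q) u (EuclideanSpace.single i 1) =
      lift (argRot P Q) (vel lam (rad P Q) (kap lam (rad P Q) u) (kapDeriv lam (rad P Q) u i)) := by
  rw [← (differentiableAt_piece hlam P Q hu).lineDeriv_eq_fderiv]
  refine HasLineDerivAt.lineDeriv ?_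
  have h0 : kap lam (rad P Q) (u + (0 : ℝ) • EuclideanSpace.single i 1) = kap lam (rad P Q) u := by
    rw [zero_smul, add_zero]
  have h := velocity_theta (X := rad P Q) (E := 0) hlam
    (γ := fun s => kap lam (rad P Q) (u + s • EuclideanSpace.single i 1))
    (v := kapDeriv lam (rad P Q) u i) (by rw [h0]; exact kap_mem hlam (rad_nonneg P Q) u)
    (by rw [h0]; exact levelDeriv_kapDeriv hlam (rad_nonneg P Q) hu.ne' i)
    (hasDerivAt_kap hlam _ hu.ne' i)
  simp only [h0] at h
  exact hasDerivAt_lift _ h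

theorem hasDerivAt_paramArg (hlam : 0 < lam) (X c d : ℝ) {u : R4} (hu : u 0 ≠ 0) (i : Fin 4) :
    HasDerivAt (fun s : ℝ => paramArg lam X c d (u + s • EuclideanSpace.single i 1))
      (argDeriv (radY' lam X (u 0)) (radT' lam X (u 0)) i) 0 := by
  have hY := hasDerivAt_radY hlam X hu
  have hT := hasDerivAt_radT hlam X hu
  have h1 (x : ℝ) : HasDerivAt (fun s : ℝ => x + s) 1 0 := (hasDerivAt_id (0 : ℝ)).const_add x
  rw [hasDerivAt_pi]
  intro j
  fin_cases i <;> fin_cases j <;>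
    simp [paramArg, argDeriv, hY, hT, h1, hasDerivAt_const]

/-- A second expression for the velocities: `fderiv_piece` serves the orientation, this one bounds
and continuity in (P, Q). -/
theorem fderiv_piece' (hlam : 0 < lam) (P Q : ℝ) {u : R4} (hu : 0 < u 0) (i : Fin 4) :
    fderiv ℝ (piece lam P Q) u (EuclideanSpace.single i 1) =
      fderiv ℝ (param lam) (paramArg lam (rad P Q) (argCos P Q) (argSin P Q) u)
        (argDeriv (radY' lam (rad P Q) (u 0)) (radT' lam (rad P Q) (u 0)) i) := by
  rw [← (differentiableAt_piece hlam P Q hu).lineDeriv_eq_fderiv]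
  refine HasLineDerivAt.lineDeriv ?_
  have h := hasDerivAt_paramArg hlam (rad P Q) (argCos P Q) (argSin P Q) hu.ne' i
  have h0 : u + (0 : ℝ) • EuclideanSpace.single i 1 = u := by rw [zero_smul, add_zero]
  have hd : DifferentiableAt ℝ (param lam) (paramArg lam (rad P Q) (argCos P Q) (argSin P Q)
      (u + (0 : ℝ) • EuclideanSpace.single i 1)) :=
    (contDiff_param hlam).differentiable (by simp) _
  have h2 := hd.hasFDerivAt.comp_hasDerivAt (0 : ℝ) h
  rw [h0] at h2
  exact h2

theorem integrand_eq (hlam : 0 < lam) (α : Amb → Amb [⋀^Fin 4]→L[ℝ] ℝ) (P Q : ℝ) {u : R4}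
    (hu : 0 < u 0) :
    pieceForm lam α P Q u =
      integrand lam α (paramArg lam (rad P Q) (argCos P Q) (argSin P Q) u)
        (radY' lam (rad P Q) (u 0)) (radT' lam (rad P Q) (u 0)) := by
  simp only [pieceForm, fderiv_piece' hlam P Q hu]
  rfl

theorem starPhiEq_piece (hlam : 0 < lam) (P Q : ℝ) {u : R4} (hu : u ∈ eulerBox) :
    ∃ c > 0, StarPhiEq lam (piece lam P Q u)
      (fun i => fderiv ℝ (piece lam P Q) u (EuclideanSpace.single i 1)) c := by
  obtain ⟨c, hc, h⟩ := starPhiEq_kap hlam (rad_nonneg P Q) hu.1 hu.2.1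
  refine ⟨c, hc, ?_⟩
  simp only [fderiv_piece hlam P Q hu.1]
  exact (argRot_isSO P Q).starPhiEq_lift (theta_mem_asd (kap_mem hlam (rad_nonneg P Q) u)).1 h

theorem injOn_piece (hlam : 0 < lam) (P Q : ℝ) : InjOn (piece lam P Q) eulerBox :=
  (Function.LeftInverse.injective (embInv_emb lam P Q 0)).comp_injOn (injOn_kap hlam _)

/-- The integral of a 4-form over a component of `M`. -/
def pieceIntegral (lam : ℝ) (α : Amb → Amb [⋀^Fin 4]→L[ℝ] ℝ) (P Q : ℝ) : ℝ :=
  ∫ u in eulerBox, pieceForm lam α P Q u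

/-- Each root contributes one positively oriented piece. Pieces are disjoint because their axis
values differ, and what is left over is a finite union of smooth images of sets of dimension at most
3. -/
theorem integralEq_M (hlam : 0 < lam) {C D : ℝ} {n : ℕ} {P Q : Fin n → ℝ} (h : IsRootFamily C D P Q)
    (α : Amb → Amb [⋀^Fin 4]→L[ℝ] ℝ)
    (hα : ∀ i, IntegrableOn (pieceForm lam α (P i) (Q i)) eulerBox) :
    IntegralEq lam (M lam C D 0) α (∑ i, pieceIntegral lam α (P i) (Q i)) := by
  have hK (i : Fin n) (u : R4) : kap lam (rad (P i) (Q i)) u ∈ K lam (rad (P i) (Q i)) 0 :=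
    kap_mem hlam (rad_nonneg _ _) u
  refine ⟨n, fun _ => eulerBox, fun i => piece lam (P i) (Q i), fun i => ⟨isOpen_eulerBox,
    (contDiffOn_piece hlam _ _).mono fun u hu => hu.1, injOn_piece hlam _ _,
    fun u _ => emb_mem_M hlam h i (hK i u), fun u hu => starPhiEq_piece hlam _ _ hu, hα i⟩, ?_, ?_, rfl⟩
  · intro i j hij
    refine Set.disjoint_left.2 ?_
    rintro _ ⟨u, -, rfl⟩ ⟨u', -, he⟩
    refine hij (h.injective ?_)
    have h1 := axisValues_emb hlam (hK i u)
    have h2 := axisValues_emb hlam (hK j u')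
    change emb lam (P j) (Q j) 0 _ = emb lam (P i) (Q i) 0 _ at he
    rw [he, h1] at h2
    exact h2
  · have hsub : M lam C D 0 \ ⋃ i, piece lam (P i) (Q i) '' eulerBox ⊆ ⋃ i, emb lam (P i) (Q i) 0 ''
        (K lam (rad (P i) (Q i)) 0 \ kap lam (rad (P i) (Q i)) '' eulerBox) := by
      rintro p ⟨hp, hp'⟩
      obtain ⟨i, hi⟩ := exists_index hlam h hp
      obtain ⟨q, hq, rfl⟩ := exists_emb_eq_of_mem_M hlam hp hi
      refine mem_iUnion.2 ⟨i, q, ⟨hq, ?_⟩, rfl⟩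
      rintro ⟨u, hu, rfl⟩
      exact hp' (mem_iUnion.2 ⟨i, u, hu, rfl⟩)
    refine ((dimH_mono hsub).trans ?_).trans_lt (b := 3) (by norm_num)
    rw [dimH_iUnion]
    exact iSup_le fun i => ((((contDiff_emb hlam (P i) (Q i) 0).of_le (by simp)).contDiffOn).dimH_image_le
      convex_univ (subset_univ _)).trans (dimH_compl_kap_le hlam (rad_nonneg _ _))

end

/-! ### Convergence of currents -/

section

variable {lam : ℝ} {α : Amb → Amb [⋀^Fin 4]→L[ℝ] ℝ}

theorem continuous_argDeriv (i : Fin 4) : Continuous fun x : ℝ × ℝ => argDeriv x.1 x.2 i := by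
  refine continuous_pi fun j => ?_
  fin_cases i <;> fin_cases j <;> simp [argDeriv] <;> fun_prop

theorem continuous_integrand (hlam : 0 < lam) (hα : Continuous α) :
    Continuous fun x : (Fin 8 → ℝ) × ℝ × ℝ => integrand lam α x.1 x.2.1 x.2.2 := by
  refine Continuous.eval ?_ (continuous_pi fun i => ?_)
  · exact hα.comp ((contDiff_param hlam).continuous.comp continuous_fst)
  · exact (((contDiff_param hlam).continuous_fderiv (by simp)).comp continuous_fst).clm_apply
      ((continuous_argDeriv i).comp continuous_snd)

theorem rSq_piece (P Q : ℝ) (hlam : 0 < lam) (u : R4) :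
    rSq (piece lam P Q u) = radT lam (rad P Q) (u 0) ^ 2 := by
  rw [piece, emb, (argRot_isSO P Q).rSq_lift, rSq_theta (kap_mem hlam (rad_nonneg P Q) u),
    norm_kap_snd]
  ring

theorem continuousOn_pieceForm (hlam : 0 < lam) (hα : Continuous α) (P Q : ℝ) :
    ContinuousOn (pieceForm lam α P Q) eulerBox := by
  have h := contDiffOn_piece hlam P Q
  have h' := h.continuousOn_fderiv_of_isOpen isOpen_pos (by simp)
  refine ContinuousOn.mono (ContinuousOn.eval ?_ (continuousOn_pi.2 fun i => ?_))
    (fun u hu => hu.1 : eulerBox ⊆ {u | 0 < u 0})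
  · exact hα.comp_continuousOn h.continuousOn
  · exact h'.clm_apply continuousOn_const

theorem abs_arg_le (P Q : ℝ) : |argCos P Q| ≤ 1 ∧ |argSin P Q| ≤ 1 := by
  have h := argCos_sq_add_argSin_sq P Q
  exact ⟨(sq_le_one_iff_abs_le_one _).1 (by linarith [sq_nonneg (argSin P Q)]),
    (sq_le_one_iff_abs_le_one _).1 (by linarith [sq_nonneg (argCos P Q)])⟩

/-- The parameters of the part of `M` with `τ ≤ k`. -/
def cutoffBox (k : ℝ) : Set R4 := WithLp.toLp 2 '' Icc ![0, 0, -Real.pi, -Real.pi] ![k, Real.pi, Real.pi, Real.pi]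

theorem isCompact_cutoffBox (k : ℝ) : IsCompact (cutoffBox k) :=
  isCompact_Icc.image (PiLp.continuous_toLp 2 _)

theorem mem_cutoffBox {k : ℝ} {u : R4} (hu : u ∈ eulerBox) (hk : u 0 ≤ k) : u ∈ cutoffBox k := by
  refine ⟨u.ofLp, ⟨?_, ?_⟩, rfl⟩ <;> intro i <;> fin_cases i
  exacts [hu.1.le, hu.2.1.1.le, hu.2.2.1.1.le, hu.2.2.2.1.le, hk, hu.2.1.2.le, hu.2.2.1.2.le,
    hu.2.2.2.2.le]

/-- For bounded X and τ all arguments of the integrand, the derivatives of the radii included, stay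
in one compact box. -/
theorem exists_arg_bound (hlam : 0 < lam) (R k : ℝ) : ∃ Z : Set ((Fin 8 → ℝ) × ℝ × ℝ), IsCompact Z ∧
    ∀ P Q : ℝ, rad P Q ≤ R → ∀ u ∈ eulerBox, u 0 ≤ k →
      (paramArg lam (rad P Q) (argCos P Q) (argSin P Q) u, radY' lam (rad P Q) (u 0),
        radT' lam (rad P Q) (u 0)) ∈ Z := by
  -- m bounds the largest of the `hyp` factors, since `baseS` ≤ X² + √λ.
  obtain ⟨m, hm⟩ : ∃ m, m = √(R ^ 2 + √lam + √lam + k ^ 2) := ⟨_, rfl⟩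
  refine ⟨Icc ![0, -1, -1, 0, 0, 0, -Real.pi, -Real.pi]
      ![R, 1, 1, 1, m ^ 2, Real.pi, Real.pi, Real.pi] ×ˢ (Icc 0 (m / √lam) ×ˢ Icc 0 (2 * m)),
    isCompact_Icc.prod (isCompact_Icc.prod isCompact_Icc), ?_⟩
  intro P Q hR u hu hk
  have hX := rad_nonneg P Q
  obtain ⟨h1, h2⟩ := abs_arg_le P Q
  rw [abs_le] at h1 h2
  have hu0 := hu.1
  generalize rad P Q = X at *
  have hm0 : hyp (baseS lam X + √lam) (u 0) ≤ m := by
    rw [hm]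
    refine Real.sqrt_le_sqrt ?_
    have e1 : baseS lam X ≤ X ^ 2 + √lam :=
      max_le (by linarith [Real.sqrt_nonneg lam]) (by linarith [sq_nonneg X])
    have e2 : X ^ 2 ≤ R ^ 2 := pow_le_pow_left₀ hX hR 2
    have e3 : u 0 ^ 2 ≤ k ^ 2 := pow_le_pow_left₀ hu0.le hk 2
    linarith
  have hT : radT lam X (u 0) ≤ m ^ 2 :=
    (radT_le lam X _).trans (pow_le_pow_left₀ (hyp_nonneg _ _) hm0 2)
  refine ⟨⟨?_, ?_⟩, ⟨radY'_nonneg hlam X hu0, (radY'_le hlam X hu0).trans ?_⟩,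
    (radT'_pos hlam X hu0).le, (radT'_le hlam X hu0).trans (by linarith)⟩
  · intro i
    fin_cases i
    exacts [hX, h1.1, h2.1, radY_nonneg _ _ _, radT_nonneg _ _ _, hu.2.1.1.le, hu.2.2.1.1.le,
      hu.2.2.2.1.le]
  · intro i
    fin_cases i
    exacts [hR, h1.2, h2.2, radY_le_one _ _ _, hT, hu.2.1.2.le, hu.2.2.1.2.le, hu.2.2.2.2.le]
  · exact div_le_div_of_nonneg_right hm0 (Real.sqrt_nonneg _)

/-- r² is bounded by some T on the support, while r = |w| ≥ τ² on the parametrized set; so τ > 1 +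
|T| lies outside the support. -/
theorem exists_cutoff (hlam : 0 < lam) (hs : HasCompactSupport α) :
    ∃ k, ∀ P Q : ℝ, ∀ u : R4, k < u 0 → α (piece lam P Q u) = 0 := by
  obtain ⟨T, hT⟩ := (hs.isCompact.image continuous_rSq).bddAbove
  refine ⟨1 + |T|, fun P Q u hu => ?_⟩
  by_contra h
  have h1 := hT ⟨_, subset_tsupport _ h, rfl⟩
  rw [rSq_piece P Q hlam] at h1
  have h2 := le_radT hlam (rad P Q) (u 0)
  have h3 : 1 + |T| ≤ u 0 ^ 2 := by nlinarith [abs_nonneg T]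
  nlinarith [abs_nonneg T, le_abs_self T]

/-- The dominating function is a constant on a compact box of parameters, from compactness of the
arguments and the cutoff in τ. -/
theorem exists_bound (hlam : 0 < lam) (hα : Continuous α) (hs : HasCompactSupport α) (R : ℝ) :
    ∃ g : R4 → ℝ, Integrable g ∧ ∀ P Q : ℝ, rad P Q ≤ R → ∀ u ∈ eulerBox,
      ‖pieceForm lam α P Q u‖ ≤ g u := by
  obtain ⟨k, hk⟩ := exists_cutoff hlam hs
  obtain ⟨Z, hZ, hmem⟩ := exists_arg_bound hlam R k
  obtain ⟨B, hB⟩ := hZ.exists_bound_of_continuousOn (continuous_integrand hlam hα).continuousOn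
  refine ⟨(cutoffBox k).indicator fun _ => |B|, ?_, fun P Q hR u hu => ?_⟩
  · rw [integrable_indicator_iff (isCompact_cutoffBox k).measurableSet]
    exact integrableOn_const (isCompact_cutoffBox k).measure_lt_top.ne
  · by_cases h : u 0 ≤ k
    · rw [indicator_of_mem (mem_cutoffBox hu h), integrand_eq hlam α P Q hu.1]
      exact (hB _ (hmem P Q hR u hu h)).trans (le_abs_self B)
    · rw [pieceForm, hk P Q u (not_le.1 h)]
      simpa using indicator_nonneg (fun _ _ => abs_nonneg B) u

theorem integrableOn_piece (hlam : 0 < lam) (hα : Continuous α) (hs : HasCompactSupport α) (P Q : ℝ) :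
    IntegrableOn (pieceForm lam α P Q) eulerBox := by
  obtain ⟨g, hg, h⟩ := exists_bound hlam hα hs (rad P Q)
  exact hg.integrableOn.mono' ((continuousOn_pieceForm hlam hα P Q).aestronglyMeasurable
    isOpen_eulerBox.measurableSet)
    ((ae_restrict_iff' isOpen_eulerBox.measurableSet).2 (Eventually.of_forall (h P Q le_rfl)))

theorem continuous_rad : Continuous fun p : ℝ × ℝ => rad p.1 p.2 :=
  ((continuous_fst.pow 2).add (continuous_snd.pow 2)).sqrt

theorem continuousAt_argCos {p : ℝ × ℝ} (hp : rad p.1 p.2 ≠ 0) :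
    ContinuousAt (fun p : ℝ × ℝ => argCos p.1 p.2) p := by
  have h : ContinuousAt (fun p : ℝ × ℝ => p.1 / rad p.1 p.2) p :=
    continuousAt_fst.div continuous_rad.continuousAt hp
  refine h.congr ?_
  filter_upwards [continuous_rad.continuousAt.eventually_ne hp] with q hq
  rw [argCos, if_neg hq]

theorem continuousAt_argSin {p : ℝ × ℝ} (hp : rad p.1 p.2 ≠ 0) :
    ContinuousAt (fun p : ℝ × ℝ => argSin p.1 p.2) p :=
  continuousAt_snd.div continuous_rad.continuousAt hp

theorem continuousAt_paramArg (hlam : 0 < lam) {p : ℝ × ℝ} (hp : rad p.1 p.2 ≠ 0) {u : R4}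
    (hu : u 0 ≠ 0) : ContinuousAt (fun q : ℝ × ℝ =>
      paramArg lam (rad q.1 q.2) (argCos q.1 q.2) (argSin q.1 q.2) u) p := by
  obtain ⟨c1, c2, -, -⟩ := continuous_rad_fun hlam hu
  refine continuousAt_pi.2 fun i => ?_
  fin_cases i
  exacts [continuous_rad.continuousAt, continuousAt_argCos hp, continuousAt_argSin hp,
    (c2.comp continuous_rad).continuousAt, (c1.comp continuous_rad).continuousAt,
    continuousAt_const, continuousAt_const, continuousAt_const]

theorem continuousAt_integrand (hlam : 0 < lam) (hα : Continuous α) {p : ℝ × ℝ}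
    {f : ℝ × ℝ → Fin 8 → ℝ} {r t : ℝ × ℝ → ℝ} (hf : ContinuousAt f p) (hr : ContinuousAt r p)
    (ht : ContinuousAt t p) : ContinuousAt (fun q => integrand lam α (f q) (r q) (t q)) p :=
  ContinuousAt.comp (f := fun q => (f q, r q, t q)) (x := p)
    (continuous_integrand hlam hα).continuousAt (hf.prodMk (hr.prodMk ht))

theorem continuousAt_pieceForm (hlam : 0 < lam) (hα : Continuous α) {p : ℝ × ℝ}
    (hp : rad p.1 p.2 ≠ 0) {u : R4} (hu : 0 < u 0) :
    ContinuousAt (fun q : ℝ × ℝ => pieceForm lam α q.1 q.2 u) p := by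
  obtain ⟨-, -, c3, c4⟩ := continuous_rad_fun hlam hu.ne'
  have h3 : ContinuousAt (fun q : ℝ × ℝ => radT' lam (rad q.1 q.2) (u 0)) p :=
    (c3.comp continuous_rad).continuousAt
  have h4 : ContinuousAt (fun q : ℝ × ℝ => radY' lam (rad q.1 q.2) (u 0)) p :=
    (c4.comp continuous_rad).continuousAt
  simp only [integrand_eq hlam α _ _ hu]
  exact continuousAt_integrand hlam hα (continuousAt_paramArg hlam hp hu.ne') h4 h3

/-- Dominated convergence. The singular value rad² = √λ is not exceptional; only (P, Q) = (0, 0) is,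
where the rotation angle is discontinuous. -/
theorem continuousAt_pieceIntegral (hlam : 0 < lam) (hα : Continuous α) (hs : HasCompactSupport α)
    {p : ℝ × ℝ} (hp : rad p.1 p.2 ≠ 0) :
    ContinuousAt (fun p : ℝ × ℝ => pieceIntegral lam α p.1 p.2) p := by
  obtain ⟨g, hg, h⟩ := exists_bound hlam hα hs (rad p.1 p.2 + 1)
  have hm := isOpen_eulerBox.measurableSet
  have hF : ∀ᶠ q : ℝ × ℝ in 𝓝 p, rad q.1 q.2 ≤ rad p.1 p.2 + 1 :=
    (continuous_rad.tendsto p).eventually_le_const (lt_add_one _)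
  have hlim (u : R4) (hu : u ∈ eulerBox) : Tendsto (fun q : ℝ × ℝ => pieceForm lam α q.1 q.2 u) (𝓝 p)
      (𝓝 (pieceForm lam α p.1 p.2 u)) := (continuousAt_pieceForm hlam hα hp hu.1).tendsto
  change Tendsto (fun q : ℝ × ℝ => ∫ u in eulerBox, pieceForm lam α q.1 q.2 u) (𝓝 p)
    (𝓝 (∫ u in eulerBox, pieceForm lam α p.1 p.2 u))
  exact tendsto_integral_filter_of_dominated_convergence
    (F := fun (q : ℝ × ℝ) u => pieceForm lam α q.1 q.2 u) (f := pieceForm lam α p.1 p.2) g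
    (Eventually.of_forall fun q =>
      (continuousOn_pieceForm hlam hα q.1 q.2).aestronglyMeasurable hm)
    (hF.mono fun q hq => (ae_restrict_iff' hm).2 (Eventually.of_forall (h q.1 q.2 hq)))
    hg.integrableOn
    ((ae_restrict_iff' hm).2 (Eventually.of_forall hlim))

/-- The pieces are matched root by root, so convergence of the roots gives convergence of the finite
sum of integrals. -/
theorem tendstoCurrents_M (hlam : 0 < lam) {C D : ℕ → ℝ} {C' D' : ℝ} {n : ℕ} {P Q : ℕ → Fin n → ℝ}
    {P' Q' : Fin n → ℝ} (h : ∀ j, IsRootFamily (C j) (D j) (P j) (Q j)) (h' : IsRootFamily C' D' P' Q')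
    (hP : ∀ i, Tendsto (fun j => P j i) atTop (𝓝 (P' i)))
    (hQ : ∀ i, Tendsto (fun j => Q j i) atTop (𝓝 (Q' i))) (h0 : √C' + √D' ≠ 0) :
    TendstoCurrents lam (fun j => M lam (C j) (D j) 0) (M lam C' D' 0) := by
  intro α hα hs
  refine ⟨fun j => ∑ i, pieceIntegral lam α (P j i) (Q j i), ∑ i, pieceIntegral lam α (P' i) (Q' i),
    fun j => integralEq_M hlam (h j) α fun i => integrableOn_piece hlam hα.continuous hs _ _,
    integralEq_M hlam h' α fun i => integrableOn_piece hlam hα.continuous hs _ _,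
    tendsto_finsetSum _ fun i _ => ?_⟩
  have hr : rad (P' i) (Q' i) ≠ 0 := fun hr => h0 (by rw [← h'.rad_sq i, hr]; ring)
  have hc : ContinuousAt (fun p : ℝ × ℝ => pieceIntegral lam α p.1 p.2) (P' i, Q' i) :=
    continuousAt_pieceIntegral hlam hα.continuous hs hr
  generalize pieceIntegral lam α = I at hc ⊢
  exact hc.tendsto.comp ((hP i).prodMk_nhds (hQ i))

end

/-! ### From the topology of K to that of M. -/

theorem homeomorph_M_of_K {lam C D E : ℝ} (hlam : 0 < lam) {n : ℕ} {P Q : Fin n → ℝ}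
    (h : IsRootFamily C D P Q) {T : Type*} [TopologicalSpace T]
    (hK : ∀ X : ℝ, 0 ≤ X → X ^ 2 = √C + √D → Nonempty (K lam X E ≃ₜ T)) :
    Nonempty (M lam C D E ≃ₜ Fin n × T) := by
  have h0 : 0 ≤ √C + √D := by positivity
  have hX := Real.sq_sqrt h0
  obtain ⟨e⟩ := hK √(√C + √D) (Real.sqrt_nonneg _) hX
  obtain ⟨e'⟩ := nonempty_homeomorph_K (E := E) hlam h (Real.sqrt_nonneg _) hX
  exact ⟨e'.trans ((Homeomorph.refl _).prodCongr e)⟩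

theorem homeomorph_of_zero_ne {lam X : ℝ} (hlam : 0 < lam) (hX0 : 0 ≤ X) (hX : X ^ 2 ≠ √lam) :
    Nonempty (K lam X 0 ≃ₜ TS2) := by
  have hl := Real.sq_sqrt hlam.le
  have h4 : X ^ 4 = (X ^ 2) ^ 2 := by ring
  have h0 := Real.sqrt_nonneg lam
  rcases lt_or_gt_of_ne hX with h | h
  · exact homeomorph_of_lt hlam (by rw [h4, ← hl]; exact pow_lt_pow_left₀ h (sq_nonneg X) two_ne_zero)
  · exact homeomorph_of_gt hlam hX0 (by rw [h4, ← hl]; exact pow_lt_pow_left₀ h h0 two_ne_zero)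

theorem homeomorph_of_zero_eq {lam X : ℝ} (hlam : 0 < lam) (hX0 : 0 ≤ X) (hX : X ^ 2 = √lam) :
    Nonempty (K lam X 0 ≃ₜ ConeSO3) :=
  homeomorph_of_eq hlam hX0 (by
    rw [show X ^ 4 = (X ^ 2) ^ 2 by ring, hX, Real.sq_sqrt hlam.le])

theorem homeomorph_K_zero {lam : ℝ} (hlam : 0 < lam) (E : ℝ) : Nonempty (K lam 0 E ≃ₜ TS2) := by
  by_cases hE : E = 0
  · rw [hE]
    exact homeomorph_of_lt hlam (by simpa using hlam)
  · exact homeomorph_of_ne hlam le_rfl hE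

end BryantSalamon

end

/-! ### The main theorem. -/

open BryantSalamon in
theorem mainTheorem5 (lam : ℝ) (hlam : 0 < lam) :
    -- `M_{C,D,E}` is a smooth coassociative submanifold outside the singular case
    (∀ C D E : ℝ, 0 ≤ C → 0 ≤ D → ¬ (E = 0 ∧ √C + √D = √lam) →
      BryantSalamon.IsCoassociative lam (BryantSalamon.M lam C D E)) ∧
    -- in the singular case it is coassociative with conical singularities
    (∀ C D : ℝ, 0 ≤ C → 0 ≤ D → √C + √D = √lam →
      BryantSalamon.IsConicallySingularCoassociative lam (BryantSalamon.M lam C D 0)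
        (BryantSalamon.apexes lam C D 0)) ∧
    -- non-compactness
    (∀ C D E : ℝ, 0 ≤ C → 0 ≤ D → ¬ IsCompact (BryantSalamon.M lam C D E)) ∧
    -- topology for `C > 0`, `D > 0`
    (∀ C D : ℝ, 0 < C → 0 < D → √C + √D ≠ √lam →
      Nonempty (BryantSalamon.M lam C D 0 ≃ₜ Fin 4 × BryantSalamon.TS2)) ∧
    (∀ C D : ℝ, 0 < C → 0 < D → √C + √D = √lam →
      Nonempty (BryantSalamon.M lam C D 0 ≃ₜ Fin 4 × BryantSalamon.ConeSO3)) ∧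
    (∀ C D E : ℝ, 0 < C → 0 < D → E ≠ 0 →
      Nonempty (BryantSalamon.M lam C D E ≃ₜ Fin 4 × BryantSalamon.TS2)) ∧
    -- topology for `C = D = 0`
    (∀ E : ℝ, Nonempty (BryantSalamon.M lam 0 0 E ≃ₜ BryantSalamon.TS2)) ∧
    -- topology for `C > 0`, `D = 0`
    (∀ C : ℝ, 0 < C → √C ≠ √lam →
      Nonempty (BryantSalamon.M lam C 0 0 ≃ₜ Fin 2 × BryantSalamon.TS2)) ∧
    (∀ C : ℝ, 0 < C → √C = √lam →
      Nonempty (BryantSalamon.M lam C 0 0 ≃ₜ Fin 2 × BryantSalamon.ConeSO3)) ∧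
    (∀ C E : ℝ, 0 < C → E ≠ 0 →
      Nonempty (BryantSalamon.M lam C 0 E ≃ₜ Fin 2 × BryantSalamon.TS2)) ∧
    -- topology for `C = 0`, `D > 0`
    (∀ D : ℝ, 0 < D → √D ≠ √lam →
      Nonempty (BryantSalamon.M lam 0 D 0 ≃ₜ Fin 2 × BryantSalamon.TS2)) ∧
    (∀ D : ℝ, 0 < D → √D = √lam →
      Nonempty (BryantSalamon.M lam 0 D 0 ≃ₜ Fin 2 × BryantSalamon.ConeSO3)) ∧
    (∀ D E : ℝ, 0 < D → E ≠ 0 →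
      Nonempty (BryantSalamon.M lam 0 D E ≃ₜ Fin 2 × BryantSalamon.TS2)) ∧
    -- the smooth coassociatives desingularize the conically singular ones
    (∀ (C D : ℕ → ℝ) (C' D' : ℝ), (∀ j, 0 < C j ∧ 0 < D j) → 0 < C' → 0 < D' →
      Filter.Tendsto C Filter.atTop (nhds C') → Filter.Tendsto D Filter.atTop (nhds D') →
      √C' + √D' = √lam →
      ((∀ j, √(C j) + √(D j) < √lam) ∨ ∀ j, √lam < √(C j) + √(D j)) →
      BryantSalamon.TendstoCurrents lam (fun j => BryantSalamon.M lam (C j) (D j) 0)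
        (BryantSalamon.M lam C' D' 0)) ∧
    (∀ (C : ℕ → ℝ) (C' : ℝ), (∀ j, 0 < C j) → Filter.Tendsto C Filter.atTop (nhds C') →
      √C' = √lam → ((∀ j, √(C j) < √lam) ∨ ∀ j, √lam < √(C j)) →
      BryantSalamon.TendstoCurrents lam (fun j => BryantSalamon.M lam (C j) 0 0)
          (BryantSalamon.M lam C' 0 0) ∧
        BryantSalamon.TendstoCurrents lam (fun j => BryantSalamon.M lam 0 (C j) 0)
          (BryantSalamon.M lam 0 C' 0)) := by
  refine ⟨fun C D E hC hD hne => ?_, fun C D hC hD hX => ?_, fun C D E hC hD => ?_,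
    fun C D hC hD hX => ?_, fun C D hC hD hX => ?_, fun C D E hC hD hE => ?_, fun E => ?_,
    fun C hC hX => ?_, fun C hC hX => ?_, fun C E hC hE => ?_, fun D hD hX => ?_, fun D hD hX => ?_,
    fun D E hD hE => ?_, ?_, ?_⟩
  · obtain ⟨n, P, Q, h, -⟩ := exists_isRootFamily hC hD
    exact isCoassociative_M hlam h hne
  · obtain ⟨n, P, Q, h, hn⟩ := exists_isRootFamily hC hD
    exact isConicallySingularCoassociative_M hlam h hn hX
  · exact not_isCompact_M hlam hC hD E
  · exact homeomorph_M_of_K hlam (isRootFamily_four hC hD) fun X h0 h =>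
      homeomorph_of_zero_ne hlam h0 (by rw [h]; exact hX)
  · exact homeomorph_M_of_K hlam (isRootFamily_four hC hD) fun X h0 h =>
      homeomorph_of_zero_eq hlam h0 (by rw [h]; exact hX)
  · exact homeomorph_M_of_K hlam (isRootFamily_four hC hD) fun X h0 h => homeomorph_of_ne hlam h0 hE
  -- For C = D = 0 there is a single root and X = 0, so h = 0 and K is |y| = 1, ⟨y, w⟩ = 0.
  · obtain ⟨e⟩ := homeomorph_M_of_K (E := E) hlam isRootFamily_zero fun X h0 h => by
      have : X = 0 := by simpa using h
      rw [this]
      exact homeomorph_K_zero hlam E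
    exact ⟨e.trans (Homeomorph.uniqueProd _ _)⟩
  · exact homeomorph_M_of_K hlam (isRootFamily_left hC) fun X h0 h =>
      homeomorph_of_zero_ne hlam h0 (by rw [h, Real.sqrt_zero, add_zero]; exact hX)
  · exact homeomorph_M_of_K hlam (isRootFamily_left hC) fun X h0 h =>
      homeomorph_of_zero_eq hlam h0 (by rw [h, Real.sqrt_zero, add_zero]; exact hX)
  · exact homeomorph_M_of_K hlam (isRootFamily_left hC) fun X h0 h => homeomorph_of_ne hlam h0 hE
  · exact homeomorph_M_of_K hlam (isRootFamily_left hD).swap fun X h0 h =>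
      homeomorph_of_zero_ne hlam h0 (by rw [h, Real.sqrt_zero, zero_add]; exact hX)
  · exact homeomorph_M_of_K hlam (isRootFamily_left hD).swap fun X h0 h =>
      homeomorph_of_zero_eq hlam h0 (by rw [h, Real.sqrt_zero, zero_add]; exact hX)
  · exact homeomorph_M_of_K hlam (isRootFamily_left hD).swap fun X h0 h => homeomorph_of_ne hlam h0 hE
  · intro C D C' D' h hC' hD' hC hD hX _
    refine tendstoCurrents_M hlam (fun j => isRootFamily_four (h j).1 (h j).2)
      (isRootFamily_four hC' hD') (fun i => ?_) (fun i => ?_) (hX ▸ (Real.sqrt_pos.2 hlam).ne')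
    · fin_cases i
      exacts [hC.sqrt.sqrt, hC.sqrt.sqrt, hC.sqrt.sqrt.neg, hC.sqrt.sqrt.neg]
    · fin_cases i
      exacts [hD.sqrt.sqrt, hD.sqrt.sqrt.neg, hD.sqrt.sqrt, hD.sqrt.sqrt.neg]
  · intro C C' h hC hX _
    have hl := Real.sqrt_pos.2 hlam
    have hC' : 0 < C' := Real.sqrt_pos.1 (hX ▸ hl)
    have h1 (i : Fin 2) : Filter.Tendsto (fun j => (![√√(C j), -√√(C j)] : Fin 2 → ℝ) i) Filter.atTop
        (nhds ((![√√C', -√√C'] : Fin 2 → ℝ) i)) := by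
      fin_cases i
      exacts [hC.sqrt.sqrt, hC.sqrt.sqrt.neg]
    have h0 : √C' + √0 ≠ 0 := by rw [hX, Real.sqrt_zero, add_zero]; exact hl.ne'
    exact ⟨tendstoCurrents_M hlam (fun j => isRootFamily_left (h j)) (isRootFamily_left hC') h1
      (fun _ => tendsto_const_nhds) h0,
      tendstoCurrents_M hlam (fun j => (isRootFamily_left (h j)).swap) (isRootFamily_left hC').swap
        (fun _ => tendsto_const_nhds) h1 (by rwa [add_comm])⟩
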